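/- Work in the plane $\mathbb R^2$, with $B_r=\{|x|<r\}$. For $\alpha\ge 0$ and $f\in L^2_{\rm loc}(\mathbb R^2;\mathbb R^2)$ put $$\|f\|_{L^2_\alpha}=\sup_{r\ge 1} r^{-(1+\alpha)}\|f\|_{L^2(B_r)},$$ and let $Y_\alpha$ be the space of vector fields $f$ with $\|f\|_{L^2_\alpha}<\infty$ which are divergence-free in the sense of distributions and whose scalar vorticity $\omega=\partial_1f_2-\partial_2f_1$ (in the sense of distributions) is bounded, with norm $\|f\|_{Y_\alpha}=\|\omega\|_{L^\infty}+\|f\|_{L^2_\alpha}$. Let $E(x)=-\frac1{2\pi}\log|x|$ and let $\theta\in C^\infty_c(\mathbb R^2)$ be a radial cut-off function with $0\le\theta\le1$, $\theta=1$ for $|x|\le 1$ and $\operatorname{supp}\theta\subset B_2$. For $u,v\in Y_\alpha$ with $0\le\alpha<\frac12$, set (summing over $j,k\in\{1,2\}$) $$\nabla\Pi(u\otimes v)=\nabla(\theta E)*(\partial_ju_k\,\partial_kv_j)+\nabla\partial_j\partial_k\big((1-\theta)E\big)*(u_jv_k),$$ which does not depend on the choice of $\theta$. Given $u_0\in Y_\alpha$,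 a *Yudovich solution* of the Euler equations with initial datum $u_0$ is a (jointly measurable) $u\in L^\infty_{\rm loc}(\mathbb R_+;Y_\alpha)$ such that, for every $\phi\in C^\infty_c(\mathbb R_+\times\mathbb R^2;\mathbb R^2)$ (not necessarily vanishing at $t=0$), $$\int\phi(0,x)\cdot u_0(x)\,dx+\int_0^\infty\!\!\int\big\{u\cdot\partial_t\phi+\nabla\phi:u\otimes u\big\}\,dx\,dt=\int_0^\infty\!\!\int \nabla\Pi(u\otimes u)\cdot\phi\,dx\,dt .$$ **Corollary.** There are an absolute constant $C>0$ and, for every $\alpha\in[0,\frac12)$, a constant $K>0$ depending only on $\frac1{1-2\alpha}$, such that for every $u_0\in Y_\alpha$, with vorticity $\omega_0$, and every Yudovich solution $u\in L^\infty_{\rm loc}(\mathbb R_+;Y_\alpha)$ with initial datum $u_0$, $$\|u(t)\|_{L^2_\alpha}\le C\Big(\|u_0\|_{L^2_\alpha}+K\,t^{\frac{1+\alpha}{1-\alpha}}\|u_0\|_{L^2_\alpha}^{\frac2{1-\alpha}}+K\,t^{\frac{2(1+\alpha)}{1-\alpha}}\|\omega_0\|_{L^\infty}^{\frac{1+\alpha}{1-\alpha}}\|u_0\|_{L^2_\alpha}^{\frac2{1-\alpha}}\Big)$$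 for almost every $t\ge0$. If moreover $u(t)$ is locally integrable for every $t\ge 0$ and $t\mapsto u(t)$ is continuous on $[0,\infty)$ with values in distributions (that is, $t\mapsto\int u(t,x)\cdot\varphi(x)\,dx$ is continuous for all $\varphi\in C_c^\infty(\mathbb R^2;\mathbb R^2)$), then the estimate holds for every $t\ge0$. -/

import Mathlib

open MeasureTheory Set
open scoped ContDiff ENNReal

noncomputable section

namespace YudovichEuler

/-- The Euclidean plane. The coordinates `1, 2` of the plane are the indices `0, 1`. -/
abbrev Plane : Type := EuclideanSpace ℝ (Fin 2)

/-- Classical partial derivative `∂ᵢ f`. -/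
def partialDeriv (i : Fin 2) (f : Plane → ℝ) (x : Plane) : ℝ :=
  fderiv ℝ f x (EuclideanSpace.single i 1)

/-- Smooth, compactly supported scalar test functions on the plane. -/
def IsTest (φ : Plane → ℝ) : Prop := ContDiff ℝ ∞ φ ∧ HasCompactSupport φ

/-- Smooth, compactly supported vector-valued test functions on the plane. -/
def IsVectorTest (φ : Plane → Plane) : Prop := ContDiff ℝ ∞ φ ∧ HasCompactSupport φ

/-- Smooth, compactly supported vector-valued test functions of `(t, x)`. Their restrictions to
`t ≥ 0` are the elements of `𝒟(ℝ₊ × ℝ²; ℝ²)`; they need not vanish at `t = 0`. -/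
def IsSpaceTimeTest (φ : ℝ × Plane → Plane) : Prop := ContDiff ℝ ∞ φ ∧ HasCompactSupport φ

/-- `∂ᵢ f = g` in the sense of distributions, with `f` and `g` locally integrable. -/
def HasWeakPartial (i : Fin 2) (f g : Plane → ℝ) : Prop :=
  LocallyIntegrable f volume ∧ LocallyIntegrable g volume ∧
    ∀ φ, IsTest φ → ∫ x, g x * φ x = -∫ x, f x * partialDeriv i φ x

open Classical in
/-- The weak partial derivative `∂ᵢ f`, which is unique up to null sets whenever it exists as a
locally integrable function. -/
def weakPartial (i : Fin 2) (f : Plane → ℝ) : Plane → ℝ :=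
  if h : ∃ g, HasWeakPartial i f g then h.choose else 0

/-- `div f = 0` in the sense of distributions. -/
def IsWeaklyDivFree (f : Plane → Plane) : Prop :=
  ∀ φ, IsTest φ → ∫ x, fderiv ℝ φ x (f x) = 0

/-- `w = ∂₁ f₂ - ∂₂ f₁` in the sense of distributions, with `w` locally integrable. -/
def IsWeakCurl (f : Plane → Plane) (w : Plane → ℝ) : Prop :=
  LocallyIntegrable w volume ∧
    ∀ φ, IsTest φ →
      ∫ x, w x * φ x = ∫ x, (f x 0 * partialDeriv 1 φ x - f x 1 * partialDeriv 0 φ x)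

open Classical in
/-- The scalar vorticity of a vector field, which is unique up to null sets whenever it exists as a
locally integrable function. -/
def vorticity (f : Plane → Plane) : Plane → ℝ :=
  if h : ∃ w, IsWeakCurl f w then h.choose else 0

/-- The norm of `L²_α`: the supremum over `r ≥ 1` of `r ^ (-(1 + α)) ‖f‖_{L²(B_r)}`. -/
def morreyNorm (α : ℝ) (f : Plane → Plane) : ℝ≥0∞ :=
  ⨆ (r : ℝ) (_ : 1 ≤ r),
    ENNReal.ofReal (r ^ (-(1 + α))) * eLpNorm f 2 (volume.restrict (Metric.ball 0 r))

/-- The norm of `Y_α`. -/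
def yudovichNorm (α : ℝ) (f : Plane → Plane) : ℝ≥0∞ :=
  eLpNorm (vorticity f) ⊤ volume + morreyNorm α f

/-- The space `Y_α`: divergence-free fields in `L²_α` with bounded vorticity. -/
structure MemYudovich (α : ℝ) (f : Plane → Plane) : Prop where
  aestronglyMeasurable : AEStronglyMeasurable f volume
  divFree : IsWeaklyDivFree f
  exists_curl : ∃ w, IsWeakCurl f w
  norm_lt_top : yudovichNorm α f < ⊤

/-- Radial smooth cut-off functions: `0 ≤ θ ≤ 1`, `θ = 1` for `|x| ≤ 1`, `supp θ ⊆ B(0, 2)`. -/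
structure IsCutoff (θ : Plane → ℝ) : Prop where
  contDiff : ContDiff ℝ ∞ θ
  radial : ∀ x y, ‖x‖ = ‖y‖ → θ x = θ y
  nonneg : ∀ x, 0 ≤ θ x
  le_one : ∀ x, θ x ≤ 1
  eq_one : ∀ x, ‖x‖ ≤ 1 → θ x = 1
  tsupport_subset : tsupport θ ⊆ Metric.ball 0 2

/-- The fundamental solution `E(x) = -(1 / 2π) log |x|`, with `-Δ E = δ₀`. -/
def fundSol (x : Plane) : ℝ := -(1 / (2 * Real.pi)) * Real.log ‖x‖

/-- The kernel `∂ᵢ (θ E)`; it is integrable and compactly supported, and its classical derivative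
away from the origin is its distributional derivative. -/
def nearKernel (θ : Plane → ℝ) (i : Fin 2) : Plane → ℝ :=
  partialDeriv i (fun x => θ x * fundSol x)

/-- The smooth kernel `∂ᵢ ∂ⱼ ∂ₖ ((1 - θ) E)`. -/
def farKernel (θ : Plane → ℝ) (i j k : Fin 2) : Plane → ℝ :=
  partialDeriv i (partialDeriv j (partialDeriv k (fun x => (1 - θ x) * fundSol x)))

/-- Convolution of two real functions on the plane. -/
def conv (f g : Plane → ℝ) : Plane → ℝ :=
  convolution f g (ContinuousLinearMap.mul ℝ ℝ) volume

/-- The pressure force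
`∇Π(u ⊗ v) = ∇(θE) * (∂ⱼ uₖ ∂ₖ vⱼ) + ∇ ∂ⱼ ∂ₖ ((1 - θ)E) * (uⱼ vₖ)`, summed over `j, k`. -/
def gradPi (θ : Plane → ℝ) (u v : Plane → Plane) (x : Plane) : Plane :=
  WithLp.toLp 2 fun i =>
    conv (nearKernel θ i)
        (fun y => ∑ j, ∑ k, weakPartial j (fun z => u z k) y * weakPartial k (fun z => v z j) y) x
      + ∑ j, ∑ k, conv (farKernel θ i j k) (fun y => u y j * v y k) x

/-- Yudovich solutions of the Euler equations with initial datum `u₀`: `u ∈ L^∞_loc(ℝ₊; Y_α)` is a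
weak solution of `∂ₜ u + div (u ⊗ u) + ∇Π(u ⊗ u) = 0`, `u(0) = u₀`. Only the values `u t` with
`t ≥ 0` matter. The field `∇Π(u ⊗ u)` does not depend on the cut-off `θ`. In the weak form,
`⟪u, (Dφ) u⟫` is `∇φ : u ⊗ u`. -/
structure IsYudovichSolution (α : ℝ) (u₀ : Plane → Plane) (u : ℝ → Plane → Plane) : Prop where
  aestronglyMeasurable :
    AEStronglyMeasurable (Function.uncurry u) ((volume.restrict (Ici (0 : ℝ))).prod volume)
  locallyBounded : ∀ T : ℝ, 0 < T → ∃ M : ℝ, ∀ᵐ t ∂volume.restrict (Icc 0 T),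
    MemYudovich α (u t) ∧ yudovichNorm α (u t) ≤ ENNReal.ofReal M
  momentum : ∃ θ, IsCutoff θ ∧ ∀ φ : ℝ × Plane → Plane, IsSpaceTimeTest φ →
    (∫ x, inner ℝ (φ (0, x)) (u₀ x)) +
      (∫ t in Ici (0 : ℝ), ∫ x,
        (inner ℝ (u t x) (deriv (fun s => φ (s, x)) t) +
          inner ℝ (u t x) (fderiv ℝ (fun y => φ (t, y)) x (u t x)))) =
      ∫ t in Ici (0 : ℝ), ∫ x, inner ℝ (gradPi θ (u t) (u t) x) (φ (t, x))

/-- The right-hand side of the growth estimate, with `A = ‖u₀‖_{L²_α}` and `W = ‖ω₀‖_{L^∞}`. -/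
def growthBound (α K t A W : ℝ) : ℝ :=
  A + K * t ^ ((1 + α) / (1 - α)) * A ^ (2 / (1 - α))
    + K * t ^ (2 * (1 + α) / (1 - α)) * W ^ ((1 + α) / (1 - α)) * A ^ (2 / (1 - α))

end YudovichEuler

end

namespace YudovichEuler

open Filter Topology Metric

noncomputable section

-- The estimate is a local energy inequality closed only beyond a large radius. Write `E(r)` for the
-- energy of `u(t)` in `B_r`, `A` for the size of the datum in `L²_α`, `W` for the bound on the
-- initial vorticity and `κ₀ = 1 / (1 - 2α)`. Testing the equation with a cut-off of radius `r`
-- times `u`, the localized energy changes at a rate of at most a constant times `(V / r) E(6r) + r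
-- √E(6r) ∫_{|y| ≥ 6r} |u|² / |y|³`, where `V` bounds `|u|` on `B_{6r}`. The first term contains the
-- transport flux and the near part of the pressure, the second one is the far part of the pressure
-- (`exists_energyRate_le`, `exists_ae_energy_le`).
--
-- Suppose `E(r) ≤ (N r^(1+α))²` for all `r ≥ R`. Dyadic summation, which converges because `α <
-- 1/2`, bounds the far integral by a constant times `κ₀ N² r^(2α-1)`. The velocity is bounded by
-- interpolation between vorticity and energy on balls of radius `r / λ`. The rate is then at most a
-- constant times `(W N² / λ + (λ + κ₀) N³ r^(α-1)) r^(2+2α)` (`exists_rate_le`). With `λ` of order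
-- `1 + TW` the first term integrates over `[0, T]` to a small multiple of `N²`. If `R^(1-α)` is at
-- least a constant times `T A (κ₀ + 1 + TW)`, so does the second. Hence the bound with `N = 8A`
-- propagates over `[0, T]` for all radii beyond `R` (`exists_flow_growth`). The a priori bound of
-- `u` in `Y_α` enters only through the length of the time steps of this continuation argument, so
-- it leaves no trace in the result. Radii below `R` are covered by monotonicity of the energy at
-- the price of a factor `R^(1+α)`. Taking `R^(1-α)` of the order of its threshold produces the
-- powers in the statement (`exists_ae_growth`).
--
-- Three facts about rough fields carry this. First, a divergence-free field with bounded vorticity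
-- is within `W ε` of its mollification at scale `ε`, because the scale derivative of a suitable
-- radial mollifier is a Laplacian, and the Laplacian of the field is a rotated gradient of the
-- vorticity (`IsField.abs_moll_sub_moll_le`). This gives a continuous representative and the
-- interpolation inequality. The integral identity between gradient, divergence and curl gives local
-- `L²` bounds of the gradient (`exists_gradient_estimate`).
--
-- Second, tested against a field `h`, the pressure force is the integral of `u ⊗ u` against second
-- derivatives of `h` correlated with the gradient of the logarithm (`IsField.integral_gradPi_mul`).
-- The cut-off `θ` disappears, and only the divergence of `h` is seen. The near part is controlled
-- by an `L²` bound of the second derivatives of a logarithmic potential, the far part by the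
-- third-order decay of the kernel (`abs_pressForm_le`).
--
-- Third, the vorticity of any Yudovich solution stays below its initial bound
-- (`IsFlow.ae_isField`). Testing with rotated gradients of the mollifier gives the mollified
-- vorticity equation without pressure. Its commutator is a covariance, and the Cauchy-Schwarz
-- inequality makes the `ε` gained from the gradient of the velocity cancel the `1 / ε` lost on the
-- vorticity, while the variance of the vorticity tends to zero. The resulting renormalized
-- equation, applied to a function vanishing exactly on `[-W, W]`, leads to a Gronwall argument over
-- the radii `2^j`. It closes because the velocity grows at most linearly.
--
-- The weak formulation in time is converted to integrated identities valid for almost every time by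
-- a du Bois-Reymond lemma. The estimate at every time, for solutions continuous with values in
-- distributions, follows by weak lower semicontinuity of local `L²` norms.

local notation "∂_" => partialDeriv

/-- The `i`-th standard basis vector of the plane. -/
abbrev basisVec (i : Fin 2) : Plane := EuclideanSpace.single i (1 : ℝ)

/-! ### Partial derivatives, integration by parts and the div-curl identity. -/

section Calculus

variable {f g : Plane → ℝ} {φ : Plane → ℝ}

theorem partialDeriv_def (i : Fin 2) (f : Plane → ℝ) (x : Plane) :
    ∂_ i f x = fderiv ℝ f x (basisVec i) := rfl

theorem plane_eq_sum (v : Plane) : v = ∑ i, v i • basisVec i := by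
  ext j; fin_cases j <;> simp [Fin.sum_univ_two, basisVec]

theorem fderiv_apply_eq_sum (f : Plane → ℝ) (x v : Plane) :
    fderiv ℝ f x v = ∑ i, v i * ∂_ i f x := by
  conv_lhs => rw [plane_eq_sum v]
  simp [partialDeriv]

theorem contDiff_partialDeriv (i : Fin 2) (hf : ContDiff ℝ ∞ f) :
    ContDiff ℝ ∞ (∂_ i f) := by
  have h : ContDiff ℝ ∞ (fderiv ℝ f) := hf.fderiv_right (by simp)
  exact h.clm_apply contDiff_const

theorem continuous_partialDeriv (i : Fin 2) (hf : ContDiff ℝ 1 f) :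
    Continuous (∂_ i f) := by
  have h : Continuous (fderiv ℝ f) := hf.continuous_fderiv (by simp)
  exact h.clm_apply continuous_const

theorem contDiff_one (hf : ContDiff ℝ ∞ f) : ContDiff ℝ 1 f := hf.of_le (by simp)

theorem partialDeriv_support_subset (i : Fin 2) (f : Plane → ℝ) :
    tsupport (∂_ i f) ⊆ tsupport f := by
  refine closure_minimal (fun x hx => ?_) (isClosed_tsupport f)
  refine support_fderiv_subset ℝ (f := f) ?_
  rw [Function.mem_support] at hx ⊢
  intro h
  exact hx (by rw [partialDeriv_def, h]; simp)

theorem hasCompactSupport_partialDeriv (i : Fin 2) (hf : HasCompactSupport f) :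
    HasCompactSupport (∂_ i f) :=
  hf.of_isClosed_subset (isClosed_tsupport _) (partialDeriv_support_subset i f)

theorem IsTest.partialDeriv (i : Fin 2) (h : IsTest φ) : IsTest (∂_ i φ) :=
  ⟨contDiff_partialDeriv i h.1, hasCompactSupport_partialDeriv i h.2⟩

theorem IsTest.continuous (h : IsTest φ) : Continuous φ := h.1.continuous

theorem IsTest.mul_left (h : IsTest φ) (hf : ContDiff ℝ ∞ f) : IsTest (fun x => f x * φ x) :=
  ⟨hf.mul h.1, h.2.mul_left⟩

theorem IsTest.mul_right (h : IsTest φ) (hf : ContDiff ℝ ∞ f) : IsTest (fun x => φ x * f x) :=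
  ⟨h.1.mul hf, h.2.mul_right⟩

theorem IsTest.sub {ψ : Plane → ℝ} (h : IsTest φ) (h' : IsTest ψ) :
    IsTest (fun x => φ x - ψ x) :=
  ⟨h.1.sub h'.1, by
    have := h.2.add h'.2.neg
    rw [← sub_eq_add_neg] at this
    exact this⟩

theorem IsTest.add {ψ : Plane → ℝ} (h : IsTest φ) (h' : IsTest ψ) :
    IsTest (fun x => φ x + ψ x) :=
  ⟨h.1.add h'.1, h.2.add h'.2⟩

theorem partialDeriv_mul (i : Fin 2) {x : Plane} (hf : DifferentiableAt ℝ f x)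
    (hg : DifferentiableAt ℝ g x) :
    ∂_ i (fun y => f y * g y) x = ∂_ i f x * g x + f x * ∂_ i g x := by
  simp only [partialDeriv]
  rw [fderiv_fun_mul hf hg]
  simp; ring

theorem partialDeriv_add (i : Fin 2) {x : Plane} (hf : DifferentiableAt ℝ f x)
    (hg : DifferentiableAt ℝ g x) :
    ∂_ i (fun y => f y + g y) x = ∂_ i f x + ∂_ i g x := by
  simp only [partialDeriv]
  rw [fderiv_fun_add hf hg]
  simp

theorem partialDeriv_sub (i : Fin 2) {x : Plane} (hf : DifferentiableAt ℝ f x)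
    (hg : DifferentiableAt ℝ g x) :
    ∂_ i (fun y => f y - g y) x = ∂_ i f x - ∂_ i g x := by
  simp only [partialDeriv]
  rw [fderiv_fun_sub hf hg]
  simp

theorem partialDeriv_const_mul (i : Fin 2) {x : Plane} (c : ℝ) (hf : DifferentiableAt ℝ f x) :
    ∂_ i (fun y => c * f y) x = c * ∂_ i f x := by
  simp only [partialDeriv]
  rw [fderiv_const_mul hf]
  simp

theorem partialDeriv_comp (i : Fin 2) {x : Plane} {β : ℝ → ℝ} (hβ : DifferentiableAt ℝ β (f x))
    (hf : DifferentiableAt ℝ f x) :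
    ∂_ i (fun y => β (f y)) x = deriv β (f x) * ∂_ i f x := by
  simp only [partialDeriv]
  have := (hβ.hasDerivAt.comp_hasFDerivAt x hf.hasFDerivAt).fderiv
  change fderiv ℝ (β ∘ f) x _ = _
  rw [this]
  simp

theorem partialDeriv_const_sub (i : Fin 2) (f : Plane → ℝ) (x y : Plane) :
    ∂_ i (fun z => f (x - z)) y = -∂_ i f (x - y) := by
  have h := fderiv_comp_smul (𝕜 := ℝ) (f := fun w => f (x + w)) (-1 : ℝ) (x := y)
  rw [fderiv_comp_add_left] at h
  simp only [neg_smul, one_smul, ← sub_eq_add_neg] at h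
  simp only [partialDeriv]
  rw [h]
  simp

theorem partialDeriv_comp_smul (i : Fin 2) (f : Plane → ℝ) (c : ℝ) (x : Plane) :
    ∂_ i (fun z => f (c • z)) x = c * ∂_ i f (c • x) := by
  simp only [partialDeriv]
  rw [fderiv_comp_smul]
  simp

theorem partialDeriv_congr {i : Fin 2} {x : Plane} (h : f =ᶠ[𝓝 x] g) :
    ∂_ i f x = ∂_ i g x := by
  simp only [partialDeriv]
  rw [h.fderiv_eq]

theorem partialDeriv_comm (i j : Fin 2) (hf : ContDiff ℝ ∞ f) (x : Plane) :
    ∂_ i (∂_ j f) x = ∂_ j (∂_ i f) x := by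
  have hd : DifferentiableAt ℝ (fderiv ℝ f) x :=
    ((hf.fderiv_right (m := ∞) (by simp)).differentiable (by simp)).differentiableAt
  have hs : IsSymmSndFDerivAt ℝ f x := hf.contDiffAt.isSymmSndFDerivAt (by
    rw [minSmoothness_of_isRCLikeNormedField]
    exact WithTop.coe_le_coe.2 (le_top : (2 : ℕ∞) ≤ ⊤))
  have key : ∀ a b : Fin 2, ∂_ a (∂_ b f) x
      = fderiv ℝ (fderiv ℝ f) x (basisVec a) (basisVec b) := by
    intro a b
    simp only [partialDeriv]
    change fderiv ℝ (fun y => fderiv ℝ f y (basisVec b)) x (basisVec a) = _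
    rw [fderiv_clm_apply hd (by fun_prop)]
    simp
  rw [key, key]
  exact hs _ _

theorem integral_mul_partialDeriv (i : Fin 2) (hf : ContDiff ℝ 1 f) (hg : ContDiff ℝ 1 g)
    (hc : HasCompactSupport f ∨ HasCompactSupport g) :
    ∫ x, f x * ∂_ i g x = -∫ x, ∂_ i f x * g x := by
  have c1 : HasCompactSupport (fun x => ∂_ i f x * g x) := by
    rcases hc with h | h
    · exact (hasCompactSupport_partialDeriv i h).mul_right
    · exact h.mul_left
  have c2 : HasCompactSupport (fun x => f x * ∂_ i g x) := by
    rcases hc with h | h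
    · exact h.mul_right
    · exact (hasCompactSupport_partialDeriv i h).mul_left
  have c3 : HasCompactSupport (fun x => f x * g x) := by
    rcases hc with h | h
    · exact h.mul_right
    · exact h.mul_left
  refine integral_mul_fderiv_eq_neg_fderiv_mul_of_integrable (μ := volume) ?_ ?_ ?_ ?_ ?_
  · exact ((continuous_partialDeriv i hf).mul hg.continuous).integrable_of_hasCompactSupport c1
  · exact (hf.continuous.mul (continuous_partialDeriv i hg)).integrable_of_hasCompactSupport c2
  · exact (hf.continuous.mul hg.continuous).integrable_of_hasCompactSupport c3
  · exact fun x _ => (hf.differentiable (by simp)).differentiableAt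
  · exact fun x _ => (hg.differentiable (by simp)).differentiableAt

/-- The div-curl identity for test fields. -/
theorem integral_grad_sq_eq_div_curl {v₀ v₁ : Plane → ℝ} (h₀ : IsTest v₀) (h₁ : IsTest v₁) :
    ∫ x, (∂_ 0 v₀ x ^ 2 + ∂_ 1 v₀ x ^ 2
        + ∂_ 0 v₁ x ^ 2 + ∂_ 1 v₁ x ^ 2)
      = ∫ x, ((∂_ 0 v₀ x + ∂_ 1 v₁ x) ^ 2
        + (∂_ 0 v₁ x - ∂_ 1 v₀ x) ^ 2) := by
  have int : ∀ i j : Fin 2, ∀ a b : Plane → ℝ, IsTest a → IsTest b →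
      Integrable (fun x => ∂_ i a x * ∂_ j b x) := fun i j a b ha hb =>
    ((ha.partialDeriv i).continuous.mul (hb.partialDeriv j).continuous).integrable_of_hasCompactSupport
      (ha.partialDeriv i).2.mul_right
  -- The Jacobian determinant is a null Lagrangian: both products equal minus the integral of `v₁`
  -- times the mixed second derivative of `v₀`. It is the only difference between the two quadratic
  -- forms.
  have e1 : ∫ x, ∂_ 0 v₁ x * ∂_ 1 v₀ x
      = ∫ x, ∂_ 1 v₁ x * ∂_ 0 v₀ x := by
    have a := integral_mul_partialDeriv 0 (contDiff_one h₁.1)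
      (contDiff_one (h₀.partialDeriv 1).1) (Or.inl h₁.2)
    have b := integral_mul_partialDeriv 1 (contDiff_one h₁.1)
      (contDiff_one (h₀.partialDeriv 0).1) (Or.inl h₁.2)
    have c : ∀ x, ∂_ 0 (∂_ 1 v₀) x = ∂_ 1 (∂_ 0 v₀) x :=
      fun x => partialDeriv_comm 0 1 h₀.1 x
    simp only [c] at a
    linarith
  rw [← sub_eq_zero, ← integral_sub]
  · have : ∀ x, (∂_ 0 v₀ x ^ 2 + ∂_ 1 v₀ x ^ 2
        + ∂_ 0 v₁ x ^ 2 + ∂_ 1 v₁ x ^ 2)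
        - ((∂_ 0 v₀ x + ∂_ 1 v₁ x) ^ 2
        + (∂_ 0 v₁ x - ∂_ 1 v₀ x) ^ 2)
        = 2 * (∂_ 0 v₁ x * ∂_ 1 v₀ x
          - ∂_ 1 v₁ x * ∂_ 0 v₀ x) := fun x => by ring
    simp only [this]
    rw [integral_const_mul, integral_sub (int _ _ _ _ h₁ h₀) (int _ _ _ _ h₁ h₀), e1]
    simp
  · simp only [pow_two]
    exact (((int _ _ _ _ h₀ h₀).add (int _ _ _ _ h₀ h₀)).add (int _ _ _ _ h₁ h₁)).add
      (int _ _ _ _ h₁ h₁)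
  · have : ∀ x, ((∂_ 0 v₀ x + ∂_ 1 v₁ x) ^ 2
        + (∂_ 0 v₁ x - ∂_ 1 v₀ x) ^ 2)
        = ∂_ 0 v₀ x * ∂_ 0 v₀ x + ∂_ 1 v₁ x * ∂_ 1 v₁ x
          + ∂_ 0 v₁ x * ∂_ 0 v₁ x + ∂_ 1 v₀ x * ∂_ 1 v₀ x
          + 2 * (∂_ 0 v₀ x * ∂_ 1 v₁ x)
          - 2 * (∂_ 0 v₁ x * ∂_ 1 v₀ x) := fun x => by ring
    simp only [this]
    exact (((((int _ _ _ _ h₀ h₀).add (int _ _ _ _ h₁ h₁)).add (int _ _ _ _ h₁ h₁)).add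
      (int _ _ _ _ h₀ h₀)).add ((int _ _ _ _ h₀ h₁).const_mul 2)).sub
      ((int _ _ _ _ h₁ h₀).const_mul 2)

end Calculus

/-! ### Convolution with smooth compactly supported kernels. -/

section ConvTest

variable {k g a : Plane → ℝ}

theorem conv_apply (k g : Plane → ℝ) (x : Plane) : conv k g x = ∫ y, k (x - y) * g y := by
  simp only [conv]
  exact convolution_mul_swap

theorem conv_apply' (k g : Plane → ℝ) (x : Plane) : conv k g x = ∫ y, k y * g (x - y) := by
  simp only [conv]
  exact convolution_mul

theorem IsTest.comp_const_sub (hk : IsTest k) (x : Plane) : IsTest (fun y => k (x - y)) := by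
  refine ⟨hk.1.comp (contDiff_const.sub contDiff_id), ?_⟩
  exact hk.2.comp_homeomorph (Homeomorph.subLeft x)

theorem IsTest.integrable_mul (hk : IsTest k) (hg : LocallyIntegrable g volume) :
    Integrable (fun y => k y * g y) := by
  have := hg.integrable_smul_left_of_hasCompactSupport hk.continuous hk.2
  simpa using this

theorem integrable_mul_of_compact (ha : Continuous a) (hc : HasCompactSupport a)
    (hg : LocallyIntegrable g volume) : Integrable (fun y => a y * g y) := by
  have := hg.integrable_smul_left_of_hasCompactSupport ha hc
  simpa using this

theorem IsTest.integrable_conv (hk : IsTest k) (hg : LocallyIntegrable g volume) (x : Plane) :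
    Integrable (fun y => k (x - y) * g y) :=
  (hk.comp_const_sub x).integrable_mul hg

theorem contDiff_conv (hk : IsTest k) (hg : LocallyIntegrable g volume) :
    ContDiff ℝ ∞ (conv k g) :=
  hk.2.contDiff_convolution_left (ContinuousLinearMap.mul ℝ ℝ) hk.1 hg

theorem partialDeriv_conv (i : Fin 2) (hk : IsTest k) (hg : LocallyIntegrable g volume)
    (x : Plane) : ∂_ i (conv k g) x = conv (∂_ i k) g x := by
  have h := hk.2.hasFDerivAt_convolution_left (ContinuousLinearMap.mul ℝ ℝ)
    (contDiff_one hk.1) hg x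
  rw [partialDeriv_def]
  change fderiv ℝ (convolution k g (ContinuousLinearMap.mul ℝ ℝ) volume) x _ = _
  rw [h.fderiv, conv_apply, convolution_eq_swap]
  have hint : Integrable (fun t => (((ContinuousLinearMap.mul ℝ ℝ).precompL Plane)
      (fderiv ℝ k (x - t))) (g t)) := by
    have hc : HasCompactSupport (fun t => fderiv ℝ k (x - t)) :=
      (hk.2.fderiv ℝ).comp_homeomorph (Homeomorph.subLeft x)
    have hcont : Continuous (fun t => fderiv ℝ k (x - t)) :=
      ((contDiff_one hk.1).continuous_fderiv (by simp)).comp (continuous_const.sub continuous_id)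
    have h2 : Integrable (fun t => g t • fderiv ℝ k (x - t)) :=
      hg.integrable_smul_right_of_hasCompactSupport hcont hc
    refine h2.congr (Eventually.of_forall fun t => ?_)
    ext v
    simp [ContinuousLinearMap.precompL_apply, mul_comm]
  rw [ContinuousLinearMap.integral_apply hint]
  refine integral_congr_ae (Eventually.of_forall fun t => ?_)
  simp [ContinuousLinearMap.precompL_apply, partialDeriv]

theorem partialDeriv_conv_right (i : Fin 2) (hk : IsTest k) (hg : LocallyIntegrable g volume)
    (x : Plane) : ∂_ i (conv g k) x = conv g (∂_ i k) x := by
  have e : ∀ m : Plane → ℝ, conv g m = conv m g := fun m => by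
    ext y; rw [conv_apply, conv_apply']; simp only [mul_comm]
  rw [e, e, partialDeriv_conv i hk hg]

theorem conv_comm (f g : Plane → ℝ) : conv f g = conv g f := by
  ext y; rw [conv_apply, conv_apply']; simp only [mul_comm]

theorem tsupport_conv_subset {ε R : ℝ} (hk : Function.support k ⊆ ball 0 ε)
    (ha : Function.support a ⊆ ball 0 R) :
    Function.support (conv k a) ⊆ ball 0 (R + ε) := by
  intro x hx
  by_contra h
  refine hx ?_
  rw [conv_apply]
  refine integral_eq_zero_of_ae (Eventually.of_forall fun y => ?_)
  by_contra h'
  have h1 : k (x - y) ≠ 0 := left_ne_zero_of_mul h'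
  have h2 : a y ≠ 0 := right_ne_zero_of_mul h'
  have h3 := hk h1
  have h4 := ha h2
  simp only [mem_ball_zero_iff] at h h3 h4
  have : ‖x‖ ≤ ‖x - y‖ + ‖y‖ := by simpa using norm_add_le (x - y) y
  linarith

theorem IsTest.conv_of_integrable (hk : IsTest k) (hc : HasCompactSupport a)
    (ha : LocallyIntegrable a volume) : IsTest (conv k a) :=
  ⟨contDiff_conv hk ha, HasCompactSupport.convolution _ hk.2 hc⟩

/-- On the support of the integrand `y` lies in the compact set of differences of `supp a` and `supp
k`. There `g` may be replaced by an integrable function, and the kernel is a bounded factor. -/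
theorem integrable_prod_conv (hk : Continuous k) (hkc : HasCompactSupport k)
    (ha : Continuous a) (hac : HasCompactSupport a)
    (hg : LocallyIntegrable g volume) :
    Integrable (fun p : Plane × Plane => a p.1 * (k (p.1 - p.2) * g p.2))
      (volume.prod volume) := by
  obtain ⟨S, hS, hSs⟩ : ∃ S : Set Plane, IsCompact S ∧
      ∀ x y, a x ≠ 0 → k (x - y) ≠ 0 → y ∈ S := by
    refine ⟨(fun p : Plane × Plane => p.1 - p.2) '' (tsupport a ×ˢ tsupport k),
      (hac.isCompact.prod hkc.isCompact).image (by fun_prop), fun x y hx hy => ?_⟩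
    exact ⟨(x, x - y), ⟨subset_tsupport _ hx, subset_tsupport _ hy⟩, by simp⟩
  obtain ⟨C, hC⟩ := hk.bounded_above_of_compact_support hkc
  have h1 : Integrable (fun p : Plane × Plane => a p.1 * S.indicator g p.2)
      (volume.prod volume) :=
    (ha.integrable_of_hasCompactSupport hac).mul_prod
      ((hg.integrableOn_isCompact hS).integrable_indicator hS.measurableSet)
  have h2 := h1.bdd_mul (c := C) (f := fun p : Plane × Plane => k (p.1 - p.2))
    (by fun_prop) (Eventually.of_forall fun p => hC _)
  refine h2.congr (Eventually.of_forall fun p => ?_)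
  by_cases hp : p.2 ∈ S
  · simp only [indicator_of_mem hp]; ring
  · simp only [indicator_of_notMem hp, mul_zero]
    by_cases ha0 : a p.1 = 0
    · simp [ha0]
    · by_cases hk0 : k (p.1 - p.2) = 0
      · simp [hk0]
      · exact absurd (hSs _ _ ha0 hk0) hp

/-- Convolution with an even kernel is self-adjoint, by Fubini. This is what moves a mollifier from
a field onto a test function. -/
theorem integral_mul_conv (hk : Continuous k) (hkc : HasCompactSupport k)
    (heven : ∀ x, k (-x) = k x)
    (ha : Continuous a) (hac : HasCompactSupport a) (hg : LocallyIntegrable g volume) :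
    ∫ x, a x * conv k g x = ∫ x, conv k a x * g x := by
  have h := integral_integral_swap (f := fun x y => a x * (k (x - y) * g y))
    (integrable_prod_conv hk hkc ha hac hg)
  simp only [conv_apply]
  calc _ = ∫ x, ∫ y, a x * (k (x - y) * g y) := by simp only [integral_const_mul]
    _ = _ := h
    _ = _ := by
      refine integral_congr_ae (Eventually.of_forall fun y => ?_)
      simp only
      rw [← integral_mul_const]
      refine integral_congr_ae (Eventually.of_forall fun x => ?_)
      simp only
      rw [← heven (x - y), neg_sub]; ring

end ConvTest

/-! ### A radial mollifier adapted to an explicit potential. -/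

section Mollifier

/-- An unnormalized radial bump on the unit ball. -/
def rawBump (x : Plane) : ℝ := deriv expNegInvGlue (1 - ‖x‖ ^ 2)

theorem contDiff_deriv_expNegInvGlue : ContDiff ℝ ∞ (deriv expNegInvGlue) :=
  (contDiff_infty_iff_deriv.1 (expNegInvGlue.contDiff (n := ⊤))).2

theorem deriv_expNegInvGlue_nonneg (s : ℝ) : 0 ≤ deriv expNegInvGlue s :=
  expNegInvGlue.monotone.deriv_nonneg

theorem deriv_expNegInvGlue_of_nonpos {s : ℝ} (hs : s ≤ 0) : deriv expNegInvGlue s = 0 := by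
  have hcl : IsClosed {s | deriv expNegInvGlue s = 0} :=
    isClosed_eq contDiff_deriv_expNegInvGlue.continuous continuous_const
  have : Iio (0 : ℝ) ⊆ {s | deriv expNegInvGlue s = 0} := by
    intro t ht
    have : expNegInvGlue =ᶠ[𝓝 t] fun _ => 0 := by
      filter_upwards [Iio_mem_nhds ht] with y hy
      exact expNegInvGlue.zero_of_nonpos (le_of_lt hy)
    simp [this.deriv_eq]
  have h2 := hcl.closure_subset_iff.2 this
  rw [closure_Iio] at h2
  exact h2 hs

theorem contDiff_rawBump : ContDiff ℝ ∞ rawBump :=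
  contDiff_deriv_expNegInvGlue.comp (contDiff_const.sub (contDiff_norm_sq ℝ))

theorem rawBump_support : Function.support rawBump ⊆ ball 0 1 := by
  intro x hx
  by_contra h
  refine hx (deriv_expNegInvGlue_of_nonpos ?_)
  simp only [mem_ball_zero_iff, not_lt] at h
  nlinarith

theorem rawBump_hasCompactSupport : HasCompactSupport rawBump :=
  HasCompactSupport.of_support_subset_isCompact (isCompact_closedBall (0 : Plane) 1)
    (rawBump_support.trans ball_subset_closedBall)

theorem rawBump_nonneg (x : Plane) : 0 ≤ rawBump x := deriv_expNegInvGlue_nonneg _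

/-- If the integral vanished, the continuous bump would be identically zero. Its value at norm `√(1
- s)` is the derivative of `expNegInvGlue` at `s`, so that function would be constant on `[0, 1]`,
but it vanishes at `0` and is positive at `1`. -/
theorem integral_rawBump_pos : 0 < ∫ x, rawBump x := by
  have hi : Integrable rawBump :=
    contDiff_rawBump.continuous.integrable_of_hasCompactSupport rawBump_hasCompactSupport
  refine lt_of_le_of_ne (integral_nonneg rawBump_nonneg) fun h => ?_
  have h0 := (integral_eq_zero_iff_of_nonneg rawBump_nonneg hi).1 h.symm
  have h1 : rawBump = 0 := (contDiff_rawBump.continuous.ae_eq_iff_eq volume continuous_const).1 h0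
  have h2 : ∀ s ∈ Icc (0 : ℝ) 1, deriv expNegInvGlue s = 0 := by
    intro s hs
    have := congrFun h1 (EuclideanSpace.single 0 (Real.sqrt (1 - s)))
    simp only [rawBump, Pi.zero_apply, PiLp.norm_single, Real.norm_eq_abs, sq_abs] at this
    rwa [Real.sq_sqrt (by linarith [hs.2]), sub_sub_cancel] at this
  have hd : Differentiable ℝ expNegInvGlue :=
    (expNegInvGlue.contDiff (n := 1)).differentiable (by simp)
  have h3 : expNegInvGlue 1 = expNegInvGlue 0 := by
    refine constant_of_derivWithin_zero (a := 0) (b := 1) hd.differentiableOn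
      (fun s hs => ?_) 1 (by simp)
    rw [(hd s).derivWithin (uniqueDiffOn_Icc (by norm_num) s ⟨hs.1, hs.2.le⟩)]
    exact h2 s ⟨hs.1, hs.2.le⟩
  have := expNegInvGlue.pos_of_pos (zero_lt_one)
  rw [h3, expNegInvGlue.zero] at this
  exact lt_irrefl _ this

/-- The total mass of `rawBump`. -/
def bumpMass : ℝ := ∫ x, rawBump x

theorem bumpMass_pos : 0 < bumpMass := integral_rawBump_pos

/-- The standard mollifier at scale `ε`. -/
def mollk (ε : ℝ) (x : Plane) : ℝ := (ε ^ 2 * bumpMass)⁻¹ * rawBump (ε⁻¹ • x)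

/-- A radial potential: its gradient at `x` is `x` times the mollifier, up to scaling. -/
def mollPot (ε : ℝ) (x : Plane) : ℝ := -(2 * bumpMass)⁻¹ * expNegInvGlue (1 - ‖ε⁻¹ • x‖ ^ 2)

/-- Mollification at scale `ε`. -/
def moll (ε : ℝ) (g : Plane → ℝ) : Plane → ℝ := conv (mollk ε) g

variable {ε : ℝ} {g : Plane → ℝ}

theorem contDiff_mollk (ε : ℝ) : ContDiff ℝ ∞ (mollk ε) :=
  contDiff_const.mul (contDiff_rawBump.comp (contDiff_const_smul _))

theorem mollk_support (hε : 0 < ε) : Function.support (mollk ε) ⊆ ball 0 ε := by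
  intro x hx
  have h1 : rawBump (ε⁻¹ • x) ≠ 0 := right_ne_zero_of_mul hx
  have := rawBump_support h1
  simp only [mem_ball_zero_iff, norm_smul, norm_inv, Real.norm_eq_abs, abs_of_pos hε] at this ⊢
  rwa [inv_mul_lt_iff₀ hε, mul_one] at this

theorem isTest_mollk (hε : 0 < ε) : IsTest (mollk ε) :=
  ⟨contDiff_mollk ε, HasCompactSupport.of_support_subset_isCompact (isCompact_closedBall 0 ε)
    ((mollk_support hε).trans ball_subset_closedBall)⟩

theorem mollk_nonneg (ε : ℝ) (x : Plane) : 0 ≤ mollk ε x :=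
  mul_nonneg (inv_nonneg.2 (mul_nonneg (sq_nonneg _) bumpMass_pos.le)) (rawBump_nonneg _)

theorem mollk_neg (ε : ℝ) (x : Plane) : mollk ε (-x) = mollk ε x := by
  simp [mollk, rawBump]

theorem integral_comp_inv_smul_plane (hε : 0 < ε) (f : Plane → ℝ) :
    ∫ x, f (ε⁻¹ • x) = ε ^ 2 * ∫ x, f x := by
  rw [Measure.integral_comp_inv_smul_of_nonneg volume f hε.le]
  simp

theorem integral_mollk (hε : 0 < ε) : ∫ x, mollk ε x = 1 := by
  simp only [mollk]
  rw [integral_const_mul, integral_comp_inv_smul_plane hε]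
  change _ * (_ * bumpMass) = 1
  have := bumpMass_pos
  field_simp

theorem integrable_mollk (hε : 0 < ε) : Integrable (mollk ε) :=
  (isTest_mollk hε).continuous.integrable_of_hasCompactSupport (isTest_mollk hε).2

theorem integral_mollk_sub (hε : 0 < ε) (x : Plane) : ∫ y, mollk ε (x - y) = 1 := by
  rw [integral_sub_left_eq_self (fun y => mollk ε y) volume x, integral_mollk hε]

theorem exists_mollk_le : ∃ C, 0 < C ∧ ∀ ε, 0 < ε → ∀ x, mollk ε x ≤ C * (ε ^ 2)⁻¹ := by
  obtain ⟨C, hC⟩ := contDiff_rawBump.continuous.bounded_above_of_compact_support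
    rawBump_hasCompactSupport
  refine ⟨bumpMass⁻¹ * (|C| + 1), mul_pos (inv_pos.2 bumpMass_pos) (by positivity),
    fun ε hε x => ?_⟩
  have h1 : rawBump (ε⁻¹ • x) ≤ |C| + 1 := by
    have := (le_abs_self _).trans (hC (ε⁻¹ • x))
    linarith [le_abs_self C]
  simp only [mollk, mul_inv]
  have := bumpMass_pos
  calc (ε ^ 2)⁻¹ * bumpMass⁻¹ * rawBump (ε⁻¹ • x) ≤ (ε ^ 2)⁻¹ * bumpMass⁻¹ * (|C| + 1) := by gcongr
    _ = _ := by ring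

theorem abs_moll_le (hε : 0 < ε) {x : Plane} {C : ℝ}
    (hb : ∀ᵐ y, y ∈ ball x ε → |g y| ≤ C) : |moll ε g x| ≤ C := by
  simp only [moll, conv_apply]
  rw [← Real.norm_eq_abs]
  have h0 : ∫ y, mollk ε (x - y) * C = C := by
    rw [integral_mul_const, integral_mollk_sub hε, one_mul]
  rw [← h0]
  refine norm_integral_le_of_norm_le ?_ ?_
  · exact ((integrable_mollk hε).comp_sub_left x).mul_const C
  · filter_upwards [hb] with y hy
    rw [Real.norm_eq_abs, abs_mul, abs_of_nonneg (mollk_nonneg _ _)]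
    by_cases h : mollk ε (x - y) = 0
    · simp [h]
    · refine mul_le_mul_of_nonneg_left (hy ?_) (mollk_nonneg _ _)
      have := mollk_support hε h
      simpa [dist_eq_norm, norm_sub_rev] using this

/-- Mollification converges at Lebesgue points. -/
theorem ae_tendsto_moll (hg : LocallyIntegrable g volume) :
    ∀ᵐ x, Tendsto (fun ε => moll ε g x) (𝓝[>] 0) (𝓝 (g x)) := by
  obtain ⟨C, hC0, hC⟩ := exists_mollk_le
  filter_upwards [(Besicovitch.vitaliFamily (volume : Measure Plane)).ae_tendsto_average_norm_sub hg]
    with x h₀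
  have h1 := h₀.comp (Besicovitch.tendsto_filterAt volume x)
  have := tendsto_integral_smul_of_tendsto_average_norm_sub (μ := volume)
    (g := fun (ε : ℝ) y => mollk ε (x - y)) (l := 𝓝[>] (0 : ℝ)) (c := g x) (f := g)
    (a := fun ε => closedBall x ε)
    (C * volume.real (closedBall (0 : Plane) 1)) h1 ?_ ?_ ?_ ?_
  · simpa only [moll, conv_apply, smul_eq_mul] using this
  · exact Eventually.of_forall fun ε => hg.integrableOn_isCompact (isCompact_closedBall _ _)
  · refine tendsto_const_nhds.congr' ?_
    filter_upwards [self_mem_nhdsWithin] with ε hε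
    rw [integral_mollk_sub hε]
  · filter_upwards [self_mem_nhdsWithin] with ε hε y hy
    have := mollk_support hε hy
    simp only [mem_ball_zero_iff] at this
    simpa [dist_eq_norm, norm_sub_rev] using this.le
  · filter_upwards [self_mem_nhdsWithin] with ε hε y
    have hε' : (0 : ℝ) < ε := hε
    rw [abs_of_nonneg (mollk_nonneg _ _), Measure.addHaar_real_closedBall volume x hε'.le,
      ← Measure.addHaar_real_closedBall_eq_addHaar_real_ball]
    have hv : 0 < volume.real (closedBall (0 : Plane) 1) :=
      ENNReal.toReal_pos (measure_closedBall_pos volume _ one_pos).ne'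
        measure_closedBall_lt_top.ne
    refine (hC ε hε _).trans (le_of_eq ?_)
    simp only [finrank_euclideanSpace, Fintype.card_fin]
    field_simp

/-- The scales `1 / (n + 1)`. -/
def scale (n : ℕ) : ℝ := 1 / ((n : ℝ) + 1)

theorem scale_pos (n : ℕ) : 0 < scale n := by unfold scale; positivity

theorem scale_le_one (n : ℕ) : scale n ≤ 1 := by
  unfold scale; rw [div_le_one (by positivity)]; linarith [(n.cast_nonneg : (0 : ℝ) ≤ n)]

theorem tendsto_scale : Tendsto scale atTop (𝓝 0) := tendsto_one_div_add_atTop_nhds_zero_nat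

theorem tendsto_scale_within : Tendsto scale atTop (𝓝[>] 0) :=
  tendsto_nhdsWithin_iff.2 ⟨tendsto_scale, Eventually.of_forall scale_pos⟩

theorem ae_tendsto_moll_scale (hg : LocallyIntegrable g volume) :
    ∀ᵐ x, Tendsto (fun n => moll (scale n) g x) atTop (𝓝 (g x)) := by
  filter_upwards [ae_tendsto_moll hg] with x hx
  exact hx.comp tendsto_scale_within

theorem contDiff_moll (hε : 0 < ε) (hg : LocallyIntegrable g volume) :
    ContDiff ℝ ∞ (moll ε g) := contDiff_conv (isTest_mollk hε) hg

theorem isTest_moll (hε : 0 < ε) (hc : HasCompactSupport g) (hg : LocallyIntegrable g volume) :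
    IsTest (moll ε g) := (isTest_mollk hε).conv_of_integrable hc hg

theorem integral_mul_moll (hε : 0 < ε) {a : Plane → ℝ} (ha : Continuous a)
    (hac : HasCompactSupport a) (hg : LocallyIntegrable g volume) :
    ∫ x, a x * moll ε g x = ∫ x, moll ε a x * g x :=
  integral_mul_conv (isTest_mollk hε).continuous (isTest_mollk hε).2 (mollk_neg ε) ha hac hg

/-- Jensen's inequality: the mollifier centred at `x` is a probability density, and the variance of
`g` under it is nonnegative. -/
theorem sq_moll_le (hε : 0 < ε) (hg : LocallyIntegrable g volume)
    (hg2 : LocallyIntegrable (fun x => g x ^ 2) volume) (x : Plane) :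
    moll ε g x ^ 2 ≤ moll ε (fun y => g y ^ 2) x := by
  have h1 : 0 ≤ ∫ y, mollk ε (x - y) * (g y - moll ε g x) ^ 2 :=
    integral_nonneg fun y => mul_nonneg (mollk_nonneg _ _) (sq_nonneg _)
  have i1 := (isTest_mollk hε).integrable_conv hg x
  have i2 := (isTest_mollk hε).integrable_conv hg2 x
  have i3 := (integrable_mollk hε).comp_sub_left x
  have e : ∀ y, mollk ε (x - y) * (g y - moll ε g x) ^ 2
      = mollk ε (x - y) * g y ^ 2 - 2 * moll ε g x * (mollk ε (x - y) * g y)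
        + mollk ε (x - y) * moll ε g x ^ 2 := fun y => by ring
  simp only [e] at h1
  have i12 : Integrable (fun y => mollk ε (x - y) * g y ^ 2
      - 2 * moll ε g x * (mollk ε (x - y) * g y)) := i2.sub (i1.const_mul _)
  rw [integral_add i12 (i3.mul_const _),
    integral_sub i2 (i1.const_mul _), integral_const_mul, integral_mul_const,
    integral_mollk_sub hε] at h1
  have e1 : moll ε g x = ∫ y, mollk ε (x - y) * g y := conv_apply _ _ _
  have e2 : moll ε (fun y => g y ^ 2) x = ∫ y, mollk ε (x - y) * g y ^ 2 := conv_apply _ _ _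
  rw [← e1, ← e2] at h1
  nlinarith

end Mollifier

/-! ### The derivative of the mollifier with respect to its scale. -/

section ScaleDerivative

variable {ε : ℝ}

theorem contDiff_mollPot (ε : ℝ) : ContDiff ℝ ∞ (mollPot ε) := by
  refine contDiff_const.mul ((expNegInvGlue.contDiff (n := ⊤)).comp ?_)
  exact contDiff_const.sub ((contDiff_norm_sq ℝ).comp (contDiff_const_smul _))

theorem isTest_mollPot (hε : 0 < ε) : IsTest (mollPot ε) := by
  refine ⟨contDiff_mollPot ε,
    HasCompactSupport.of_support_subset_isCompact (isCompact_closedBall 0 ε) fun x hx => ?_⟩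
  by_contra h
  refine hx ?_
  simp only [mollPot]
  rw [expNegInvGlue.zero_of_nonpos, mul_zero]
  simp only [mem_closedBall_zero_iff, not_le] at h
  have h1 : 1 ≤ ‖ε⁻¹ • x‖ := by
    rw [norm_smul, norm_inv, Real.norm_eq_abs, abs_of_pos hε, le_inv_mul_iff₀ hε]
    linarith
  nlinarith

theorem partialDeriv_norm_sq (i : Fin 2) (x : Plane) :
    ∂_ i (fun y => ‖y‖ ^ 2) x = 2 * x i := by
  rw [partialDeriv_def, (hasStrictFDerivAt_norm_sq x).hasFDerivAt.fderiv]
  simp [basisVec, EuclideanSpace.inner_single_right]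

theorem differentiable_expNegInvGlue : Differentiable ℝ expNegInvGlue :=
  (expNegInvGlue.contDiff (n := 1)).differentiable (by simp)

/-- This is why the bump is the derivative of a glue function evaluated at `1 - ‖x‖²`: the position
vector times the mollifier becomes an exact gradient of a compactly supported function. -/
theorem partialDeriv_mollPot (hε : 0 < ε) (i : Fin 2) (x : Plane) :
    ∂_ i (mollPot ε) x = x i * mollk ε x := by
  have hn : Differentiable ℝ (fun y : Plane => ‖y‖ ^ 2) :=
    (contDiff_norm_sq ℝ (n := 1)).differentiable (by simp)
  have h1 : ∀ y : Plane, ∂_ i (fun z => expNegInvGlue (1 - ‖z‖ ^ 2)) y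
      = -2 * y i * rawBump y := by
    intro y
    rw [partialDeriv_comp i (β := fun s => expNegInvGlue (1 - s)) (f := fun z : Plane => ‖z‖ ^ 2)
      (differentiable_expNegInvGlue.comp (by fun_prop : Differentiable ℝ fun s : ℝ => 1 - s)
        |>.differentiableAt) hn.differentiableAt, partialDeriv_norm_sq]
    rw [deriv_comp_const_sub (f := expNegInvGlue)]
    simp only [rawBump]; ring
  have h2 : mollPot ε = fun x => -(2 * bumpMass)⁻¹ *
      (fun y : Plane => (fun z : Plane => expNegInvGlue (1 - ‖z‖ ^ 2)) (ε⁻¹ • y)) x := rfl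
  have hd : Differentiable ℝ (fun z : Plane => expNegInvGlue (1 - ‖z‖ ^ 2)) :=
    differentiable_expNegInvGlue.comp (by fun_prop)
  rw [h2, partialDeriv_const_mul,
    partialDeriv_comp_smul i (fun z : Plane => expNegInvGlue (1 - ‖z‖ ^ 2)), h1]
  · simp only [mollk, PiLp.smul_apply, smul_eq_mul]
    have := bumpMass_pos
    field_simp
  · exact (hd.comp (differentiable_id.const_smul ε⁻¹)).differentiableAt

/-- The derivative of the mollifier with respect to its scale. -/
def mollkDeriv (ε : ℝ) (z : Plane) : ℝ :=
  -ε⁻¹ * (2 * mollk ε z + (z 0 * ∂_ 0 (mollk ε) z + z 1 * ∂_ 1 (mollk ε) z))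

theorem partialDeriv_mollk (i : Fin 2) (ε : ℝ) (z : Plane) :
    ∂_ i (mollk ε) z
      = (ε ^ 2 * bumpMass)⁻¹ * (ε⁻¹ * ∂_ i rawBump (ε⁻¹ • z)) := by
  have : mollk ε = fun x => (ε ^ 2 * bumpMass)⁻¹ * (fun y => rawBump (ε⁻¹ • y)) x := rfl
  rw [this, partialDeriv_const_mul, partialDeriv_comp_smul]
  exact ((contDiff_rawBump.comp (contDiff_const_smul _)).differentiable (by simp)).differentiableAt

theorem hasDerivAt_mollk (hε : 0 < ε) (z : Plane) :
    HasDerivAt (fun s => mollk s z) (mollkDeriv ε z) ε := by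
  have h1 : HasDerivAt (fun s : ℝ => (s ^ 2 * bumpMass)⁻¹)
      (-(2 * ε * bumpMass) / (ε ^ 2 * bumpMass) ^ 2) ε := by
    have h := ((hasDerivAt_pow 2 ε).mul_const bumpMass).inv
      (by have := bumpMass_pos; positivity)
    refine h.congr_deriv ?_
    simp
  have h2 : HasDerivAt (fun s : ℝ => s⁻¹ • z) ((-(ε ^ 2)⁻¹) • z) ε :=
    (hasDerivAt_inv hε.ne').smul_const z
  have h3 : HasDerivAt (fun s : ℝ => rawBump (s⁻¹ • z))
      (fderiv ℝ rawBump (ε⁻¹ • z) ((-(ε ^ 2)⁻¹) • z)) ε :=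
    ((contDiff_rawBump.differentiable (by simp)).differentiableAt.hasFDerivAt).comp_hasDerivAt ε h2
  have h := h1.mul h3
  refine h.congr_deriv ?_
  rw [fderiv_apply_eq_sum]
  simp only [mollkDeriv, partialDeriv_mollk, Fin.sum_univ_two, mollk, PiLp.smul_apply, smul_eq_mul]
  have := bumpMass_pos
  field_simp
  ring

/-- By scaling, the derivative in `ε` is `-1/ε` times the divergence of `z` times the mollifier, and
that vector field is a gradient. A change of scale therefore tests a field against a Laplacian,
where only its divergence and curl are visible. -/
theorem mollkDeriv_eq_laplacian (hε : 0 < ε) (z : Plane) :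
    mollkDeriv ε z = -ε⁻¹ * (∂_ 0 (∂_ 0 (mollPot ε)) z
      + ∂_ 1 (∂_ 1 (mollPot ε)) z) := by
  have hk : Differentiable ℝ (mollk ε) := (contDiff_mollk ε).differentiable (by simp)
  have hc : ∀ i : Fin 2, Differentiable ℝ (fun x : Plane => x i) := fun i => by fun_prop
  have hp : ∀ i, ∂_ i (fun x : Plane => x i) z = 1 := fun i => by
    rw [partialDeriv_def]
    have : (fun x : Plane => x i) = (EuclideanSpace.proj i : Plane →L[ℝ] ℝ) := rfl
    rw [this, ContinuousLinearMap.fderiv]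
    simp [basisVec]
  have h : ∀ i, ∂_ i (∂_ i (mollPot ε)) z
      = mollk ε z + z i * ∂_ i (mollk ε) z := by
    intro i
    have : ∂_ i (mollPot ε) = fun x => x i * mollk ε x :=
      funext fun x => partialDeriv_mollPot hε i x
    rw [this, partialDeriv_mul i (hc i).differentiableAt hk.differentiableAt, hp]
    ring
  rw [h, h, mollkDeriv]; ring

theorem mollkDeriv_support (hε : 0 < ε) {z : Plane} (hz : ε ≤ ‖z‖) : mollkDeriv ε z = 0 := by
  have h0 : ∀ z : Plane, ε ≤ ‖z‖ → mollk ε z = 0 := fun z hz => by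
    by_contra h
    have := mollk_support hε h
    simp only [mem_ball_zero_iff] at this
    linarith
  have h1 : ∀ i, ∂_ i (mollk ε) z = 0 := by
    intro i
    have hcl : IsClosed {z : Plane | ∂_ i (mollk ε) z = 0} :=
      isClosed_eq (continuous_partialDeriv i (contDiff_one (contDiff_mollk ε))) continuous_const
    have hsub : (closedBall (0 : Plane) ε)ᶜ ⊆ {z | ∂_ i (mollk ε) z = 0} := by
      intro y hy
      have : mollk ε =ᶠ[𝓝 y] fun _ => 0 := by
        filter_upwards [isClosed_closedBall.isOpen_compl.mem_nhds hy] with x hx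
        simp only [mem_compl_iff, mem_closedBall_zero_iff, not_le] at hx
        exact h0 x hx.le
      change ∂_ i (mollk ε) y = 0
      rw [partialDeriv_congr this]
      simp [partialDeriv]
    -- The gradient vanishes on the open exterior by locality; taking the closure adds the sphere of
    -- radius `ε`, which the hypothesis allows.
    have h2 := hcl.closure_subset_iff.2 hsub
    rw [closure_compl, interior_closedBall _ hε.ne'] at h2
    exact h2 (by simpa using hz)
  simp [mollkDeriv, h0 z hz, h1]

/-- Uniformity over a compact range of scales supplies the dominating function for differentiation
under the integral sign. -/
theorem exists_mollkDeriv_le {a b : ℝ} (ha : 0 < a) : ∃ C, ∀ s ∈ Icc a b, ∀ z : Plane,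
    |mollkDeriv s z| ≤ C := by
  obtain ⟨C, hC0, hC⟩ := exists_mollk_le
  have hb : ∀ i : Fin 2, ∃ C, ∀ z, |∂_ i rawBump z| ≤ C := fun i =>
    (contDiff_partialDeriv i contDiff_rawBump).continuous.bounded_above_of_compact_support
      (hasCompactSupport_partialDeriv i rawBump_hasCompactSupport)
  obtain ⟨C0, h0⟩ := hb 0
  obtain ⟨C1, h1⟩ := hb 1
  have hm := bumpMass_pos
  have hC0' : 0 ≤ C0 := (abs_nonneg _).trans (h0 0)
  have hC1' : 0 ≤ C1 := (abs_nonneg _).trans (h1 0)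
  refine ⟨a⁻¹ * (2 * (C * (a ^ 2)⁻¹) + (b * ((a ^ 2 * bumpMass)⁻¹ * (a⁻¹ * C0))
    + b * ((a ^ 2 * bumpMass)⁻¹ * (a⁻¹ * C1)))), fun s hs z => ?_⟩
  have hs0 : 0 < s := ha.trans_le hs.1
  have hab : 0 ≤ b := hs0.le.trans hs.2
  have hsi : s⁻¹ ≤ a⁻¹ := inv_anti₀ ha hs.1
  have hs2 : (s ^ 2)⁻¹ ≤ (a ^ 2)⁻¹ := inv_anti₀ (by positivity) (by gcongr; exact hs.1)
  have hs3 : (s ^ 2 * bumpMass)⁻¹ ≤ (a ^ 2 * bumpMass)⁻¹ :=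
    inv_anti₀ (by positivity) (by gcongr; exact hs.1)
  by_cases hz : s ≤ ‖z‖
  · rw [mollkDeriv_support hs0 hz, abs_zero]
    positivity
  have hz' : ∀ i, |z i| ≤ b := fun i =>
    (PiLp.norm_apply_le z i).trans ((not_le.1 hz).le.trans hs.2)
  simp only [mollkDeriv, partialDeriv_mollk]
  rw [abs_mul, abs_neg, abs_of_pos (inv_pos.2 hs0)]
  refine mul_le_mul hsi ?_ (abs_nonneg _) (by positivity)
  refine (abs_add_le _ _).trans (add_le_add ?_ ((abs_add_le _ _).trans (add_le_add ?_ ?_)))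
  · rw [abs_mul, abs_of_nonneg (mollk_nonneg _ _), abs_two]
    have := hC s hs0 z
    gcongr
    exact this.trans (by gcongr)
  · rw [abs_mul, abs_mul, abs_mul, abs_of_pos (inv_pos.2 hs0), abs_of_pos (show 0 < (s ^ 2 * bumpMass)⁻¹ by positivity)]
    gcongr
    · exact hz' 0
    · exact h0 _
  · rw [abs_mul, abs_mul, abs_mul, abs_of_pos (inv_pos.2 hs0), abs_of_pos (show 0 < (s ^ 2 * bumpMass)⁻¹ by positivity)]
    gcongr
    · exact hz' 1
    · exact h1 _

theorem hasDerivAt_moll {g : Plane → ℝ} (hg : LocallyIntegrable g volume) (hε : 0 < ε)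
    (x : Plane) :
    HasDerivAt (fun s => moll s g x) (∫ y, mollkDeriv ε (x - y) * g y) ε := by
  simp only [moll, conv_apply]
  obtain ⟨C, hC⟩ := exists_mollkDeriv_le (a := ε / 2) (b := 2 * ε) (by positivity)
  have hnhds : Icc (ε / 2) (2 * ε) ∈ 𝓝 ε := Icc_mem_nhds (by linarith) (by linarith)
  have hcont : ∀ s, Continuous (mollkDeriv s) := by
    intro s
    have h0 := continuous_partialDeriv 0 (contDiff_one (contDiff_mollk s))
    have h1 := continuous_partialDeriv 1 (contDiff_one (contDiff_mollk s))
    have h2 := (contDiff_mollk s).continuous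
    unfold mollkDeriv
    fun_prop
  refine (hasDerivAt_integral_of_dominated_loc_of_deriv_le (μ := volume) (𝕜 := ℝ)
    (F := fun s y => mollk s (x - y) * g y) (F' := fun s y => mollkDeriv s (x - y) * g y)
    (bound := (closedBall x (2 * ε)).indicator fun y => C * |g y|)
    hnhds ?_ ?_ ?_ ?_ ?_ ?_).2
  · refine Eventually.of_forall fun s => ?_
    exact (((contDiff_mollk s).continuous.comp
      (continuous_const.sub continuous_id)).aestronglyMeasurable).mul hg.aestronglyMeasurable
  · exact (isTest_mollk hε).integrable_conv hg x
  · exact (((hcont ε).comp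
      (continuous_const.sub continuous_id)).aestronglyMeasurable).mul hg.aestronglyMeasurable
  · refine Eventually.of_forall fun y s hs => ?_
    by_cases hy : y ∈ closedBall x (2 * ε)
    · rw [indicator_of_mem hy, norm_mul]
      exact mul_le_mul_of_nonneg_right (hC s hs _) (norm_nonneg _)
    · rw [indicator_of_notMem hy]
      simp only [mem_closedBall, not_le, dist_eq_norm] at hy
      rw [mollkDeriv_support (lt_of_lt_of_le (by linarith) hs.1)
        (by rw [norm_sub_rev]; exact hs.2.trans hy.le)]
      simp
  · rw [integrable_indicator_iff isClosed_closedBall.measurableSet]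
    exact ((hg.integrableOn_isCompact (isCompact_closedBall _ _)).norm).const_mul C
  · refine Eventually.of_forall fun y s hs => ?_
    exact (hasDerivAt_mollk (lt_of_lt_of_le (by linarith) hs.1) _).mul_const _

end ScaleDerivative

/-! ### Fields with bounded vorticity: approximation by mollification and continuous
representatives. -/

/-- A divergence-free vector field whose vorticity `w` is bounded by `W`. -/
structure IsField (f : Plane → Plane) (w : Plane → ℝ) (W : ℝ) : Prop where
  locInt : LocallyIntegrable f volume
  divFree : IsWeaklyDivFree f
  curl : IsWeakCurl f w
  bound : ∀ᵐ x, |w x| ≤ W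

namespace IsField

variable {f : Plane → Plane} {w : Plane → ℝ} {W : ℝ} {ε ρ : ℝ}

theorem coord (h : IsField f w W) (i : Fin 2) : LocallyIntegrable (fun x => f x i) volume := by
  refine h.locInt.mono ?_ (Eventually.of_forall fun x => PiLp.norm_apply_le (f x) i)
  exact (EuclideanSpace.proj i : Plane →L[ℝ] ℝ).continuous.comp_aestronglyMeasurable
    h.locInt.aestronglyMeasurable

theorem bound_nonneg (h : IsField f w W) : 0 ≤ W := by
  obtain ⟨x, hx⟩ := h.bound.exists
  exact (abs_nonneg _).trans hx

theorem integral_div (h : IsField f w W) {φ : Plane → ℝ} (hφ : IsTest φ) :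
    ∫ x, (f x 0 * ∂_ 0 φ x + f x 1 * ∂_ 1 φ x) = 0 := by
  have := h.divFree φ hφ
  simpa only [fderiv_apply_eq_sum, Fin.sum_univ_two] using this

theorem int_mul (h : IsField f w W) (i : Fin 2) {φ : Plane → ℝ} (hφ : IsTest φ) :
    Integrable (fun x => f x i * φ x) := by
  simpa only [mul_comm] using hφ.integrable_mul (h.coord i)

/-- The weak form of "the Laplacian of a divergence-free field is a rotated gradient of its
vorticity": the curl is tested with `∂₁φ`, the divergence with `∂₀φ`, and the mixed derivatives
cancel. -/
theorem integral_laplacian_zero (h : IsField f w W) {φ : Plane → ℝ} (hφ : IsTest φ) :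
    ∫ x, f x 0 * (∂_ 0 (∂_ 0 φ) x + ∂_ 1 (∂_ 1 φ) x)
      = ∫ x, w x * ∂_ 1 φ x := by
  rw [h.curl.2 _ (hφ.partialDeriv 1), ← add_zero (∫ x, _ - _), ← h.integral_div (hφ.partialDeriv 0),
    ← integral_add]
  · refine integral_congr_ae (Eventually.of_forall fun x => ?_)
    simp only [partialDeriv_comm 1 0 hφ.1]
    ring
  · exact (h.int_mul 0 ((hφ.partialDeriv 1).partialDeriv 1)).sub
      (h.int_mul 1 ((hφ.partialDeriv 1).partialDeriv 0))
  · exact (h.int_mul 0 ((hφ.partialDeriv 0).partialDeriv 0)).add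
      (h.int_mul 1 ((hφ.partialDeriv 0).partialDeriv 1))

theorem integral_laplacian_one (h : IsField f w W) {φ : Plane → ℝ} (hφ : IsTest φ) :
    ∫ x, f x 1 * (∂_ 0 (∂_ 0 φ) x + ∂_ 1 (∂_ 1 φ) x)
      = -∫ x, w x * ∂_ 0 φ x := by
  rw [h.curl.2 _ (hφ.partialDeriv 0), ← zero_sub, ← h.integral_div (hφ.partialDeriv 1),
    ← integral_sub]
  · refine integral_congr_ae (Eventually.of_forall fun x => ?_)
    simp only [partialDeriv_comm 1 0 hφ.1]
    ring
  · exact (h.int_mul 0 ((hφ.partialDeriv 1).partialDeriv 0)).add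
      (h.int_mul 1 ((hφ.partialDeriv 1).partialDeriv 1))
  · exact (h.int_mul 0 ((hφ.partialDeriv 0).partialDeriv 1)).sub
      (h.int_mul 1 ((hφ.partialDeriv 0).partialDeriv 0))

/-- The gradient of the potential is the position times the mollifier, hence at most `ε` times a
probability density. -/
theorem abs_integral_curl_mollPot_le (h : IsField f w W) (hε : 0 < ε) (i : Fin 2) (x : Plane) :
    |∫ y, w y * ∂_ i (fun z => mollPot ε (x - z)) y| ≤ W * ε := by
  rw [← Real.norm_eq_abs]
  have h0 : ∫ y, W * ε * mollk ε (x - y) = W * ε := by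
    rw [integral_const_mul, integral_mollk_sub hε, mul_one]
  rw [← h0]
  refine norm_integral_le_of_norm_le (((integrable_mollk hε).comp_sub_left x).const_mul _) ?_
  filter_upwards [h.bound] with y hy
  rw [partialDeriv_const_sub, partialDeriv_mollPot hε, Real.norm_eq_abs, abs_mul, abs_neg, abs_mul,
    abs_of_nonneg (mollk_nonneg _ _), mul_assoc]
  have hW := h.bound_nonneg
  by_cases hz : mollk ε (x - y) = 0
  · simp [hz]
  · have h1 := mollk_support hε hz
    simp only [mem_ball_zero_iff] at h1
    have h2 : |(x - y) i| ≤ ε := (PiLp.norm_apply_le (x - y) i).trans h1.le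
    have := mollk_nonneg ε (x - y)
    gcongr

/-- The factor `1/ε` in front of the Laplacian is compensated by the factor `ε` in the bound for the
gradient of the potential. -/
theorem abs_deriv_moll_le (h : IsField f w W) (hε : 0 < ε) (i : Fin 2) (x : Plane) :
    |∫ y, mollkDeriv ε (x - y) * f y i| ≤ W := by
  have hφ := (isTest_mollPot hε).comp_const_sub x
  have e : ∀ y, mollkDeriv ε (x - y) * f y i
      = -ε⁻¹ * (f y i * (∂_ 0 (∂_ 0 (fun z => mollPot ε (x - z))) y
        + ∂_ 1 (∂_ 1 (fun z => mollPot ε (x - z))) y)) := by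
    intro y
    have h2 : ∀ j, ∂_ j (∂_ j (fun z => mollPot ε (x - z))) y
        = ∂_ j (∂_ j (mollPot ε)) (x - y) := by
      intro j
      have : ∂_ j (fun z => mollPot ε (x - z))
          = fun z => (fun u => -∂_ j (mollPot ε) u) (x - z) :=
        funext fun z => partialDeriv_const_sub j _ _ _
      rw [this, partialDeriv_const_sub j (fun u => -∂_ j (mollPot ε) u)]
      have h3 : (fun u => -∂_ j (mollPot ε) u)
          = fun u => (-1) * ∂_ j (mollPot ε) u := by ext; ring
      rw [h3, partialDeriv_const_mul]
      · ring
      · exact ((contDiff_partialDeriv j (contDiff_mollPot ε)).differentiable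
          (by simp)).differentiableAt
    rw [h2, h2, mollkDeriv_eq_laplacian hε]; ring
  simp only [e]
  rw [integral_const_mul, abs_mul, abs_neg, abs_of_pos (inv_pos.2 hε), inv_mul_le_iff₀ hε]
  rw [mul_comm ε W]
  fin_cases i
  · simp only [Fin.zero_eta]
    rw [h.integral_laplacian_zero hφ]
    exact h.abs_integral_curl_mollPot_le hε 1 x
  · simp only [Fin.mk_one]
    rw [h.integral_laplacian_one hφ, abs_neg]
    exact h.abs_integral_curl_mollPot_le hε 0 x

/-- The mean value inequality in the scale. No logarithm is lost, although the gradient of a field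
with bounded vorticity need not be bounded; the cancellation is that of the radial mollifier. -/
theorem abs_moll_sub_moll_le (h : IsField f w W) (hε : 0 < ε) (hρ : 0 < ρ) (i : Fin 2)
    (x : Plane) :
    |moll ρ (fun y => f y i) x - moll ε (fun y => f y i) x| ≤ W * |ρ - ε| := by
  have := (convex_Ioi (0 : ℝ)).norm_image_sub_le_of_norm_hasDerivWithin_le
    (f := fun s => moll s (fun y => f y i) x) (C := W)
    (fun s hs => (hasDerivAt_moll (h.coord i) hs x).hasDerivWithinAt)
    (fun s hs => h.abs_deriv_moll_le hs i x) (mem_Ioi.2 hε) (mem_Ioi.2 hρ)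
  simpa only [Real.norm_eq_abs] using this

end IsField

/-- The continuous representative of a field with bounded vorticity. -/
def fieldRep (f : Plane → Plane) (x : Plane) : Plane :=
  WithLp.toLp 2 fun i => limUnder atTop fun n => moll (scale n) (fun y => f y i) x

namespace IsField

variable {f : Plane → Plane} {w : Plane → ℝ} {W : ℝ} {ε ρ : ℝ}

theorem cauchySeq_moll (h : IsField f w W) (i : Fin 2) (x : Plane) :
    CauchySeq fun n => moll (scale n) (fun y => f y i) x := by
  have h0 : CauchySeq scale := tendsto_scale.cauchySeq
  rw [Metric.cauchySeq_iff] at h0 ⊢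
  intro δ hδ
  have hW := h.bound_nonneg
  obtain ⟨N, hN⟩ := h0 (δ / (W + 1)) (by positivity)
  refine ⟨N, fun m hm n hn => ?_⟩
  have h1 := hN m hm n hn
  rw [Real.dist_eq] at h1 ⊢
  refine (h.abs_moll_sub_moll_le (scale_pos n) (scale_pos m) i x).trans_lt ?_
  rw [lt_div_iff₀ (by positivity)] at h1
  nlinarith [abs_nonneg (scale m - scale n)]

theorem tendsto_fieldRep (h : IsField f w W) (i : Fin 2) (x : Plane) :
    Tendsto (fun n => moll (scale n) (fun y => f y i) x) atTop (𝓝 (fieldRep f x i)) :=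
  (h.cauchySeq_moll i x).tendsto_limUnder

theorem abs_fieldRep_sub_moll_le (h : IsField f w W) (hε : 0 < ε) (i : Fin 2) (x : Plane) :
    |fieldRep f x i - moll ε (fun y => f y i) x| ≤ W * ε := by
  have h1 := ((h.tendsto_fieldRep i x).sub_const (moll ε (fun y => f y i) x)).abs
  have h2 : Tendsto (fun n => W * |scale n - ε|) atTop (𝓝 (W * |0 - ε|)) :=
    (((tendsto_scale.sub_const ε).abs).const_mul W)
  have := le_of_tendsto_of_tendsto h1 h2 (Eventually.of_forall fun n =>
    h.abs_moll_sub_moll_le hε (scale_pos n) i x)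
  rwa [zero_sub, abs_neg, abs_of_pos hε] at this

theorem continuous_fieldRep (h : IsField f w W) : Continuous (fieldRep f) := by
  refine (PiLp.continuous_toLp 2 _).comp (continuous_pi fun i => ?_)
  have h1 : TendstoUniformly (fun n x => moll (scale n) (fun y => f y i) x)
      (fun x => fieldRep f x i) atTop := by
    rw [Metric.tendstoUniformly_iff]
    intro δ hδ
    have h2 : Tendsto (fun n => W * scale n) atTop (𝓝 (W * 0)) := tendsto_scale.const_mul W
    rw [mul_zero] at h2
    filter_upwards [h2.eventually (gt_mem_nhds hδ)] with n hn x
    rw [Real.dist_eq]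
    exact (h.abs_fieldRep_sub_moll_le (scale_pos n) i x).trans_lt hn
  exact h1.continuous (Frequently.of_forall fun n =>
    (contDiff_moll (scale_pos n) (h.coord i)).continuous)

theorem fieldRep_ae_eq (h : IsField f w W) : fieldRep f =ᵐ[volume] f := by
  have h1 : ∀ i, ∀ᵐ x, fieldRep f x i = f x i := fun i => by
    filter_upwards [ae_tendsto_moll_scale (h.coord i)] with x hx
    exact tendsto_nhds_unique (h.tendsto_fieldRep i x) hx
  filter_upwards [h1 0, h1 1] with x h0 h1
  ext i; fin_cases i <;> assumption

theorem congr_ae {g : Plane → Plane} (h : IsField f w W) (e : f =ᵐ[volume] g) :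
    IsField g w W := by
  refine ⟨h.locInt.congr e, fun φ hφ => ?_, ⟨h.curl.1, fun φ hφ => ?_⟩, h.bound⟩
  · rw [← h.divFree φ hφ]
    refine integral_congr_ae ?_
    filter_upwards [e] with x hx
    rw [hx]
  · rw [h.curl.2 φ hφ]
    refine integral_congr_ae ?_
    filter_upwards [e] with x hx
    rw [hx]

theorem isField_fieldRep (h : IsField f w W) : IsField (fieldRep f) w W :=
  h.congr_ae h.fieldRep_ae_eq.symm

theorem fieldRep_eq (h : IsField f w W) (hc : Continuous f) : fieldRep f = f :=
  (h.continuous_fieldRep.ae_eq_iff_eq volume hc).1 h.fieldRep_ae_eq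

theorem abs_sub_moll_le (h : IsField f w W) (hc : Continuous f) (hε : 0 < ε) (i : Fin 2)
    (x : Plane) : |f x i - moll ε (fun y => f y i) x| ≤ W * ε := by
  have := h.abs_fieldRep_sub_moll_le hε i x
  rwa [h.fieldRep_eq hc] at this

theorem wLoc (h : IsField f w W) : LocallyIntegrable w volume := h.curl.1

theorem partialDeriv_moll (h : IsField f w W) (hε : 0 < ε) (i j : Fin 2) (x : Plane) :
    ∂_ j (moll ε (fun y => f y i)) x
      = -∫ y, f y i * ∂_ j (fun z => mollk ε (x - z)) y := by
  rw [moll, partialDeriv_conv j (isTest_mollk hε) (h.coord i), conv_apply, ← integral_neg]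
  refine integral_congr_ae (Eventually.of_forall fun y => ?_)
  simp only [partialDeriv_const_sub]; ring

theorem div_moll (h : IsField f w W) (hε : 0 < ε) (x : Plane) :
    ∂_ 0 (moll ε (fun y => f y 0)) x + ∂_ 1 (moll ε (fun y => f y 1)) x = 0 := by
  have hφ := (isTest_mollk hε).comp_const_sub x
  rw [h.partialDeriv_moll hε, h.partialDeriv_moll hε, ← neg_add, ← integral_add
    (h.int_mul 0 (hφ.partialDeriv 0)) (h.int_mul 1 (hφ.partialDeriv 1)), h.integral_div hφ, neg_zero]

theorem curl_moll (h : IsField f w W) (hε : 0 < ε) (x : Plane) :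
    ∂_ 0 (moll ε (fun y => f y 1)) x - ∂_ 1 (moll ε (fun y => f y 0)) x
      = moll ε w x := by
  have hφ := (isTest_mollk hε).comp_const_sub x
  have h1 := h.curl.2 _ hφ
  rw [integral_sub (h.int_mul 0 (hφ.partialDeriv 1)) (h.int_mul 1 (hφ.partialDeriv 0))] at h1
  rw [h.partialDeriv_moll hε, h.partialDeriv_moll hε, moll, conv_apply]
  simp only [mul_comm (mollk _ _)]
  rw [h1]; ring

theorem abs_moll_curl_le (h : IsField f w W) (hε : 0 < ε) (x : Plane) : |moll ε w x| ≤ W :=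
  abs_moll_le hε (by filter_upwards [h.bound] with y hy _ using hy)

end IsField

theorem norm_sq_eq (v : Plane) : ‖v‖ ^ 2 = v 0 ^ 2 + v 1 ^ 2 := by
  rw [EuclideanSpace.real_norm_sq_eq, Fin.sum_univ_two]

theorem norm_le_abs_add (v : Plane) : ‖v‖ ≤ |v 0| + |v 1| := by
  refine abs_le_of_sq_le_sq' ?_ (by positivity) |>.2
  rw [norm_sq_eq]
  nlinarith [sq_abs (v 0), sq_abs (v 1), abs_nonneg (v 0), abs_nonneg (v 1)]

theorem Continuous.coord {f : Plane → Plane} (hc : Continuous f) (i : Fin 2) :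
    Continuous fun x => f x i := by fun_prop

/-- Interpolation of the supremum between local energy and vorticity. -/
theorem exists_norm_le_energy_add_vorticity : ∃ C, 0 < C ∧ ∀ f w W, IsField f w W → Continuous f →
    ∀ x ρ, 0 < ρ → ‖f x‖ ≤ 2 * W * ρ + C / ρ * √(∫ y in ball x ρ, ‖f y‖ ^ 2) := by
  obtain ⟨C, hC0, hC⟩ := exists_mollk_le
  -- Mollify at scale `ρ`. In each coordinate the error is at most `W ρ`, and Jensen's inequality
  -- with the bound `C / ρ²` of the mollifier controls the average by the local energy. The factors
  -- `2` add up the two coordinates.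
  refine ⟨2 * √C, by positivity, fun f w W h hc x ρ hρ => ?_⟩
  have hcf : Continuous fun y => ‖f y‖ ^ 2 := by fun_prop
  have key : ∀ i, |f x i| ≤ W * ρ + √C / ρ * √(∫ y in ball x ρ, ‖f y‖ ^ 2) := by
    intro i
    have hci : Continuous fun y => f y i := Continuous.coord hc i
    have h1 := h.abs_sub_moll_le hc hρ i x
    have h2 : |moll ρ (fun y => f y i) x| ≤ √C / ρ * √(∫ y in ball x ρ, ‖f y‖ ^ 2) := by
      refine abs_le_of_sq_le_sq ?_ (by positivity)
      rw [mul_pow, div_pow, Real.sq_sqrt hC0.le,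
        Real.sq_sqrt (integral_nonneg fun y => by positivity)]
      refine (sq_moll_le hρ hci.locallyIntegrable (hci.pow 2).locallyIntegrable x).trans ?_
      rw [moll, conv_apply, ← integral_const_mul, ← integral_indicator isOpen_ball.measurableSet]
      refine integral_mono
        ((isTest_mollk hρ).integrable_conv (hci.pow 2).locallyIntegrable x) ?_ fun y => ?_
      · rw [integrable_indicator_iff isOpen_ball.measurableSet]
        exact ((hcf.locallyIntegrable.integrableOn_isCompact (isCompact_closedBall x ρ)).mono_set
          ball_subset_closedBall).const_mul _
      · by_cases hy : y ∈ ball x ρ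
        · rw [indicator_of_mem hy]
          have h3 : f y i ^ 2 ≤ ‖f y‖ ^ 2 := by
            rw [← sq_abs]; gcongr; exact PiLp.norm_apply_le (f y) i
          have h4 := hC ρ hρ (x - y)
          rw [div_eq_mul_inv]
          have := mollk_nonneg ρ (x - y)
          gcongr
        · rw [indicator_of_notMem hy]
          have : mollk ρ (x - y) = 0 := by
            by_contra h5
            refine hy ?_
            simpa [dist_eq_norm, norm_sub_rev] using mollk_support hρ h5
          simp [this]
    calc |f x i| ≤ |f x i - moll ρ (fun y => f y i) x| + |moll ρ (fun y => f y i) x| := by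
          have := abs_add_le (f x i - moll ρ (fun y => f y i) x) (moll ρ (fun y => f y i) x)
          simpa using this
      _ ≤ _ := add_le_add h1 h2
  have := norm_le_abs_add (f x)
  have k0 := key 0
  have k1 := key 1
  have e : 2 * W * ρ + 2 * √C / ρ * √(∫ y in ball x ρ, ‖f y‖ ^ 2)
    = (W * ρ + √C / ρ * √(∫ y in ball x ρ, ‖f y‖ ^ 2))
      + (W * ρ + √C / ρ * √(∫ y in ball x ρ, ‖f y‖ ^ 2)) := by ring
  linarith

/-! ### Cut-off functions and the interior gradient estimate. -/

section Cutoff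

/-- A smooth cut-off equal to one on the ball of radius `R` and supported in the ball of
radius `2 R`. -/
def cut (R : ℝ) (x : Plane) : ℝ := Real.smoothTransition (2 - ‖R⁻¹ • x‖ ^ 2)

variable {R : ℝ}

theorem contDiff_cut (R : ℝ) : ContDiff ℝ ∞ (cut R) :=
  (Real.smoothTransition.contDiff (n := ⊤)).comp
    (contDiff_const.sub ((contDiff_norm_sq ℝ).comp (contDiff_const_smul _)))

theorem cut_nonneg (R : ℝ) (x : Plane) : 0 ≤ cut R x := Real.smoothTransition.nonneg _

theorem cut_le_one (R : ℝ) (x : Plane) : cut R x ≤ 1 := Real.smoothTransition.le_one _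

theorem cut_eq_one (hR : 0 < R) {x : Plane} (hx : ‖x‖ ≤ R) : cut R x = 1 := by
  refine Real.smoothTransition.one_of_one_le ?_
  have : ‖R⁻¹ • x‖ ≤ 1 := by
    rw [norm_smul, norm_inv, Real.norm_eq_abs, abs_of_pos hR, inv_mul_le_iff₀ hR]; linarith
  nlinarith [norm_nonneg (R⁻¹ • x)]

theorem cut_support (hR : 0 < R) : Function.support (cut R) ⊆ ball 0 (2 * R) := by
  intro x hx
  by_contra h
  refine hx (Real.smoothTransition.zero_of_nonpos ?_)
  simp only [mem_ball_zero_iff, not_lt] at h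
  have : 2 ≤ ‖R⁻¹ • x‖ := by
    rw [norm_smul, norm_inv, Real.norm_eq_abs, abs_of_pos hR, le_inv_mul_iff₀ hR]; linarith
  nlinarith

theorem isTest_cut (hR : 0 < R) : IsTest (cut R) :=
  ⟨contDiff_cut R, HasCompactSupport.of_support_subset_isCompact (isCompact_closedBall 0 (2 * R))
    ((cut_support hR).trans ball_subset_closedBall)⟩

theorem partialDeriv_cut_eq_zero (hR : 0 < R) (i : Fin 2) {x : Plane} (hx : 2 * R ≤ ‖x‖) :
    ∂_ i (cut R) x = 0 := by
  have hcl : IsClosed {z : Plane | ∂_ i (cut R) z = 0} :=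
    isClosed_eq (continuous_partialDeriv i (contDiff_one (contDiff_cut R))) continuous_const
  have hsub : (closedBall (0 : Plane) (2 * R))ᶜ ⊆ {z | ∂_ i (cut R) z = 0} := by
    intro y hy
    have : cut R =ᶠ[𝓝 y] fun _ => 0 := by
      filter_upwards [isClosed_closedBall.isOpen_compl.mem_nhds hy] with x hx
      by_contra h
      exact hx (ball_subset_closedBall (cut_support hR h))
    change ∂_ i (cut R) y = 0
    rw [partialDeriv_congr this]
    simp [partialDeriv]
  have h2 := hcl.closure_subset_iff.2 hsub
  rw [closure_compl, interior_closedBall _ (by positivity)] at h2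
  exact h2 (by simpa using hx)

theorem exists_partialDeriv_cut_le : ∃ C, 0 < C ∧ ∀ R, 0 < R → ∀ i x,
    |∂_ i (cut R) x| ≤ C / R := by
  have hb : ∀ i : Fin 2, ∃ C, ∀ z, |∂_ i (cut 1) z| ≤ C := fun i =>
    (contDiff_partialDeriv i (contDiff_cut 1)).continuous.bounded_above_of_compact_support
      (hasCompactSupport_partialDeriv i (isTest_cut one_pos).2)
  obtain ⟨C0, h0⟩ := hb 0
  obtain ⟨C1, h1⟩ := hb 1
  refine ⟨|C0| + |C1| + 1, by positivity, fun R hR i x => ?_⟩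
  have e : cut R = fun x => cut 1 (R⁻¹ • x) := by ext x; simp [cut]
  rw [e, partialDeriv_comp_smul, abs_mul, abs_of_pos (inv_pos.2 hR), inv_mul_eq_div]
  gcongr
  fin_cases i
  · exact (h0 _).trans (by linarith [le_abs_self C0, abs_nonneg C1])
  · exact (h1 _).trans (by linarith [le_abs_self C1, abs_nonneg C0])

/-- Interior gradient estimate in terms of divergence and curl. -/
theorem exists_gradient_estimate : ∃ C, 0 < C ∧ ∀ R, 0 < R → ∀ a₀ a₁ : Plane → ℝ,
    ContDiff ℝ ∞ a₀ → ContDiff ℝ ∞ a₁ →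
    ∫ x in ball 0 R, (∂_ 0 a₀ x ^ 2 + ∂_ 1 a₀ x ^ 2
        + ∂_ 0 a₁ x ^ 2 + ∂_ 1 a₁ x ^ 2)
      ≤ ∫ x in ball 0 (2 * R), (2 * (∂_ 0 a₀ x + ∂_ 1 a₁ x) ^ 2
        + 2 * (∂_ 0 a₁ x - ∂_ 1 a₀ x) ^ 2
        + C / R ^ 2 * (a₀ x ^ 2 + a₁ x ^ 2)) := by
  obtain ⟨C, hC0, hC⟩ := exists_partialDeriv_cut_le
  refine ⟨8 * C ^ 2, by positivity, fun R hR a₀ a₁ h₀ h₁ => ?_⟩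
  have hχ := isTest_cut hR
  have t₀ := hχ.mul_right h₀
  have t₁ := hχ.mul_right h₁
  have dχ : Differentiable ℝ (cut R) := (contDiff_cut R).differentiable (by simp)
  have d₀ : Differentiable ℝ a₀ := h₀.differentiable (by simp)
  have d₁ : Differentiable ℝ a₁ := h₁.differentiable (by simp)
  have p₀ : ∀ i x, ∂_ i (fun y => cut R y * a₀ y) x
      = ∂_ i (cut R) x * a₀ x + cut R x * ∂_ i a₀ x :=
    fun i x => partialDeriv_mul i dχ.differentiableAt d₀.differentiableAt
  have p₁ : ∀ i x, ∂_ i (fun y => cut R y * a₁ y) x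
      = ∂_ i (cut R) x * a₁ x + cut R x * ∂_ i a₁ x :=
    fun i x => partialDeriv_mul i dχ.differentiableAt d₁.differentiableAt
  -- The identity is used for the field multiplied by the cut-off. Its divergence and curl are those
  -- of the field, times the cut-off, plus terms without derivatives of the field; these are of size
  -- `C / R` and make up the last summand.
  have key := integral_grad_sq_eq_div_curl t₀ t₁
  have c0 := fun i => (contDiff_partialDeriv i h₀).continuous
  have c1 := fun i => (contDiff_partialDeriv i h₁).continuous
  have ct0 := fun i => (t₀.partialDeriv i).continuous
  have ct1 := fun i => (t₁.partialDeriv i).continuous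
  have intOn : ∀ {F : Plane → ℝ}, Continuous F → ∀ r, IntegrableOn F (ball 0 r) :=
    fun hF r => (hF.locallyIntegrable.integrableOn_isCompact (isCompact_closedBall 0 r)).mono_set
      ball_subset_closedBall
  have hcs : HasCompactSupport (fun x => ∂_ 0 (fun y => cut R y * a₀ y) x ^ 2
      + ∂_ 1 (fun y => cut R y * a₀ y) x ^ 2
      + ∂_ 0 (fun y => cut R y * a₁ y) x ^ 2
      + ∂_ 1 (fun y => cut R y * a₁ y) x ^ 2) := by
    have q : ∀ {u : Plane → ℝ}, HasCompactSupport u → HasCompactSupport fun x => u x ^ 2 := by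
      intro u hu
      simp only [pow_two]
      exact hu.mul_left
    exact (((q (t₀.partialDeriv 0).2).add (q (t₀.partialDeriv 1).2)).add
      (q (t₁.partialDeriv 0).2)).add (q (t₁.partialDeriv 1).2)
  calc _ = ∫ x in ball 0 R, (∂_ 0 (fun y => cut R y * a₀ y) x ^ 2
        + ∂_ 1 (fun y => cut R y * a₀ y) x ^ 2
        + ∂_ 0 (fun y => cut R y * a₁ y) x ^ 2
        + ∂_ 1 (fun y => cut R y * a₁ y) x ^ 2) := by
        refine setIntegral_congr_fun isOpen_ball.measurableSet fun x hx => ?_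
        have e : ∀ a : Plane → ℝ, (fun y => cut R y * a y) =ᶠ[𝓝 x] a := fun a => by
          filter_upwards [isOpen_ball.mem_nhds hx] with y hy
          rw [cut_eq_one hR (le_of_lt (by simpa using hy)), one_mul]
        simp only [partialDeriv_congr (e a₀), partialDeriv_congr (e a₁)]
    _ ≤ ∫ x, (∂_ 0 (fun y => cut R y * a₀ y) x ^ 2
        + ∂_ 1 (fun y => cut R y * a₀ y) x ^ 2
        + ∂_ 0 (fun y => cut R y * a₁ y) x ^ 2
        + ∂_ 1 (fun y => cut R y * a₁ y) x ^ 2) := by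
        refine setIntegral_le_integral ?_ (Eventually.of_forall fun x => by positivity)
        exact Continuous.integrable_of_hasCompactSupport (by fun_prop) hcs
    _ = _ := key
    _ = ∫ x in ball 0 (2 * R), ((∂_ 0 (fun y => cut R y * a₀ y) x
        + ∂_ 1 (fun y => cut R y * a₁ y) x) ^ 2
        + (∂_ 0 (fun y => cut R y * a₁ y) x
        - ∂_ 1 (fun y => cut R y * a₀ y) x) ^ 2) := by
        rw [setIntegral_eq_integral_of_forall_compl_eq_zero]
        intro x hx
        simp only [mem_ball_zero_iff, not_lt] at hx
        have hz : cut R x = 0 := by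
          by_contra h
          have := cut_support hR h
          simp only [mem_ball_zero_iff] at this
          linarith
        simp only [p₀, p₁, partialDeriv_cut_eq_zero hR _ hx, hz]
        ring
    _ ≤ _ := by
        refine setIntegral_mono (intOn (by fun_prop) _) (intOn (by fun_prop) _) fun x => ?_
        simp only [p₀, p₁]
        have hc0 : ∂_ 0 (cut R) x ^ 2 ≤ C ^ 2 / R ^ 2 := by
          rw [← div_pow, ← sq_abs]; gcongr; exact hC R hR 0 x
        have hc1 : ∂_ 1 (cut R) x ^ 2 ≤ C ^ 2 / R ^ 2 := by
          rw [← div_pow, ← sq_abs]; gcongr; exact hC R hR 1 x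
        have hl := cut_le_one R x
        have hn := cut_nonneg R x
        have hs : cut R x ^ 2 ≤ 1 := by nlinarith
        set A := ∂_ 0 (cut R) x
        set B := ∂_ 1 (cut R) x
        set D := ∂_ 0 a₀ x + ∂_ 1 a₁ x with hD
        set E := ∂_ 0 a₁ x - ∂_ 1 a₀ x with hE
        have e1 : A * a₀ x + cut R x * ∂_ 0 a₀ x + (B * a₁ x + cut R x * ∂_ 1 a₁ x)
          = cut R x * D + (A * a₀ x + B * a₁ x) := by rw [hD]; ring
        have e2 : A * a₁ x + cut R x * ∂_ 0 a₁ x - (B * a₀ x + cut R x * ∂_ 1 a₀ x)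
          = cut R x * E + (A * a₁ x - B * a₀ x) := by rw [hE]; ring
        rw [e1, e2]
        have f1 : (cut R x * D + (A * a₀ x + B * a₁ x)) ^ 2
            ≤ 2 * D ^ 2 + 2 * (A * a₀ x + B * a₁ x) ^ 2 := by
          nlinarith [sq_nonneg (cut R x * D - (A * a₀ x + B * a₁ x)),
            mul_le_mul_of_nonneg_right hs (sq_nonneg D)]
        have f2 : (cut R x * E + (A * a₁ x - B * a₀ x)) ^ 2
            ≤ 2 * E ^ 2 + 2 * (A * a₁ x - B * a₀ x) ^ 2 := by
          nlinarith [sq_nonneg (cut R x * E - (A * a₁ x - B * a₀ x)),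
            mul_le_mul_of_nonneg_right hs (sq_nonneg E)]
        have f3 : (A * a₀ x + B * a₁ x) ^ 2 + (A * a₁ x - B * a₀ x) ^ 2
            = A ^ 2 * (a₀ x ^ 2 + a₁ x ^ 2) + B ^ 2 * (a₀ x ^ 2 + a₁ x ^ 2) := by ring
        have f4 := mul_le_mul_of_nonneg_right hc0 (by positivity : 0 ≤ a₀ x ^ 2 + a₁ x ^ 2)
        have f5 := mul_le_mul_of_nonneg_right hc1 (by positivity : 0 ≤ a₀ x ^ 2 + a₁ x ^ 2)
        have f6 : 8 * C ^ 2 / R ^ 2 * (a₀ x ^ 2 + a₁ x ^ 2)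
            = 8 * (C ^ 2 / R ^ 2 * (a₀ x ^ 2 + a₁ x ^ 2)) := by ring
        have f7 : 0 ≤ C ^ 2 / R ^ 2 * (a₀ x ^ 2 + a₁ x ^ 2) := by positivity
        rw [f6]
        linarith

end Cutoff

/-! ### Convergence in `L²`, for bilinear limits. -/

section L2

variable {α : Type*} [MeasurableSpace α] {μ : Measure α}

theorem norm_toLp_sq {f : α → ℝ} (hf : MemLp f 2 μ) : ‖hf.toLp f‖ ^ 2 = ∫ x, f x ^ 2 ∂μ := by
  rw [← real_inner_self_eq_norm_sq, L2.inner_def]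
  refine integral_congr_ae ?_
  filter_upwards [hf.coeFn_toLp] with x hx
  rw [hx]
  simp [pow_two]

theorem inner_toLp {f g : α → ℝ} (hf : MemLp f 2 μ) (hg : MemLp g 2 μ) :
    inner ℝ (hf.toLp f) (hg.toLp g) = ∫ x, f x * g x ∂μ := by
  rw [L2.inner_def]
  refine integral_congr_ae ?_
  filter_upwards [hf.coeFn_toLp, hg.coeFn_toLp] with x hx hy
  rw [hx, hy]
  simp [mul_comm]

theorem abs_integral_mul_le {f g : α → ℝ} (hf : MemLp f 2 μ) (hg : MemLp g 2 μ) :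
    |∫ x, f x * g x ∂μ| ≤ √(∫ x, f x ^ 2 ∂μ) * √(∫ x, g x ^ 2 ∂μ) := by
  rw [← inner_toLp hf hg, ← norm_toLp_sq hf, ← norm_toLp_sq hg, Real.sqrt_sq (norm_nonneg _),
    Real.sqrt_sq (norm_nonneg _)]
  exact abs_real_inner_le_norm _ _

theorem norm_toLp_sub_sq {f g : α → ℝ} (hf : MemLp f 2 μ) (hg : MemLp g 2 μ) :
    ‖hf.toLp f - hg.toLp g‖ ^ 2 = ∫ x, (f x - g x) ^ 2 ∂μ := by
  rw [← MemLp.toLp_sub, norm_toLp_sq (hf.sub hg)]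
  rfl

/-- Convergence of a sequence in `L²`. -/
structure L2Tendsto (μ : Measure α) (F : ℕ → α → ℝ) (G : α → ℝ) : Prop where
  memLp : ∀ n, MemLp (F n) 2 μ
  memLp_lim : MemLp G 2 μ
  tendsto : Tendsto (fun n => ∫ x, (F n x - G x) ^ 2 ∂μ) atTop (𝓝 0)

namespace L2Tendsto

variable {F F' : ℕ → α → ℝ} {G G' : α → ℝ}

theorem tendsto_toLp (h : L2Tendsto μ F G) :
    Tendsto (fun n => (h.memLp n).toLp (F n)) atTop (𝓝 (h.memLp_lim.toLp G)) := by
  rw [tendsto_iff_norm_sub_tendsto_zero]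
  have := h.tendsto.sqrt
  rw [Real.sqrt_zero] at this
  refine this.congr fun n => ?_
  rw [← norm_toLp_sub_sq (h.memLp n) h.memLp_lim, Real.sqrt_sq (norm_nonneg _)]

theorem integral_mul (h : L2Tendsto μ F G) (h' : L2Tendsto μ F' G') :
    Tendsto (fun n => ∫ x, F n x * F' n x ∂μ) atTop (𝓝 (∫ x, G x * G' x ∂μ)) := by
  have := h.tendsto_toLp.inner (𝕜 := ℝ) h'.tendsto_toLp
  rw [inner_toLp] at this
  exact this.congr fun n => inner_toLp _ _

theorem mul_bdd (h : L2Tendsto μ F G) {φ : α → ℝ} (hφ : AEStronglyMeasurable φ μ) {C : ℝ}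
    (hC : ∀ x, |φ x| ≤ C) : L2Tendsto μ (fun n x => F n x * φ x) (fun x => G x * φ x) := by
  have m : ∀ {u : α → ℝ}, MemLp u 2 μ → MemLp (fun x => u x * φ x) 2 μ := by
    intro u hu
    refine MemLp.of_le_mul hu (hu.1.mul hφ) (c := C) (Eventually.of_forall fun x => ?_)
    rw [norm_mul, mul_comm]
    exact mul_le_mul_of_nonneg_right (hC x) (norm_nonneg _)
  refine ⟨fun n => m (h.memLp n), m h.memLp_lim, ?_⟩
  have h2 := h.tendsto.const_mul (C ^ 2)
  rw [mul_zero] at h2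
  refine squeeze_zero (fun n => integral_nonneg fun x => sq_nonneg _) (fun n => ?_) h2
  rw [← integral_const_mul]
  refine integral_mono_of_nonneg (Eventually.of_forall fun x => sq_nonneg _)
    ((((h.memLp n).sub h.memLp_lim).integrable_sq).const_mul _) (Eventually.of_forall fun x => ?_)
  simp only
  rw [← sub_mul, mul_pow, mul_comm]
  have : φ x ^ 2 ≤ C ^ 2 := by rw [← sq_abs]; gcongr; exact hC x
  exact mul_le_mul_of_nonneg_right this (sq_nonneg _)

theorem congr_right (h : L2Tendsto μ F G) (e : G =ᵐ[μ] G') : L2Tendsto μ F G' := by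
  refine ⟨h.memLp, h.memLp_lim.ae_eq e, h.tendsto.congr fun n => integral_congr_ae ?_⟩
  filter_upwards [e] with x hx
  rw [hx]

theorem of_bdd_ae [IsFiniteMeasure μ] {C : ℝ} (hF : ∀ n, AEStronglyMeasurable (F n) μ)
    (hb : ∀ n, ∀ᵐ x ∂μ, |F n x| ≤ C) (hl : ∀ᵐ x ∂μ, Tendsto (fun n => F n x) atTop (𝓝 (G x))) :
    L2Tendsto μ F G := by
  have hG : AEStronglyMeasurable G μ := aestronglyMeasurable_of_tendsto_ae atTop hF hl
  have hGb : ∀ᵐ x ∂μ, |G x| ≤ C := by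
    filter_upwards [hl, ae_all_iff.2 hb] with x hx hbx
    exact le_of_tendsto hx.abs (Eventually.of_forall hbx)
  refine ⟨fun n => MemLp.of_bound (hF n) C (hb n), MemLp.of_bound hG C hGb, ?_⟩
  have := tendsto_integral_of_dominated_convergence (μ := μ)
    (F := fun n x => (F n x - G x) ^ 2) (f := fun _ => 0) (fun _ => (2 * C) ^ 2)
    (fun n => ((hF n).sub hG).pow 2) (integrable_const _) (fun n => ?_) ?_
  · simpa using this
  · filter_upwards [hb n, hGb] with x h1 h2
    rw [Real.norm_eq_abs, abs_pow]
    gcongr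
    exact (abs_sub _ _).trans (by linarith)
  · filter_upwards [hl] with x hx
    have := (hx.sub_const (G x)).pow 2
    simpa using this

end L2Tendsto

theorem exists_L2Tendsto {F : ℕ → α → ℝ} (hF : ∀ n, MemLp (F n) 2 μ)
    (hC : ∀ δ, 0 < δ → ∃ N, ∀ m ≥ N, ∀ n ≥ N, ∫ x, (F m x - F n x) ^ 2 ∂μ ≤ δ) :
    ∃ G, L2Tendsto μ F G := by
  have hcs : CauchySeq fun n => (hF n).toLp (F n) := by
    rw [Metric.cauchySeq_iff]
    intro δ hδ
    obtain ⟨N, hN⟩ := hC ((δ / 2) ^ 2) (by positivity)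
    refine ⟨N, fun m hm n hn => ?_⟩
    rw [dist_eq_norm]
    have := hN m hm n hn
    rw [← norm_toLp_sub_sq (hF m) (hF n)] at this
    have := abs_le_of_sq_le_sq this (by positivity)
    rw [abs_of_nonneg (norm_nonneg _)] at this
    linarith
  obtain ⟨L, hL⟩ := cauchySeq_tendsto_of_complete hcs
  refine ⟨L, hF, Lp.memLp L, ?_⟩
  rw [tendsto_iff_norm_sub_tendsto_zero] at hL
  have := hL.pow 2
  rw [zero_pow two_ne_zero] at this
  refine this.congr fun n => ?_
  rw [← norm_toLp_sub_sq (hF n) (Lp.memLp L), Lp.toLp_coeFn]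

end L2

/-! ### Weak gradients in `L²_loc` as limits of gradients of mollifications. -/

theorem memLp_two_ball {F : Plane → ℝ} (hF : Continuous F) (c : Plane) (R : ℝ) :
    MemLp F 2 (volume.restrict (ball c R)) := by
  have h1 : MemLp F 2 (volume.restrict (closedBall c R)) := by
    obtain ⟨C, hC⟩ := (isCompact_closedBall c R).exists_bound_of_continuousOn hF.continuousOn
    have : IsFiniteMeasure (volume.restrict (closedBall c R)) :=
      ⟨by
        rw [Measure.restrict_apply_univ]
        exact measure_closedBall_lt_top⟩
    refine MemLp.of_bound hF.aestronglyMeasurable C ?_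
    filter_upwards [ae_restrict_mem isClosed_closedBall.measurableSet] with x hx
    exact hC x hx
  exact h1.mono_measure (Measure.restrict_mono ball_subset_closedBall le_rfl)

instance isFiniteMeasure_restrict_ball (c : Plane) (R : ℝ) :
    IsFiniteMeasure (volume.restrict (ball c R)) :=
  ⟨by
    rw [Measure.restrict_apply_univ]
    exact measure_ball_lt_top⟩

theorem Continuous.integrableOn_ball {F : Plane → ℝ} (hF : Continuous F) (c : Plane) (r : ℝ) :
    IntegrableOn F (ball c r) :=
  (hF.locallyIntegrable.integrableOn_isCompact (isCompact_closedBall c r)).mono_set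
    ball_subset_closedBall

/-- Test functions are supported in some ball. -/
theorem exists_ball_of_hasCompactSupport {φ : Plane → ℝ} (h : HasCompactSupport φ) :
    ∃ R, 0 < R ∧ tsupport φ ⊆ ball 0 R := by
  obtain ⟨R, hR⟩ := h.isCompact.isBounded.subset_ball 0
  exact ⟨max R 1, by positivity, hR.trans (ball_subset_ball (le_max_left _ _))⟩

theorem integral_eq_ball {φ : Plane → ℝ} {R : ℝ} (h : Function.support φ ⊆ ball 0 R) :
    ∫ x, φ x = ∫ x in ball 0 R, φ x := by
  rw [setIntegral_eq_integral_of_forall_compl_eq_zero]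
  intro x hx
  by_contra h'
  exact hx (h h')

/-- The weak gradient of the `k`-th component, as a limit of mollifications. -/
def weakGrad (j k : Fin 2) (f : Plane → Plane) (x : Plane) : ℝ :=
  limUnder atTop fun n => ∂_ j (moll (scale n) fun y => f y k) x

namespace IsField

variable {f : Plane → Plane} {w : Plane → ℝ} {W : ℝ} {ε ρ : ℝ}

theorem moll_continuous (h : IsField f w W) (n : ℕ) (i : Fin 2) :
    Continuous (moll (scale n) fun y => f y i) :=
  (contDiff_moll (scale_pos n) (h.coord i)).continuous

theorem tendsto_moll (h : IsField f w W) (hc : Continuous f) (i : Fin 2) (x : Plane) :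
    Tendsto (fun n => moll (scale n) (fun y => f y i) x) atTop (𝓝 (f x i)) := by
  have := h.tendsto_fieldRep i x
  rwa [h.fieldRep_eq hc] at this

theorem L2Tendsto_curl (h : IsField f w W) (R : ℝ) :
    L2Tendsto (volume.restrict (ball 0 R)) (fun n => moll (scale n) w) w :=
  L2Tendsto.of_bdd_ae (C := W)
    (fun n => (contDiff_moll (scale_pos n) h.wLoc).continuous.aestronglyMeasurable)
    (fun n => Eventually.of_forall fun x => h.abs_moll_curl_le (scale_pos n) x)
    (ae_restrict_of_ae (ae_tendsto_moll_scale h.wLoc))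

theorem abs_moll_le_of_bound (h : IsField f w W) (hc : Continuous f) {C : ℝ} {x : Plane}
    (hC : ‖f x‖ ≤ C) (n : ℕ) (i : Fin 2) : |moll (scale n) (fun y => f y i) x| ≤ C + W := by
  have h1 := h.abs_sub_moll_le hc (scale_pos n) i x
  have h2 := (PiLp.norm_apply_le (f x) i).trans hC
  rw [Real.norm_eq_abs] at h2
  have h3 : W * scale n ≤ W := mul_le_of_le_one_right h.bound_nonneg (scale_le_one n)
  rw [abs_le] at *
  constructor <;> linarith [h1.1, h1.2, h2.1, h2.2]

theorem exists_bound_ball (hc : Continuous f) (R : ℝ) :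
    ∃ C, 0 ≤ C ∧ ∀ x ∈ ball (0 : Plane) R, ‖f x‖ ≤ C := by
  obtain ⟨C, hC⟩ := (isCompact_closedBall (0 : Plane) R).exists_bound_of_continuousOn hc.continuousOn
  exact ⟨|C|, abs_nonneg _, fun x hx =>
    (hC x (ball_subset_closedBall hx)).trans (le_abs_self _)⟩

theorem L2Tendsto_moll (h : IsField f w W) (hc : Continuous f) (R : ℝ) (i : Fin 2) :
    L2Tendsto (volume.restrict (ball 0 R)) (fun n => moll (scale n) fun y => f y i)
      (fun x => f x i) := by
  obtain ⟨C, hC0, hC⟩ := exists_bound_ball hc R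
  refine L2Tendsto.of_bdd_ae (C := C + W) (fun n => (h.moll_continuous n i).aestronglyMeasurable)
    (fun n => ?_) (Eventually.of_forall fun x => h.tendsto_moll hc i x)
  filter_upwards [ae_restrict_mem isOpen_ball.measurableSet] with x hx
  exact h.abs_moll_le_of_bound hc (hC x hx) n i

/-- The interior gradient estimate is applied to the difference of two mollifications. That
difference has zero divergence, and its values and its curl form Cauchy sequences in `L²` of the
doubled ball. -/
theorem exists_L2Tendsto_partialDeriv (h : IsField f w W) (hc : Continuous f) {R : ℝ} (hR : 0 < R)
    (j k : Fin 2) : ∃ G, L2Tendsto (volume.restrict (ball 0 R))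
      (fun n => ∂_ j (moll (scale n) fun y => f y k)) G := by
  obtain ⟨C, hC0, hC⟩ := exists_gradient_estimate
  have hs : ∀ n i, ContDiff ℝ ∞ (moll (scale n) fun y => f y i) :=
    fun n i => contDiff_moll (scale_pos n) (h.coord i)
  have hd : ∀ n i, Differentiable ℝ (moll (scale n) fun y => f y i) :=
    fun n i => (hs n i).differentiable (by simp)
  refine exists_L2Tendsto (fun n => memLp_two_ball (contDiff_partialDeriv j (hs n k)).continuous _ _)
    fun δ hδ => ?_
  set B := volume.restrict (ball (0 : Plane) (2 * R)) with hB
  have cs : ∀ {F : ℕ → Plane → ℝ} {G : Plane → ℝ}, L2Tendsto B F G → ∀ η, 0 < η →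
      ∃ N, ∀ m ≥ N, ∀ n ≥ N, ∫ x, (F m x - F n x) ^ 2 ∂B ≤ η := by
    intro F G hFG η hη
    have h1 := hFG.tendsto_toLp.cauchySeq
    rw [Metric.cauchySeq_iff] at h1
    obtain ⟨N, hN⟩ := h1 (√η) (by positivity)
    refine ⟨N, fun m hm n hn => ?_⟩
    have h2 := hN m hm n hn
    rw [dist_eq_norm] at h2
    rw [← norm_toLp_sub_sq (hFG.memLp m) (hFG.memLp n)]
    calc _ ≤ √η ^ 2 := by gcongr
      _ = η := Real.sq_sqrt hη.le
  set K := C / R ^ 2 with hK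
  have hK0 : 0 < K := by positivity
  -- The tolerances add up to `δ`: `2 * (δ / 6)` from the curl and `K * (2 * (δ / (3 * K)))` from
  -- the two coordinates.
  obtain ⟨N1, hN1⟩ := cs (h.L2Tendsto_curl (2 * R)) (δ / 6) (by positivity)
  obtain ⟨N2, hN2⟩ := cs (h.L2Tendsto_moll hc (2 * R) 0) (δ / (3 * K)) (by positivity)
  obtain ⟨N3, hN3⟩ := cs (h.L2Tendsto_moll hc (2 * R) 1) (δ / (3 * K)) (by positivity)
  refine ⟨max N1 (max N2 N3), fun m hm n hn => ?_⟩
  have b1 := hN1 m (le_trans (le_max_left _ _) hm) n (le_trans (le_max_left _ _) hn)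
  have b2 := hN2 m (le_trans (le_trans (le_max_left _ _) (le_max_right _ _)) hm) n
    (le_trans (le_trans (le_max_left _ _) (le_max_right _ _)) hn)
  have b3 := hN3 m (le_trans (le_trans (le_max_right _ _) (le_max_right _ _)) hm) n
    (le_trans (le_trans (le_max_right _ _) (le_max_right _ _)) hn)
  have key := hC R hR _ _ ((hs m 0).sub (hs n 0)) ((hs m 1).sub (hs n 1))
  simp only [partialDeriv_sub _ (hd m _).differentiableAt (hd n _).differentiableAt] at key
  have e1 : ∀ x, (∂_ 0 (moll (scale m) fun y => f y 0) x
      - ∂_ 0 (moll (scale n) fun y => f y 0) x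
      + (∂_ 1 (moll (scale m) fun y => f y 1) x
      - ∂_ 1 (moll (scale n) fun y => f y 1) x)) = 0 := fun x => by
    linarith [h.div_moll (scale_pos m) x, h.div_moll (scale_pos n) x]
  have e2 : ∀ x, (∂_ 0 (moll (scale m) fun y => f y 1) x
      - ∂_ 0 (moll (scale n) fun y => f y 1) x
      - (∂_ 1 (moll (scale m) fun y => f y 0) x
      - ∂_ 1 (moll (scale n) fun y => f y 0) x))
      = moll (scale m) w x - moll (scale n) w x := fun x => by
    linarith [h.curl_moll (scale_pos m) x, h.curl_moll (scale_pos n) x]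
  simp only [e1, e2] at key
  have c1 := fun i => (contDiff_partialDeriv i ((hs m 0).sub (hs n 0))).continuous
  have cm : ∀ n i, Continuous (moll (scale n) fun y => f y i) := fun n i => h.moll_continuous n i
  have cw : ∀ n, Continuous (moll (scale n) w) :=
    fun n => (contDiff_moll (scale_pos n) h.wLoc).continuous
  have cp : ∀ n i j, Continuous (∂_ j (moll (scale n) fun y => f y i)) :=
    fun n i j => (contDiff_partialDeriv j (hs n i)).continuous
  have r : ∫ x in ball 0 (2 * R), (2 * (0 : ℝ) ^ 2
      + 2 * (moll (scale m) w x - moll (scale n) w x) ^ 2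
      + C / R ^ 2 * ((moll (scale m) (fun y => f y 0) x - moll (scale n) (fun y => f y 0) x) ^ 2
        + (moll (scale m) (fun y => f y 1) x - moll (scale n) (fun y => f y 1) x) ^ 2))
      = 2 * (∫ x, (moll (scale m) w x - moll (scale n) w x) ^ 2 ∂B)
        + K * ((∫ x, (moll (scale m) (fun y => f y 0) x
            - moll (scale n) (fun y => f y 0) x) ^ 2 ∂B)
          + ∫ x, (moll (scale m) (fun y => f y 1) x
            - moll (scale n) (fun y => f y 1) x) ^ 2 ∂B) := by
    have i1 : Integrable (fun x => (moll (scale m) w x - moll (scale n) w x) ^ 2) B :=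
      Continuous.integrableOn_ball (((cw m).sub (cw n)).pow 2) 0 (2 * R)
    have i2 : ∀ i, Integrable (fun x => (moll (scale m) (fun y => f y i) x
        - moll (scale n) (fun y => f y i) x) ^ 2) B := fun i =>
      Continuous.integrableOn_ball (((cm m i).sub (cm n i)).pow 2) 0 (2 * R)
    have i3 : Integrable (fun x => K * ((moll (scale m) (fun y => f y 0) x
        - moll (scale n) (fun y => f y 0) x) ^ 2 + (moll (scale m) (fun y => f y 1) x
        - moll (scale n) (fun y => f y 1) x) ^ 2)) B := ((i2 0).add (i2 1)).const_mul K
    rw [← integral_const_mul, ← integral_add (i2 0) (i2 1), ← integral_const_mul,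
      ← integral_add (i1.const_mul 2) i3]
    refine integral_congr_ae (Eventually.of_forall fun x => ?_)
    simp [hK]
  rw [r] at key
  refine le_trans ?_ (key.trans ?_)
  · refine integral_mono ?_ ?_ fun x => ?_
    · exact Continuous.integrableOn_ball (((cp m k j).sub (cp n k j)).pow 2) 0 R
    · refine Continuous.integrableOn_ball ?_ 0 R
      fun_prop
    · simp only
      fin_cases j <;> fin_cases k <;> simp <;> nlinarith [sq_nonneg
        (∂_ 0 (moll (scale m) fun y => f y 0) x
        - ∂_ 0 (moll (scale n) fun y => f y 0) x), sq_nonneg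
        (∂_ 1 (moll (scale m) fun y => f y 0) x
        - ∂_ 1 (moll (scale n) fun y => f y 0) x), sq_nonneg
        (∂_ 0 (moll (scale m) fun y => f y 1) x
        - ∂_ 0 (moll (scale n) fun y => f y 1) x), sq_nonneg
        (∂_ 1 (moll (scale m) fun y => f y 1) x
        - ∂_ 1 (moll (scale n) fun y => f y 1) x)]
  · have b4 := add_le_add b2 b3
    have : K * (δ / (3 * K) + δ / (3 * K)) = 2 * δ / 3 := by field_simp; ring
    have b5 := mul_le_mul_of_nonneg_left b4 hK0.le
    linarith

/-- The `L²` limit `G` on the ball is the weak derivative there. Hence near an interior point the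
derivative of the mollification is, for large `n`, the mollification of `G` extended by zero, which
converges to `G` almost everywhere. The pointwise limit does not depend on the ball, so one function
serves all radii. -/
theorem L2Tendsto_weakGrad (h : IsField f w W) (hc : Continuous f) {R : ℝ} (hR : 0 < R)
    (j k : Fin 2) : L2Tendsto (volume.restrict (ball 0 R))
      (fun n => ∂_ j (moll (scale n) fun y => f y k)) (weakGrad j k f) := by
  obtain ⟨G, hG⟩ := h.exists_L2Tendsto_partialDeriv hc hR j k
  refine hG.congr_right ?_
  set G' := (ball (0 : Plane) R).indicator G with hG'
  have hGi : IntegrableOn G (ball 0 R) := hG.memLp_lim.integrable (by norm_num)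
  have hG'i : Integrable G' := hGi.integrable_indicator isOpen_ball.measurableSet
  have weak : ∀ φ, IsTest φ → Function.support φ ⊆ ball 0 R →
      ∫ x, G' x * φ x = -∫ x, f x k * ∂_ j φ x := by
    intro φ hφ hsup
    obtain ⟨C, hC⟩ := hφ.continuous.bounded_above_of_compact_support hφ.2
    have l1 : Tendsto (fun n => ∫ x in ball 0 R,
        ∂_ j (moll (scale n) fun y => f y k) x * φ x) atTop
        (𝓝 (∫ x in ball 0 R, G x * φ x)) := by
      have hφ2 : L2Tendsto (volume.restrict (ball (0 : Plane) R)) (fun _ => φ) φ :=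
        ⟨fun _ => memLp_two_ball hφ.continuous _ _, memLp_two_ball hφ.continuous _ _, by simp⟩
      exact hG.integral_mul hφ2
    obtain ⟨R', hR', hs'⟩ := exists_ball_of_hasCompactSupport (hφ.partialDeriv j).2
    have l2 : Tendsto (fun n => ∫ x in ball 0 R',
        moll (scale n) (fun y => f y k) x * ∂_ j φ x) atTop
        (𝓝 (∫ x in ball 0 R', f x k * ∂_ j φ x)) := by
      have hφ2 : L2Tendsto (volume.restrict (ball (0 : Plane) R')) (fun _ => ∂_ j φ)
          (∂_ j φ) :=
        ⟨fun _ => memLp_two_ball (hφ.partialDeriv j).continuous _ _,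
          memLp_two_ball (hφ.partialDeriv j).continuous _ _, by simp⟩
      exact (h.L2Tendsto_moll hc R' k).integral_mul hφ2
    have e2 : ∀ u : Plane → ℝ, ∫ x in ball 0 R', u x * ∂_ j φ x
        = ∫ x, u x * ∂_ j φ x := fun u => (integral_eq_ball
        ((Function.support_mul_subset_right _ _).trans ((subset_tsupport _).trans hs'))).symm
    have e1 : ∀ u : Plane → ℝ, ∫ x in ball 0 R, u x * φ x = ∫ x, u x * φ x :=
      fun u => (integral_eq_ball ((Function.support_mul_subset_right _ _).trans hsup)).symm
    have e3 : ∫ x, G' x * φ x = ∫ x in ball 0 R, G x * φ x := by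
      rw [← e1]
      refine setIntegral_congr_fun isOpen_ball.measurableSet fun x hx => ?_
      simp only [hG', indicator_of_mem hx]
    rw [e3, ← e2]
    refine tendsto_nhds_unique l1 (l2.neg.congr fun n => ?_)
    rw [e1, e2, integral_mul_partialDeriv j
      (contDiff_one (contDiff_moll (scale_pos n) (h.coord k))) (contDiff_one hφ.1) (Or.inr hφ.2),
      neg_neg]
  rw [EventuallyEq, ae_restrict_iff' isOpen_ball.measurableSet]
  filter_upwards [ae_tendsto_moll_scale hG'i.locallyIntegrable] with x hx hxR
  have e4 : G x = G' x := by rw [hG', indicator_of_mem hxR]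
  rw [e4]
  refine (Tendsto.limUnder_eq (hx.congr' ?_)).symm
  have hlt : ‖x‖ < R := by simpa using hxR
  filter_upwards [tendsto_scale.eventually (gt_mem_nhds (sub_pos.2 hlt))] with n hn
  rw [h.partialDeriv_moll (scale_pos n), ← weak _ ((isTest_mollk (scale_pos n)).comp_const_sub x),
    moll, conv_apply]
  · simp only [mul_comm]
  · intro y hy
    have := mollk_support (scale_pos n) hy
    simp only [mem_ball_zero_iff] at this ⊢
    have h2 := norm_sub_norm_le y x
    rw [norm_sub_rev] at h2
    linarith

end IsField

theorem integrable_fun_sub {α : Type*} [MeasurableSpace α] {μ : Measure α} {u v : α → ℝ}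
    (hu : Integrable u μ) (hv : Integrable v μ) : Integrable (fun x => u x - v x) μ := hu.sub hv

/-! ### Quadratic identities for smooth divergence-free fields. -/

section DivergenceForms

theorem partialDeriv_fun_const (i : Fin 2) (c : ℝ) (x : Plane) :
    ∂_ i (fun _ => c) x = 0 := by
  simp [partialDeriv]

theorem integral_partialDeriv_eq_zero (i : Fin 2) {φ : Plane → ℝ} (h : ContDiff ℝ 1 φ)
    (hc : HasCompactSupport φ) : ∫ x, ∂_ i φ x = 0 := by
  have := integral_mul_partialDeriv i (contDiff_const (c := (1 : ℝ))) h (Or.inr hc)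
  simpa [partialDeriv] using this

theorem integral_eq_of_sub_eq_div {F G P₀ P₁ : Plane → ℝ} (hF : Integrable F) (hG : Integrable G)
    (h₀ : ContDiff ℝ 1 P₀) (h₁ : ContDiff ℝ 1 P₁) (c₀ : HasCompactSupport P₀)
    (c₁ : HasCompactSupport P₁)
    (e : ∀ x, F x - G x = ∂_ 0 P₀ x + ∂_ 1 P₁ x) :
    ∫ x, F x = ∫ x, G x := by
  rw [← sub_eq_zero, ← integral_sub hF hG]
  simp only [e]
  rw [integral_add, integral_partialDeriv_eq_zero 0 h₀ c₀, integral_partialDeriv_eq_zero 1 h₁ c₁,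
    add_zero]
  · exact (continuous_partialDeriv 0 h₀).integrable_of_hasCompactSupport
      (hasCompactSupport_partialDeriv 0 c₀)
  · exact (continuous_partialDeriv 1 h₁).integrable_of_hasCompactSupport
      (hasCompactSupport_partialDeriv 1 c₁)

variable {a₀ a₁ φ : Plane → ℝ}

/-- The acceleration `(a · ∇) a` is the vorticity times the rotated field plus the gradient of `|a|²
/ 2`. Tested against a rotated gradient, the gradient part disappears and the flux of the vorticity
remains. -/
theorem integral_flux_smooth (h₀ : ContDiff ℝ ∞ a₀) (h₁ : ContDiff ℝ ∞ a₁) (hφ : IsTest φ)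
    (hdiv : ∀ x, ∂_ 0 a₀ x + ∂_ 1 a₁ x = 0) :
    ∫ x, (a₀ x * (a₀ x * ∂_ 0 (∂_ 1 φ) x
        - a₁ x * ∂_ 0 (∂_ 0 φ) x)
      + a₁ x * (a₀ x * ∂_ 1 (∂_ 1 φ) x
        - a₁ x * ∂_ 1 (∂_ 0 φ) x))
      = ∫ x, (∂_ 0 a₁ x - ∂_ 1 a₀ x)
        * (a₀ x * ∂_ 0 φ x + a₁ x * ∂_ 1 φ x) := by
  have t₀ := hφ.partialDeriv 0
  have t₁ := hφ.partialDeriv 1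
  have t₀₀ := t₀.partialDeriv 0
  have t₀₁ := t₀.partialDeriv 1
  have t₁₀ := t₁.partialDeriv 0
  have t₁₁ := t₁.partialDeriv 1
  have comm : ∀ x, ∂_ 1 (∂_ 0 φ) x = ∂_ 0 (∂_ 1 φ) x :=
    fun x => partialDeriv_comm 1 0 hφ.1 x
  have b0 := fun i => contDiff_partialDeriv i h₀
  have b1 := fun i => contDiff_partialDeriv i h₁
  -- With `h` the rotated gradient `(∂₁φ, -∂₀φ)`, the flux is `a (a · h) - |a|² h / 2`.
  refine integral_eq_of_sub_eq_div
    (P₀ := fun x => a₀ x * (a₀ x * ∂_ 1 φ x - a₁ x * ∂_ 0 φ x)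
      - (a₀ x * a₀ x + a₁ x * a₁ x) * (1 / 2 * ∂_ 1 φ x))
    (P₁ := fun x => a₁ x * (a₀ x * ∂_ 1 φ x - a₁ x * ∂_ 0 φ x)
      + (a₀ x * a₀ x + a₁ x * a₁ x) * (1 / 2 * ∂_ 0 φ x)) ?_ ?_ ?_ ?_ ?_ ?_ ?_
  · have i : IsTest (fun x => a₀ x * (a₀ x * ∂_ 0 (∂_ 1 φ) x
        - a₁ x * ∂_ 0 (∂_ 0 φ) x)
      + a₁ x * (a₀ x * ∂_ 1 (∂_ 1 φ) x
        - a₁ x * ∂_ 1 (∂_ 0 φ) x)) :=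
      (((t₁₀.mul_left h₀).sub (t₀₀.mul_left h₁)).mul_left h₀).add
        (((t₁₁.mul_left h₀).sub (t₀₁.mul_left h₁)).mul_left h₁)
    exact i.continuous.integrable_of_hasCompactSupport i.2
  · have i : IsTest (fun x => (∂_ 0 a₁ x - ∂_ 1 a₀ x)
        * (a₀ x * ∂_ 0 φ x + a₁ x * ∂_ 1 φ x)) :=
      ((t₀.mul_left h₀).add (t₁.mul_left h₁)).mul_left ((b1 0).sub (b0 1))
    exact i.continuous.integrable_of_hasCompactSupport i.2
  · exact contDiff_one (((((t₁.mul_left h₀).sub (t₀.mul_left h₁)).mul_left h₀).1).sub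
      (((h₀.mul h₀).add (h₁.mul h₁)).mul (contDiff_const.mul t₁.1)))
  · exact contDiff_one (((((t₁.mul_left h₀).sub (t₀.mul_left h₁)).mul_left h₁).1).add
      (((h₀.mul h₀).add (h₁.mul h₁)).mul (contDiff_const.mul t₀.1)))
  · exact ((((t₁.mul_left h₀).sub (t₀.mul_left h₁)).mul_left h₀).sub
      ((t₁.mul_left contDiff_const).mul_left ((h₀.mul h₀).add (h₁.mul h₁)))).2
  · exact ((((t₁.mul_left h₀).sub (t₀.mul_left h₁)).mul_left h₁).add
      ((t₀.mul_left contDiff_const).mul_left ((h₀.mul h₀).add (h₁.mul h₁)))).2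
  · intro x
    have d₀ : Differentiable ℝ a₀ := h₀.differentiable (by simp)
    have d₁ : Differentiable ℝ a₁ := h₁.differentiable (by simp)
    have dp₀ : Differentiable ℝ (∂_ 0 φ) := t₀.1.differentiable (by simp)
    have dp₁ : Differentiable ℝ (∂_ 1 φ) := t₁.1.differentiable (by simp)
    have hx := hdiv x
    have hcx := comm x
    generalize ∂_ 0 φ = p₀ at *
    generalize ∂_ 1 φ = p₁ at *
    simp (disch := fun_prop) only [partialDeriv_mul, partialDeriv_add, partialDeriv_sub,
      partialDeriv_fun_const]
    rw [hcx]
    have e : ∂_ 1 a₁ x = -∂_ 0 a₀ x := by linarith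
    rw [e]
    ring

/-- For a divergence-free field, `∂ⱼ∂ₖ(aⱼ aₖ) = ∂ⱼaₖ ∂ₖaⱼ`. This reconciles the two halves of the
definition of the pressure force, which contain the gradient and the field itself respectively. -/
theorem integral_product_smooth (h₀ : ContDiff ℝ ∞ a₀) (h₁ : ContDiff ℝ ∞ a₁) (hφ : IsTest φ)
    (hdiv : ∀ x, ∂_ 0 a₀ x + ∂_ 1 a₁ x = 0) :
    ∫ x, (a₀ x * a₀ x * ∂_ 0 (∂_ 0 φ) x
      + a₀ x * a₁ x * ∂_ 0 (∂_ 1 φ) x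
      + (a₁ x * a₀ x * ∂_ 1 (∂_ 0 φ) x
      + a₁ x * a₁ x * ∂_ 1 (∂_ 1 φ) x))
      = ∫ x, (∂_ 0 a₀ x * ∂_ 0 a₀ x * φ x
        + ∂_ 0 a₁ x * ∂_ 1 a₀ x * φ x
        + (∂_ 1 a₀ x * ∂_ 0 a₁ x * φ x
        + ∂_ 1 a₁ x * ∂_ 1 a₁ x * φ x)) := by
  have t₀ := hφ.partialDeriv 0
  have t₁ := hφ.partialDeriv 1
  have t₀₀ := t₀.partialDeriv 0
  have t₀₁ := t₀.partialDeriv 1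
  have t₁₀ := t₁.partialDeriv 0
  have t₁₁ := t₁.partialDeriv 1
  have b0 := fun i => contDiff_partialDeriv i h₀
  have b1 := fun i => contDiff_partialDeriv i h₁
  have T : ∀ {a b : Plane → ℝ}, ContDiff ℝ ∞ a → ContDiff ℝ ∞ b →
    IsTest (fun x => a x * (a₀ x * ∂_ 0 φ x + a₁ x * ∂_ 1 φ x)
      - (a₀ x * ∂_ 0 b x + a₁ x * ∂_ 1 b x) * φ x) := fun ha hb =>
    (((t₀.mul_left h₀).add (t₁.mul_left h₁)).mul_left ha).sub
      (hφ.mul_left ((h₀.mul (contDiff_partialDeriv 0 hb)).add (h₁.mul (contDiff_partialDeriv 1 hb))))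
  -- The flux has the components `aᵢ (a · ∇φ) - (a · ∇aᵢ) φ`.
  refine integral_eq_of_sub_eq_div
    (P₀ := fun x => a₀ x * (a₀ x * ∂_ 0 φ x + a₁ x * ∂_ 1 φ x)
      - (a₀ x * ∂_ 0 a₀ x + a₁ x * ∂_ 1 a₀ x) * φ x)
    (P₁ := fun x => a₁ x * (a₀ x * ∂_ 0 φ x + a₁ x * ∂_ 1 φ x)
      - (a₀ x * ∂_ 0 a₁ x + a₁ x * ∂_ 1 a₁ x) * φ x) ?_ ?_
    (contDiff_one (T h₀ h₀).1) (contDiff_one (T h₁ h₁).1) (T h₀ h₀).2 (T h₁ h₁).2 ?_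
  · have i := ((t₀₀.mul_left (h₀.mul h₀)).add (t₁₀.mul_left (h₀.mul h₁))).add
      ((t₀₁.mul_left (h₁.mul h₀)).add (t₁₁.mul_left (h₁.mul h₁)))
    exact i.continuous.integrable_of_hasCompactSupport i.2
  · have i := ((hφ.mul_left ((b0 0).mul (b0 0))).add (hφ.mul_left ((b1 0).mul (b0 1)))).add
      ((hφ.mul_left ((b0 1).mul (b1 0))).add (hφ.mul_left ((b1 1).mul (b1 1))))
    exact i.continuous.integrable_of_hasCompactSupport i.2
  · intro x
    have d₀ : Differentiable ℝ a₀ := h₀.differentiable (by simp)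
    have d₁ : Differentiable ℝ a₁ := h₁.differentiable (by simp)
    have dφ : Differentiable ℝ φ := hφ.1.differentiable (by simp)
    have dp₀ : Differentiable ℝ (∂_ 0 φ) := t₀.1.differentiable (by simp)
    have dp₁ : Differentiable ℝ (∂_ 1 φ) := t₁.1.differentiable (by simp)
    have d₀₀ : Differentiable ℝ (∂_ 0 a₀) := (b0 0).differentiable (by simp)
    have d₁₀ : Differentiable ℝ (∂_ 1 a₀) := (b0 1).differentiable (by simp)
    have d₀₁ : Differentiable ℝ (∂_ 0 a₁) := (b1 0).differentiable (by simp)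
    have d₁₁ : Differentiable ℝ (∂_ 1 a₁) := (b1 1).differentiable (by simp)
    have hx := hdiv x
    have c0 := partialDeriv_comm 0 1 h₀ x
    have c1 := partialDeriv_comm 0 1 h₁ x
    have hz : (fun y => ∂_ 0 a₀ y + ∂_ 1 a₁ y) = fun _ => 0 := funext hdiv
    have z : ∀ i, ∂_ i (∂_ 0 a₀) x + ∂_ i (∂_ 1 a₁) x = 0 := by
      intro i
      rw [← partialDeriv_add i d₀₀.differentiableAt d₁₁.differentiableAt, hz]
      simp [partialDeriv]
    have z0 := z 0
    have z1 := z 1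
    have r : ∀ (i : Fin 2) (u : Plane → ℝ), (fun y => u y) = u := fun _ _ => rfl
    generalize hp₀ : ∂_ 0 φ = p₀ at *
    generalize hp₁ : ∂_ 1 φ = p₁ at *
    generalize hq₀₀ : ∂_ 0 a₀ = q₀₀ at *
    generalize hq₁₀ : ∂_ 1 a₀ = q₁₀ at *
    generalize hq₀₁ : ∂_ 0 a₁ = q₀₁ at *
    generalize hq₁₁ : ∂_ 1 a₁ = q₁₁ at *
    simp (disch := fun_prop) only [partialDeriv_mul, partialDeriv_add, partialDeriv_sub]
    rw [hp₀, hp₁, hq₀₀, hq₁₀, hq₀₁, hq₁₁]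
    have e : q₁₁ x = -q₀₀ x := by linarith
    have e2 : ∂_ 1 q₁₁ x = -∂_ 1 q₀₀ x := by linarith
    have e3 : ∂_ 0 q₁₁ x = -∂_ 0 q₀₀ x := by linarith
    rw [e, e2, c0, ← c1, e3]
    ring

end DivergenceForms

/-! ### The quadratic identities for fields with bounded vorticity, and uniqueness of weak
derivatives. -/

namespace IsField

variable {f : Plane → Plane} {w : Plane → ℝ} {W : ℝ} {φ : Plane → ℝ}

theorem memLp_weakGrad (h : IsField f w W) (hc : Continuous f) (R : ℝ) (j k : Fin 2) :
    MemLp (weakGrad j k f) 2 (volume.restrict (ball 0 R)) :=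
  (h.L2Tendsto_weakGrad hc (R := max R 1) (by positivity) j k).memLp_lim.mono_measure
    (Measure.restrict_mono (ball_subset_ball (le_max_left _ _)) le_rfl)

end IsField

theorem locallyIntegrable_of_ball {g : Plane → ℝ} (h : ∀ R, IntegrableOn g (ball 0 R)) :
    LocallyIntegrable g volume := fun x =>
  ⟨ball 0 (‖x‖ + 1), isOpen_ball.mem_nhds (by simp), h _⟩

theorem L2Tendsto_const {α : Type*} [MeasurableSpace α] {μ : Measure α} {u : α → ℝ}
    (hu : MemLp u 2 μ) : L2Tendsto μ (fun _ => u) u := ⟨fun _ => hu, hu, by simp⟩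

theorem integral_ball_eq_of_tsupport {u ψ : Plane → ℝ} {R : ℝ} (h : tsupport ψ ⊆ ball 0 R) :
    ∫ x in ball 0 R, u x * ψ x = ∫ x, u x * ψ x :=
  (integral_eq_ball ((Function.support_mul_subset_right _ _).trans
    ((subset_tsupport _).trans h))).symm

theorem L2Tendsto.tendsto_integral_mul_test {F F' : ℕ → Plane → ℝ} {G G' φ : Plane → ℝ} {R : ℝ}
    (h : L2Tendsto (volume.restrict (ball 0 R)) F G)
    (h' : L2Tendsto (volume.restrict (ball 0 R)) F' G')
    (hφ : Continuous φ) (hφc : HasCompactSupport φ) (hs : tsupport φ ⊆ ball 0 R) :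
    Tendsto (fun n => ∫ x, F n x * F' n x * φ x) atTop (𝓝 (∫ x, G x * G' x * φ x)) := by
  obtain ⟨C, hC⟩ := hφ.bounded_above_of_compact_support hφc
  have h2 := h'.mul_bdd hφ.aestronglyMeasurable hC
  have := h.integral_mul h2
  have e : ∀ u v : Plane → ℝ, ∫ x in ball 0 R, u x * (v x * φ x)
      = ∫ x, u x * v x * φ x := fun u v => by
    simp only [← mul_assoc]
    exact integral_ball_eq_of_tsupport hs
  simp only [e] at this
  exact this

theorem MemLp.integrable_mul_test {F F' φ : Plane → ℝ} {R : ℝ}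
    (h : MemLp F 2 (volume.restrict (ball 0 R)))
    (h' : MemLp F' 2 (volume.restrict (ball 0 R)))
    (hφ : Continuous φ) (hφc : HasCompactSupport φ) (hs : tsupport φ ⊆ ball 0 R) :
    Integrable (fun x => F x * F' x * φ x) := by
  obtain ⟨C, hC⟩ := hφ.bounded_above_of_compact_support hφc
  have h1 : IntegrableOn (fun x => F x * F' x) (ball 0 R) := h.integrable_mul h'
  have h2 : IntegrableOn (fun x => F x * F' x * φ x) (ball 0 R) :=
    h1.mul_bdd (c := C) hφ.aestronglyMeasurable (Eventually.of_forall hC)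
  rwa [integrableOn_iff_integrable_of_support_subset] at h2
  exact (Function.support_mul_subset_right _ _).trans ((subset_tsupport _).trans hs)

namespace IsField

variable {f : Plane → Plane} {w : Plane → ℝ} {W : ℝ} {φ : Plane → ℝ}

theorem locallyIntegrable_weakGrad (h : IsField f w W) (hc : Continuous f) (j k : Fin 2) :
    LocallyIntegrable (weakGrad j k f) volume :=
  locallyIntegrable_of_ball fun R => (h.memLp_weakGrad hc R j k).integrable (by norm_num)

theorem hasWeakPartial (h : IsField f w W) (hc : Continuous f) (j k : Fin 2) :
    HasWeakPartial j (fun x => f x k) (weakGrad j k f) := by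
  refine ⟨h.coord k, h.locallyIntegrable_weakGrad hc j k, fun φ hφ => ?_⟩
  obtain ⟨R, hR, hs⟩ := exists_ball_of_hasCompactSupport hφ.2
  have hs' := (partialDeriv_support_subset j φ).trans hs
  have l1 := (h.L2Tendsto_weakGrad hc hR j k).integral_mul
    (L2Tendsto_const (memLp_two_ball hφ.continuous 0 R))
  have l2 := (h.L2Tendsto_moll hc R k).integral_mul
    (L2Tendsto_const (memLp_two_ball (hφ.partialDeriv j).continuous 0 R))
  simp only [integral_ball_eq_of_tsupport hs, integral_ball_eq_of_tsupport hs'] at l1 l2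
  refine tendsto_nhds_unique l1 (l2.neg.congr fun n => ?_)
  rw [integral_mul_partialDeriv j
    (contDiff_one (contDiff_moll (scale_pos n) (h.coord k))) (contDiff_one hφ.1) (Or.inr hφ.2),
    neg_neg]

/-- Both sides are bilinear in the field and its vorticity, whose mollifications converge in `L²` on
a ball containing the support of the test function. The identity thus passes to the limit term by
term. -/
theorem integral_flux (h : IsField f w W) (hc : Continuous f) (hφ : IsTest φ) :
    ∫ x, (f x 0 * (f x 0 * ∂_ 0 (∂_ 1 φ) x
        - f x 1 * ∂_ 0 (∂_ 0 φ) x)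
      + f x 1 * (f x 0 * ∂_ 1 (∂_ 1 φ) x
        - f x 1 * ∂_ 1 (∂_ 0 φ) x))
      = ∫ x, w x * (f x 0 * ∂_ 0 φ x + f x 1 * ∂_ 1 φ x) := by
  obtain ⟨R, hR, hs⟩ := exists_ball_of_hasCompactSupport hφ.2
  have t := fun i => hφ.partialDeriv i
  have tt := fun i j => (t j).partialDeriv i
  have s := fun i => (partialDeriv_support_subset i φ).trans hs
  have ss := fun i j => (partialDeriv_support_subset i (∂_ j φ)).trans (s j)
  have M := h.L2Tendsto_moll hc R
  have Mw := h.L2Tendsto_curl R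
  have L1 : ∀ i j k l, Tendsto (fun n => ∫ x, moll (scale n) (fun y => f y i) x
      * moll (scale n) (fun y => f y j) x * ∂_ k (∂_ l φ) x) atTop
      (𝓝 (∫ x, f x i * f x j * ∂_ k (∂_ l φ) x)) := fun i j k l =>
    (M i).tendsto_integral_mul_test (M j) (tt k l).continuous (tt k l).2 (ss k l)
  have L2 : ∀ i j, Tendsto (fun n => ∫ x, moll (scale n) w x
      * moll (scale n) (fun y => f y i) x * ∂_ j φ x) atTop
      (𝓝 (∫ x, w x * f x i * ∂_ j φ x)) := fun i j =>
    Mw.tendsto_integral_mul_test (M i) (t j).continuous (t j).2 (s j)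
  have J1 : ∀ {g : Fin 2 → Plane → ℝ}, (∀ i, MemLp (g i) 2 (volume.restrict (ball 0 R))) →
      ∫ x, (g 0 x * (g 0 x * ∂_ 0 (∂_ 1 φ) x
        - g 1 x * ∂_ 0 (∂_ 0 φ) x)
      + g 1 x * (g 0 x * ∂_ 1 (∂_ 1 φ) x
        - g 1 x * ∂_ 1 (∂_ 0 φ) x))
      = (∫ x, g 0 x * g 0 x * ∂_ 0 (∂_ 1 φ) x)
        - (∫ x, g 0 x * g 1 x * ∂_ 0 (∂_ 0 φ) x)
        + ((∫ x, g 1 x * g 0 x * ∂_ 1 (∂_ 1 φ) x)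
        - ∫ x, g 1 x * g 1 x * ∂_ 1 (∂_ 0 φ) x) := by
    intro g hg
    have I : ∀ i j k l, Integrable fun x => g i x * g j x * ∂_ k (∂_ l φ) x :=
      fun i j k l => MemLp.integrable_mul_test (hg i) (hg j) (tt k l).continuous (tt k l).2 (ss k l)
    rw [← integral_sub (I _ _ _ _) (I _ _ _ _), ← integral_sub (I _ _ _ _) (I _ _ _ _),
      ← integral_add (integrable_fun_sub (I _ _ _ _) (I _ _ _ _)) (integrable_fun_sub (I _ _ _ _) (I _ _ _ _))]
    refine integral_congr_ae (Eventually.of_forall fun x => ?_)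
    simp only; ring
  have J2 : ∀ {u : Plane → ℝ} {g : Fin 2 → Plane → ℝ},
      MemLp u 2 (volume.restrict (ball 0 R)) →
      (∀ i, MemLp (g i) 2 (volume.restrict (ball 0 R))) →
      ∫ x, u x * (g 0 x * ∂_ 0 φ x + g 1 x * ∂_ 1 φ x)
      = (∫ x, u x * g 0 x * ∂_ 0 φ x) + ∫ x, u x * g 1 x * ∂_ 1 φ x := by
    intro u g hu hg
    have I : ∀ i, Integrable fun x => u x * g i x * ∂_ i φ x :=
      fun i => MemLp.integrable_mul_test hu (hg i) (t i).continuous (t i).2 (s i)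
    rw [← integral_add (I _) (I _)]
    refine integral_congr_ae (Eventually.of_forall fun x => ?_)
    simp only; ring
  have A := ((L1 0 0 0 1).sub (L1 0 1 0 0)).add ((L1 1 0 1 1).sub (L1 1 1 1 0))
  have B := (L2 0 0).add (L2 1 1)
  rw [← J1 (g := fun i x => f x i) fun i => (M i).memLp_lim] at A
  rw [← J2 (g := fun i x => f x i) Mw.memLp_lim fun i => (M i).memLp_lim] at B
  refine tendsto_nhds_unique A (B.congr fun n => ?_)
  rw [← J2 (u := moll (scale n) w) (g := fun i => moll (scale n) fun y => f y i) (Mw.memLp n)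
    fun i => (M i).memLp n]
  rw [← J1 (g := fun i => moll (scale n) fun y => f y i) fun i => (M i).memLp n]
  rw [integral_flux_smooth (contDiff_moll (scale_pos n) (h.coord 0))
    (contDiff_moll (scale_pos n) (h.coord 1)) hφ (h.div_moll (scale_pos n))]
  simp only [h.curl_moll (scale_pos n)]

theorem integral_weakGrad_product (h : IsField f w W) (hc : Continuous f) (hφ : IsTest φ) :
    ∫ x, (∑ j, ∑ k, weakGrad j k f x * weakGrad k j f x) * φ x
      = ∫ x, ∑ j, ∑ k, f x j * f x k * ∂_ j (∂_ k φ) x := by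
  obtain ⟨R, hR, hs⟩ := exists_ball_of_hasCompactSupport hφ.2
  have tt := fun i j => (hφ.partialDeriv j).partialDeriv i
  have ss := fun i j => (partialDeriv_support_subset i (∂_ j φ)).trans
    ((partialDeriv_support_subset j φ).trans hs)
  have M := h.L2Tendsto_moll hc R
  have D := fun j k => h.L2Tendsto_weakGrad hc hR j k
  have L1 : ∀ j k, Tendsto (fun n => ∫ x, moll (scale n) (fun y => f y j) x
      * moll (scale n) (fun y => f y k) x * ∂_ j (∂_ k φ) x) atTop
      (𝓝 (∫ x, f x j * f x k * ∂_ j (∂_ k φ) x)) := fun j k =>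
    (M j).tendsto_integral_mul_test (M k) (tt j k).continuous (tt j k).2 (ss j k)
  have L2 : ∀ j k, Tendsto (fun n => ∫ x, ∂_ j (moll (scale n) (fun y => f y k)) x
      * ∂_ k (moll (scale n) (fun y => f y j)) x * φ x) atTop
      (𝓝 (∫ x, weakGrad j k f x * weakGrad k j f x * φ x)) := fun j k =>
    (D j k).tendsto_integral_mul_test (D k j) hφ.continuous hφ.2 hs
  have J1 : ∀ {g : Fin 2 → Plane → ℝ}, (∀ i, MemLp (g i) 2 (volume.restrict (ball 0 R))) →
      ∀ j k, Integrable fun x => g j x * g k x * ∂_ j (∂_ k φ) x := fun hg j k =>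
    MemLp.integrable_mul_test (hg j) (hg k) (tt j k).continuous (tt j k).2 (ss j k)
  have J2 : ∀ {g : Fin 2 → Fin 2 → Plane → ℝ},
      (∀ i j, MemLp (g i j) 2 (volume.restrict (ball 0 R))) →
      ∀ j k, Integrable fun x => g j k x * g k j x * φ x := fun hg j k =>
    MemLp.integrable_mul_test (hg j k) (hg k j) hφ.continuous hφ.2 hs
  have A := ((L1 0 0).add (L1 0 1)).add ((L1 1 0).add (L1 1 1))
  have B := ((L2 0 0).add (L2 0 1)).add ((L2 1 0).add (L2 1 1))
  have a1 := J1 (g := fun i x => f x i) fun i => (M i).memLp_lim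
  have b1 := J2 (g := fun j k => weakGrad j k f) fun j k => (D j k).memLp_lim
  have e1 : ∫ x, ∑ j, ∑ k, f x j * f x k * ∂_ j (∂_ k φ) x
      = ((∫ x, f x 0 * f x 0 * ∂_ 0 (∂_ 0 φ) x)
        + ∫ x, f x 0 * f x 1 * ∂_ 0 (∂_ 1 φ) x)
        + ((∫ x, f x 1 * f x 0 * ∂_ 1 (∂_ 0 φ) x)
        + ∫ x, f x 1 * f x 1 * ∂_ 1 (∂_ 1 φ) x) := by
    simp only [Fin.sum_univ_two]
    rw [← integral_add (a1 0 0) (a1 0 1), ← integral_add (a1 1 0) (a1 1 1),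
      ← integral_add ((a1 0 0).fun_add (a1 0 1)) ((a1 1 0).fun_add (a1 1 1))]
  have e2 : ∫ x, (∑ j, ∑ k, weakGrad j k f x * weakGrad k j f x) * φ x
      = ((∫ x, weakGrad 0 0 f x * weakGrad 0 0 f x * φ x)
        + ∫ x, weakGrad 0 1 f x * weakGrad 1 0 f x * φ x)
        + ((∫ x, weakGrad 1 0 f x * weakGrad 0 1 f x * φ x)
        + ∫ x, weakGrad 1 1 f x * weakGrad 1 1 f x * φ x) := by
    simp only [Fin.sum_univ_two]
    rw [← integral_add (b1 0 0) (b1 0 1), ← integral_add (b1 1 0) (b1 1 1),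
      ← integral_add ((b1 0 0).fun_add (b1 0 1)) ((b1 1 0).fun_add (b1 1 1))]
    refine integral_congr_ae (Eventually.of_forall fun x => ?_)
    simp; ring
  rw [e1, e2]
  refine tendsto_nhds_unique B (A.congr fun n => ?_)
  have a2 := J1 (g := fun i => moll (scale n) fun y => f y i) fun i => (M i).memLp n
  have b2 := J2 (g := fun j k => ∂_ j (moll (scale n) fun y => f y k))
    fun j k => (D j k).memLp n
  rw [← integral_add (a2 0 0) (a2 0 1), ← integral_add (a2 1 0) (a2 1 1),
    ← integral_add ((a2 0 0).fun_add (a2 0 1)) ((a2 1 0).fun_add (a2 1 1)),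
    ← integral_add (b2 0 0) (b2 0 1), ← integral_add (b2 1 0) (b2 1 1),
    ← integral_add ((b2 0 0).fun_add (b2 0 1)) ((b2 1 0).fun_add (b2 1 1))]
  exact integral_product_smooth (contDiff_moll (scale_pos n) (h.coord 0))
    (contDiff_moll (scale_pos n) (h.coord 1)) hφ (h.div_moll (scale_pos n))

end IsField

theorem HasWeakPartial.ae_eq {i : Fin 2} {u g g' : Plane → ℝ} (h : HasWeakPartial i u g)
    (h' : HasWeakPartial i u g') : g =ᵐ[volume] g' := by
  have := ae_eq_zero_of_integral_contDiff_smul_eq_zero (μ := (volume : Measure Plane))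
    (h.2.1.sub h'.2.1) fun φ hφ hc => ?_
  · filter_upwards [this] with x hx
    simpa [sub_eq_zero] using hx
  · have a := h.2.2 φ ⟨hφ, hc⟩
    have b := h'.2.2 φ ⟨hφ, hc⟩
    have t : IsTest φ := ⟨hφ, hc⟩
    simp only [Pi.sub_apply, smul_eq_mul, mul_sub]
    rw [integral_sub (t.integrable_mul h.2.1) (t.integrable_mul h'.2.1)]
    simp only [mul_comm (φ _)]
    rw [a, b, sub_self]

theorem weakPartial_spec {i : Fin 2} {u g : Plane → ℝ} (h : HasWeakPartial i u g) :
    weakPartial i u =ᵐ[volume] g := by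
  have hex : ∃ g, HasWeakPartial i u g := ⟨g, h⟩
  have : weakPartial i u = hex.choose := by simp [weakPartial, hex]
  rw [this]
  exact hex.choose_spec.ae_eq h

theorem IsField.weakPartial_ae_eq {f : Plane → Plane} {w : Plane → ℝ} {W : ℝ} (h : IsField f w W)
    (hc : Continuous f) (j k : Fin 2) :
    weakPartial j (fun z => f z k) =ᵐ[volume] weakGrad j k f :=
  weakPartial_spec (h.hasWeakPartial hc j k)

/-! ### The kernel `x / |x|²` and its smooth regularizations. -/

section RegularizedKernel

/-- The reciprocal of `‖x‖² + δ`. -/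
def regWeight (δ : ℝ) (x : Plane) : ℝ := (‖x‖ ^ 2 + δ)⁻¹

/-- The kernel `xᵢ / (‖x‖² + δ)`. -/
def regKern (δ : ℝ) (i : Fin 2) (x : Plane) : ℝ := x i * regWeight δ x

theorem contDiff_coord (i : Fin 2) : ContDiff ℝ ∞ (fun x : Plane => x i) := by fun_prop

theorem partialDeriv_coord (i j : Fin 2) (x : Plane) :
    ∂_ j (fun y => y i) x = if i = j then 1 else 0 := by
  have : HasFDerivAt (fun y : Plane => y i) (EuclideanSpace.proj i : Plane →L[ℝ] ℝ) x :=
    (EuclideanSpace.proj i : Plane →L[ℝ] ℝ).hasFDerivAt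
  rw [partialDeriv, this.fderiv]
  simp

variable {δ : ℝ} {x : Plane}

theorem contDiffAt_regWeight (h : ‖x‖ ^ 2 + δ ≠ 0) : ContDiffAt ℝ ∞ (regWeight δ) x :=
  ((contDiff_norm_sq ℝ).add contDiff_const).contDiffAt.inv h

theorem contDiffAt_regKern (i : Fin 2) (h : ‖x‖ ^ 2 + δ ≠ 0) : ContDiffAt ℝ ∞ (regKern δ i) x :=
  (contDiff_coord i).contDiffAt.mul (contDiffAt_regWeight h)

theorem contDiff_regKern (hδ : 0 < δ) (i : Fin 2) : ContDiff ℝ ∞ (regKern δ i) :=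
  contDiff_iff_contDiffAt.2 fun _ => contDiffAt_regKern i (by positivity)

theorem partialDeriv_regWeight (h : ‖x‖ ^ 2 + δ ≠ 0) (j : Fin 2) :
    ∂_ j (regWeight δ) x = -(2 * x j * regWeight δ x ^ 2) := by
  have h1 : ∂_ j (fun y : Plane => ‖y‖ ^ 2 + δ) x = 2 * x j := by
    rw [partialDeriv_add j (contDiff_norm_sq ℝ (n := 1)).differentiable_one.differentiableAt
      (differentiableAt_const _), partialDeriv_norm_sq, partialDeriv_fun_const, add_zero]
  change ∂_ j (fun y : Plane => (fun s : ℝ => s⁻¹) (‖y‖ ^ 2 + δ)) x = _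
  rw [partialDeriv_comp (β := fun s : ℝ => s⁻¹) j (differentiableAt_inv h)
    (((contDiff_norm_sq ℝ (n := 1)).differentiable_one.differentiableAt).fun_add
      (differentiableAt_const _)), h1]
  rw [show deriv (fun s : ℝ => s⁻¹) (‖x‖ ^ 2 + δ) = _ from deriv_inv]
  simp only [regWeight]
  field_simp

theorem partialDeriv_regKern (h : ‖x‖ ^ 2 + δ ≠ 0) (i j : Fin 2) :
    ∂_ j (regKern δ i) x
      = (if i = j then 1 else 0) * regWeight δ x - 2 * (x i * (x j * regWeight δ x ^ 2)) := by
  change ∂_ j (fun y : Plane => y i * regWeight δ y) x = _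
  rw [partialDeriv_mul j ((contDiff_coord i).differentiable (by simp)).differentiableAt
    ((contDiffAt_regWeight h).differentiableAt (by simp)), partialDeriv_coord,
    partialDeriv_regWeight h]
  ring

theorem partialDeriv_partialDeriv_regKern (h : ‖x‖ ^ 2 + δ ≠ 0) (i j k : Fin 2) :
    ∂_ k (∂_ j (regKern δ i)) x
      = -2 * (if i = j then 1 else 0) * x k * regWeight δ x ^ 2
        - 2 * ((if i = k then 1 else 0) * x j + (if j = k then 1 else 0) * x i) * regWeight δ x ^ 2
        + 8 * (x i * x j * x k) * regWeight δ x ^ 3 := by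
  have hev : ∀ᶠ y : Plane in 𝓝 x, ‖y‖ ^ 2 + δ ≠ 0 :=
    ContinuousAt.eventually_ne (by fun_prop) h
  rw [partialDeriv_congr (hev.mono fun y hy => partialDeriv_regKern hy i j)]
  have dw : DifferentiableAt ℝ (regWeight δ) x :=
    (contDiffAt_regWeight h).differentiableAt (by simp)
  have di : ∀ i, DifferentiableAt ℝ (fun y : Plane => y i) x := fun i =>
    ((contDiff_coord i).differentiable (by simp)).differentiableAt
  simp only [sq]
  rw [partialDeriv_sub k (dw.const_mul _)
      (((di i).fun_mul ((di j).fun_mul (dw.fun_mul dw))).const_mul _),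
    partialDeriv_const_mul k _ dw, partialDeriv_const_mul k _ ((di i).fun_mul ((di j).fun_mul (dw.fun_mul dw))),
    partialDeriv_mul k (di i) ((di j).fun_mul (dw.fun_mul dw)), partialDeriv_mul k (di j) (dw.fun_mul dw),
    partialDeriv_mul k dw dw, partialDeriv_coord, partialDeriv_coord, partialDeriv_regWeight h]
  ring

theorem abs_coord_le (x : Plane) (i : Fin 2) : |x i| ≤ ‖x‖ := by
  simpa using EuclideanSpace.norm_eq x ▸ PiLp.norm_apply_le x i

theorem regWeight_nonneg (hδ : 0 ≤ δ) (x : Plane) : 0 ≤ regWeight δ x := by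
  unfold regWeight; positivity

theorem regWeight_le (hδ : 0 ≤ δ) (hx : x ≠ 0) : regWeight δ x ≤ (‖x‖ ^ 2)⁻¹ := by
  have : 0 < ‖x‖ := norm_pos_iff.2 hx
  unfold regWeight
  gcongr
  linarith

theorem abs_regKern_le (hδ : 0 ≤ δ) (i : Fin 2) (x : Plane) : |regKern δ i x| ≤ ‖x‖⁻¹ := by
  by_cases hx : x = 0
  · simp [regKern, hx]
  have : 0 < ‖x‖ := norm_pos_iff.2 hx
  rw [regKern, abs_mul, abs_of_nonneg (regWeight_nonneg hδ x)]
  calc |x i| * regWeight δ x ≤ ‖x‖ * (‖x‖ ^ 2)⁻¹ :=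
        mul_le_mul (abs_coord_le x i) (regWeight_le hδ hx) (regWeight_nonneg hδ x) (norm_nonneg _)
    _ = _ := by field_simp

/-- The bound is uniform in `δ`, so it survives the removal of the regularization. The constant
counts the terms of the explicit second derivative: `2 + 4 + 8`. -/
theorem abs_partialDeriv_partialDeriv_regKern_le (hδ : 0 ≤ δ) (hx : x ≠ 0) (i j k : Fin 2) :
    |∂_ k (∂_ j (regKern δ i)) x| ≤ 14 * (‖x‖ ^ 3)⁻¹ := by
  have hn : 0 < ‖x‖ := norm_pos_iff.2 hx
  rw [partialDeriv_partialDeriv_regKern (by positivity)]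
  have hs := regWeight_nonneg hδ x
  have hs1 := regWeight_le hδ hx
  have b2 : ∀ l, |x l * regWeight δ x ^ 2| ≤ (‖x‖ ^ 3)⁻¹ := fun l => by
    rw [abs_mul, abs_of_nonneg (pow_nonneg hs 2)]
    calc |x l| * regWeight δ x ^ 2 ≤ ‖x‖ * ((‖x‖ ^ 2)⁻¹) ^ 2 := by
          gcongr
          exact abs_coord_le x l
      _ = _ := by field_simp
  have b3 : |x i * x j * x k * regWeight δ x ^ 3| ≤ (‖x‖ ^ 3)⁻¹ := by
    rw [abs_mul, abs_mul, abs_mul, abs_of_nonneg (pow_nonneg hs 3)]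
    calc |x i| * |x j| * |x k| * regWeight δ x ^ 3 ≤ ‖x‖ * ‖x‖ * ‖x‖ * ((‖x‖ ^ 2)⁻¹) ^ 3 := by
          gcongr <;> exact abs_coord_le x _
      _ = _ := by field_simp
  have hite : ∀ (p : Prop) [Decidable p] (t : ℝ), |(if p then (1 : ℝ) else 0) * t| ≤ |t| := by
    intro p _ t
    split_ifs <;> simp
  have t1 := (hite (i = j) _).trans (b2 k)
  have t2 := (hite (i = k) _).trans (b2 j)
  have t3 := (hite (j = k) _).trans (b2 i)
  rw [abs_le] at t1 t2 t3 b3 ⊢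
  constructor <;> nlinarith

theorem integrableOn_ball_norm_inv (R : ℝ) :
    IntegrableOn (fun x : Plane => ‖x‖⁻¹) (ball 0 R) := by
  refine integrableOn_ball_of_norm_le_rpow (C := 1) (α := 1) (by simp) (by simp)
    (Eventually.of_forall fun x => ?_) (by fun_prop)
  rw [Real.rpow_neg_one]; simp

theorem locallyIntegrable_norm_inv : LocallyIntegrable (fun x : Plane => ‖x‖⁻¹) volume :=
  locallyIntegrable_of_ball integrableOn_ball_norm_inv

theorem aestronglyMeasurable_regKern (δ : ℝ) (i : Fin 2) :
    AEStronglyMeasurable (regKern δ i) volume := by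
  unfold regKern regWeight
  exact (by fun_prop : Measurable _).aestronglyMeasurable

theorem locallyIntegrable_regKern (hδ : 0 ≤ δ) (i : Fin 2) :
    LocallyIntegrable (regKern δ i) volume :=
  locallyIntegrable_norm_inv.mono (aestronglyMeasurable_regKern δ i)
    (Eventually.of_forall fun x => by simpa using abs_regKern_le hδ i x)

theorem tendsto_integral_regKern {ψ : Plane → ℝ} (hψ : Continuous ψ) (hc : HasCompactSupport ψ)
    (i : Fin 2) {d : ℕ → ℝ} (hd : ∀ n, 0 ≤ d n) (hd0 : Tendsto d atTop (𝓝 0)) :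
    Tendsto (fun n => ∫ x, regKern (d n) i x * ψ x) atTop (𝓝 (∫ x, regKern 0 i x * ψ x)) := by
  refine tendsto_integral_of_dominated_convergence (fun x => |ψ x| * ‖x‖⁻¹) (fun n =>
    (aestronglyMeasurable_regKern _ i).mul hψ.aestronglyMeasurable)
    (integrable_mul_of_compact hψ.abs (by simpa [Function.comp_def] using hc.comp_left (g := fun s : ℝ => |s|) abs_zero) locallyIntegrable_norm_inv)
    (fun n => Eventually.of_forall fun x => ?_) ?_
  · rw [norm_mul, mul_comm]
    exact mul_le_mul_of_nonneg_left (abs_regKern_le (hd n) i x) (norm_nonneg _)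
  · have : ∀ᵐ x : Plane, x ≠ 0 := by simp [ae_iff, measure_singleton]
    filter_upwards [this] with x hx
    have hn : 0 < ‖x‖ := norm_pos_iff.2 hx
    refine (Tendsto.mul_const _ (Tendsto.const_mul _ ?_))
    exact ((tendsto_const_nhds.add hd0).inv₀ (by positivity))

/-- The regularized kernel is smooth with a symmetric Jacobian matrix. Integrating by parts there
and removing the regularization by dominated convergence avoids any excision of the origin. -/
theorem integral_regKern_curl {ψ : Plane → ℝ} (hψ : IsTest ψ) :
    ∫ x, regKern 0 0 x * ∂_ 1 ψ x = ∫ x, regKern 0 1 x * ∂_ 0 ψ x := by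
  have t := fun i => hψ.partialDeriv i
  refine tendsto_nhds_unique (tendsto_integral_regKern (t 1).continuous (t 1).2 0
    (fun n => (scale_pos n).le) tendsto_scale)
    ((tendsto_integral_regKern (t 0).continuous (t 0).2 1
    (fun n => (scale_pos n).le) tendsto_scale).congr fun n => ?_)
  rw [integral_mul_partialDeriv _ (contDiff_one (contDiff_regKern (scale_pos n) _))
    (contDiff_one hψ.1) (Or.inr hψ.2), integral_mul_partialDeriv _
    (contDiff_one (contDiff_regKern (scale_pos n) _)) (contDiff_one hψ.1) (Or.inr hψ.2)]
  congr 1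
  refine integral_congr_ae (Eventually.of_forall fun x => ?_)
  have := scale_pos n
  simp only
  rw [partialDeriv_regKern (by positivity), partialDeriv_regKern (by positivity)]
  simp; ring_nf; simp

/-- The mass of the Laplacian of the logarithm, up to sign. -/
def logMass : ℝ := ∫ x : Plane, 2 * regWeight 1 x ^ 2

theorem integrable_regWeight_sq : Integrable (fun x : Plane => 2 * regWeight 1 x ^ 2) := by
  have := (integrable_rpow_neg_one_add_norm_sq (E := Plane) (μ := volume) (r := 4) (by norm_num)).const_mul 2
  refine this.congr (Eventually.of_forall fun x => ?_)
  simp only [regWeight]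
  rw [show (-4 / 2 : ℝ) = -(2 : ℕ) by norm_num, Real.rpow_neg (by positivity), Real.rpow_natCast,
    inv_pow, add_comm]

/-- The divergence of the regularized kernel is `2δ / (‖x‖² + δ)²`. With `δ` the square of a scale
this is an approximate identity of mass `logMass`. The value of that mass is not needed. -/
theorem integral_regKern_div {ψ : Plane → ℝ} (hψ : IsTest ψ) :
    (∫ x, regKern 0 0 x * ∂_ 0 ψ x) + ∫ x, regKern 0 1 x * ∂_ 1 ψ x
      = -(logMass * ψ 0) := by
  have t := fun i => hψ.partialDeriv i
  have hd : ∀ n, 0 < scale n ^ 2 := fun n => pow_pos (scale_pos n) 2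
  have hd0 : Tendsto (fun n => scale n ^ 2) atTop (𝓝 0) := by simpa using tendsto_scale.pow 2
  refine tendsto_nhds_unique ((tendsto_integral_regKern (t 0).continuous (t 0).2 0
    (fun n => (hd n).le) hd0).add (tendsto_integral_regKern (t 1).continuous (t 1).2 1
    (fun n => (hd n).le) hd0)) ?_
  obtain ⟨C, hC⟩ := hψ.continuous.bounded_above_of_compact_support hψ.2
  have L : Tendsto (fun n => ∫ z, 2 * regWeight 1 z ^ 2 * ψ (scale n • z)) atTop
      (𝓝 (∫ z, 2 * regWeight 1 z ^ 2 * ψ 0)) := by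
    refine tendsto_integral_of_dominated_convergence (fun z => 2 * regWeight 1 z ^ 2 * C)
      (fun n => integrable_regWeight_sq.aestronglyMeasurable.mul
        (hψ.continuous.comp (continuous_const_smul _)).aestronglyMeasurable)
      (integrable_regWeight_sq.mul_const C) (fun n => Eventually.of_forall fun z => ?_)
      (Eventually.of_forall fun z => Tendsto.const_mul _ ?_)
    · rw [norm_mul, Real.norm_of_nonneg (by positivity)]
      exact mul_le_mul_of_nonneg_left (hC _) (by positivity)
    · refine (hψ.continuous.tendsto 0).comp ?_
      simpa using tendsto_scale.smul_const z
  rw [integral_mul_const] at L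
  refine (L.neg).congr fun n => ?_
  have hs := scale_pos n
  have h2 := hd n
  rw [integral_mul_partialDeriv _ (contDiff_one (contDiff_regKern (hd n) _))
    (contDiff_one hψ.1) (Or.inr hψ.2), integral_mul_partialDeriv _
    (contDiff_one (contDiff_regKern (hd n) _)) (contDiff_one hψ.1) (Or.inr hψ.2), ← neg_add,
    ← integral_add]
  · congr 1
    have := integral_comp_inv_smul_plane hs (fun z => 2 * regWeight 1 z ^ 2 * ψ (scale n • z))
    rw [← mul_right_inj' (a := scale n ^ 2) (by positivity), ← this, ← integral_const_mul]
    refine integral_congr_ae (Eventually.of_forall fun x => ?_)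
    simp only
    rw [partialDeriv_regKern (by positivity), partialDeriv_regKern (by positivity),
      smul_smul, mul_inv_cancel₀ hs.ne', one_smul]
    simp only [regWeight, norm_smul, norm_sq_eq x, mul_pow, Real.norm_eq_abs, sq_abs]
    have : 0 < x 0 ^ 2 + x 1 ^ 2 + scale n ^ 2 := by positivity
    have e : (scale n)⁻¹ ^ 2 * (x 0 ^ 2 + x 1 ^ 2) + 1
      = (scale n ^ 2)⁻¹ * (x 0 ^ 2 + x 1 ^ 2 + scale n ^ 2) := by field_simp
    rw [e]
    simp
    field_simp
    ring
  all_goals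
    exact ((continuous_partialDeriv _ (contDiff_one (contDiff_regKern (hd n) _))).mul
      hψ.continuous).integrable_of_hasCompactSupport hψ.2.mul_left

end RegularizedKernel

/-! ### Correlation of a singular kernel with a test function. -/

section Correlation

variable {k h : Plane → ℝ}

/-- The correlation of a kernel with a test function. -/
def corr (k h : Plane → ℝ) (y : Plane) : ℝ := ∫ z, k z * h (z + y)

theorem corr_apply (k h : Plane → ℝ) (y : Plane) : corr k h y = ∫ x, k (x - y) * h x := by
  rw [corr, ← integral_sub_right_eq_self _ y]
  simp

theorem corr_eq_conv (k h : Plane → ℝ) : corr k h = conv (fun z => k (-z)) h := by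
  ext y
  rw [conv_apply, corr_apply]
  simp

theorem locallyIntegrable_comp_neg (hk : LocallyIntegrable k volume) :
    LocallyIntegrable (fun z => k (-z)) volume := by
  refine locallyIntegrable_of_ball fun R => ?_
  have h1 : IntegrableOn k (closedBall 0 R) :=
    hk.integrableOn_isCompact (isCompact_closedBall 0 R)
  have h2 := (h1.mono_set ball_subset_closedBall : IntegrableOn k (ball 0 R))
  rw [← integrable_indicator_iff measurableSet_ball] at h2 ⊢
  refine h2.comp_neg.congr (Eventually.of_forall fun x => ?_)
  simp [indicator]

theorem IsTest.comp_add_right (hh : IsTest h) (y : Plane) : IsTest (fun z => h (z + y)) :=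
  ⟨hh.1.comp (contDiff_id.add contDiff_const), hh.2.comp_homeomorph (Homeomorph.addRight y)⟩

theorem partialDeriv_comp_add_right (i : Fin 2) (h : Plane → ℝ) (y z : Plane) :
    ∂_ i (fun x => h (x + y)) z = ∂_ i h (z + y) := by
  simp only [partialDeriv, fderiv_comp_add_right]

theorem contDiff_corr (hk : LocallyIntegrable k volume) (hh : IsTest h) :
    ContDiff ℝ ∞ (corr k h) := by
  rw [corr_eq_conv, conv_comm]
  exact contDiff_conv hh (locallyIntegrable_comp_neg hk)

theorem partialDeriv_corr (hk : LocallyIntegrable k volume) (hh : IsTest h) (i : Fin 2)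
    (y : Plane) : ∂_ i (corr k h) y = corr k (∂_ i h) y := by
  rw [corr_eq_conv, corr_eq_conv]
  exact partialDeriv_conv_right i hh (locallyIntegrable_comp_neg hk) y

theorem integrable_corr (hk : LocallyIntegrable k volume) (hh : IsTest h) (y : Plane) :
    Integrable fun z => k z * h (z + y) := by
  have := (hh.comp_add_right y).integrable_mul hk
  simpa only [mul_comm] using this

theorem corr_add {h' : Plane → ℝ} (hk : LocallyIntegrable k volume) (hh : IsTest h)
    (hh' : IsTest h') (y : Plane) :
    corr k (fun x => h x + h' x) y = corr k h y + corr k h' y := by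
  simp only [corr, mul_add]
  exact integral_add (integrable_corr hk hh y) (integrable_corr hk hh' y)

theorem corr_add_left {k' : Plane → ℝ} (hk : LocallyIntegrable k volume)
    (hk' : LocallyIntegrable k' volume) (hh : IsTest h) (y : Plane) :
    corr (fun x => k x + k' x) h y = corr k h y + corr k' h y := by
  simp only [corr, add_mul]
  exact integral_add (integrable_corr hk hh y) (integrable_corr hk' hh y)

theorem corr_const_mul_left (c : ℝ) (y : Plane) :
    corr (fun x => c * k x) h y = c * corr k h y := by
  simp only [corr, mul_assoc, integral_const_mul]

theorem corr_partialDeriv (hk : ContDiff ℝ ∞ k) (hh : IsTest h) (i : Fin 2) (y : Plane) :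
    corr k (∂_ i h) y = -corr (∂_ i k) h y := by
  have t := hh.comp_add_right y
  simp only [corr]
  simp only [← partialDeriv_comp_add_right]
  exact integral_mul_partialDeriv i (contDiff_one hk) (contDiff_one t.1) (Or.inr t.2)

theorem abs_corr_le {ρ C : ℝ} (hs : Function.support h ⊆ ball 0 ρ)
    {y : Plane} (hi : Integrable h) (hC : ∀ x ∈ ball (0 : Plane) ρ, |k (x - y)| ≤ C) :
    |corr k h y| ≤ C * ∫ x, |h x| := by
  rw [corr_apply, ← integral_const_mul]
  rw [← Real.norm_eq_abs]
  refine norm_integral_le_of_norm_le (hi.abs.const_mul C) (Eventually.of_forall fun x => ?_)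
  rw [norm_mul, Real.norm_eq_abs, Real.norm_eq_abs]
  by_cases hx : x ∈ ball (0 : Plane) ρ
  · exact mul_le_mul_of_nonneg_right (hC x hx) (abs_nonneg _)
  · have : h x = 0 := by
      by_contra h0
      exact hx (hs h0)
    simp [this]

end Correlation

/-! ### Derivatives of logarithmic potentials: decay and an `L²` bound. -/

section LogPotential

variable {g h : Plane → ℝ} {ρ : ℝ}

theorem half_norm_le_of_mem_ball {x y : Plane} (hx : x ∈ ball (0 : Plane) ρ)
    (hy : 2 * ρ ≤ ‖y‖) : ‖y‖ / 2 ≤ ‖x - y‖ := by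
  have h1 : ‖y‖ - ‖x‖ ≤ ‖y - x‖ := norm_sub_norm_le y x
  rw [norm_sub_rev y x] at h1
  have h2 : ‖x‖ < ρ := by simpa using hx
  linarith

theorem logKern_locInt (i : Fin 2) : LocallyIntegrable (regKern 0 i) volume :=
  locallyIntegrable_regKern le_rfl i

/-- The kernel is curl-free, so its index may be exchanged with that of a derivative on the test
function. -/
theorem corr_regKern_comm (hg : IsTest g) (i j : Fin 2) (y : Plane) :
    corr (regKern 0 i) (∂_ j g) y = corr (regKern 0 j) (∂_ i g) y := by
  have key : corr (regKern 0 0) (∂_ 1 g) y = corr (regKern 0 1) (∂_ 0 g) y := by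
    have := integral_regKern_curl (hg.comp_add_right y)
    simp only [partialDeriv_comp_add_right] at this
    exact this
  fin_cases i <;> fin_cases j <;> first | rfl | exact key | exact key.symm

theorem corr_regKern_div (hg : IsTest g) (y : Plane) :
    corr (regKern 0 0) (∂_ 0 g) y + corr (regKern 0 1) (∂_ 1 g) y
      = -(logMass * g y) := by
  have := integral_regKern_div (hg.comp_add_right y)
  simp only [partialDeriv_comp_add_right, zero_add] at this
  exact this

theorem abs_corr_regKern_le (hρ : 0 < ρ) (hg : IsTest g)
    (hs : Function.support g ⊆ ball 0 ρ) (i : Fin 2) {y : Plane} (hy : 2 * ρ ≤ ‖y‖) :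
    |corr (regKern 0 i) g y| ≤ 2 * ‖y‖⁻¹ * ∫ x, |g x| := by
  have hy0 : 0 < ‖y‖ := by linarith
  refine abs_corr_le hs (hg.continuous.integrable_of_hasCompactSupport hg.2) fun x hx => ?_
  refine (abs_regKern_le le_rfl i _).trans ?_
  rw [show 2 * ‖y‖⁻¹ = (‖y‖ / 2)⁻¹ by field_simp]
  exact inv_anti₀ (by positivity) (half_norm_le_of_mem_ball hx hy)

/-- Away from the support both derivatives are moved onto the kernel. This is done for the
regularized kernel, where no singularity interferes and the bounds are uniform. The constant is `14
* 2 ^ 3`, since points of the support have distance at least `‖y‖ / 2` from `y`. -/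
theorem abs_corr_regKern_partialDeriv_le (hρ : 0 < ρ) (hg : IsTest g)
    (hs : Function.support g ⊆ ball 0 ρ) (i j k : Fin 2) {y : Plane} (hy : 2 * ρ ≤ ‖y‖) :
    |corr (regKern 0 i) (∂_ j (∂_ k g)) y|
      ≤ 112 * (‖y‖ ^ 3)⁻¹ * ∫ x, |g x| := by
  have hy0 : 0 < ‖y‖ := by linarith
  have t := ((hg.partialDeriv k).partialDeriv j).comp_add_right y
  refine le_of_tendsto (tendsto_integral_regKern t.continuous t.2 i
    (fun n => (scale_pos n).le) tendsto_scale).abs (Eventually.of_forall fun n => ?_)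
  have hk := contDiff_regKern (scale_pos n) i
  have e := corr_partialDeriv hk (hg.partialDeriv k) j y
  rw [corr_partialDeriv (contDiff_partialDeriv j hk) hg k y, neg_neg] at e
  change |corr _ _ y| ≤ _
  rw [e]
  refine abs_corr_le hs (hg.continuous.integrable_of_hasCompactSupport hg.2) fun x hx => ?_
  have h2 := half_norm_le_of_mem_ball hx hy
  have hz : x - y ≠ 0 := norm_pos_iff.1 (by linarith)
  refine (abs_partialDeriv_partialDeriv_regKern_le (scale_pos n).le hz i j k).trans ?_
  rw [show 112 * (‖y‖ ^ 3)⁻¹ = 14 * ((‖y‖ / 2) ^ 3)⁻¹ by field_simp; norm_num]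
  gcongr

/-- The square actually decays like `‖y‖⁻²`, but `‖y‖⁻¹` suffices to make the cut-off error below
vanish at infinity, and one formula then covers all `y` other than the origin. The origin is
excluded because `‖0‖⁻¹ = 0` here. -/
theorem exists_corr_regKern_sq_le (hg : IsTest g) (i : Fin 2) :
    ∃ C, ∀ y, corr (regKern 0 i) g y ^ 2 ≤ C * ‖y‖⁻¹ ∨ y = 0 := by
  obtain ⟨ρ, hρ, hs⟩ := exists_ball_of_hasCompactSupport hg.2
  have hs' := (subset_tsupport g).trans hs
  set I := ∫ x, |g x| with hI
  have hI0 : 0 ≤ I := integral_nonneg fun x => abs_nonneg _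
  obtain ⟨B, hB⟩ := (isCompact_closedBall (0 : Plane) (2 * ρ)).exists_bound_of_continuousOn
    (contDiff_corr (logKern_locInt i) hg).continuous.continuousOn
  refine ⟨B ^ 2 * (2 * ρ) + 4 * I ^ 2 * (2 * ρ)⁻¹, fun y => ?_⟩
  by_cases hy : y = 0
  · exact Or.inr hy
  left
  have hy0 : 0 < ‖y‖ := norm_pos_iff.2 hy
  rw [add_mul]
  rcases le_total ‖y‖ (2 * ρ) with h1 | h1
  · have h2 := hB y (by simpa using h1)
    have h3 : corr (regKern 0 i) g y ^ 2 ≤ B ^ 2 := sq_le_sq' (neg_le_of_abs_le h2) (le_of_abs_le h2)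
    have h4 : B ^ 2 ≤ B ^ 2 * (2 * ρ) * ‖y‖⁻¹ := by
      rw [mul_assoc]
      refine le_mul_of_one_le_right (sq_nonneg _) ?_
      rw [← div_eq_mul_inv, one_le_div hy0]; exact h1
    have : 0 ≤ 4 * I ^ 2 * (2 * ρ)⁻¹ * ‖y‖⁻¹ := by positivity
    linarith
  · have h2 := abs_corr_regKern_le hρ hg hs' i h1
    have h3 : corr (regKern 0 i) g y ^ 2 ≤ (2 * ‖y‖⁻¹ * I) ^ 2 :=
      sq_le_sq' (neg_le_of_abs_le h2) (le_of_abs_le h2)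
    have h4 : (2 * ‖y‖⁻¹ * I) ^ 2 = 4 * I ^ 2 * ‖y‖⁻¹ * ‖y‖⁻¹ := by ring
    have h5 : ‖y‖⁻¹ ≤ (2 * ρ)⁻¹ := inv_anti₀ (by positivity) h1
    have h6 : 4 * I ^ 2 * ‖y‖⁻¹ * ‖y‖⁻¹ ≤ 4 * I ^ 2 * (2 * ρ)⁻¹ * ‖y‖⁻¹ := by gcongr
    have : 0 ≤ B ^ 2 * (2 * ρ) * ‖y‖⁻¹ := by positivity
    linarith

theorem integral_ball_norm_inv {R : ℝ} (hR : 0 < R) :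
    ∫ y in ball (0 : Plane) (2 * R), ‖y‖⁻¹ = R * ∫ y in ball (0 : Plane) 2, ‖y‖⁻¹ := by
  rw [← integral_indicator measurableSet_ball, ← integral_indicator measurableSet_ball]
  have := integral_comp_inv_smul_plane hR ((ball (0 : Plane) 2).indicator fun y => ‖y‖⁻¹)
  have e : ∀ x : Plane, (ball (0 : Plane) 2).indicator (fun y => ‖y‖⁻¹) (R⁻¹ • x)
      = R * (ball (0 : Plane) (2 * R)).indicator (fun y => ‖y‖⁻¹) x := by
    intro x
    have : R⁻¹ • x ∈ ball (0 : Plane) 2 ↔ x ∈ ball (0 : Plane) (2 * R) := by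
      simp only [mem_ball_zero_iff, norm_smul, norm_inv, Real.norm_of_nonneg hR.le]
      rw [inv_mul_lt_iff₀ hR, mul_comm]
    by_cases hx : x ∈ ball (0 : Plane) (2 * R)
    · rw [indicator_of_mem hx, indicator_of_mem (this.2 hx), norm_smul, norm_inv,
        Real.norm_of_nonneg hR.le, mul_inv, inv_inv]
    · rw [indicator_of_notMem hx, indicator_of_notMem (mt this.1 hx), mul_zero]
  simp only [e, integral_const_mul] at this
  have h2 : R * ∫ x, (ball (0 : Plane) (2 * R)).indicator (fun y => ‖y‖⁻¹) x
    = R * (R * ∫ x, (ball (0 : Plane) 2).indicator (fun y => ‖y‖⁻¹) x) := by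
    rw [this]; ring
  exact mul_left_cancel₀ hR.ne' h2

/-- The two correlations form a curl-free field with divergence `-logMass * g`. The interior
gradient estimate on balls of radius `S` gives the bound up to a cut-off error of order `1 / S`,
which is then sent to zero. This replaces an appeal to singular integral theory. -/
theorem integral_ball_grad_corr_le (hg : IsTest g) (R : ℝ) :
    ∫ x in ball 0 R, (∂_ 0 (corr (regKern 0 0) g) x ^ 2
        + ∂_ 1 (corr (regKern 0 0) g) x ^ 2
        + ∂_ 0 (corr (regKern 0 1) g) x ^ 2
        + ∂_ 1 (corr (regKern 0 1) g) x ^ 2)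
      ≤ 2 * logMass ^ 2 * ∫ x, g x ^ 2 := by
  set p₀ := corr (regKern 0 0) g with hp₀
  set p₁ := corr (regKern 0 1) g with hp₁
  have s₀ : ContDiff ℝ ∞ p₀ := contDiff_corr (logKern_locInt 0) hg
  have s₁ : ContDiff ℝ ∞ p₁ := contDiff_corr (logKern_locInt 1) hg
  obtain ⟨C₀, h₀⟩ := exists_corr_regKern_sq_le hg 0
  obtain ⟨C₁, h₁⟩ := exists_corr_regKern_sq_le hg 1
  obtain ⟨C, hC, hest⟩ := exists_gradient_estimate
  set J := ∫ y in ball (0 : Plane) 2, ‖y‖⁻¹ with hJ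
  have hdiv : ∀ x, ∂_ 0 p₀ x + ∂_ 1 p₁ x = -(logMass * g x) := fun x => by
    rw [partialDeriv_corr (logKern_locInt 0) hg, partialDeriv_corr (logKern_locInt 1) hg]
    exact corr_regKern_div hg x
  have hcurl : ∀ x, ∂_ 0 p₁ x - ∂_ 1 p₀ x = 0 := fun x => by
    rw [partialDeriv_corr (logKern_locInt 0) hg, partialDeriv_corr (logKern_locInt 1) hg,
      corr_regKern_comm hg 1 0, sub_self]
  have hgi : Integrable fun x => g x ^ 2 := by
    have t : IsTest fun x => g x * g x := hg.mul_left hg.1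
    simpa only [sq] using t.continuous.integrable_of_hasCompactSupport t.2
  have cont : Continuous fun x => ∂_ 0 p₀ x ^ 2 + ∂_ 1 p₀ x ^ 2
        + ∂_ 0 p₁ x ^ 2 + ∂_ 1 p₁ x ^ 2 := by
    have c := fun i => continuous_partialDeriv i (contDiff_one s₀)
    have c' := fun i => continuous_partialDeriv i (contDiff_one s₁)
    have := c 0; have := c 1; have := c' 0; have := c' 1
    fun_prop
  have bound : ∀ S, 0 < S → R ≤ S → ∫ x in ball 0 R, (∂_ 0 p₀ x ^ 2
        + ∂_ 1 p₀ x ^ 2 + ∂_ 0 p₁ x ^ 2 + ∂_ 1 p₁ x ^ 2)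
      ≤ 2 * logMass ^ 2 * (∫ x, g x ^ 2) + C * (C₀ + C₁) * J * S⁻¹ := by
    intro S hS hRS
    have h1 := setIntegral_mono_set (Continuous.integrableOn_ball cont 0 S)
      (Eventually.of_forall fun x => by simp only [Pi.zero_apply]; positivity)
      (ball_subset_ball hRS).eventuallyLE
    refine h1.trans ((hest S hS p₀ p₁ s₀ s₁).trans ?_)
    simp only [hdiv, hcurl]
    have i1 : Integrable (fun x => 2 * logMass ^ 2 * g x ^ 2)
      (volume.restrict (ball 0 (2 * S))) := (hgi.const_mul _).integrableOn
    have i2 : Integrable (fun x : Plane => C / S ^ 2 * (C₀ + C₁) * ‖x‖⁻¹)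
      (volume.restrict (ball 0 (2 * S))) := (integrableOn_ball_norm_inv _).const_mul _
    calc _ ≤ ∫ x in ball 0 (2 * S), (2 * logMass ^ 2 * g x ^ 2
          + C / S ^ 2 * (C₀ + C₁) * ‖x‖⁻¹) := by
          refine integral_mono_ae ?_ (i1.add i2) ?_
          · refine (Continuous.integrableOn_ball ?_ 0 _)
            have := hg.continuous; have := s₀.continuous; have := s₁.continuous
            fun_prop
          · have h0 : ∀ᵐ x : Plane ∂volume.restrict (ball 0 (2 * S)), x ≠ 0 :=
              ae_restrict_of_ae (by simp [ae_iff, measure_singleton])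
            filter_upwards [h0] with x hx
            have a := (h₀ x).resolve_right hx
            have b := (h₁ x).resolve_right hx
            have : C / S ^ 2 * (p₀ x ^ 2 + p₁ x ^ 2) ≤ C / S ^ 2 * ((C₀ + C₁) * ‖x‖⁻¹) := by
              gcongr
              linarith
            nlinarith
      _ ≤ _ := by
          rw [integral_add i1 i2, integral_const_mul, integral_const_mul, integral_ball_norm_inv hS]
          have : ∫ x in ball 0 (2 * S), g x ^ 2 ≤ ∫ x, g x ^ 2 :=
            setIntegral_le_integral hgi (Eventually.of_forall fun x => sq_nonneg _)
          have e : C / S ^ 2 * (C₀ + C₁) * (S * J) = C * (C₀ + C₁) * J * S⁻¹ := by field_simp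
          rw [e]
          gcongr
  have L : Tendsto (fun S : ℝ => 2 * logMass ^ 2 * (∫ x, g x ^ 2) + C * (C₀ + C₁) * J * S⁻¹) atTop
      (𝓝 (2 * logMass ^ 2 * (∫ x, g x ^ 2) + C * (C₀ + C₁) * J * 0)) :=
    (tendsto_inv_atTop_zero.const_mul _).const_add _
  rw [mul_zero, add_zero] at L
  refine ge_of_tendsto L ?_
  filter_upwards [eventually_gt_atTop 0, eventually_ge_atTop R] with S h1 h2 using bound S h1 h2

end LogPotential

/-! ### The near and far kernels in the definition of the pressure force. -/

section CutKernels

variable {θ : Plane → ℝ}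

/-- The part of the fundamental solution away from the origin. -/
def farSol (θ : Plane → ℝ) (x : Plane) : ℝ := (1 - θ x) * fundSol x

/-- The constant `-1 / 2π`. -/
def logConst : ℝ := -(1 / (2 * Real.pi))

theorem abs_logConst_le : |logConst| ≤ 1 := by
  have := Real.pi_gt_three
  rw [logConst, abs_neg, abs_of_nonneg (by positivity), div_le_one (by positivity)]
  linarith

theorem contDiffAt_fundSol {x : Plane} (hx : x ≠ 0) : ContDiffAt ℝ ∞ fundSol x :=
  contDiffAt_const.mul ((contDiffAt_norm ℝ hx).log (norm_ne_zero_iff.2 hx))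

theorem partialDeriv_fundSol {x : Plane} (hx : x ≠ 0) (i : Fin 2) :
    ∂_ i fundSol x = logConst * regKern 0 i x := by
  have hn : ‖x‖ ≠ 0 := norm_ne_zero_iff.2 hx
  have hs : ‖x‖ ^ 2 ≠ 0 := pow_ne_zero 2 hn
  have e : fundSol = fun y => (logConst / 2) * (fun s => Real.log s) (‖y‖ ^ 2) := by
    ext y
    simp only [fundSol, logConst, Real.log_pow]
    push_cast; ring
  have d : DifferentiableAt ℝ (fun y : Plane => ‖y‖ ^ 2) x :=
    (contDiff_norm_sq ℝ (n := 1)).differentiable_one.differentiableAt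
  rw [e, partialDeriv_const_mul (f := fun y : Plane => Real.log (‖y‖ ^ 2)) i _ (d.log hs),
    partialDeriv_comp (β := fun s => Real.log s) i (Real.differentiableAt_log hs) d,
    partialDeriv_norm_sq, Real.deriv_log, regKern, regWeight]
  field_simp
  ring

theorem contDiff_farSol (hθ : IsCutoff θ) : ContDiff ℝ ∞ (farSol θ) := by
  refine contDiff_iff_contDiffAt.2 fun x => ?_
  by_cases hx : ‖x‖ < 1
  · have : farSol θ =ᶠ[𝓝 x] fun _ => 0 := by
      filter_upwards [isOpen_ball.mem_nhds (show x ∈ ball (0 : Plane) 1 by simpa)]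
        with y hy
      simp [farSol, hθ.eq_one y (by simpa using (mem_ball_zero_iff.1 hy).le)]
    exact contDiffAt_const.congr_of_eventuallyEq this
  · have h0 : x ≠ 0 := by rintro rfl; simp at hx
    exact (contDiffAt_const.sub hθ.contDiff.contDiffAt).mul (contDiffAt_fundSol h0)

theorem nearKernel_eq (hθ : IsCutoff θ) (i : Fin 2) {x : Plane} (hx : x ≠ 0) :
    nearKernel θ i x = logConst * regKern 0 i x - ∂_ i (farSol θ) x := by
  have e : (fun x => θ x * fundSol x) = fun x => fundSol x - farSol θ x := by
    ext y; simp only [farSol]; ring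
  rw [nearKernel, e, partialDeriv_sub i ((contDiffAt_fundSol hx).differentiableAt (by simp))
    ((contDiff_farSol hθ).differentiable (by simp)).differentiableAt, partialDeriv_fundSol hx]

theorem ae_ne_zero : ∀ᵐ x : Plane, x ≠ 0 := by simp [ae_iff, measure_singleton]

theorem nearKernel_ae_eq (hθ : IsCutoff θ) (i : Fin 2) : nearKernel θ i =ᵐ[volume]
    fun x => logConst * regKern 0 i x - ∂_ i (farSol θ) x :=
  ae_ne_zero.mono fun _ hx => nearKernel_eq hθ i hx

theorem tsupport_nearKernel (hθ : IsCutoff θ) (i : Fin 2) :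
    tsupport (nearKernel θ i) ⊆ ball 0 2 :=
  (partialDeriv_support_subset i _).trans
    ((closure_mono (Function.support_mul_subset_left _ _)).trans hθ.tsupport_subset)

theorem hasCompactSupport_nearKernel (hθ : IsCutoff θ) (i : Fin 2) :
    HasCompactSupport (nearKernel θ i) :=
  HasCompactSupport.of_support_subset_isCompact (isCompact_closedBall (0 : Plane) 2)
    ((subset_tsupport _).trans ((tsupport_nearKernel hθ i).trans ball_subset_closedBall))

theorem continuous_partialDeriv_farSol (hθ : IsCutoff θ) (i : Fin 2) :
    Continuous (∂_ i (farSol θ)) :=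
  continuous_partialDeriv i (contDiff_one (contDiff_farSol hθ))

theorem locallyIntegrable_nearKernel (hθ : IsCutoff θ) (i : Fin 2) :
    LocallyIntegrable (nearKernel θ i) volume := by
  have h1 : LocallyIntegrable (fun x => logConst * regKern 0 i x
      - ∂_ i (farSol θ) x) volume := by
    have := ((logKern_locInt i).smul logConst).sub
      (continuous_partialDeriv_farSol hθ i).locallyIntegrable
    exact this
  exact h1.mono (h1.aestronglyMeasurable.congr (nearKernel_ae_eq hθ i).symm)
    ((nearKernel_ae_eq hθ i).mono fun x hx => by rw [hx])

theorem integrable_nearKernel (hθ : IsCutoff θ) (i : Fin 2) : Integrable (nearKernel θ i) := by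
  rw [← integrableOn_iff_integrable_of_support_subset (s := closedBall 0 2)
    ((subset_tsupport _).trans ((tsupport_nearKernel hθ i).trans ball_subset_closedBall))]
  exact (locallyIntegrable_nearKernel hθ i).integrableOn_isCompact (isCompact_closedBall _ _)

/-- The decay rate of the far kernel. -/
def farWeight (x : Plane) : ℝ := ((1 + ‖x‖) ^ 3)⁻¹

theorem farWeight_pos (x : Plane) : 0 < farWeight x := by unfold farWeight; positivity

theorem farWeight_sub_le {x y : Plane} {R : ℝ} (hx : ‖x‖ ≤ R) :
    farWeight (x - y) ≤ (1 + R) ^ 3 * farWeight y := by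
  have h0 := norm_nonneg x
  have h1 : ‖y‖ ≤ ‖x - y‖ + ‖x‖ := by
    have := norm_sub_le x (x - y)
    rw [sub_sub_cancel] at this
    linarith
  have h2 : 1 + ‖y‖ ≤ (1 + R) * (1 + ‖x - y‖) := by
    have := norm_nonneg (x - y)
    nlinarith
  rw [farWeight, farWeight, ← div_eq_mul_inv, inv_eq_one_div, div_le_div_iff₀ (by positivity)
    (by positivity), one_mul, ← mul_pow]
  gcongr

theorem contDiff_farKernel (hθ : IsCutoff θ) (i j k : Fin 2) : ContDiff ℝ ∞ (farKernel θ i j k) :=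
  contDiff_partialDeriv i (contDiff_partialDeriv j (contDiff_partialDeriv k (contDiff_farSol hθ)))

theorem farKernel_eq (hθ : IsCutoff θ) (i j k : Fin 2) {x : Plane} (hx : 2 ≤ ‖x‖) :
    farKernel θ i j k x = logConst * ∂_ i (∂_ j (regKern 0 k)) x := by
  have hU : ∀ᶠ y in 𝓝 x, y ∈ (tsupport θ)ᶜ ∩ {y | y ≠ 0} := by
    refine ((isClosed_tsupport θ).isOpen_compl.inter isOpen_ne).mem_nhds ⟨fun h => ?_, ?_⟩
    · have := hθ.tsupport_subset h
      simp at this; linarith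
    · rintro rfl; simp at hx; linarith
  have h1 : ∀ᶠ y in 𝓝 x, farSol θ y = fundSol y := hU.mono fun y hy => by
    simp [farSol, image_eq_zero_of_notMem_tsupport hy.1]
  have h2 : ∀ᶠ y in 𝓝 x, ∂_ k (farSol θ) y = logConst * regKern 0 k y := by
    filter_upwards [h1.eventually_nhds, hU] with y hy hy'
    rw [partialDeriv_congr hy, partialDeriv_fundSol hy'.2]
  have h3 : ∀ᶠ y in 𝓝 x, ∂_ j (∂_ k (farSol θ)) y
      = logConst * ∂_ j (regKern 0 k) y := by
    filter_upwards [h2.eventually_nhds, hU] with y hy hy'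
    have : ‖y‖ ≠ 0 := norm_ne_zero_iff.2 hy'.2
    rw [partialDeriv_congr hy, partialDeriv_const_mul j _
      ((contDiffAt_regKern k (by positivity)).differentiableAt (by simp))]
  change ∂_ i (∂_ j (∂_ k (farSol θ))) x = _
  have hx0 : ‖x‖ ≠ 0 := by linarith
  have hd : DifferentiableAt ℝ (∂_ j (regKern 0 k)) x := by
    have hc : ContDiffAt ℝ ∞ (regKern 0 k) x := contDiffAt_regKern k (by positivity)
    have : ContDiffAt ℝ ∞ (fun y => fderiv ℝ (regKern 0 k) y) x :=
      hc.fderiv_right (m := ∞) le_rfl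
    exact (this.differentiableAt (by simp)).clm_apply (differentiableAt_const _)
  rw [partialDeriv_congr h3, partialDeriv_const_mul i _ hd]

theorem exists_abs_farKernel_le (hθ : IsCutoff θ) (i j k : Fin 2) :
    ∃ C, 0 ≤ C ∧ ∀ x, |farKernel θ i j k x| ≤ C * farWeight x := by
  obtain ⟨B, hB⟩ := (isCompact_closedBall (0 : Plane) 2).exists_bound_of_continuousOn
    (contDiff_farKernel hθ i j k).continuous.continuousOn
  have hB0 : 0 ≤ B := (norm_nonneg _).trans (hB 0 (by simp))
  -- Within radius `2` the weight costs at most `(1 + 2) ^ 3 = 27`. Outside, `1 + ‖x‖ ≤ (3 / 2)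
  -- ‖x‖`, and `14 * (27 / 8) ≤ 48`.
  refine ⟨27 * B + 48, by positivity, fun x => ?_⟩
  rw [farWeight, ← div_eq_mul_inv, le_div_iff₀ (by positivity)]
  rcases le_total ‖x‖ 2 with h | h
  · have h1 := hB x (by simpa using h)
    have h2 : (1 + ‖x‖) ^ 3 ≤ (1 + 2) ^ 3 := by gcongr
    rw [Real.norm_eq_abs] at h1
    have : |farKernel θ i j k x| * (1 + ‖x‖) ^ 3 ≤ B * (1 + 2) ^ 3 := by gcongr
    linarith
  · rw [farKernel_eq hθ i j k h, abs_mul]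
    have hx : x ≠ 0 := by rintro rfl; simp at h; linarith
    have hn : 0 < ‖x‖ := by linarith
    have h1 := abs_partialDeriv_partialDeriv_regKern_le le_rfl hx k j i
    have h2 : |logConst| * |∂_ i (∂_ j (regKern 0 k)) x|
        ≤ 1 * (14 * (‖x‖ ^ 3)⁻¹) := by
      gcongr
      exact abs_logConst_le
    calc _ ≤ 1 * (14 * (‖x‖ ^ 3)⁻¹) * (3 / 2 * ‖x‖) ^ 3 := by
          gcongr
          linarith
      _ = 14 * (27 / 8) := by field_simp; norm_num
      _ ≤ _ := by linarith

end CutKernels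

/-! ### Fubini's theorem for convolutions with the near and far kernels. -/

section ConvFubini

variable {k g h : Plane → ℝ}

theorem conv_congr_ae {g' : Plane → ℝ} (e : g =ᵐ[volume] g') : conv k g = conv k g' := by
  ext x
  rw [conv_apply, conv_apply]
  exact integral_congr_ae (e.mono fun y hy => by simp only [hy])

theorem integral_mul_conv_eq_corr
    (hi : Integrable (fun p : Plane × Plane => h p.1 * (k (p.1 - p.2) * g p.2))
      (volume.prod volume)) :
    ∫ x, h x * conv k g x = ∫ y, corr k h y * g y := by
  have H := integral_integral_swap (f := fun x y => h x * (k (x - y) * g y)) hi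
  simp only [conv_apply, ← integral_const_mul]
  rw [H]
  refine integral_congr_ae (Eventually.of_forall fun y => ?_)
  simp only [corr_apply]
  rw [← integral_mul_const]
  refine integral_congr_ae (Eventually.of_forall fun x => ?_)
  simp only
  ring

theorem integrable_mul_conv
    (hi : Integrable (fun p : Plane × Plane => h p.1 * (k (p.1 - p.2) * g p.2))
      (volume.prod volume)) :
    Integrable fun x => h x * conv k g x := by
  refine hi.integral_prod_left.congr (Eventually.of_forall fun x => ?_)
  simp only [conv_apply, integral_const_mul]

theorem integrable_corr_mul
    (hi : Integrable (fun p : Plane × Plane => h p.1 * (k (p.1 - p.2) * g p.2))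
      (volume.prod volume)) :
    Integrable fun y => corr k h y * g y := by
  refine hi.integral_prod_right.congr (Eventually.of_forall fun y => ?_)
  simp only [corr_apply]
  rw [← integral_mul_const]
  refine integral_congr_ae (Eventually.of_forall fun x => ?_)
  simp only
  ring

theorem locallyIntegrable_conv (H : ∀ h, IsTest h →
      Integrable (fun p : Plane × Plane => h p.1 * (k (p.1 - p.2) * g p.2)) (volume.prod volume)) :
    LocallyIntegrable (conv k g) volume := by
  refine locallyIntegrable_of_ball fun R => ?_
  have hR : 0 < max R 1 := by positivity
  have h1 := (integrable_mul_conv (H _ (isTest_cut hR))).integrableOn (s := ball 0 R)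
  refine h1.congr_fun (fun x hx => ?_) measurableSet_ball
  have : ‖x‖ ≤ max R 1 := (mem_ball_zero_iff.1 hx).le.trans (le_max_left _ _)
  simp [cut_eq_one hR this]

/-- The kernel may be singular and `g` is only locally integrable. Restricting `g` to the ball that
the supports can reach leaves the convolution integrand of two integrable functions, times a bounded
factor. -/
theorem integrable_prod_of_integrable_kernel {ρ : ℝ} (hk : Integrable k)
    (hks : Function.support k ⊆ ball 0 ρ) (hg : LocallyIntegrable g volume)
    (hh : IsTest h) :
    Integrable (fun p : Plane × Plane => h p.1 * (k (p.1 - p.2) * g p.2)) (volume.prod volume) := by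
  obtain ⟨R, hR, hs⟩ := exists_ball_of_hasCompactSupport hh.2
  obtain ⟨C, hC⟩ := hh.continuous.bounded_above_of_compact_support hh.2
  set S := closedBall (0 : Plane) (R + ρ)
  have hgS : Integrable (S.indicator g) :=
    (hg.integrableOn_isCompact (isCompact_closedBall _ _)).integrable_indicator
      measurableSet_closedBall
  have h1 := Integrable.convolution_integrand (ContinuousLinearMap.mul ℝ ℝ) hgS hk
  have h2 := h1.bdd_mul (c := C) (f := fun p : Plane × Plane => h p.1)
    (hh.continuous.comp continuous_fst).aestronglyMeasurable (Eventually.of_forall fun p => hC _)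
  refine h2.congr (Eventually.of_forall fun p => ?_)
  simp only [ContinuousLinearMap.mul_apply']
  by_cases hp : p.2 ∈ S
  · simp only [indicator_of_mem hp]; ring
  · simp only [indicator_of_notMem hp, mul_zero, zero_mul]
    by_cases h0 : h p.1 = 0
    · simp [h0]
    by_cases hk0 : k (p.1 - p.2) = 0
    · simp [hk0]
    exfalso
    refine hp ?_
    have a : ‖p.1‖ < R := by simpa using hs (subset_tsupport _ h0)
    have b : ‖p.1 - p.2‖ < ρ := by simpa using hks hk0
    have c := norm_sub_le p.1 (p.1 - p.2)
    rw [sub_sub_cancel] at c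
    simp only [S, mem_closedBall_zero_iff]
    linarith

theorem integrable_prod_of_farWeight {C : ℝ} (hk : Continuous k)
    (hkC : ∀ x, |k x| ≤ C * farWeight x)
    (hg : Integrable fun y => g y * farWeight y) (hh : IsTest h) :
    Integrable (fun p : Plane × Plane => h p.1 * (k (p.1 - p.2) * g p.2)) (volume.prod volume) := by
  obtain ⟨R, hR, hs⟩ := exists_ball_of_hasCompactSupport hh.2
  have hC : 0 ≤ C := by
    have := (abs_nonneg _).trans (hkC 0)
    exact (mul_nonneg_iff_of_pos_right (farWeight_pos 0)).1 this
  have h1 : Integrable (fun p : Plane × Plane => h p.1 * (g p.2 * farWeight p.2))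
      (volume.prod volume) :=
    (hh.continuous.integrable_of_hasCompactSupport hh.2).mul_prod hg
  have hgm : AEStronglyMeasurable g volume := by
    have := hg.aestronglyMeasurable.mul
      (show AEStronglyMeasurable (fun y : Plane => (1 + ‖y‖) ^ 3) volume by fun_prop)
    refine this.congr (Eventually.of_forall fun y => ?_)
    simp only [farWeight, Pi.mul_apply]
    field_simp
  refine (h1.norm.const_mul (C * (1 + R) ^ 3)).mono' ?_ (Eventually.of_forall fun p => ?_)
  · exact (hh.continuous.comp continuous_fst).aestronglyMeasurable.mul
      ((hk.comp (by fun_prop)).aestronglyMeasurable.mul hgm.comp_snd)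
  · simp only [norm_mul, Real.norm_eq_abs]
    by_cases h0 : h p.1 = 0
    · simp [h0]
    have a : ‖p.1‖ < R := by simpa using hs (subset_tsupport _ h0)
    have b := (hkC (p.1 - p.2)).trans (mul_le_mul_of_nonneg_left (farWeight_sub_le a.le) hC)
    rw [abs_of_pos (farWeight_pos p.2)]
    calc |h p.1| * (|k (p.1 - p.2)| * |g p.2|)
        ≤ |h p.1| * (C * ((1 + R) ^ 3 * farWeight p.2) * |g p.2|) := by gcongr
      _ = _ := by ring

end ConvFubini

/-- The weight makes the energy density integrable. -/
def FarIntegrable (f : Plane → Plane) : Prop :=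
  Integrable fun y => ‖f y‖ ^ 2 * farWeight y

/-- The kernel pairing `u ⊗ u` with a test function in the `i`-th component. -/
def pressKer (i : Fin 2) (h : Plane → ℝ) (f : Plane → Plane) (y : Plane) : ℝ :=
  ∑ j, ∑ k, f y j * f y k * corr (regKern 0 i) (∂_ j (∂_ k h)) y

/-- The pressure force tested against a scalar test function in the `i`-th component. -/
def pressForm (i : Fin 2) (h : Plane → ℝ) (f : Plane → Plane) : ℝ :=
  logConst * ∫ y, pressKer i h f y

theorem abs_coord_mul_le (v : Plane) (j k : Fin 2) : |v j * v k| ≤ ‖v‖ ^ 2 := by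
  rw [abs_mul, sq]
  exact mul_le_mul (abs_coord_le v j) (abs_coord_le v k) (abs_nonneg _) (norm_nonneg _)

/-! ### The pressure force tested against a function, free of the cut-off. -/

section Representation

variable {θ : Plane → ℝ} {f : Plane → Plane} {w : Plane → ℝ} {W : ℝ} {h : Plane → ℝ}

theorem FarIntegrable.coord (hf : FarIntegrable f) (hc : Continuous f) (j k : Fin 2) :
    Integrable fun y => f y j * f y k * farWeight y := by
  have : Continuous farWeight := by
    unfold farWeight
    exact (by fun_prop : Continuous fun x : Plane => (1 + ‖x‖) ^ 3).inv₀ fun x => by positivity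
  refine hf.mono' (by fun_prop) (Eventually.of_forall fun y => ?_)
  rw [norm_mul, Real.norm_of_nonneg (farWeight_pos y).le]
  exact mul_le_mul_of_nonneg_right (abs_coord_mul_le _ _ _) (farWeight_pos y).le

theorem isTest_corr_nearKernel (hθ : IsCutoff θ) (i : Fin 2) (hh : IsTest h) :
    IsTest (corr (nearKernel θ i) h) := by
  have hc : HasCompactSupport fun z => nearKernel θ i (-z) :=
    (hasCompactSupport_nearKernel hθ i).comp_homeomorph (Homeomorph.neg Plane)
  rw [corr_eq_conv, conv_comm]
  exact hh.conv_of_integrable hc (locallyIntegrable_comp_neg (locallyIntegrable_nearKernel hθ i))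

theorem corr_farKernel (hθ : IsCutoff θ) (i j k : Fin 2) (hh : IsTest h) (y : Plane) :
    corr (farKernel θ i j k) h y
      = corr (∂_ i (farSol θ)) (∂_ j (∂_ k h)) y := by
  have hM := contDiff_farSol hθ
  rw [corr_partialDeriv (contDiff_partialDeriv i hM) (hh.partialDeriv k), corr_partialDeriv
    (contDiff_partialDeriv j (contDiff_partialDeriv i hM)) hh, neg_neg]
  congr 1
  have e1 : ∂_ j (∂_ i (farSol θ)) = ∂_ i (∂_ j (farSol θ)) :=
    funext (partialDeriv_comm j i hM)
  have e2 : ∂_ j (∂_ k (farSol θ)) = ∂_ k (∂_ j (farSol θ)) :=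
    funext (partialDeriv_comm j k hM)
  change ∂_ i (∂_ j (∂_ k (farSol θ))) = _
  rw [e1, e2]
  exact funext (partialDeriv_comm i k (contDiff_partialDeriv j hM))

/-- Once the far kernel carries a single derivative and the test function the other two, near and
far parts are cut-offs of one and the same kernel and add up to the gradient of the logarithm. This
is the independence of `θ`. -/
theorem corr_nearKernel_add_farKernel (hθ : IsCutoff θ) (i j k : Fin 2) (hh : IsTest h)
    (y : Plane) :
    corr (nearKernel θ i) (∂_ j (∂_ k h)) y + corr (farKernel θ i j k) h y
      = logConst * corr (regKern 0 i) (∂_ j (∂_ k h)) y := by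
  rw [corr_farKernel hθ i j k hh, ← corr_const_mul_left, ← corr_add_left
    (locallyIntegrable_nearKernel hθ i) (continuous_partialDeriv_farSol hθ i).locallyIntegrable
    ((hh.partialDeriv k).partialDeriv j)]
  refine integral_congr_ae ((nearKernel_ae_eq hθ i).mono fun z hz => ?_)
  simp only [hz, sub_add_cancel]

theorem weakPartial_congr_ae {i : Fin 2} {u v : Plane → ℝ} (e : u =ᵐ[volume] v) :
    weakPartial i u = weakPartial i v := by
  have : ∀ g, HasWeakPartial i u g ↔ HasWeakPartial i v g := fun g => by
    refine and_congr ?_ (and_congr Iff.rfl (forall₂_congr fun φ _ => ?_))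
    · exact ⟨fun H => H.mono (H.aestronglyMeasurable.congr e) (e.mono fun x hx => by rw [hx]),
        fun H => H.mono (H.aestronglyMeasurable.congr e.symm) (e.mono fun x hx => by rw [hx])⟩
    · rw [integral_congr_ae (e.mono fun x hx => by simp only [hx] :
        (fun x => u x * ∂_ i φ x) =ᵐ[volume] fun x => v x * ∂_ i φ x)]
  have e2 : HasWeakPartial i u = HasWeakPartial i v := funext fun g => propext (this g)
  unfold weakPartial
  rw [e2]

theorem gradPi_congr_ae {u v : Plane → Plane} (e : u =ᵐ[volume] v) :
    gradPi θ u u = gradPi θ v v := by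
  have c : ∀ j, (fun z => u z j) =ᵐ[volume] fun z => v z j := fun j =>
    e.mono fun z hz => by simp only [hz]
  ext x i
  simp only [gradPi, weakPartial_congr_ae (c _)]
  congr 1
  refine Finset.sum_congr rfl fun j _ => Finset.sum_congr rfl fun k _ => ?_
  exact congrFun (conv_congr_ae (e.mono fun z hz => by simp only [hz])) x

/-- The source of the pressure, in terms of the representatives of the weak gradient. -/
def gradProd (f : Plane → Plane) (y : Plane) : ℝ := ∑ j, ∑ k, weakGrad j k f y * weakGrad k j f y

theorem IsField.locallyIntegrable_gradProd (H : IsField f w W) (hc : Continuous f) :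
    LocallyIntegrable (gradProd f) volume := by
  refine locallyIntegrable_of_ball fun R => ?_
  have I : ∀ j k, Integrable (fun y => weakGrad j k f y * weakGrad k j f y)
      (volume.restrict (ball 0 R)) := fun j k =>
    (H.memLp_weakGrad hc R j k).integrable_mul (H.memLp_weakGrad hc R k j)
  exact integrable_finsetSum _ fun j _ => integrable_finsetSum _ fun k _ => I j k

theorem IsField.gradPi_apply (H : IsField f w W) (hc : Continuous f) (i : Fin 2) (x : Plane) :
    gradPi θ f f x i = conv (nearKernel θ i) (gradProd f) x
      + ∑ j, ∑ k, conv (farKernel θ i j k) (fun y => f y j * f y k) x := by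
  have e : (fun y => ∑ j, ∑ k, weakPartial j (fun z => f z k) y * weakPartial k (fun z => f z j) y)
      =ᵐ[volume] gradProd f := by
    have a : ∀ᵐ y, ∀ j k, weakPartial j (fun z => f z k) y = weakGrad j k f y := by
      rw [ae_all_iff]; intro j
      rw [ae_all_iff]; intro k
      exact H.weakPartial_ae_eq hc j k
    filter_upwards [a] with y hy
    simp only [gradProd, hy]
  simp only [gradPi]
  rw [conv_congr_ae e]

theorem IsField.integrable_near (H : IsField f w W) (hc : Continuous f) (hθ : IsCutoff θ)
    (i : Fin 2) (hh : IsTest h) :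
    Integrable (fun p : Plane × Plane => h p.1 * (nearKernel θ i (p.1 - p.2) * gradProd f p.2))
      (volume.prod volume) :=
  integrable_prod_of_integrable_kernel (integrable_nearKernel hθ i)
    ((subset_tsupport _).trans (tsupport_nearKernel hθ i)) (H.locallyIntegrable_gradProd hc) hh

theorem FarIntegrable.integrable_far (hf : FarIntegrable f) (hc : Continuous f) (hθ : IsCutoff θ)
    (i j k : Fin 2) (hh : IsTest h) :
    Integrable (fun p : Plane × Plane => h p.1 * (farKernel θ i j k (p.1 - p.2)
      * (f p.2 j * f p.2 k))) (volume.prod volume) := by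
  obtain ⟨C, -, hC⟩ := exists_abs_farKernel_le hθ i j k
  exact integrable_prod_of_farWeight (g := fun y => f y j * f y k)
    (contDiff_farKernel hθ i j k).continuous hC (hf.coord hc j k) hh

theorem IsField.locallyIntegrable_gradPi (H : IsField f w W) (hc : Continuous f)
    (hf : FarIntegrable f) (hθ : IsCutoff θ) (i : Fin 2) :
    LocallyIntegrable (fun x => gradPi θ f f x i) volume := by
  simp only [H.gradPi_apply hc]
  refine (locallyIntegrable_conv fun h hh => H.integrable_near hc hθ i hh).add ?_
  refine locallyIntegrable_finsetSum _ fun j _ => locallyIntegrable_finsetSum _ fun k _ => ?_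
  exact locallyIntegrable_conv (g := fun y => f y j * f y k) fun h hh => hf.integrable_far hc hθ i j k hh

theorem FarIntegrable.integrable_mul_corr (hf : FarIntegrable f) (hc : Continuous f)
    (hθ : IsCutoff θ) (i j k : Fin 2) (hh : IsTest h) :
    Integrable fun y => f y j * f y k
      * corr (regKern 0 i) (∂_ j (∂_ k h)) y := by
  have hl : logConst ≠ 0 := by
    have := Real.pi_pos
    simp [logConst, this.ne']
  have t := isTest_corr_nearKernel hθ i ((hh.partialDeriv k).partialDeriv j)
  have i1 : Integrable fun y => f y j * f y k
      * corr (nearKernel θ i) (∂_ j (∂_ k h)) y :=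
    (((Continuous.coord hc j).mul (Continuous.coord hc k)).mul t.continuous
      ).integrable_of_hasCompactSupport t.2.mul_left
  have i2 := integrable_corr_mul (g := fun y => f y j * f y k) (hf.integrable_far hc hθ i j k hh)
  refine ((i1.add i2).const_mul logConst⁻¹).congr (Eventually.of_forall fun y => ?_)
  have := corr_nearKernel_add_farKernel hθ i j k hh y
  simp only [Pi.add_apply]
  rw [mul_comm (corr _ _ _), ← mul_add, this]
  field_simp

theorem FarIntegrable.integrable_pressKer (hf : FarIntegrable f) (hc : Continuous f)
    (hθ : IsCutoff θ) (i : Fin 2) (hh : IsTest h) : Integrable (pressKer i h f) :=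
  integrable_finsetSum _ fun j _ => integrable_finsetSum _ fun k _ =>
    hf.integrable_mul_corr hc hθ i j k hh

/-- In the near term the product of gradients is tested with a smooth compactly supported
correlation, so `integral_weakGrad_product` turns it into `u ⊗ u` against second derivatives. It
then has the same form as the far term, and the two kernels recombine. -/
theorem IsField.integral_gradPi_mul (H : IsField f w W) (hc : Continuous f)
    (hf : FarIntegrable f) (hθ : IsCutoff θ) (i : Fin 2) (hh : IsTest h) :
    ∫ x, h x * gradPi θ f f x i = pressForm i h f := by
  have t := fun j k => isTest_corr_nearKernel hθ i ((hh.partialDeriv k).partialDeriv j)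
  have i1 : ∀ j k, Integrable fun y => f y j * f y k
      * corr (nearKernel θ i) (∂_ j (∂_ k h)) y := fun j k =>
    (((Continuous.coord hc j).mul (Continuous.coord hc k)).mul (t j k).continuous
      ).integrable_of_hasCompactSupport (t j k).2.mul_left
  have i2 := fun j k => integrable_corr_mul (g := fun y => f y j * f y k) (hf.integrable_far hc hθ i j k hh)
  have I1 := integrable_mul_conv (H.integrable_near hc hθ i hh)
  have I2 := fun j k => integrable_mul_conv (g := fun y => f y j * f y k) (hf.integrable_far hc hθ i j k hh)
  have e : (fun x => h x * gradPi θ f f x i) = fun x => h x * conv (nearKernel θ i) (gradProd f) x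
      + ∑ j, ∑ k, h x * conv (farKernel θ i j k) (fun y => f y j * f y k) x := by
    ext x
    rw [H.gradPi_apply hc, mul_add, Finset.mul_sum]
    simp only [Finset.mul_sum]
  rw [e, integral_add I1 (integrable_finsetSum _ fun j _ => integrable_finsetSum _ fun k _ => I2 j k),
    integral_finsetSum _ (fun j _ => integrable_finsetSum _ fun k _ => I2 j k)]
  simp only [integral_finsetSum _ (fun k _ => I2 _ k)]
  rw [integral_mul_conv_eq_corr (H.integrable_near hc hθ i hh)]
  have far : ∀ j k, ∫ x, h x * conv (farKernel θ i j k) (fun y => f y j * f y k) x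
      = ∫ y, corr (farKernel θ i j k) h y * (f y j * f y k) := fun j k =>
    integral_mul_conv_eq_corr (hf.integrable_far hc hθ i j k hh)
  simp only [far]
  have P := H.integral_weakGrad_product hc (isTest_corr_nearKernel hθ i hh)
  have P' : ∫ y, corr (nearKernel θ i) h y * gradProd f y
      = ∑ j, ∑ k, ∫ y, f y j * f y k
        * corr (nearKernel θ i) (∂_ j (∂_ k h)) y := by
    have e1 : ∀ j k y, ∂_ j (∂_ k (corr (nearKernel θ i) h)) y
        = corr (nearKernel θ i) (∂_ j (∂_ k h)) y := fun j k y => by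
      rw [funext (partialDeriv_corr (locallyIntegrable_nearKernel hθ i) hh k),
        partialDeriv_corr (locallyIntegrable_nearKernel hθ i) (hh.partialDeriv k)]
    simp only [e1] at P
    rw [integral_finsetSum _ (fun j _ => integrable_finsetSum _ fun k _ => i1 j k)] at P
    simp only [integral_finsetSum _ (fun k _ => i1 _ k)] at P
    rw [← P]
    refine integral_congr_ae (Eventually.of_forall fun y => ?_)
    simp only [gradProd, mul_comm]
  rw [P', ← Finset.sum_add_distrib]
  have e3 : ∀ j, (∑ k, ∫ y, f y j * f y k * corr (nearKernel θ i) (∂_ j (∂_ k h)) y)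
      + ∑ k, ∫ y, corr (farKernel θ i j k) h y * (f y j * f y k)
      = ∑ k, ∫ y, logConst * (f y j * f y k
        * corr (regKern 0 i) (∂_ j (∂_ k h)) y) := fun j => by
    rw [← Finset.sum_add_distrib]
    refine Finset.sum_congr rfl fun k _ => ?_
    rw [← integral_add (i1 j k) (i2 j k)]
    refine integral_congr_ae (Eventually.of_forall fun y => ?_)
    have := corr_nearKernel_add_farKernel hθ i j k hh y
    simp only
    linear_combination (f y j * f y k) * this
  simp only [e3, integral_const_mul, ← Finset.mul_sum]
  rw [pressForm]
  congr 1
  simp only [pressKer]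
  rw [integral_finsetSum _ (fun j _ => integrable_finsetSum _ fun k _ =>
    hf.integrable_mul_corr hc hθ i j k hh)]
  refine Finset.sum_congr rfl fun j _ => ?_
  rw [integral_finsetSum _ fun k _ => hf.integrable_mul_corr hc hθ i j k hh]

end Representation

/-! ### Bounds for the work of the pressure. -/

section PressureBound

variable {θ : Plane → ℝ} {f : Plane → Plane} {h₀ h₁ : Plane → ℝ}

theorem isTest_div (t₀ : IsTest h₀) (t₁ : IsTest h₁) :
    IsTest fun x => ∂_ 0 h₀ x + ∂_ 1 h₁ x :=
  (t₀.partialDeriv 0).add (t₁.partialDeriv 1)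

/-- Exchanging the kernel index with the derivative index moves the summed index onto the test
field, where it forms the divergence. The pressure does no work on divergence-free fields, and on a
cut-off velocity it only sees the gradient of the cut-off. -/
theorem corr_regKern_sum (t₀ : IsTest h₀) (t₁ : IsTest h₁) (j k : Fin 2) (y : Plane) :
    corr (regKern 0 0) (∂_ j (∂_ k h₀)) y
      + corr (regKern 0 1) (∂_ j (∂_ k h₁)) y
      = ∂_ j (corr (regKern 0 k) fun x => ∂_ 0 h₀ x + ∂_ 1 h₁ x) y := by
  have swap : ∀ {h : Plane → ℝ}, IsTest h → ∀ i, corr (regKern 0 i) (∂_ j (∂_ k h)) y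
      = corr (regKern 0 k) (∂_ j (∂_ i h)) y := by
    intro h t i
    rw [funext (partialDeriv_comm j k t.1), corr_regKern_comm (t.partialDeriv j) i k,
      funext (partialDeriv_comm i j t.1)]
  rw [swap t₀, swap t₁, partialDeriv_corr (logKern_locInt k) (isTest_div t₀ t₁), ← corr_add
    (logKern_locInt k) ((t₀.partialDeriv 0).partialDeriv j) ((t₁.partialDeriv 1).partialDeriv j)]
  congr 1
  ext x
  rw [partialDeriv_add j ((t₀.partialDeriv 0).1.differentiable (by simp)).differentiableAt
    ((t₁.partialDeriv 1).1.differentiable (by simp)).differentiableAt]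

theorem pressKer_add (t₀ : IsTest h₀) (t₁ : IsTest h₁) (y : Plane) :
    pressKer 0 h₀ f y + pressKer 1 h₁ f y = ∑ j, ∑ k, f y j * f y k
      * ∂_ j (corr (regKern 0 k) fun x => ∂_ 0 h₀ x + ∂_ 1 h₁ x) y := by
  simp only [pressKer, ← Finset.sum_add_distrib, ← mul_add, corr_regKern_sum t₀ t₁]

theorem pressForm_of_div_eq_zero (hf : FarIntegrable f) (hc : Continuous f) (hθ : IsCutoff θ)
    (t₀ : IsTest h₀) (t₁ : IsTest h₁) (hdiv : ∀ x, ∂_ 0 h₀ x + ∂_ 1 h₁ x = 0) :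
    pressForm 0 h₀ f + pressForm 1 h₁ f = 0 := by
  rw [pressForm, pressForm, ← mul_add, ← integral_add (hf.integrable_pressKer hc hθ 0 t₀)
    (hf.integrable_pressKer hc hθ 1 t₁)]
  have z : ∀ k, (corr (regKern 0 k) fun _ : Plane => (0 : ℝ)) = fun _ => 0 := fun k => by
    ext y; simp [corr]
  simp only [pressKer_add t₀ t₁, hdiv, z, partialDeriv_fun_const, mul_zero, Finset.sum_const_zero,
    integral_zero]

/-- Within radius `2ρ` the Cauchy-Schwarz inequality is combined with the `L²` bound for the
derivatives of the logarithmic potential of the divergence. Beyond it the third-order decay of the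
kernel is used with the `L¹` norms of the test functions. The number `448 = 4 * 112` counts the four
pairs of indices. -/
theorem abs_pressForm_le {ρ : ℝ} (hf : FarIntegrable f) (hc : Continuous f)
    (hθ : IsCutoff θ) (hρ : 0 < ρ) (t₀ : IsTest h₀) (t₁ : IsTest h₁)
    (s₀ : Function.support h₀ ⊆ ball 0 ρ) (s₁ : Function.support h₁ ⊆ ball 0 ρ) :
    |pressForm 0 h₀ f + pressForm 1 h₁ f| ≤ (448 + 4 * √(2 * logMass ^ 2))
      * (√(∫ y in ball 0 (2 * ρ), ‖f y‖ ^ 4)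
          * √(∫ x, (∂_ 0 h₀ x + ∂_ 1 h₁ x) ^ 2)
        + ((∫ x, |h₀ x|) + ∫ x, |h₁ x|) * ∫ y in (ball 0 (2 * ρ))ᶜ, ‖f y‖ ^ 2 * (‖y‖ ^ 3)⁻¹) := by
  set g : Plane → ℝ := fun x => ∂_ 0 h₀ x + ∂_ 1 h₁ x with hg
  have tg : IsTest g := isTest_div t₀ t₁
  set D : Fin 2 → Fin 2 → Plane → ℝ := fun j k => ∂_ j (corr (regKern 0 k) g) with hD
  set B := ball (0 : Plane) (2 * ρ) with hB
  set N := (∫ x, |h₀ x|) + ∫ x, |h₁ x| with hN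
  have hN0 : 0 ≤ N := add_nonneg (integral_nonneg fun _ => abs_nonneg _)
    (integral_nonneg fun _ => abs_nonneg _)
  set G := ∫ x, g x ^ 2 with hG
  set Q := ∫ y in B, ‖f y‖ ^ 4 with hQ
  set Z := ∫ y in Bᶜ, ‖f y‖ ^ 2 * (‖y‖ ^ 3)⁻¹ with hZ
  have hZ0 : 0 ≤ Z := integral_nonneg fun _ => by positivity
  have cD : ∀ j k, Continuous (D j k) := fun j k =>
    continuous_partialDeriv j (contDiff_one (contDiff_corr (logKern_locInt k) tg))
  have hK := (hf.integrable_pressKer hc hθ 0 t₀).fun_add (hf.integrable_pressKer hc hθ 1 t₁)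
  have hKe : ∀ y, pressKer 0 h₀ f y + pressKer 1 h₁ f y = ∑ j, ∑ k, f y j * f y k * D j k y :=
    fun y => pressKer_add t₀ t₁ y
  have e : pressForm 0 h₀ f + pressForm 1 h₁ f
      = logConst * ∫ y, (pressKer 0 h₀ f y + pressKer 1 h₁ f y) := by
    rw [pressForm, pressForm, ← mul_add, ← integral_add (hf.integrable_pressKer hc hθ 0 t₀)
      (hf.integrable_pressKer hc hθ 1 t₁)]
  have near : |∫ y in B, (pressKer 0 h₀ f y + pressKer 1 h₁ f y)|
      ≤ 4 * √(2 * logMass ^ 2) * (√Q * √G) := by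
    have cF : ∀ j k, Continuous fun y => f y j * f y k := fun j k =>
      (Continuous.coord hc j).mul (Continuous.coord hc k)
    have I : ∀ j k, Integrable (fun y => f y j * f y k * D j k y) (volume.restrict B) := fun j k =>
      Continuous.integrableOn_ball ((cF j k).mul (cD j k)) 0 _
    simp only [hKe]
    rw [integral_finsetSum _ fun j _ => integrable_finsetSum _ fun k _ => I j k]
    simp only [integral_finsetSum _ fun k _ => I _ k]
    have b : ∀ j k, |∫ y in B, f y j * f y k * D j k y| ≤ √(2 * logMass ^ 2) * (√Q * √G) := by
      intro j k
      refine (abs_integral_mul_le (memLp_two_ball (cF j k) 0 _)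
        (memLp_two_ball (cD j k) 0 _)).trans ?_
      have q1 : ∫ y in B, (f y j * f y k) ^ 2 ≤ Q := by
        refine setIntegral_mono (Continuous.integrableOn_ball ((cF j k).pow 2) 0 _)
          (Continuous.integrableOn_ball (hc.norm.pow 4) 0 _) fun y => ?_
        have := abs_coord_mul_le (f y) j k
        calc (f y j * f y k) ^ 2 = |f y j * f y k| ^ 2 := (sq_abs _).symm
          _ ≤ (‖f y‖ ^ 2) ^ 2 := by gcongr
          _ = ‖f y‖ ^ 4 := by ring
      have q2 : ∫ y in B, D j k y ^ 2 ≤ 2 * logMass ^ 2 * G := by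
        refine le_trans ?_ (integral_ball_grad_corr_le tg (2 * ρ))
        have c00 := cD 0 0; have c01 := cD 0 1; have c10 := cD 1 0; have c11 := cD 1 1
        refine setIntegral_mono (Continuous.integrableOn_ball ((cD j k).pow 2) 0 _)
          (Continuous.integrableOn_ball ((((c00.pow 2).add (c10.pow 2)).add (c01.pow 2)).add
            (c11.pow 2)) 0 _) fun y => ?_
        fin_cases j <;> fin_cases k <;> simp only [hD] <;> simp <;> nlinarith [sq_nonneg (D 0 0 y), sq_nonneg (D 0 1 y), sq_nonneg (D 1 0 y), sq_nonneg (D 1 1 y)]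
      calc _ ≤ √Q * √(2 * logMass ^ 2 * G) := by gcongr
        _ = _ := by rw [Real.sqrt_mul (by positivity)]; ring
    simp only [Fin.sum_univ_two]
    have a00 := abs_le.1 (b 0 0)
    have a01 := abs_le.1 (b 0 1)
    have a10 := abs_le.1 (b 1 0)
    have a11 := abs_le.1 (b 1 1)
    rw [abs_le]
    constructor <;> linarith [a00.1, a01.1, a10.1, a11.1, a00.2, a01.2, a10.2, a11.2]
  have far : |∫ y in Bᶜ, (pressKer 0 h₀ f y + pressKer 1 h₁ f y)| ≤ 448 * (N * Z) := by
    have hw : ∀ y ∈ Bᶜ, (‖y‖ ^ 3)⁻¹ ≤ (1 + (2 * ρ)⁻¹) ^ 3 * farWeight y := by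
      intro y hy
      have hy' : 2 * ρ ≤ ‖y‖ := by simpa [hB] using hy
      have : 0 < ‖y‖ := by linarith
      rw [farWeight, ← div_eq_mul_inv, inv_eq_one_div, div_le_div_iff₀ (by positivity)
        (by positivity), one_mul, ← mul_pow]
      have : 1 ≤ (2 * ρ)⁻¹ * ‖y‖ := by
        rw [inv_mul_eq_div, one_le_div (by positivity)]; exact hy'
      gcongr
      linarith
    have iZ : IntegrableOn (fun y => ‖f y‖ ^ 2 * (‖y‖ ^ 3)⁻¹) Bᶜ := by
      refine Integrable.mono' ((Integrable.const_mul hf ((1 + (2 * ρ)⁻¹) ^ 3)).integrableOn (s := Bᶜ)) ?_ ?_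
      · have := hc.measurable
        exact (by fun_prop : Measurable fun y => ‖f y‖ ^ 2 * (‖y‖ ^ 3)⁻¹).aestronglyMeasurable
      · refine (ae_restrict_iff' measurableSet_ball.compl).2 (Eventually.of_forall fun y hy => ?_)
        rw [Real.norm_of_nonneg (by positivity)]
        calc _ ≤ ‖f y‖ ^ 2 * ((1 + (2 * ρ)⁻¹) ^ 3 * farWeight y) := by
              gcongr; exact hw y hy
          _ = _ := by ring
    have : 448 * (N * Z) = ∫ y in Bᶜ, 448 * N * (‖f y‖ ^ 2 * (‖y‖ ^ 3)⁻¹) := by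
      rw [integral_const_mul]; ring
    rw [this, ← Real.norm_eq_abs]
    refine norm_integral_le_of_norm_le (iZ.const_mul _)
      ((ae_restrict_iff' measurableSet_ball.compl).2 (Eventually.of_forall fun y hy => ?_))
    have hy' : 2 * ρ ≤ ‖y‖ := by simpa [hB] using hy
    rw [hKe, Real.norm_eq_abs]
    have b : ∀ j k, |f y j * f y k * D j k y| ≤ ‖f y‖ ^ 2 * (112 * (‖y‖ ^ 3)⁻¹ * N) := by
      intro j k
      rw [abs_mul]
      have : |D j k y| ≤ 112 * (‖y‖ ^ 3)⁻¹ * N := by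
        simp only [hD, hg]
        rw [← corr_regKern_sum t₀ t₁, hN, mul_add]
        exact (abs_add_le _ _).trans (add_le_add
          (abs_corr_regKern_partialDeriv_le hρ t₀ s₀ 0 j k hy')
          (abs_corr_regKern_partialDeriv_le hρ t₁ s₁ 1 j k hy'))
      exact mul_le_mul (abs_coord_mul_le _ _ _) this (abs_nonneg _) (by positivity)
    simp only [Fin.sum_univ_two]
    have a00 := abs_le.1 (b 0 0)
    have a01 := abs_le.1 (b 0 1)
    have a10 := abs_le.1 (b 1 0)
    have a11 := abs_le.1 (b 1 1)
    have e : 448 * N * (‖f y‖ ^ 2 * (‖y‖ ^ 3)⁻¹) = 4 * (‖f y‖ ^ 2 * (112 * (‖y‖ ^ 3)⁻¹ * N)) := by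
      ring
    rw [e, abs_le]
    constructor <;> linarith [a00.1, a01.1, a10.1, a11.1, a00.2, a01.2, a10.2, a11.2]
  rw [e, abs_mul, ← integral_add_compl measurableSet_ball hK]
  have hl := abs_logConst_le
  have h1 := (abs_add_le _ _).trans (add_le_add near far)
  calc _ ≤ 1 * (4 * √(2 * logMass ^ 2) * (√Q * √G) + 448 * (N * Z)) := by gcongr
    _ ≤ _ := by
      have p1 : 0 ≤ √Q * √G := by positivity
      have p2 : 0 ≤ √(2 * logMass ^ 2) * (N * Z) := by positivity
      nlinarith

end PressureBound

/-- The energy of a field in the ball of radius `r` around the origin. -/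
def energy (f : Plane → Plane) (r : ℝ) : ℝ := ∫ x in ball 0 r, ‖f x‖ ^ 2

/-- The growth bound `‖f‖_{L²(B_r)} ≤ N r ^ (1 + α)` for all radii `r ≥ R`. -/
def EnergyBound (α N R : ℝ) (f : Plane → Plane) : Prop :=
  ∀ r, R ≤ r → energy f r ≤ (N * r ^ (1 + α)) ^ 2

/-! ### Growth bounds for the energy, far integrals, and the Morrey norm. -/

section Energy

variable {f : Plane → Plane} {α N R ρ : ℝ}

theorem energy_nonneg (f : Plane → Plane) (r : ℝ) : 0 ≤ energy f r :=
  integral_nonneg fun _ => by positivity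

theorem energy_mono (hc : Continuous f) {r r' : ℝ} (h : r ≤ r') : energy f r ≤ energy f r' :=
  setIntegral_mono_set (Continuous.integrableOn_ball (hc.norm.pow 2) 0 _)
    (Eventually.of_forall fun x => by simp only [Pi.zero_apply]; positivity)
    (ball_subset_ball h).eventuallyLE

theorem energy_congr_ae {g : Plane → Plane} (e : f =ᵐ[volume] g) (r : ℝ) :
    energy f r = energy g r :=
  integral_congr_ae (ae_restrict_of_ae (e.mono fun x hx => by simp only [hx]))

theorem EnergyBound.mono {R' N' : ℝ} (h : EnergyBound α N R f) (hN : 0 ≤ N) (hNN : N ≤ N')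
    (hR : R ≤ R') (hR0 : 0 ≤ R') : EnergyBound α N' R' f := fun r hr => by
  have : 0 ≤ r := hR0.trans hr
  refine (h r (hR.trans hr)).trans ?_
  gcongr

/-- Bernoulli's inequality for exponents in `[0, 1]`. It bounds the sum of the geometric series
below by a multiple of `1 / (1 - 2α)`, the only source of that quantity. -/
theorem one_sub_half_rpow {x : ℝ} (h0 : 0 < x) (h1 : x ≤ 1) : x / 2 ≤ 1 - (1 / 2 : ℝ) ^ x := by
  have := rpow_one_add_le_one_add_mul_self (s := (-1 / 2 : ℝ)) (by norm_num) h0.le h1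
  norm_num at this
  norm_num
  linarith

/-- The exterior is split into the annuli between the radii `2^k ρ`. The `k`-th one contributes a
multiple of `ρ^(2α-1) q^k` with `q = 2^(-(1-2α))`, which is summable exactly because `α < 1/2`.
Lower integrals yield integrability together with the value. -/
theorem lintegral_far_le (hc : Continuous f) (hα : 0 ≤ α) (hα' : α < 1 / 2)
    (h : EnergyBound α N R f) (hR : 0 < R) (hρ : R ≤ ρ) :
    ∫⁻ y in (ball 0 ρ)ᶜ, ENNReal.ofReal (‖f y‖ ^ 2 * (‖y‖ ^ 3)⁻¹)
      ≤ ENNReal.ofReal (16 * (1 / (1 - 2 * α)) * N ^ 2 * ρ ^ (2 * α - 1)) := by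
  have hρ0 : 0 < ρ := hR.trans_le hρ
  set a : ℕ → ℝ := fun k => 2 ^ k * ρ with ha
  have ha0 : ∀ k, 0 < a k := fun k => by positivity
  set S : ℕ → Set Plane := fun k => ball 0 (a (k + 1)) \ ball 0 (a k) with hS
  set q : ℝ := (1 / 2 : ℝ) ^ (1 - 2 * α) with hq
  have hq0 : 0 ≤ q := by positivity
  have hq1 : (1 - 2 * α) / 2 ≤ 1 - q := one_sub_half_rpow (by linarith) (by linarith)
  set D : ℝ := 8 * N ^ 2 * ρ ^ (2 * α - 1) with hD
  have hcov : (ball (0 : Plane) ρ)ᶜ ⊆ ⋃ k, S k := by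
    intro y hy
    have hy' : ρ ≤ ‖y‖ := by simpa using hy
    obtain ⟨n, hn1, hn2⟩ := exists_nat_pow_near (x := ‖y‖ / ρ) (y := (2 : ℝ))
      ((one_le_div hρ0).2 hy') (by norm_num)
    refine mem_iUnion.2 ⟨n, ?_, ?_⟩
    · rw [div_lt_iff₀ hρ0] at hn2; simpa [ha] using hn2
    · rw [le_div_iff₀ hρ0] at hn1; simpa [ha] using hn1
  have hterm : ∀ k, ∫⁻ y in S k, ENNReal.ofReal (‖f y‖ ^ 2 * (‖y‖ ^ 3)⁻¹)
      ≤ ENNReal.ofReal (D * q ^ k) := by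
    intro k
    have hSm : MeasurableSet (S k) := measurableSet_ball.diff measurableSet_ball
    calc ∫⁻ y in S k, ENNReal.ofReal (‖f y‖ ^ 2 * (‖y‖ ^ 3)⁻¹)
        ≤ ∫⁻ y in S k, ENNReal.ofReal (‖f y‖ ^ 2 * (a k ^ 3)⁻¹) := by
          refine setLIntegral_mono' hSm fun y hy => ?_
          have hy' : a k ≤ ‖y‖ := by simpa using hy.2
          have := ha0 k
          gcongr
      _ ≤ ∫⁻ y in ball 0 (a (k + 1)), ENNReal.ofReal (‖f y‖ ^ 2 * (a k ^ 3)⁻¹) :=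
          lintegral_mono_set sdiff_subset
      _ = ENNReal.ofReal (energy f (a (k + 1)) * (a k ^ 3)⁻¹) := by
          rw [← ofReal_integral_eq_lintegral_ofReal, integral_mul_const, energy]
          · exact (Continuous.integrableOn_ball (hc.norm.pow 2) 0 _).mul_const _
          · exact Eventually.of_forall fun y => by
              have := ha0 k
              simp only [Pi.zero_apply]; positivity
      _ ≤ ENNReal.ofReal (D * q ^ k) := by
          refine ENNReal.ofReal_le_ofReal ?_
          have hak : R ≤ a (k + 1) := hρ.trans (by
            simp only [ha]
            nlinarith [one_le_pow₀ (n := k + 1) (show (1 : ℝ) ≤ 2 by norm_num)])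
          have h1 := h _ hak
          have h2 : a (k + 1) = 2 * a k := by simp only [ha]; ring
          have h3 : a (k + 1) ^ (1 + α) = (2 : ℝ) ^ (1 + α) * a k ^ (1 + α) := by
            rw [h2, Real.mul_rpow (by norm_num) (ha0 k).le]
          have h4 : ((2 : ℝ) ^ (1 + α)) ^ 2 ≤ 8 := by
            rw [← Real.rpow_natCast, ← Real.rpow_mul (by norm_num)]
            calc (2 : ℝ) ^ ((1 + α) * (2 : ℕ)) ≤ 2 ^ (3 : ℝ) :=
                  Real.rpow_le_rpow_of_exponent_le (by norm_num) (by push_cast; linarith)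
              _ = 8 := by norm_num
          have h5 : (a k ^ (1 + α)) ^ 2 * (a k ^ 3)⁻¹ = ρ ^ (2 * α - 1) * q ^ k := by
            have e1 : (a k ^ (1 + α)) ^ 2 * (a k ^ 3)⁻¹ = a k ^ (2 * α - 1) := by
              rw [← Real.rpow_natCast, ← Real.rpow_mul (ha0 k).le, ← Real.rpow_natCast (a k) 3,
                ← Real.rpow_neg (ha0 k).le, ← Real.rpow_add (ha0 k)]
              congr 1; push_cast; ring
            rw [e1]
            simp only [ha, hq]
            rw [Real.mul_rpow (by positivity) hρ0.le, mul_comm]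
            congr 1
            rw [← Real.rpow_natCast, ← Real.rpow_natCast, ← Real.rpow_mul (by norm_num),
              ← Real.rpow_mul (by norm_num), one_div, Real.inv_rpow (by norm_num),
              ← Real.rpow_neg (by norm_num)]
            congr 1; ring
          calc energy f (a (k + 1)) * (a k ^ 3)⁻¹
              ≤ (N * a (k + 1) ^ (1 + α)) ^ 2 * (a k ^ 3)⁻¹ := by
                have := ha0 k
                gcongr
            _ = ((2 : ℝ) ^ (1 + α)) ^ 2 * N ^ 2 * ((a k ^ (1 + α)) ^ 2 * (a k ^ 3)⁻¹) := by
                rw [h3]; ring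
            _ ≤ 8 * N ^ 2 * (ρ ^ (2 * α - 1) * q ^ k) := by rw [h5]; gcongr
            _ = D * q ^ k := by rw [hD]; ring
  have hD0 : 0 ≤ D := by positivity
  have hql : q < 1 := by linarith
  have hx : 0 < 1 - 2 * α := by linarith
  calc _ ≤ ∫⁻ y in ⋃ k, S k, ENNReal.ofReal (‖f y‖ ^ 2 * (‖y‖ ^ 3)⁻¹) := lintegral_mono_set hcov
    _ ≤ ∑' k, ∫⁻ y in S k, ENNReal.ofReal (‖f y‖ ^ 2 * (‖y‖ ^ 3)⁻¹) := lintegral_iUnion_le _ _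
    _ ≤ ∑' k, ENNReal.ofReal (D * q ^ k) := ENNReal.tsum_le_tsum hterm
    _ = ENNReal.ofReal (∑' k, D * q ^ k) := (ENNReal.ofReal_tsum_of_nonneg
        (fun k => by positivity) ((summable_geometric_of_lt_one hq0 hql).mul_left D)).symm
    _ ≤ _ := by
        rw [tsum_mul_left, tsum_geometric_of_lt_one hq0 hql]
        refine ENNReal.ofReal_le_ofReal ?_
        have : (1 - q)⁻¹ ≤ 2 * (1 / (1 - 2 * α)) := by
          rw [show 2 * (1 / (1 - 2 * α)) = ((1 - 2 * α) / 2)⁻¹ by field_simp]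
          exact inv_anti₀ (by linarith) hq1
        calc D * (1 - q)⁻¹ ≤ D * (2 * (1 / (1 - 2 * α))) := by gcongr
          _ = _ := by rw [hD]; ring

theorem integrableOn_far (hc : Continuous f) (hα : 0 ≤ α) (hα' : α < 1 / 2)
    (h : EnergyBound α N R f) (hR : 0 < R) (hρ : R ≤ ρ) :
    IntegrableOn (fun y => ‖f y‖ ^ 2 * (‖y‖ ^ 3)⁻¹) (ball 0 ρ)ᶜ := by
  have hm := hc.measurable
  refine ⟨(by fun_prop : Measurable _).aestronglyMeasurable, ?_⟩
  rw [hasFiniteIntegral_iff_ofReal (Eventually.of_forall fun y => by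
    simp only [Pi.zero_apply]; positivity)]
  exact (lintegral_far_le hc hα hα' h hR hρ).trans_lt ENNReal.ofReal_lt_top

theorem integral_far_le (hc : Continuous f) (hα : 0 ≤ α) (hα' : α < 1 / 2)
    (h : EnergyBound α N R f) (hR : 0 < R) (hρ : R ≤ ρ) :
    ∫ y in (ball 0 ρ)ᶜ, ‖f y‖ ^ 2 * (‖y‖ ^ 3)⁻¹
      ≤ 16 * (1 / (1 - 2 * α)) * N ^ 2 * ρ ^ (2 * α - 1) := by
  have hρ0 : 0 < ρ := hR.trans_le hρ
  have : 0 < 1 - 2 * α := by linarith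
  rw [← ENNReal.ofReal_le_ofReal_iff (by positivity), ofReal_integral_eq_lintegral_ofReal
    (integrableOn_far hc hα hα' h hR hρ) (Eventually.of_forall fun y => by
    simp only [Pi.zero_apply]; positivity)]
  exact lintegral_far_le hc hα hα' h hR hρ

theorem EnergyBound.farIntegrable (hc : Continuous f) (hα : 0 ≤ α) (hα' : α < 1 / 2)
    (h : EnergyBound α N R f) (hR : 0 < R) : FarIntegrable f := by
  have cw : Continuous farWeight := by
    unfold farWeight
    exact (by fun_prop : Continuous fun x : Plane => (1 + ‖x‖) ^ 3).inv₀ fun x => by positivity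
  have c : Continuous fun y => ‖f y‖ ^ 2 * farWeight y := (hc.norm.pow 2).mul cw
  have h1 : IntegrableOn (fun y => ‖f y‖ ^ 2 * farWeight y) (ball 0 R) :=
    Continuous.integrableOn_ball c 0 R
  have h2 : IntegrableOn (fun y => ‖f y‖ ^ 2 * farWeight y) (ball 0 R)ᶜ := by
    refine (integrableOn_far hc hα hα' h hR le_rfl).mono' c.aestronglyMeasurable
      ((ae_restrict_iff' measurableSet_ball.compl).2 (Eventually.of_forall fun y hy => ?_))
    have hy' : R ≤ ‖y‖ := by simpa using hy
    have : 0 < ‖y‖ := hR.trans_le hy'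
    rw [Real.norm_of_nonneg (mul_nonneg (by positivity) (farWeight_pos y).le), farWeight]
    gcongr
    linarith
  rw [FarIntegrable, ← integrableOn_univ, ← union_compl_self (ball (0 : Plane) R)]
  exact h1.union h2

theorem energy_eq_eLpNorm {r : ℝ} (hf : MemLp f 2 (volume.restrict (ball 0 r))) :
    eLpNorm f 2 (volume.restrict (ball 0 r)) = ENNReal.ofReal √(energy f r) := by
  rw [hf.eLpNorm_eq_integral_rpow_norm (by norm_num) (by norm_num)]
  simp only [ENNReal.toReal_ofNat, Real.rpow_ofNat, energy]
  rw [Real.sqrt_eq_rpow, one_div]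

theorem morreyNorm_le (hN : 0 ≤ N)
    (hf : ∀ r, MemLp f 2 (volume.restrict (ball 0 r))) (h : EnergyBound α N 1 f) :
    morreyNorm α f ≤ ENNReal.ofReal N := by
  refine iSup₂_le fun r hr => ?_
  have hr0 : 0 < r := by linarith
  rw [energy_eq_eLpNorm (hf r), ← ENNReal.ofReal_mul (by positivity)]
  refine ENNReal.ofReal_le_ofReal ?_
  have h1 : √(energy f r) ≤ N * r ^ (1 + α) :=
    Real.sqrt_le_iff.2 ⟨by positivity, h r hr⟩
  rw [Real.rpow_neg hr0.le, inv_mul_le_iff₀ (by positivity), mul_comm]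
  exact h1

theorem eLpNorm_ball_le_morreyNorm {r : ℝ} (hr : 1 ≤ r) (f : Plane → Plane) :
    eLpNorm f 2 (volume.restrict (ball 0 r))
      ≤ ENNReal.ofReal (r ^ (1 + α)) * morreyNorm α f := by
  have hr0 : 0 < r := by linarith
  have h1 : ENNReal.ofReal (r ^ (-(1 + α))) * eLpNorm f 2 (volume.restrict (ball 0 r))
      ≤ morreyNorm α f :=
    le_iSup₂ (f := fun (r : ℝ) (_ : 1 ≤ r) => ENNReal.ofReal (r ^ (-(1 + α))) * eLpNorm f 2
      (volume.restrict (ball 0 r))) r hr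
  calc eLpNorm f 2 (volume.restrict (ball 0 r))
      = ENNReal.ofReal (r ^ (1 + α)) * (ENNReal.ofReal (r ^ (-(1 + α)))
        * eLpNorm f 2 (volume.restrict (ball 0 r))) := by
        rw [← mul_assoc, ← ENNReal.ofReal_mul (by positivity), ← Real.rpow_add hr0]
        simp
    _ ≤ _ := by gcongr

theorem memLp_ball_of_morreyNorm (hm : AEStronglyMeasurable f volume) (h : morreyNorm α f < ⊤)
    (r : ℝ) : MemLp f 2 (volume.restrict (ball 0 r)) := by
  have h1 : MemLp f 2 (volume.restrict (ball 0 (max r 1))) :=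
    ⟨hm.restrict, (eLpNorm_ball_le_morreyNorm (α := α) (le_max_right r 1) f).trans_lt
      (ENNReal.mul_lt_top ENNReal.ofReal_lt_top h)⟩
  exact h1.mono_measure (Measure.restrict_mono (ball_subset_ball (le_max_left _ _)) le_rfl)

theorem energyBound_of_morreyNorm (hm : AEStronglyMeasurable f volume) (hN : 0 ≤ N)
    (h : morreyNorm α f ≤ ENNReal.ofReal N) : EnergyBound α N 1 f := by
  intro r hr
  have hr0 : 0 < r := by linarith
  have h1 := eLpNorm_ball_le_morreyNorm (α := α) hr f
  rw [energy_eq_eLpNorm (memLp_ball_of_morreyNorm hm (h.trans_lt ENNReal.ofReal_lt_top) r)] at h1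
  have h2 := h1.trans (mul_le_mul_right h _)
  rw [← ENNReal.ofReal_mul (by positivity), ENNReal.ofReal_le_ofReal_iff (by positivity)] at h2
  have := (Real.sqrt_le_iff.1 h2).2
  rwa [mul_comm] at this

namespace MemYudovich

theorem morreyNorm_lt_top (h : MemYudovich α f) : morreyNorm α f < ⊤ :=
  lt_of_le_of_lt le_add_self h.norm_lt_top

theorem eLpNorm_vorticity_lt_top (h : MemYudovich α f) : eLpNorm (vorticity f) ⊤ volume < ⊤ :=
  lt_of_le_of_lt le_self_add h.norm_lt_top

theorem memLp_ball (h : MemYudovich α f) (r : ℝ) :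
    MemLp f 2 (volume.restrict (ball 0 r)) :=
  memLp_ball_of_morreyNorm h.aestronglyMeasurable h.morreyNorm_lt_top r

theorem locallyIntegrable (h : MemYudovich α f) : LocallyIntegrable f volume := fun x =>
  ⟨ball 0 (‖x‖ + 1), isOpen_ball.mem_nhds (by simp),
    (h.memLp_ball _).integrable (by norm_num)⟩

theorem isWeakCurl_vorticity (h : MemYudovich α f) : IsWeakCurl f (vorticity f) := by
  have : vorticity f = h.exists_curl.choose := by
    unfold vorticity
    rw [dif_pos h.exists_curl]
  rw [this]
  exact h.exists_curl.choose_spec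

theorem isField (h : MemYudovich α f) :
    IsField f (vorticity f) (eLpNorm (vorticity f) ⊤ volume).toReal := by
  refine ⟨h.locallyIntegrable, h.divFree, h.isWeakCurl_vorticity, ?_⟩
  have := ae_le_eLpNormEssSup (f := vorticity f) (μ := volume)
  filter_upwards [this] with x hx
  rw [← eLpNorm_exponent_top] at hx
  have := ENNReal.toReal_mono h.eLpNorm_vorticity_lt_top.ne hx
  simpa using this

end MemYudovich

end Energy

/-! ### Calculus in time for functions that are only measurable and bounded. -/

section TimeCalculus

variable {T K : ℝ} {b : ℝ → ℝ}

theorem intervalIntegrable_of_bounded (hm : StronglyMeasurable b) (hb : ∀ s, |b s| ≤ K) (x y : ℝ) :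
    IntervalIntegrable b volume x y :=
  (intervalIntegrable_const (c := K)).mono_fun hm.aestronglyMeasurable
    (Eventually.of_forall fun s => by
      simpa using (hb s).trans (le_abs_self K))

theorem lipschitzWith_integral (hm : StronglyMeasurable b) (hb : ∀ s, |b s| ≤ K) (hK : 0 ≤ K)
    (c : ℝ) : LipschitzWith K.toNNReal fun t => c + ∫ s in (0 : ℝ)..t, b s := by
  refine LipschitzWith.of_dist_le_mul fun t t' => ?_
  have I := fun x y => intervalIntegrable_of_bounded hm hb x y
  rw [Real.dist_eq, Real.dist_eq, add_sub_add_left_eq_sub,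
    intervalIntegral.integral_interval_sub_left (I _ _) (I _ _), Real.coe_toNNReal K hK]
  rw [← Real.norm_eq_abs]
  exact intervalIntegral.norm_integral_le_of_norm_le_const fun s _ => hb s

/-- The chain rule for the primitive of a bounded function. -/
theorem comp_integral_eq (hm : StronglyMeasurable b) (hb : ∀ s, |b s| ≤ K) {β : ℝ → ℝ}
    (hβ : ContDiff ℝ 1 β) (c t : ℝ) :
    β (c + ∫ s in (0 : ℝ)..t, b s)
      = β c + ∫ s in (0 : ℝ)..t, deriv β (c + ∫ r in (0 : ℝ)..s, b r) * b s := by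
  have hK : 0 ≤ K := (abs_nonneg _).trans (hb 0)
  set F : ℝ → ℝ := fun t => c + ∫ s in (0 : ℝ)..t, b s with hF
  have hL := lipschitzWith_integral hm hb hK c
  obtain ⟨L, hL2⟩ := (hβ.contDiffOn (s := Icc (c - K * |t|) (c + K * |t|))).exists_lipschitzOnWith
    (by simp) (convex_Icc _ _) isCompact_Icc
  have hmaps : MapsTo F (uIcc 0 t) (Icc (c - K * |t|) (c + K * |t|)) := by
    intro s hs
    have h1 : ‖∫ r in (0 : ℝ)..s, b r‖ ≤ K * |s - 0| :=
      intervalIntegral.norm_integral_le_of_norm_le_const fun s _ => hb s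
    have h2 : |s| ≤ |t| := by
      have := abs_sub_left_of_mem_uIcc hs
      simpa using this
    rw [sub_zero, Real.norm_eq_abs] at h1
    have h3 := abs_le.1 (h1.trans (mul_le_mul_of_nonneg_left h2 hK))
    exact ⟨by simp only [hF]; linarith, by simp only [hF]; linarith⟩
  -- The integrand is merely bounded and measurable, so the primitive is differentiable only almost
  -- everywhere. Lipschitz continuity of the composition is what allows its derivative to be
  -- integrated back.
  have hac : AbsolutelyContinuousOnInterval (β ∘ F) 0 t :=
    (hL2.comp hL.lipschitzOnWith hmaps).absolutelyContinuousOnInterval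
  have h1 := hac.integral_deriv_eq_sub
  have h2 : ∫ s in (0 : ℝ)..t, deriv (β ∘ F) s = ∫ s in (0 : ℝ)..t, deriv β (F s) * b s := by
    refine intervalIntegral.integral_congr_ae ?_
    filter_upwards [(intervalIntegrable_of_bounded hm hb 0 t).ae_hasDerivAt_integral] with s hs hs'
    have hd := (hs (uIoc_subset_uIcc hs') 0 (by simp)).const_add c
    exact (((hβ.differentiable (by simp)) (F s)).hasDerivAt.comp s hd).deriv
  rw [h2] at h1
  have h0 : F 0 = c := by simp [hF]
  simp only [Function.comp_apply, h0] at h1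
  linarith

/-- The lemma of du Bois-Reymond, with initial value. -/
theorem ae_eq_add_integral {V D : ℝ → ℝ} {V₀ : ℝ} (hT : 0 < T)
    (hV : IntegrableOn V (Icc 0 T)) (hD : IntervalIntegrable D volume 0 T)
    (H : ∀ a : ℝ → ℝ, ContDiff ℝ ∞ a → HasCompactSupport a → (∀ t, T ≤ t → a t = 0) →
      ∫ t in Icc 0 T, (deriv a t * V t + a t * D t) = -(a 0 * V₀)) :
    ∀ᵐ t ∂volume.restrict (Icc 0 T), V t = V₀ + ∫ s in (0 : ℝ)..t, D s := by
  set P : ℝ → ℝ := fun t => ∫ s in (0 : ℝ)..t, D s with hP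
  have hPac : AbsolutelyContinuousOnInterval P 0 T :=
    hD.absolutelyContinuousOnInterval_intervalIntegral (by simp)
  have hPc : ContinuousOn P (Icc 0 T) := by
    have := hPac.continuousOn
    rwa [uIcc_of_le hT.le] at this
  have hU : IntegrableOn (fun t => V t - V₀ - P t) (Icc 0 T) :=
    (hV.sub (continuousOn_const.integrableOn_Icc)).sub hPc.integrableOn_Icc
  have key : ∀ᵐ t, t ∈ Ioo 0 T → V t - V₀ - P t = 0 := by
    refine isOpen_Ioo.ae_eq_zero_of_integral_contDiff_smul_eq_zero
      ((hU.mono_set Ioo_subset_Icc_self).locallyIntegrableOn) fun b hb hbc hbs => ?_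
    have hb0 : ∀ t, t ∉ Ioo 0 T → b t = 0 := fun t ht =>
      image_eq_zero_of_notMem_tsupport fun h => ht (hbs h)
    -- The primitive is taken from `T`, so that it vanishes after `T` but not at `0`; the value at
    -- `0` brings in the initial datum. The bump `χ` below makes it compactly supported without
    -- changing it near `[0, T]`.
    set B : ℝ → ℝ := fun t => ∫ s in T..t, b s with hB
    have hBd : ∀ t, HasDerivAt B (b t) t := fun t => hb.continuous.integral_hasStrictDerivAt T t |>.hasDerivAt
    have hBs : ContDiff ℝ ∞ B := by
      rw [contDiff_infty_iff_deriv]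
      exact ⟨fun t => (hBd t).differentiableAt, by rwa [funext fun t => (hBd t).deriv]⟩
    let χ : ContDiffBump (0 : ℝ) := ⟨T + 1, T + 2, by linarith, by linarith⟩
    have hχ1 : ∀ t, t ∈ Ioo (-(T + 1)) (T + 1) → χ t = 1 := fun t ht =>
      χ.one_of_mem_closedBall (by
        simp only [mem_closedBall_zero_iff, Real.norm_eq_abs]
        exact abs_le.2 ⟨ht.1.le, ht.2.le⟩)
    have hBT : ∀ t, T ≤ t → B t = 0 := fun t ht => by
      simp only [hB]
      refine intervalIntegral.integral_zero_ae (Eventually.of_forall fun s hs => hb0 s ?_)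
      rw [uIoc_of_le ht] at hs
      exact fun h => absurd hs.1 (not_lt.2 h.2.le)
    have e := H (fun t => χ t * B t) (χ.contDiff.mul hBs) χ.hasCompactSupport.mul_right
      fun t ht => by rw [hBT t ht, mul_zero]
    have da : ∀ t ∈ Icc 0 T, χ t = 1 ∧ deriv (fun t => χ t * B t) t = b t := by
      intro t ht
      have ht' : t ∈ Ioo (-(T + 1)) (T + 1) := ⟨by linarith [ht.1], by linarith [ht.2]⟩
      refine ⟨hχ1 t ht', ?_⟩
      have : (fun t => χ t * B t) =ᶠ[𝓝 t] B := by
        filter_upwards [isOpen_Ioo.mem_nhds ht'] with s hs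
        rw [hχ1 s hs, one_mul]
      rw [this.deriv_eq, (hBd t).deriv]
    have e2 : ∫ t in Icc 0 T, (b t * V t + B t * D t) = -(B 0 * V₀) := by
      rw [← (hχ1 0 ⟨by linarith, by linarith⟩ ▸ one_mul (B 0) : χ 0 * B 0 = B 0), ← e]
      refine setIntegral_congr_fun measurableSet_Icc fun t ht => ?_
      rw [(da t ht).1, (da t ht).2, one_mul]
    have hDI : IntegrableOn D (Icc 0 T) := by
      rw [integrableOn_Icc_iff_integrableOn_Ioc]
      exact (intervalIntegrable_iff_integrableOn_Ioc_of_le hT.le).1 hD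
    have ibV : IntegrableOn (fun t => b t * V t) (Icc 0 T) :=
      hV.continuousOn_mul hb.continuous.continuousOn isCompact_Icc
    have iBD : IntegrableOn (fun t => B t * D t) (Icc 0 T) :=
      hDI.continuousOn_mul hBs.continuous.continuousOn isCompact_Icc
    have ibP : IntegrableOn (fun t => b t * P t) (Icc 0 T) :=
      (hb.continuous.continuousOn.mul hPc).integrableOn_Icc
    rw [integral_add ibV iBD] at e2
    have hBac : AbsolutelyContinuousOnInterval B 0 T :=
      ((hBs.of_le (by simp) : ContDiff ℝ 1 B).contDiffOn).absolutelyContinuousOnInterval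
    have ibp := hBac.integral_mul_deriv_eq_deriv_mul hPac
    have e3 : ∫ t in (0 : ℝ)..T, B t * deriv P t = ∫ t in Icc 0 T, B t * D t := by
      rw [integral_Icc_eq_integral_Ioc, ← intervalIntegral.integral_of_le hT.le]
      refine intervalIntegral.integral_congr_ae ?_
      filter_upwards [hD.ae_hasDerivAt_integral] with s hs hs'
      rw [(hs (uIoc_subset_uIcc hs') 0 (by simp)).deriv]
    have e4 : ∫ t in (0 : ℝ)..T, deriv B t * P t = ∫ t in Icc 0 T, b t * P t := by
      rw [integral_Icc_eq_integral_Ioc, ← intervalIntegral.integral_of_le hT.le]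
      simp only [(hBd _).deriv]
    rw [e3, e4, hBT T le_rfl, show P 0 = 0 by simp [hP]] at ibp
    have eB : B 0 = -∫ t in Icc 0 T, b t := by
      rw [integral_Icc_eq_integral_Ioc, ← intervalIntegral.integral_of_le hT.le, hB]
      exact intervalIntegral.integral_symm _ _
    have ib : IntegrableOn b (Icc 0 T) := hb.continuous.continuousOn.integrableOn_Icc
    have e5 : ∫ t, b t • (V t - V₀ - P t) = ∫ t in Icc 0 T, b t * (V t - V₀ - P t) := by
      symm
      refine setIntegral_eq_integral_of_forall_compl_eq_zero fun t ht => ?_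
      rw [hb0 t fun h => ht (Ioo_subset_Icc_self h), zero_mul]
    rw [e5]
    have e6 : ∫ t in Icc 0 T, b t * (V t - V₀ - P t)
        = (∫ t in Icc 0 T, b t * V t) - (∫ t in Icc 0 T, b t) * V₀ - ∫ t in Icc 0 T, b t * P t := by
      rw [← integral_mul_const, ← integral_sub ibV (ib.mul_const V₀),
        ← integral_sub (integrable_fun_sub ibV (ib.mul_const V₀)) ibP]
      exact integral_congr_ae (Eventually.of_forall fun t => by simp only; ring)
    rw [e6]
    rw [eB] at e2
    linarith
  rw [← restrict_Ioo_eq_restrict_Icc, ae_restrict_iff' measurableSet_Ioo]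
  filter_upwards [key] with t ht ht'
  linarith [ht ht']

/-- Gronwall's inequality for a sequence of functions, each controlled by the next one. -/
theorem ae_le_zero_of_le_integral_succ {y : ℕ → ℝ → ℝ} {Λ c : ℝ} (hΛ : 0 ≤ Λ)
    (hm : ∀ j, StronglyMeasurable (y j)) (hb : ∀ j s, |y j s| ≤ K * c ^ j)
    (h : ∀ j, ∀ᵐ t ∂volume.restrict (Icc 0 T), y j t ≤ Λ * ∫ s in (0 : ℝ)..t, y (j + 1) s) (j : ℕ) :
    ∀ᵐ t ∂volume.restrict (Icc 0 T), y j t ≤ 0 := by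
  -- After `n` iterations the index is `j + n`, which costs `c ^ n`, while the iterated time
  -- integral gains `t ^ n / n!`. Exponential growth in the index is therefore harmless on any time
  -- interval.
  have step : ∀ n : ℕ, ∀ j, ∀ᵐ t ∂volume.restrict (Icc 0 T),
      y j t ≤ K * c ^ j * (c * Λ * t) ^ n / n.factorial := by
    intro n
    induction n with
    | zero => exact fun j => Eventually.of_forall fun t => by simpa using (abs_le.1 (hb j t)).2
    | succ n ih =>
      intro j
      filter_upwards [h j, ae_restrict_mem measurableSet_Icc] with t ht htT
      refine ht.trans ?_
      have i2 : Continuous fun s : ℝ => K * c ^ (j + 1) * (c * Λ * s) ^ n / n.factorial := by fun_prop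
      have h1 : ∫ s in (0 : ℝ)..t, y (j + 1) s
          ≤ ∫ s in (0 : ℝ)..t, K * c ^ (j + 1) * (c * Λ * s) ^ n / n.factorial := by
        refine intervalIntegral.integral_mono_ae_restrict htT.1
          (intervalIntegrable_of_bounded (hm _) (hb _) _ _) (i2.intervalIntegrable _ _) ?_
        exact ae_restrict_of_ae_restrict_of_subset (Icc_subset_Icc le_rfl htT.2) (ih (j + 1))
      refine (mul_le_mul_of_nonneg_left h1 hΛ).trans (le_of_eq ?_)
      have : ∀ s : ℝ, K * c ^ (j + 1) * (c * Λ * s) ^ n / n.factorial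
          = K * c ^ (j + 1) * (c * Λ) ^ n / n.factorial * s ^ n := fun s => by
        rw [mul_pow]; ring
      simp only [this, intervalIntegral.integral_const_mul, integral_pow, Nat.factorial_succ]
      push_cast
      have : (n : ℝ) + 1 ≠ 0 := by positivity
      field_simp
      ring
  have step' := fun n => step n j
  rw [← ae_all_iff] at step'
  filter_upwards [step'] with t ht
  have L : Tendsto (fun n : ℕ => K * c ^ j * (c * Λ * t) ^ n / n.factorial) atTop (𝓝 0) := by
    have := (FloorSemiring.tendsto_pow_div_factorial_atTop (c * Λ * t)).const_mul (K * c ^ j)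
    simpa only [mul_div_assoc, mul_zero] using this
  exact ge_of_tendsto L (Eventually.of_forall ht)

/-- Evolution of a weighted integral of a renormalized transported quantity. -/
theorem ae_integral_comp_eq {f B : ℝ → Plane → ℝ} {f₀ χ : Plane → ℝ} {R : ℝ} {β : ℝ → ℝ}
    (hf : StronglyMeasurable (Function.uncurry f)) (hB : StronglyMeasurable (Function.uncurry B))
    (hf₀ : Continuous f₀) (hχ : Continuous χ) (hχs : Function.support χ ⊆ ball 0 R)
    (hfK : ∀ s, ∀ x ∈ ball (0 : Plane) R, |f s x| ≤ K)
    (hBK : ∀ s, ∀ x ∈ ball (0 : Plane) R, |B s x| ≤ K) (hβ : ContDiff ℝ 1 β)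
    (H : ∀ x, ∀ᵐ t ∂volume.restrict (Icc 0 T), f t x = f₀ x + ∫ s in (0 : ℝ)..t, B s x) :
    ∀ᵐ t ∂volume.restrict (Icc 0 T), ∫ x, χ x * β (f t x)
      = (∫ x, χ x * β (f₀ x)) + ∫ s in (0 : ℝ)..t, ∫ x, χ x * (deriv β (f s x) * B s x) := by
  have hBx : ∀ x, StronglyMeasurable fun s => B s x := fun x =>
    hB.comp_measurable (measurable_id.prodMk measurable_const)
  have hχc : HasCompactSupport χ :=
    HasCompactSupport.of_support_subset_isCompact (isCompact_closedBall (0 : Plane) R)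
      (hχs.trans ball_subset_closedBall)
  have hprim : StronglyMeasurable fun p : ℝ × Plane => ∫ s in Ioc 0 p.1, B s p.2 := by
    have : StronglyMeasurable fun q : (ℝ × Plane) × ℝ =>
        {q : (ℝ × Plane) × ℝ | q.2 ∈ Ioc 0 q.1.1}.indicator (fun q => B q.2 q.1.2) q := by
      refine StronglyMeasurable.indicator
        (hB.comp_measurable (measurable_snd.prodMk measurable_fst.snd)) ?_
      exact (measurableSet_lt measurable_const measurable_snd).inter
        (measurableSet_le measurable_snd measurable_fst.fst)
    have h2 := this.integral_prod_right' (ν := (volume : Measure ℝ))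
    have e : (fun p : ℝ × Plane => ∫ s in Ioc 0 p.1, B s p.2) = fun p => ∫ s,
        {q : (ℝ × Plane) × ℝ | q.2 ∈ Ioc 0 q.1.1}.indicator (fun q => B q.2 q.1.2) (p, s) := by
      ext p
      rw [← integral_indicator measurableSet_Ioc]
      rfl
    rw [e]
    exact h2
  have hbad : MeasurableSet {p : ℝ × Plane | f p.1 p.2 = f₀ p.2 + ∫ s in Ioc 0 p.1, B s p.2} :=
    measurableSet_eq_fun hf.measurable ((hf₀.measurable.comp measurable_snd).add hprim.measurable)
  have hI : ∀ t x, 0 ≤ t → ∫ s in Ioc 0 t, B s x = ∫ s in (0 : ℝ)..t, B s x := fun t x ht =>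
    (intervalIntegral.integral_of_le ht).symm
  -- The exceptional times depend on `x`. Joint measurability of the equation allows the two
  -- almost-everywhere quantifiers to be exchanged.
  have hswap : ∀ᵐ t ∂volume.restrict (Icc 0 T), ∀ᵐ x,
      f t x = f₀ x + ∫ s in Ioc 0 t, B s x := by
    rw [Measure.ae_ae_comm hbad]
    refine Eventually.of_forall fun x => ?_
    filter_upwards [H x, ae_restrict_mem measurableSet_Icc] with t ht htT
    rw [ht, hI t x htT.1]
  obtain ⟨Cβ, hCβ⟩ := (isCompact_Icc (a := -K) (b := K)).exists_bound_of_continuousOn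
    (hβ.continuous_deriv (by simp)).continuousOn
  filter_upwards [hswap, ae_restrict_mem measurableSet_Icc] with t ht htT
  have e1 : ∀ᵐ x, χ x * β (f t x)
      = χ x * β (f₀ x) + ∫ s in Ioc 0 t, χ x * (deriv β (f s x) * B s x) := by
    filter_upwards [ht] with x hx
    by_cases h0 : χ x = 0
    · simp [h0]
    have hxb := hχs h0
    rw [hx, hI t x htT.1, comp_integral_eq (hBx x) (fun s => hBK s x hxb) hβ, integral_const_mul,
      mul_add, intervalIntegral.integral_of_le htT.1]
    congr 2
    refine setIntegral_congr_ae measurableSet_Ioc ?_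
    have := (ae_restrict_iff' measurableSet_Icc).1 (H x)
    filter_upwards [this] with s hs hs'
    rw [hs ⟨hs'.1.le, hs'.2.trans htT.2⟩]
  have hint : Integrable (Function.uncurry fun x s => χ x * (deriv β (f s x) * B s x))
      (volume.prod (volume.restrict (Ioc 0 t))) := by
    have h1 : Integrable (fun p : Plane × ℝ => |χ p.1| * (Cβ * K))
        (volume.prod (volume.restrict (Ioc 0 t))) :=
      (hχ.integrable_of_hasCompactSupport hχc).abs.mul_prod (integrable_const (Cβ * K))
    refine h1.mono' ?_ (Eventually.of_forall fun p => ?_)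
    · exact ((hχ.measurable.comp measurable_fst).mul
        (((hβ.continuous_deriv (by simp)).measurable.comp
          (hf.measurable.comp measurable_swap)).mul
          (hB.measurable.comp measurable_swap))).aestronglyMeasurable
    · simp only [Function.uncurry, norm_mul, Real.norm_eq_abs]
      by_cases h0 : χ p.1 = 0
      · simp [h0]
      have hxb := hχs h0
      have h2 := hCβ (f p.2 p.1) (abs_le.1 (hfK p.2 p.1 hxb))
      rw [Real.norm_eq_abs] at h2
      exact mul_le_mul_of_nonneg_left (mul_le_mul h2 (hBK p.2 p.1 hxb) (abs_nonneg _)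
        ((abs_nonneg _).trans h2)) (abs_nonneg _)
  rw [integral_congr_ae e1, integral_add, integral_integral_swap hint,
    intervalIntegral.integral_of_le htT.1]
  · exact ((hχ.mul (hβ.continuous.comp hf₀)).integrable_of_hasCompactSupport hχc.mul_right)
  · exact hint.integral_prod_left

end TimeCalculus

/-- The vorticity of a field, as a limit of mollifications. -/
def curlRep (f : Plane → Plane) (x : Plane) : ℝ :=
  limUnder atTop fun n => ∂_ 0 (moll (scale n) fun y => f y 1) x
    - ∂_ 1 (moll (scale n) fun y => f y 0) x

/-- Continuous divergence-free fields with vorticity and energy growth bounded by `M`. -/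
structure InClass (α M : ℝ) (f : Plane → Plane) : Prop where
  field : IsField f (curlRep f) M
  cont : Continuous f
  bound : EnergyBound α M 1 f

/-- The momentum flux tested against the vector field with components `h₀`, `h₁`. -/
def fluxForm (f : Plane → Plane) (h₀ h₁ : Plane → ℝ) : ℝ :=
  ∫ y, (f y 0 * (f y 0 * ∂_ 0 h₀ y + f y 1 * ∂_ 0 h₁ y)
    + f y 1 * (f y 0 * ∂_ 1 h₀ y + f y 1 * ∂_ 1 h₁ y))

/-- The right-hand side of the momentum equation tested against the vector field with components
`h₀`, `h₁`. -/
def momForm (f : Plane → Plane) (h₀ h₁ : Plane → ℝ) : ℝ :=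
  fluxForm f h₀ h₁ - (pressForm 0 h₀ f + pressForm 1 h₁ f)

/-! ### Bounds that are uniform over a class of fields. -/

section Static

variable {α M : ℝ} {f : Plane → Plane} {w : Plane → ℝ} {W : ℝ}

theorem IsField.congr_vort {w' : Plane → ℝ} (h : IsField f w W) (e : w =ᵐ[volume] w') :
    IsField f w' W := by
  refine ⟨h.locInt, h.divFree, ⟨?_, fun φ hφ => ?_⟩, ?_⟩
  · exact h.wLoc.mono (h.wLoc.aestronglyMeasurable.congr e) (e.mono fun x hx => by rw [hx])
  · rw [← h.curl.2 φ hφ]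
    exact integral_congr_ae (e.mono fun x hx => by simp only [hx])
  · filter_upwards [h.bound, e] with x hx he using he ▸ hx

/-- The limit depends on the field alone, so it gives a vorticity that is jointly measurable in time
and space. A choice of vorticity made separately at each time would not. -/
theorem IsField.curlRep_ae_eq (h : IsField f w W) : w =ᵐ[volume] curlRep f := by
  filter_upwards [ae_tendsto_moll_scale h.wLoc] with x hx
  simp only [curlRep, h.curl_moll (scale_pos _)]
  exact hx.limUnder_eq.symm

theorem IsField.isField_curlRep (h : IsField f w W) : IsField f (curlRep f) W :=
  h.congr_vort h.curlRep_ae_eq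

theorem IsField.mono_bound {W' : ℝ} (h : IsField f w W) (hW : W ≤ W') : IsField f w W' :=
  ⟨h.locInt, h.divFree, h.curl, h.bound.mono fun _ hx => hx.trans hW⟩

theorem IsField.zero (hW : 0 ≤ W) : IsField (fun _ : Plane => (0 : Plane)) (fun _ => 0) W := by
  refine ⟨locallyIntegrable_const _, fun φ _ => by simp, ⟨locallyIntegrable_const _, fun φ _ => by simp⟩,
    Eventually.of_forall fun x => by simpa using hW⟩

/-- Local sup bound in terms of the energy in a slightly larger ball. -/
theorem exists_norm_le_energy : ∃ C, 0 < C ∧ ∀ f w W, IsField f w W → Continuous f →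
    ∀ r ρ, 0 < ρ → ∀ x, ‖x‖ ≤ r → ‖f x‖ ≤ 2 * W * ρ + C / ρ * √(energy f (r + ρ)) := by
  obtain ⟨C, hC, H⟩ := exists_norm_le_energy_add_vorticity
  refine ⟨C, hC, fun f w W hf hc r ρ hρ x hx => (H f w W hf hc x ρ hρ).trans ?_⟩
  have : ∫ y in ball x ρ, ‖f y‖ ^ 2 ≤ energy f (r + ρ) := by
    refine setIntegral_mono_set (Continuous.integrableOn_ball (hc.norm.pow 2) 0 _)
      (Eventually.of_forall fun x => by simp only [Pi.zero_apply]; positivity)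
      (LE.le.eventuallyLE fun y hy => ?_)
    have h1 := norm_le_norm_add_norm_sub' y x
    have h2 : ‖y - x‖ < ρ := by simpa [dist_eq_norm] using hy
    simp only [mem_ball_zero_iff]
    linarith
  gcongr

/-- The interpolation inequality is used on a ball of radius `1 + ‖x‖`, where the energy norm grows
at most quadratically since `α ≤ 1`. Linear growth is the borderline for the Gronwall argument over
dyadic radii. -/
theorem exists_norm_le_linear : ∃ C, 0 < C ∧ ∀ f w M α, IsField f w M → Continuous f →
    0 ≤ α → α ≤ 1 → EnergyBound α M 1 f → ∀ x, ‖f x‖ ≤ C * M * (1 + ‖x‖) := by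
  obtain ⟨C, hC, H⟩ := exists_norm_le_energy
  refine ⟨2 + 4 * C, by positivity, fun f w M α hf hc hα hα' hb x => ?_⟩
  have hM := hf.bound_nonneg
  have hx := norm_nonneg x
  set ρ := 1 + ‖x‖ with hρ
  have hρ1 : 1 ≤ ρ := by linarith
  refine (H f w M hf hc ρ ρ (by positivity) x (by linarith)).trans ?_
  have h1 : √(energy f (ρ + ρ)) ≤ M * (4 * ρ ^ 2) := by
    refine Real.sqrt_le_iff.2 ⟨by positivity, (hb _ (by linarith)).trans ?_⟩
    have : (ρ + ρ) ^ (1 + α) ≤ 4 * ρ ^ 2 := by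
      calc (ρ + ρ) ^ (1 + α) ≤ (ρ + ρ) ^ (2 : ℝ) :=
            Real.rpow_le_rpow_of_exponent_le (by linarith) (by linarith)
        _ = 4 * ρ ^ 2 := by rw [Real.rpow_two]; ring
    gcongr
  calc _ ≤ 2 * M * ρ + C / ρ * (M * (4 * ρ ^ 2)) := by gcongr
    _ = _ := by field_simp

theorem integral_le_of_ball {g : Plane → ℝ} {ρ C : ℝ} (hs : Function.support g ⊆ ball 0 ρ)
    (hC : ∀ x, |g x| ≤ C) : |∫ x, g x| ≤ C * volume.real (ball (0 : Plane) ρ) := by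
  rw [integral_eq_ball hs, ← Real.norm_eq_abs]
  exact norm_setIntegral_le_of_norm_le_const measure_ball_lt_top fun x _ => hC x

theorem InClass.farIntegrable (h : InClass α M f) (hα : 0 ≤ α) (hα' : α < 1 / 2) :
    FarIntegrable f := h.bound.farIntegrable h.cont hα hα' one_pos

theorem support_partialDeriv_subset {g : Plane → ℝ} {ρ : ℝ} (i : Fin 2)
    (hs : tsupport g ⊆ ball 0 ρ) :
    Function.support (∂_ i g) ⊆ ball 0 ρ :=
  (subset_tsupport _).trans ((partialDeriv_support_subset i g).trans hs)

theorem integral_norm_pow_four_le {r V : ℝ} (hc : Continuous f)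
    (hV : ∀ x ∈ ball (0 : Plane) r, ‖f x‖ ≤ V) :
    ∫ y in ball 0 r, ‖f y‖ ^ 4 ≤ V ^ 2 * energy f r := by
  rw [energy, ← integral_const_mul]
  refine setIntegral_mono_on (Continuous.integrableOn_ball (hc.norm.pow 4) 0 _)
    (Continuous.integrableOn_ball (continuous_const.mul (hc.norm.pow 2)) 0 _) measurableSet_ball
    fun y hy => ?_
  have : ‖f y‖ ^ 2 ≤ V ^ 2 := by gcongr; exact hV y hy
  calc ‖f y‖ ^ 4 = ‖f y‖ ^ 2 * ‖f y‖ ^ 2 := by ring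
    _ ≤ _ := by gcongr

/-- Only the finiteness of `K` and its uniformity over the class matter: they make the right-hand
sides of all evolution equations bounded in time. -/
theorem exists_momForm_bound {θ : Plane → ℝ} (hθ : IsCutoff θ) (hα : 0 ≤ α) (hα' : α < 1 / 2)
    (hM : 0 ≤ M) {ρ C : ℝ} (hρ : 1 ≤ ρ) (hC : 0 ≤ C) : ∃ K, ∀ h₀ h₁, IsTest h₀ → IsTest h₁ →
    tsupport h₀ ⊆ ball 0 ρ → tsupport h₁ ⊆ ball 0 ρ →
    (∀ x, |h₀ x| ≤ C) → (∀ x, |h₁ x| ≤ C) → (∀ i x, |∂_ i h₀ x| ≤ C) →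
    (∀ i x, |∂_ i h₁ x| ≤ C) → ∀ f, InClass α M f →
      |fluxForm f h₀ h₁| ≤ K ∧ |momForm f h₀ h₁| ≤ K := by
  obtain ⟨A, hA, hlin⟩ := exists_norm_le_linear
  set v := volume.real (ball (0 : Plane) ρ) with hv
  set V := A * M * (1 + 2 * ρ) with hV
  set E₁ := (M * ρ ^ (1 + α)) ^ 2 with hE₁
  set E₂ := (M * (2 * ρ) ^ (1 + α)) ^ 2 with hE₂
  set Z := 16 * (1 / (1 - 2 * α)) * M ^ 2 * (2 * ρ) ^ (2 * α - 1) with hZ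
  refine ⟨4 * C * E₁ + (448 + 4 * √(2 * logMass ^ 2)) * (√(V ^ 2 * E₂) * √((2 * C) ^ 2 * v)
    + (C * v + C * v) * Z), fun h₀ h₁ t₀ t₁ s₀ s₁ b₀ b₁ d₀ d₁ f hf => ?_⟩
  have hv0 : 0 ≤ v := measureReal_nonneg
  have flux : |fluxForm f h₀ h₁| ≤ 4 * C * E₁ := by
    have hs : Function.support (fun y => f y 0 * (f y 0 * ∂_ 0 h₀ y + f y 1 * ∂_ 0 h₁ y)
        + f y 1 * (f y 0 * ∂_ 1 h₀ y + f y 1 * ∂_ 1 h₁ y)) ⊆ ball 0 ρ := by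
      intro y hy
      by_contra hy'
      have z : ∀ i, ∂_ i h₀ y = 0 ∧ ∂_ i h₁ y = 0 := fun i =>
        ⟨by_contra fun h => hy' (support_partialDeriv_subset i s₀ h),
          by_contra fun h => hy' (support_partialDeriv_subset i s₁ h)⟩
      simp [(z 0).1, (z 0).2, (z 1).1, (z 1).2] at hy
    rw [fluxForm, integral_eq_ball hs]
    have h1 : 4 * C * energy f ρ ≤ 4 * C * E₁ := by
      gcongr
      exact hf.bound ρ hρ
    refine le_trans ?_ h1
    rw [energy, ← integral_const_mul, ← Real.norm_eq_abs]
    refine norm_integral_le_of_norm_le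
      (Continuous.integrableOn_ball (continuous_const.mul (hf.cont.norm.pow 2)) 0 _)
      (Eventually.of_forall fun y => ?_)
    have k : ∀ i j, ∀ p, |p| ≤ C → |f y i * (f y j * p)| ≤ C * ‖f y‖ ^ 2 := fun i j p hp => by
      rw [← mul_assoc, abs_mul, mul_comm C]
      exact mul_le_mul (abs_coord_mul_le _ _ _) hp (abs_nonneg _) (by positivity)
    have k1 := abs_le.1 (k 0 0 _ (d₀ 0 y))
    have k2 := abs_le.1 (k 0 1 _ (d₁ 0 y))
    have k3 := abs_le.1 (k 1 0 _ (d₀ 1 y))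
    have k4 := abs_le.1 (k 1 1 _ (d₁ 1 y))
    rw [Real.norm_eq_abs, mul_add, mul_add, abs_le]
    constructor <;> linarith [k1.1, k1.2, k2.1, k2.2, k3.1, k3.2, k4.1, k4.2]
  have press := abs_pressForm_le (hf.farIntegrable hα hα') hf.cont hθ (by linarith : 0 < ρ) t₀ t₁
    ((subset_tsupport _).trans s₀) ((subset_tsupport _).trans s₁)
  have p1 : ∫ y in ball 0 (2 * ρ), ‖f y‖ ^ 4 ≤ V ^ 2 * E₂ := by
    refine (integral_norm_pow_four_le (V := V) hf.cont fun x hx => ?_).trans ?_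
    · refine (hlin f _ M α hf.field hf.cont hα (by linarith) hf.bound x).trans ?_
      have := (mem_ball_zero_iff.1 hx).le
      rw [hV]; gcongr
    · gcongr
      exact hf.bound _ (by linarith)
  have p2 : ∫ x, (∂_ 0 h₀ x + ∂_ 1 h₁ x) ^ 2 ≤ (2 * C) ^ 2 * v := by
    refine (le_abs_self _).trans (integral_le_of_ball ?_ fun x => ?_)
    · intro y hy
      by_contra hy'
      have z1 : ∂_ 0 h₀ y = 0 :=
        by_contra fun h => hy' (support_partialDeriv_subset 0 s₀ h)
      have z2 : ∂_ 1 h₁ y = 0 :=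
        by_contra fun h => hy' (support_partialDeriv_subset 1 s₁ h)
      simp [z1, z2] at hy
    · rw [abs_of_nonneg (sq_nonneg _), ← sq_abs]
      gcongr
      refine (abs_add_le _ _).trans ?_
      linarith [d₀ 0 x, d₁ 1 x]
  have p3 : ∀ {h : Plane → ℝ}, tsupport h ⊆ ball 0 ρ → (∀ x, |h x| ≤ C) →
      ∫ x, |h x| ≤ C * v := fun {h} s b => by
    refine (le_abs_self _).trans (integral_le_of_ball (fun y hy => ?_) fun x => by
      rw [abs_abs]; exact b x)
    exact s (subset_tsupport _ fun h0 => hy (by simp [h0]))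
  have p4 : ∫ y in (ball 0 (2 * ρ))ᶜ, ‖f y‖ ^ 2 * (‖y‖ ^ 3)⁻¹ ≤ Z :=
    integral_far_le hf.cont hα hα' hf.bound one_pos (by linarith)
  have p5 : 0 ≤ ∫ y in (ball (0 : Plane) (2 * ρ))ᶜ, ‖f y‖ ^ 2 * (‖y‖ ^ 3)⁻¹ :=
    integral_nonneg fun _ => by positivity
  have hx : 0 < 1 - 2 * α := by linarith
  refine ⟨flux.trans (le_add_of_nonneg_right (by positivity)), ?_⟩
  rw [momForm]
  refine (abs_sub _ _).trans (add_le_add flux (press.trans ?_))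
  gcongr
  · exact p3 s₀ b₀
  · exact p3 s₁ b₁

end Static

/-! ### Joint measurability in time and space. -/

section Measurability

variable {X : Type*} [MeasurableSpace X]

theorem stronglyMeasurable_conv {k : Plane → ℝ} (hk : Continuous k) {g : X → Plane → ℝ}
    (hg : StronglyMeasurable (Function.uncurry g)) :
    StronglyMeasurable (Function.uncurry fun t => conv k (g t)) := by
  have h : StronglyMeasurable fun q : (X × Plane) × Plane => k (q.1.2 - q.2) * g q.1.1 q.2 :=
    ((hk.measurable.comp (measurable_fst.snd.sub measurable_snd)).stronglyMeasurable).mul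
      (hg.comp_measurable (measurable_fst.fst.prodMk measurable_snd))
  have e : (Function.uncurry fun t => conv k (g t))
      = fun p : X × Plane => ∫ y, k (p.2 - y) * g p.1 y := by
    ext p; simp only [Function.uncurry, conv_apply]
  rw [e]
  exact h.integral_prod_right'

theorem stronglyMeasurable_coord {g : X → Plane → Plane}
    (hg : StronglyMeasurable (Function.uncurry g)) (i : Fin 2) :
    StronglyMeasurable (Function.uncurry fun t y => g t y i) :=
  (by fun_prop : Continuous fun v : Plane => v i).comp_stronglyMeasurable hg

theorem stronglyMeasurable_moll {ε : ℝ} {g : X → Plane → ℝ}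
    (hg : StronglyMeasurable (Function.uncurry g)) :
    StronglyMeasurable (Function.uncurry fun t => moll ε (g t)) :=
  stronglyMeasurable_conv (contDiff_mollk ε).continuous hg

/-- Pointwise limits of jointly measurable mollifications are jointly measurable. This is the reason
for defining the representative by `limUnder` rather than by choice. -/
theorem stronglyMeasurable_fieldRep {g : X → Plane → Plane}
    (hg : StronglyMeasurable (Function.uncurry g)) :
    StronglyMeasurable (Function.uncurry fun t => fieldRep (g t)) := by
  have h : ∀ i, StronglyMeasurable fun p : X × Plane =>
      limUnder atTop fun n => moll (scale n) (fun y => g p.1 y i) p.2 := fun i =>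
    StronglyMeasurable.limUnder fun n => stronglyMeasurable_moll (stronglyMeasurable_coord hg i)
  refine Measurable.stronglyMeasurable ?_
  have : Measurable fun p : X × Plane => (fun i => limUnder atTop fun n =>
      moll (scale n) (fun y => g p.1 y i) p.2 : Fin 2 → ℝ) :=
    measurable_pi_iff.2 fun i => (h i).measurable
  exact (WithLp.measurable_toLp 2 (Fin 2 → ℝ)).comp this

theorem stronglyMeasurable_fluxForm {v : X → Plane → Plane}
    (hv : StronglyMeasurable (Function.uncurry v)) {h₀ h₁ : Plane → ℝ} (t₀ : IsTest h₀)
    (t₁ : IsTest h₁) : StronglyMeasurable fun t => fluxForm (v t) h₀ h₁ := by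
  have c := fun i => (stronglyMeasurable_coord hv i).measurable
  have d₀ := fun i => (t₀.partialDeriv i).continuous.measurable.comp
    (measurable_snd : Measurable fun p : X × Plane => p.2)
  have d₁ := fun i => (t₁.partialDeriv i).continuous.measurable.comp
    (measurable_snd : Measurable fun p : X × Plane => p.2)
  refine StronglyMeasurable.integral_prod_right (f := fun t y =>
    (v t y 0 * (v t y 0 * ∂_ 0 h₀ y + v t y 1 * ∂_ 0 h₁ y)
    + v t y 1 * (v t y 0 * ∂_ 1 h₀ y + v t y 1 * ∂_ 1 h₁ y))) ?_
  exact (((c 0).mul (((c 0).mul (d₀ 0)).add ((c 1).mul (d₁ 0)))).add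
    ((c 1).mul (((c 0).mul (d₀ 1)).add ((c 1).mul (d₁ 1))))).stronglyMeasurable

theorem stronglyMeasurable_pressForm {v : X → Plane → Plane}
    (hv : StronglyMeasurable (Function.uncurry v)) (i : Fin 2) {h : Plane → ℝ} (hh : IsTest h) :
    StronglyMeasurable fun t => pressForm i h (v t) := by
  have c := fun i => stronglyMeasurable_coord hv i
  refine StronglyMeasurable.const_mul (StronglyMeasurable.integral_prod_right
    (f := fun t y => pressKer i h (v t) y) ?_) _
  have e : (Function.uncurry fun t y => pressKer i h (v t) y) = fun p : X × Plane =>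
      ∑ j, ∑ k, v p.1 p.2 j * v p.1 p.2 k
        * corr (regKern 0 i) (∂_ j (∂_ k h)) p.2 := rfl
  rw [e]
  refine Finset.stronglyMeasurable_fun_sum _ fun j _ => Finset.stronglyMeasurable_fun_sum _ fun k _ => ?_
  refine ((c j).mul (c k)).mul ?_
  exact ((contDiff_corr (logKern_locInt i)
    ((hh.partialDeriv k).partialDeriv j)).continuous.measurable.comp
    measurable_snd).stronglyMeasurable

theorem stronglyMeasurable_momForm {v : X → Plane → Plane}
    (hv : StronglyMeasurable (Function.uncurry v)) {h₀ h₁ : Plane → ℝ} (t₀ : IsTest h₀)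
    (t₁ : IsTest h₁) : StronglyMeasurable fun t => momForm (v t) h₀ h₁ :=
  (stronglyMeasurable_fluxForm hv t₀ t₁).sub
    ((stronglyMeasurable_pressForm hv 0 t₀).add (stronglyMeasurable_pressForm hv 1 t₁))

end Measurability

/-- A jointly measurable family of fields of a fixed class that solves the momentum equation on
the time interval `[0, T]`, with initial datum `v₀`. -/
structure IsFlow (α M T : ℝ) (v₀ : Plane → Plane) (v : ℝ → Plane → Plane) : Prop where
  meas : StronglyMeasurable (Function.uncurry v)
  inClass : ∀ t, InClass α M (v t)
  eqn : ∀ h₀ h₁, IsTest h₀ → IsTest h₁ → ∀ᵐ t ∂volume.restrict (Icc 0 T),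
    ∫ x, (v t x 0 * h₀ x + v t x 1 * h₁ x)
      = (∫ x, (v₀ x 0 * h₀ x + v₀ x 1 * h₁ x)) + ∫ s in (0 : ℝ)..t, momForm (v s) h₀ h₁

/-! ### A version of the solution that lies in a fixed class at every time. -/

section Construction

variable {α M T : ℝ} {u₀ : Plane → Plane} {u v : ℝ → Plane → Plane}

theorem inner_eq_add (a b : Plane) : inner ℝ a b = a 0 * b 0 + a 1 * b 1 := by
  simp [PiLp.inner_apply, Fin.sum_univ_two, mul_comm]

theorem InClass.zero (hM : 0 ≤ M) : InClass α M (fun _ => (0 : Plane)) := by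
  refine ⟨(IsField.zero hM).isField_curlRep, continuous_const, fun r _ => ?_⟩
  simp only [energy, norm_zero]
  simp
  positivity

theorem InClass.fieldRep {f : Plane → Plane} {w : Plane → ℝ} (h : IsField f w M)
    (hb : EnergyBound α M 1 f) : InClass α M (fieldRep f) :=
  ⟨h.isField_fieldRep.isField_curlRep, h.continuous_fieldRep, fun r hr => by
    rw [energy_congr_ae h.fieldRep_ae_eq]; exact hb r hr⟩

/-- At good times the continuous representative of a measurable version of `u` is taken, at the
remaining null set of times the zero field. Later arguments may then use the bounds at every time.
-/
theorem IsYudovichSolution.exists_inClass (hu : IsYudovichSolution α u₀ u) (hT : 0 < T) :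
    ∃ M, 0 ≤ M ∧ ∃ v : ℝ → Plane → Plane, StronglyMeasurable (Function.uncurry v) ∧
      (∀ t, InClass α M (v t)) ∧ ∀ᵐ t ∂volume.restrict (Icc 0 T), v t =ᵐ[volume] u t := by
  obtain ⟨M₀, hM₀⟩ := hu.locallyBounded T hT
  set M := max M₀ 0 with hM
  have hM0 : 0 ≤ M := le_max_right _ _
  set ut : ℝ → Plane → Plane := fun t x => hu.aestronglyMeasurable.mk _ (t, x) with hut
  have mt : StronglyMeasurable (Function.uncurry ut) := by
    exact hu.aestronglyMeasurable.stronglyMeasurable_mk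
  have e1 : ∀ᵐ t ∂volume.restrict (Icc 0 T), u t =ᵐ[volume] ut t := by
    have := Measure.ae_ae_of_ae_prod hu.aestronglyMeasurable.ae_eq_mk
    exact ae_restrict_of_ae_restrict_of_subset Icc_subset_Ici_self this
  have good : ∀ᵐ t ∂volume.restrict (Icc 0 T),
      (∃ w, IsField (ut t) w M) ∧ EnergyBound α M 1 (ut t) ∧ u t =ᵐ[volume] ut t := by
    filter_upwards [hM₀, e1] with t ht he
    have b1 : morreyNorm α (u t) ≤ ENNReal.ofReal M :=
      (le_add_self.trans ht.2).trans (ENNReal.ofReal_le_ofReal (le_max_left _ _))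
    have b2 : (eLpNorm (vorticity (u t)) ⊤ volume).toReal ≤ M :=
      ENNReal.toReal_le_of_le_ofReal hM0
        ((le_self_add.trans ht.2).trans (ENNReal.ofReal_le_ofReal (le_max_left _ _)))
    refine ⟨⟨_, (ht.1.isField.mono_bound b2).congr_ae he⟩, fun r hr => ?_, he⟩
    rw [← energy_congr_ae he]
    exact energyBound_of_morreyNorm ht.1.aestronglyMeasurable hM0 b1 r hr
  -- The set of bad times need not be measurable; enlarging it keeps the modified field jointly
  -- measurable.
  obtain ⟨S, hS1, hS2, hS3⟩ := exists_measurable_superset_of_null (ae_iff.1 good)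
  have hS : ∀ t, t ∉ S → (∃ w, IsField (ut t) w M) ∧ EnergyBound α M 1 (ut t)
      ∧ u t =ᵐ[volume] ut t := fun t ht => by_contra fun h => ht (hS1 h)
  classical
  refine ⟨M, hM0, fun t x => if t ∈ S then 0 else fieldRep (ut t) x, ?_, fun t => ?_, ?_⟩
  · have : StronglyMeasurable fun p : ℝ × Plane => if p.1 ∈ S then (0 : Plane) else fieldRep (ut p.1) p.2 :=
      StronglyMeasurable.ite (measurable_fst hS2) stronglyMeasurable_const
        (stronglyMeasurable_fieldRep mt)
    exact this
  · by_cases ht : t ∈ S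
    · simp only [ht, if_true]; exact InClass.zero hM0
    · simp only [ht, if_false]
      obtain ⟨⟨w, hw⟩, hb, -⟩ := hS t ht
      exact InClass.fieldRep hw hb
  · filter_upwards [(measure_eq_zero_iff_ae_notMem.1 hS3)] with t ht
    simp only [ht, if_false]
    obtain ⟨⟨w, hw⟩, hb, he⟩ := hS t ht
    exact hw.fieldRep_ae_eq.trans he.symm

end Construction

/-! ### From the weak formulation to an integrated momentum equation. -/

section MomentumEquation

variable {α M T : ℝ} {u₀ : Plane → Plane} {u v : ℝ → Plane → Plane} {h₀ h₁ : Plane → ℝ}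

/-- The vector field with components `h₀`, `h₁`. -/
def vecField (h₀ h₁ : Plane → ℝ) (x : Plane) : Plane := !₂[h₀ x, h₁ x]

@[simp] theorem vecField_zero (x : Plane) : vecField h₀ h₁ x 0 = h₀ x := rfl

@[simp] theorem vecField_one (x : Plane) : vecField h₀ h₁ x 1 = h₁ x := rfl

theorem contDiff_vecField (t₀ : ContDiff ℝ ∞ h₀) (t₁ : ContDiff ℝ ∞ h₁) :
    ContDiff ℝ ∞ (vecField h₀ h₁) := by
  refine contDiff_euclidean.2 fun i => ?_
  fin_cases i
  · exact t₀
  · exact t₁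

theorem hasCompactSupport_vecField (t₀ : HasCompactSupport h₀) (t₁ : HasCompactSupport h₁) :
    HasCompactSupport (vecField h₀ h₁) := by
  refine HasCompactSupport.of_support_subset_isCompact (t₀.isCompact.union t₁.isCompact) fun x hx => ?_
  by_contra h
  rw [mem_union, not_or] at h
  refine hx ?_
  have z₀ : h₀ x = 0 := image_eq_zero_of_notMem_tsupport h.1
  have z₁ : h₁ x = 0 := image_eq_zero_of_notMem_tsupport h.2
  ext i
  fin_cases i
  · exact z₀
  · exact z₁

theorem fderiv_coord {H : Plane → Plane} {x : Plane} (hH : DifferentiableAt ℝ H x) (w : Plane)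
    (i : Fin 2) : fderiv ℝ H x w i = ∑ j, w j * ∂_ j (fun y => H y i) x := by
  have h1 : HasFDerivAt (fun y => H y i) ((EuclideanSpace.proj i : Plane →L[ℝ] ℝ).comp
      (fderiv ℝ H x)) x :=
    (EuclideanSpace.proj i : Plane →L[ℝ] ℝ).hasFDerivAt.comp x hH.hasFDerivAt
  rw [← fderiv_apply_eq_sum, h1.fderiv]
  rfl

theorem InClass.integrable_flux {f : Plane → Plane} (h : InClass α M f) (t₀ : IsTest h₀)
    (t₁ : IsTest h₁) : Integrable fun y =>
      f y 0 * (f y 0 * ∂_ 0 h₀ y + f y 1 * ∂_ 0 h₁ y)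
        + f y 1 * (f y 0 * ∂_ 1 h₀ y + f y 1 * ∂_ 1 h₁ y) := by
  have c := fun i => Continuous.coord h.cont i
  have d : ∀ {g : Plane → ℝ}, IsTest g → ∀ i j k, Integrable fun y => f y i * (f y j * ∂_ k g y) :=
    fun t i j k => ((c i).mul ((c j).mul (t.partialDeriv k).continuous)
      ).integrable_of_hasCompactSupport ((t.partialDeriv k).2.mul_left.mul_left)
  simp only [mul_add]
  exact ((d t₀ 0 0 0).fun_add (d t₁ 0 1 0)).fun_add ((d t₀ 1 0 1).fun_add (d t₁ 1 1 1))

theorem exists_common_bound (t₀ : IsTest h₀) (t₁ : IsTest h₁) : ∃ ρ C, 1 ≤ ρ ∧ 0 ≤ C ∧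
    tsupport h₀ ⊆ ball 0 ρ ∧ tsupport h₁ ⊆ ball 0 ρ ∧
    (∀ x, |h₀ x| ≤ C) ∧ (∀ x, |h₁ x| ≤ C) ∧ (∀ i x, |∂_ i h₀ x| ≤ C) ∧
    (∀ i x, |∂_ i h₁ x| ≤ C) := by
  have single : ∀ {h : Plane → ℝ}, IsTest h → ∃ ρ C, 0 < ρ ∧ tsupport h ⊆ ball 0 ρ ∧
      (∀ x, |h x| ≤ C) ∧ ∀ i x, |∂_ i h x| ≤ C := by
    intro h t
    obtain ⟨ρ, hρ, hs⟩ := exists_ball_of_hasCompactSupport t.2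
    obtain ⟨C, hC⟩ := t.continuous.bounded_above_of_compact_support t.2
    obtain ⟨C0, hC0⟩ := (t.partialDeriv 0).continuous.bounded_above_of_compact_support
      (t.partialDeriv 0).2
    obtain ⟨C1, hC1⟩ := (t.partialDeriv 1).continuous.bounded_above_of_compact_support
      (t.partialDeriv 1).2
    refine ⟨ρ, max C (max C0 C1), hρ, hs, fun x => (hC x).trans (le_max_left _ _), fun i x => ?_⟩
    fin_cases i
    · exact (hC0 x).trans ((le_max_left _ _).trans (le_max_right _ _))
    · exact (hC1 x).trans ((le_max_right _ _).trans (le_max_right _ _))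
  obtain ⟨ρ, C, hρ, hs, hb, hd⟩ := single t₀
  obtain ⟨ρ', C', hρ', hs', hb', hd'⟩ := single t₁
  exact ⟨max 1 (max ρ ρ'), max C C', le_max_left _ _,
    (abs_nonneg _).trans ((hb 0).trans (le_max_left _ _)),
    hs.trans (ball_subset_ball ((le_max_left _ _).trans (le_max_right _ _))),
    hs'.trans (ball_subset_ball ((le_max_right _ _).trans (le_max_right _ _))),
    fun x => (hb x).trans (le_max_left _ _), fun x => (hb' x).trans (le_max_right _ _),
    fun i x => (hd i x).trans (le_max_left _ _), fun i x => (hd' i x).trans (le_max_right _ _)⟩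

theorem exists_pairing_bound (hα : 0 ≤ α) (hα' : α < 1 / 2) (hM : 0 ≤ M) (t₀ : IsTest h₀)
    (t₁ : IsTest h₁) :
    ∃ K, ∀ f, InClass α M f → |∫ x, (f x 0 * h₀ x + f x 1 * h₁ x)| ≤ K := by
  obtain ⟨ρ, C, hρ, hC, s₀, s₁, b₀, b₁, -, -⟩ := exists_common_bound t₀ t₁
  obtain ⟨A, hA, hlin⟩ := exists_norm_le_linear
  refine ⟨2 * (A * M * (1 + ρ)) * C * volume.real (ball (0 : Plane) ρ), fun f hf => ?_⟩
  refine integral_le_of_ball (fun x hx => ?_) fun x => ?_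
  · by_contra h
    have z₀ : h₀ x = 0 := by_contra fun h' => h (s₀ (subset_tsupport _ h'))
    have z₁ : h₁ x = 0 := by_contra fun h' => h (s₁ (subset_tsupport _ h'))
    simp [z₀, z₁] at hx
  · by_cases hx : x ∈ ball (0 : Plane) ρ
    · have hn := (mem_ball_zero_iff.1 hx).le
      have hf1 : ‖f x‖ ≤ A * M * (1 + ρ) :=
        (hlin f _ M α hf.field hf.cont hα (by linarith) hf.bound x).trans (by gcongr)
      refine (abs_add_le _ _).trans ?_
      rw [abs_mul, abs_mul]
      have k : ∀ i, |f x i| ≤ A * M * (1 + ρ) := fun i => (abs_coord_le _ i).trans hf1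
      have := mul_le_mul (k 0) (b₀ x) (abs_nonneg _) (by positivity)
      have := mul_le_mul (k 1) (b₁ x) (abs_nonneg _) (by positivity)
      linarith
    · have z₀ : h₀ x = 0 := by_contra fun h' => hx (s₀ (subset_tsupport _ h'))
      have z₁ : h₁ x = 0 := by_contra fun h' => hx (s₁ (subset_tsupport _ h'))
      rw [z₀, z₁]
      simp
      positivity

theorem stronglyMeasurable_pairing (hv : StronglyMeasurable (Function.uncurry v))
    (t₀ : IsTest h₀) (t₁ : IsTest h₁) :
    StronglyMeasurable fun t => ∫ x, (v t x 0 * h₀ x + v t x 1 * h₁ x) := by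
  refine StronglyMeasurable.integral_prod_right
    (f := fun t x => v t x 0 * h₀ x + v t x 1 * h₁ x) ?_
  exact ((stronglyMeasurable_coord hv 0).mul
    (t₀.continuous.measurable.comp measurable_snd).stronglyMeasurable).add
    ((stronglyMeasurable_coord hv 1).mul
    (t₁.continuous.measurable.comp measurable_snd).stronglyMeasurable)

/-- The weak form is tested with products of a function of time and a field in space. Replacing the
pressure by its representation turns it into the hypothesis of the du Bois-Reymond lemma, with a
bounded right-hand side that no longer contains `θ`. -/
theorem IsYudovichSolution.exists_isFlow (hu : IsYudovichSolution α u₀ u) (hα : 0 ≤ α)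
    (hα' : α < 1 / 2) (hT : 0 < T) : ∃ M, 0 ≤ M ∧ ∃ v, IsFlow α M T u₀ v ∧
      ∀ᵐ t ∂volume.restrict (Icc 0 T), v t =ᵐ[volume] u t := by
  obtain ⟨M, hM, v, mv, cv, ev⟩ := hu.exists_inClass hT
  obtain ⟨θ, hθ, mom⟩ := hu.momentum
  refine ⟨M, hM, v, ⟨mv, cv, fun h₀ h₁ t₀ t₁ => ?_⟩, ev⟩
  obtain ⟨ρ, C, hρ, hC, s₀, s₁, b₀, b₁, d₀, d₁⟩ := exists_common_bound t₀ t₁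
  obtain ⟨K, hK⟩ := exists_momForm_bound hθ hα hα' hM hρ hC
  obtain ⟨K', hK'⟩ := exists_pairing_bound hα hα' hM t₀ t₁
  have mD := stronglyMeasurable_momForm mv t₀ t₁
  have bD : ∀ t, |momForm (v t) h₀ h₁| ≤ K := fun t => hK h₀ h₁ t₀ t₁ s₀ s₁ b₀ b₁ d₀ d₁ _ (cv t) |>.2
  have bF : ∀ t, |fluxForm (v t) h₀ h₁| ≤ K :=
    fun t => hK h₀ h₁ t₀ t₁ s₀ s₁ b₀ b₁ d₀ d₁ _ (cv t) |>.1
  have mV := stronglyMeasurable_pairing mv t₀ t₁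
  refine ae_eq_add_integral hT (Integrable.of_bound mV.aestronglyMeasurable K'
    (Eventually.of_forall fun t => hK' _ (cv t))) (intervalIntegrable_of_bounded mD bD _ _)
    fun a ha hac haT => ?_
  set H := vecField h₀ h₁ with hH
  have cH : ContDiff ℝ ∞ H := contDiff_vecField t₀.1 t₁.1
  have kH : HasCompactSupport H := hasCompactSupport_vecField t₀.2 t₁.2
  have dH : Differentiable ℝ H := cH.differentiable (by simp)
  have da : Differentiable ℝ a := ha.differentiable (by simp)
  have e := mom (fun p => a p.1 • H p.2) ⟨(ha.comp contDiff_fst).smul (cH.comp contDiff_snd), by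
    refine HasCompactSupport.of_support_subset_isCompact (hac.isCompact.prod kH.isCompact)
      fun p hp => ?_
    have hp' : a p.1 • H p.2 ≠ 0 := hp
    rw [smul_ne_zero_iff] at hp'
    exact ⟨subset_tsupport _ hp'.1, subset_tsupport _ hp'.2⟩⟩
  simp only at e
  have e1 : ∫ x, inner ℝ (a 0 • H x) (u₀ x)
      = a 0 * ∫ x, (u₀ x 0 * h₀ x + u₀ x 1 * h₁ x) := by
    rw [← integral_const_mul]
    refine integral_congr_ae (Eventually.of_forall fun x => ?_)
    simp only [inner_eq_add, PiLp.smul_apply, smul_eq_mul, hH, vecField_zero, vecField_one]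
    ring
  have red : ∀ F : ℝ → ℝ, (∀ t, T < t → F t = 0) → ∫ t in Ici (0 : ℝ), F t = ∫ t in Icc 0 T, F t := by
    intro F hF
    refine setIntegral_eq_of_subset_of_forall_sdiff_eq_zero measurableSet_Ici Icc_subset_Ici_self
      fun t ht => hF t ?_
    by_contra h
    exact ht.2 ⟨ht.1, not_lt.1 h⟩
  have da0 : ∀ t, T < t → deriv a t = 0 := fun t ht => by
    have : a =ᶠ[𝓝 t] fun _ => 0 := by
      filter_upwards [Ioi_mem_nhds ht] with s hs using haT s (le_of_lt hs)
    rw [this.deriv_eq, deriv_const]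
  have dsm : ∀ t x, deriv (fun s => a s • H x) t = deriv a t • H x := fun t x =>
    deriv_smul_const (da t) (H x)
  have fsm : ∀ t x, fderiv ℝ (fun y => a t • H y) x = a t • fderiv ℝ H x := fun t x =>
    fderiv_const_smul (dH x) (a t)
  rw [e1, red, red] at e
  rotate_left
  · intro t ht
    simp [haT t ht.le]
  · intro t ht
    simp [haT t ht.le, dsm, da0 t ht]
  have e2 : ∫ t in Icc 0 T, ∫ x, (inner ℝ (u t x) (deriv (fun s => a s • H x) t)
        + inner ℝ (u t x) (fderiv ℝ (fun y => a t • H y) x (u t x)))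
      = ∫ t in Icc 0 T, (deriv a t * (∫ x, (v t x 0 * h₀ x + v t x 1 * h₁ x))
        + a t * fluxForm (v t) h₀ h₁) := by
    refine integral_congr_ae ?_
    filter_upwards [ev] with t ht
    have i1 : Integrable fun x => v t x 0 * h₀ x + v t x 1 * h₁ x :=
      ((cv t).field.int_mul 0 t₀).add ((cv t).field.int_mul 1 t₁)
    rw [fluxForm, ← integral_const_mul, ← integral_const_mul, ← integral_add (i1.const_mul _)
      (((cv t).integrable_flux t₀ t₁).const_mul _)]
    refine integral_congr_ae ?_
    filter_upwards [ht] with x hx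
    rw [dsm, fsm, ← hx]
    have k := fun i => fderiv_coord (dH x) (v t x) i
    have k0 := k 0
    have k1 := k 1
    simp only [hH, vecField_zero, vecField_one, Fin.sum_univ_two] at k0 k1
    simp only [inner_eq_add, PiLp.smul_apply, smul_eq_mul, _root_.smul_apply,
      hH, vecField_zero, vecField_one]
    rw [k0, k1]
    ring
  have e3 : ∫ t in Icc 0 T, ∫ x, inner ℝ (gradPi θ (u t) (u t) x) (a t • H x)
      = ∫ t in Icc 0 T, a t * (pressForm 0 h₀ (v t) + pressForm 1 h₁ (v t)) := by
    refine integral_congr_ae ?_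
    filter_upwards [ev] with t ht
    have hF := (cv t).farIntegrable hα hα'
    have li := fun i => (cv t).field.locallyIntegrable_gradPi (cv t).cont hF hθ i
    rw [gradPi_congr_ae ht.symm, ← (cv t).field.integral_gradPi_mul (cv t).cont hF hθ 0 t₀,
      ← (cv t).field.integral_gradPi_mul (cv t).cont hF hθ 1 t₁, ← integral_add
      (t₀.integrable_mul (li 0)) (t₁.integrable_mul (li 1)), ← integral_const_mul]
    refine integral_congr_ae (Eventually.of_forall fun x => ?_)
    simp only [inner_eq_add, PiLp.smul_apply, smul_eq_mul, hH, vecField_zero, vecField_one]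
    ring
  rw [e2, e3] at e
  have cda : Continuous (deriv a) := ha.continuous_deriv (by simp)
  have bint : ∀ {F : ℝ → ℝ} {L : ℝ} {c : ℝ → ℝ}, Continuous c → StronglyMeasurable F →
      (∀ t, |F t| ≤ L) → IntegrableOn (fun t => c t * F t) (Icc 0 T) := by
    intro F L c hc hm hb
    have : IntegrableOn F (Icc 0 T) :=
      Integrable.of_bound hm.aestronglyMeasurable L (Eventually.of_forall hb)
    exact this.continuousOn_mul hc.continuousOn isCompact_Icc
  have iV := bint cda mV fun t => hK' _ (cv t)
  have iF := bint ha.continuous (stronglyMeasurable_fluxForm mv t₀ t₁) bF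
  have iD := bint ha.continuous mD bD
  have iP : IntegrableOn (fun t => a t * (pressForm 0 h₀ (v t) + pressForm 1 h₁ (v t)))
      (Icc 0 T) := by
    refine (integrable_fun_sub iF iD).congr (Eventually.of_forall fun t => ?_)
    simp only [momForm]
    ring
  have e4 : ∫ t in Icc 0 T, (deriv a t * (∫ x, (v t x 0 * h₀ x + v t x 1 * h₁ x))
        + a t * momForm (v t) h₀ h₁)
      = (∫ t in Icc 0 T, (deriv a t * (∫ x, (v t x 0 * h₀ x + v t x 1 * h₁ x))
        + a t * fluxForm (v t) h₀ h₁))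
        - ∫ t in Icc 0 T, a t * (pressForm 0 h₀ (v t) + pressForm 1 h₁ (v t)) := by
    rw [← integral_sub (iV.fun_add iF) iP]
    refine integral_congr_ae (Eventually.of_forall fun t => ?_)
    simp only [momForm]
    ring
  rw [e4]
  linarith

end MomentumEquation

/-! ### Variance and covariance under mollification. -/

section Variance

variable {ε R : ℝ} {g h : Plane → ℝ}

/-- The variance of `g` with respect to the mollifier centred at `x`. -/
def mvar (ε : ℝ) (g : Plane → ℝ) (x : Plane) : ℝ := moll ε (fun y => g y ^ 2) x - moll ε g x ^ 2

/-- The covariance of `g` and `h` with respect to the mollifier centred at `x`. -/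
def mcov (ε : ℝ) (g h : Plane → ℝ) (x : Plane) : ℝ :=
  moll ε (fun y => g y * h y) x - moll ε g x * moll ε h x

theorem mvar_nonneg (hε : 0 < ε) (hg : LocallyIntegrable g volume)
    (hg2 : LocallyIntegrable (fun x => g x ^ 2) volume) (x : Plane) : 0 ≤ mvar ε g x :=
  sub_nonneg.2 (sq_moll_le hε hg hg2 x)

/-- The Cauchy-Schwarz inequality for the probability density of the mollifier: the variance of `g +
s h` is a nonnegative quadratic polynomial in `s`. -/
theorem mcov_sq_le (hε : 0 < ε) (hg : LocallyIntegrable g volume)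
    (hg2 : LocallyIntegrable (fun x => g x ^ 2) volume) (hh : LocallyIntegrable h volume)
    (hh2 : LocallyIntegrable (fun x => h x ^ 2) volume)
    (hgh : LocallyIntegrable (fun x => g x * h x) volume) (x : Plane) :
    mcov ε g h x ^ 2 ≤ mvar ε g x * mvar ε h x := by
  have hk := isTest_mollk hε
  have key : ∀ s : ℝ, 0 ≤ mvar ε h x * (s * s) + 2 * mcov ε g h x * s + mvar ε g x := by
    intro s
    have e2 : ∀ y, (g y + s * h y) ^ 2 = g y ^ 2 + (2 * s * (g y * h y) + s ^ 2 * h y ^ 2) :=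
      fun y => by ring
    have h1 := sq_moll_le (ε := ε) (g := fun y => g y + s * h y) hε (hg.add (hh.smul s))
      (by simp only [e2]; exact hg2.add ((hgh.smul (2 * s)).add (hh2.smul (s ^ 2)))) x
    have m1 : moll ε (fun y => g y + s * h y) x = moll ε g x + s * moll ε h x := by
      simp only [moll, conv_apply, mul_add, mul_left_comm _ s]
      rw [integral_add (hk.integrable_conv hg x) ((hk.integrable_conv hh x).const_mul s),
        integral_const_mul]
    have m2 : moll ε (fun y => (g y + s * h y) ^ 2) x = moll ε (fun y => g y ^ 2) x
        + (2 * s * moll ε (fun y => g y * h y) x + s ^ 2 * moll ε (fun y => h y ^ 2) x) := by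
      simp only [e2]
      simp only [moll, conv_apply, mul_add, mul_left_comm _ (2 * s), mul_left_comm _ (s ^ 2)]
      rw [integral_add (hk.integrable_conv hg2 x)
        (((hk.integrable_conv hgh x).const_mul _).fun_add ((hk.integrable_conv hh2 x).const_mul _)),
        integral_add ((hk.integrable_conv hgh x).const_mul _)
          ((hk.integrable_conv hh2 x).const_mul _), integral_const_mul, integral_const_mul]
    rw [m1, m2] at h1
    simp only [mvar, mcov]
    nlinarith
  have := discrim_le_zero key
  rw [discrim] at this
  nlinarith

/-- The second moment about any value, here `g x`, is at least the variance. -/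
theorem mvar_le (hε : 0 < ε) (hg : LocallyIntegrable g volume)
    (hg2 : LocallyIntegrable (fun x => g x ^ 2) volume) (x : Plane) :
    mvar ε g x ≤ ∫ z, mollk ε z * (g (x - z) - g x) ^ 2 := by
  have hk := isTest_mollk hε
  have i1 := hk.integrable_conv hg x
  have i2 := hk.integrable_conv hg2 x
  have i3 := (integrable_mollk hε).comp_sub_left x
  have e : ∫ z, mollk ε z * (g (x - z) - g x) ^ 2 = ∫ y, mollk ε (x - y) * (g y - g x) ^ 2 := by
    rw [← integral_sub_left_eq_self (fun y => mollk ε (x - y) * (g y - g x) ^ 2) volume x]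
    simp
  have e' : ∀ y, mollk ε (x - y) * (g y - g x) ^ 2 = (mollk ε (x - y) * g y ^ 2
      - 2 * g x * (mollk ε (x - y) * g y)) + mollk ε (x - y) * g x ^ 2 := fun y => by ring
  rw [e]
  simp only [e']
  rw [integral_add (integrable_fun_sub i2 (i1.const_mul _)) (i3.mul_const _),
    integral_sub i2 (i1.const_mul _), integral_const_mul, integral_mul_const, integral_mollk_sub hε,
    ← conv_apply, ← conv_apply (mollk ε) g]
  simp only [mvar]
  change moll _ _ _ - moll _ _ _ ^ 2 ≤ moll _ _ _ - 2 * g x * moll _ _ _ + _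
  nlinarith [sq_nonneg (moll ε g x - g x)]

/-- `L²` bound for translations. -/
theorem integral_translate_sq_le (hg : ContDiff ℝ ∞ g) {z : Plane} (hz : ‖z‖ ≤ 1) :
    ∫ x in ball 0 R, (g (x - z) - g x) ^ 2 ≤ ‖z‖ ^ 2 *
      ∫ x in ball 0 (R + 1), (∂_ 0 g x ^ 2 + ∂_ 1 g x ^ 2) := by
  set G : Plane → ℝ := fun x => ∂_ 0 g x ^ 2 + ∂_ 1 g x ^ 2 with hG
  have hGc : Continuous G := ((continuous_partialDeriv 0 (contDiff_one hg)).pow 2).add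
    ((continuous_partialDeriv 1 (contDiff_one hg)).pow 2)
  have hG0 : ∀ x, 0 ≤ G x := fun x => by positivity
  have hdiff : Differentiable ℝ g := hg.differentiable (by simp)
  have pt : ∀ x, (g (x - z) - g x) ^ 2 ≤ ‖z‖ ^ 2 * ∫ s in Ioc (0 : ℝ) 1, G (x - s • z) := by
    intro x
    set p : ℝ → ℝ := fun s => fderiv ℝ g (x - s • z) (-z) with hp
    have hpc : Continuous p := by
      have : Continuous (fderiv ℝ g) := hg.continuous_fderiv (by simp)
      exact (this.comp (by fun_prop)).clm_apply continuous_const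
    have h1 : ∫ s in (0 : ℝ)..1, p s = g (x - z) - g x := by
      have := intervalIntegral.integral_eq_sub_of_hasDerivAt (a := (0 : ℝ)) (b := 1)
        (f := fun s : ℝ => g (x - s • z)) (f' := p) (fun s _ => by
          have hin : HasDerivAt (fun s : ℝ => x - s • z) (-z) s := by
            simpa using ((hasDerivAt_id s).smul_const z).const_sub x
          exact (hdiff _).hasFDerivAt.comp_hasDerivAt s hin) (hpc.intervalIntegrable _ _)
      simpa using this
    have h2 : (g (x - z) - g x) ^ 2 ≤ ∫ s in (0 : ℝ)..1, p s ^ 2 := by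
      set m := g (x - z) - g x
      have h3 : 0 ≤ ∫ s in (0 : ℝ)..1, (p s - m) ^ 2 :=
        intervalIntegral.integral_nonneg zero_le_one fun s _ => sq_nonneg _
      have h4 : ∀ s, (p s - m) ^ 2 = p s ^ 2 - 2 * m * p s + m ^ 2 := fun s => by ring
      simp only [h4] at h3
      have i1 : Continuous fun s => p s ^ 2 - 2 * m * p s := by fun_prop
      have i2 : Continuous fun s => p s ^ 2 := by fun_prop
      have i3 : Continuous fun s => 2 * m * p s := by fun_prop
      rw [intervalIntegral.integral_add (i1.intervalIntegrable _ _)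
        intervalIntegrable_const, intervalIntegral.integral_sub (i2.intervalIntegrable _ _)
        (i3.intervalIntegrable _ _), intervalIntegral.integral_const_mul,
        h1] at h3
      simp at h3
      nlinarith
    refine h2.trans ?_
    rw [intervalIntegral.integral_of_le zero_le_one, ← integral_const_mul]
    refine setIntegral_mono_on ?_ ?_ measurableSet_Ioc fun s _ => ?_
    · exact ((hpc.pow 2).integrableOn_Icc).mono_set Ioc_subset_Icc_self
    · refine (Continuous.integrableOn_Icc ?_).mono_set Ioc_subset_Icc_self
      exact continuous_const.mul (hGc.comp (by fun_prop))
    · simp only [hp, fderiv_apply_eq_sum, Fin.sum_univ_two, norm_sq_eq, hG, PiLp.neg_apply]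
      nlinarith [sq_nonneg (z 0 * ∂_ 1 g (x - s • z) - z 1 * ∂_ 0 g (x - s • z))]
  have hin : ∀ x ∈ ball (0 : Plane) R, ∀ s ∈ Ioc (0 : ℝ) 1,
      x - s • z ∈ ball (0 : Plane) (R + 1) := by
    intro x hx s hs
    rw [mem_ball_zero_iff] at *
    have : ‖s • z‖ ≤ 1 := by
      rw [norm_smul, Real.norm_eq_abs, abs_of_pos hs.1]
      nlinarith [hs.2, norm_nonneg z]
    linarith [norm_sub_le x (s • z)]
  obtain ⟨C, hC⟩ := (isCompact_closedBall (0 : Plane) (R + 1)).exists_bound_of_continuousOn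
    hGc.continuousOn
  have hfub : Integrable (fun p : Plane × ℝ => G (p.1 - p.2 • z))
      ((volume.restrict (ball 0 R)).prod (volume.restrict (Ioc (0 : ℝ) 1))) := by
    refine Integrable.of_bound (hGc.comp (by fun_prop)).aestronglyMeasurable C ?_
    rw [Measure.prod_restrict]
    filter_upwards [ae_restrict_mem (measurableSet_ball.prod measurableSet_Ioc)] with p hp
    exact hC _ (ball_subset_closedBall (hin _ hp.1 _ hp.2))
  have hcont : Continuous fun x => (g (x - z) - g x) ^ 2 := by
    have := hg.continuous
    fun_prop
  calc _ ≤ ∫ x in ball 0 R, ‖z‖ ^ 2 * ∫ s in Ioc (0 : ℝ) 1, G (x - s • z) :=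
        integral_mono (Continuous.integrableOn_ball hcont 0 R) (hfub.integral_prod_left.const_mul _) pt
    _ = ‖z‖ ^ 2 * ∫ s in Ioc (0 : ℝ) 1, ∫ x in ball 0 R, G (x - s • z) := by
        rw [integral_const_mul, integral_integral_swap hfub]
    _ ≤ _ := by
        refine mul_le_mul_of_nonneg_left ?_ (by positivity)
        have hb : ∀ s ∈ Ioc (0 : ℝ) 1, ∫ x in ball 0 R, G (x - s • z)
            ≤ ∫ x in ball 0 (R + 1), G x := by
          intro s hs
          have e1 := (measurePreserving_sub_right (volume : Measure Plane) (s • z)).setIntegral_preimage_emb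
            (MeasurableEquiv.subRight (s • z)).measurableEmbedding G
            ((fun x => x - s • z) '' ball 0 R)
          rw [Set.preimage_image_eq _ (sub_left_injective)] at e1
          rw [e1]
          refine setIntegral_mono_set (Continuous.integrableOn_ball hGc 0 _)
            (Eventually.of_forall fun x => hG0 x) (LE.le.eventuallyLE ?_)
          rintro _ ⟨x, hx, rfl⟩
          exact hin x hx s hs
        calc _ ≤ ∫ s in Ioc (0 : ℝ) 1, ∫ x in ball 0 (R + 1), G x :=
              setIntegral_mono_on hfub.integral_prod_right (by simp) measurableSet_Ioc hb
          _ = _ := by simp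

theorem exists_gradient_bound : ∃ C, 0 < C ∧ ∀ R, 1 ≤ R → ∀ f w W V, IsField f w W →
    Continuous f → (∀ x ∈ ball (0 : Plane) (2 * R), ‖f x‖ ≤ V) → ∀ n i,
      ∫ x in ball 0 R, (∂_ 0 (moll (scale n) fun y => f y i) x ^ 2
        + ∂_ 1 (moll (scale n) fun y => f y i) x ^ 2)
      ≤ (2 * W ^ 2 + C * (V + W) ^ 2) * volume.real (ball (0 : Plane) (2 * R)) := by
  obtain ⟨C, hC, H⟩ := exists_gradient_estimate
  refine ⟨2 * C, by positivity, fun R hR f w W V hf hc hV n i => ?_⟩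
  have hs : ∀ i, ContDiff ℝ ∞ (moll (scale n) fun y => f y i) :=
    fun i => contDiff_moll (scale_pos n) (hf.coord i)
  have hd : ∀ i j, Continuous (∂_ j (moll (scale n) fun y => f y i)) :=
    fun i j => continuous_partialDeriv j (contDiff_one (hs i))
  have h1 := H R (by linarith) _ _ (hs 0) (hs 1)
  have q : ∀ i j, IntegrableOn (fun x => ∂_ j (moll (scale n) fun y => f y i) x ^ 2)
    (ball 0 R) := fun i j => Continuous.integrableOn_ball ((hd i j).pow 2) 0 R
  refine le_trans ?_ (h1.trans ?_)
  · refine integral_mono ((q i 0).fun_add (q i 1))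
      ((((q 0 0).fun_add (q 0 1)).fun_add (q 1 0)).fun_add (q 1 1)) fun x => ?_
    fin_cases i <;> simp only [Fin.zero_eta, Fin.mk_one] <;> nlinarith [
      sq_nonneg (∂_ 0 (moll (scale n) fun y => f y 0) x),
      sq_nonneg (∂_ 1 (moll (scale n) fun y => f y 0) x),
      sq_nonneg (∂_ 0 (moll (scale n) fun y => f y 1) x),
      sq_nonneg (∂_ 1 (moll (scale n) fun y => f y 1) x)]
  · refine (le_abs_self _).trans ?_
    rw [← Real.norm_eq_abs]
    refine norm_setIntegral_le_of_norm_le_const measure_ball_lt_top fun x hx => ?_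
    rw [hf.div_moll (scale_pos n), hf.curl_moll (scale_pos n), Real.norm_eq_abs,
      abs_of_nonneg (by positivity)]
    have b0 := sq_le_sq' (abs_le.1 (hf.abs_moll_le_of_bound hc (hV x hx) n 0)).1
      (abs_le.1 (hf.abs_moll_le_of_bound hc (hV x hx) n 0)).2
    have b1 := sq_le_sq' (abs_le.1 (hf.abs_moll_le_of_bound hc (hV x hx) n 1)).1
      (abs_le.1 (hf.abs_moll_le_of_bound hc (hV x hx) n 1)).2
    have b2 := sq_le_sq' (abs_le.1 (hf.abs_moll_curl_le (scale_pos n) x)).1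
      (abs_le.1 (hf.abs_moll_curl_le (scale_pos n) x)).2
    have hCR : C / R ^ 2 ≤ C := div_le_self hC.le (by nlinarith)
    have : C / R ^ 2 * (moll (scale n) (fun y => f y 0) x ^ 2 + moll (scale n) (fun y => f y 1) x ^ 2)
        ≤ C * ((V + W) ^ 2 + (V + W) ^ 2) := by gcongr
    nlinarith

/-- The variance is at most an average of squared translation differences over distances below `ε`,
and these are controlled in `L²` by the gradient. The gain `ε²` is what pays for derivatives of
mollified quantities below. -/
theorem IsField.integral_mvar_le {f : Plane → Plane} {w : Plane → ℝ} {W D : ℝ} (hf : IsField f w W)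
    (hc : Continuous f) (i : Fin 2) (hD : ∀ n,
      ∫ x in ball 0 (R + 1), (∂_ 0 (moll (scale n) fun y => f y i) x ^ 2
        + ∂_ 1 (moll (scale n) fun y => f y i) x ^ 2) ≤ D) (hε : 0 < ε) (hε1 : ε ≤ 1) :
    ∫ x in ball 0 R, mvar ε (fun y => f y i) x ≤ ε ^ 2 * D := by
  have hci := Continuous.coord hc i
  have tr : ∀ z : Plane, ‖z‖ ≤ 1 →
      ∫ x in ball 0 R, (f (x - z) i - f x i) ^ 2 ≤ ‖z‖ ^ 2 * D := by
    intro z hz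
    obtain ⟨V, hV0, hV⟩ := IsField.exists_bound_ball hc (R + 1)
    have hW := hf.bound_nonneg
    have lim : Tendsto (fun n => ∫ x in ball 0 R,
        (moll (scale n) (fun y => f y i) (x - z) - moll (scale n) (fun y => f y i) x) ^ 2) atTop
        (𝓝 (∫ x in ball 0 R, (f (x - z) i - f x i) ^ 2)) := by
      refine tendsto_integral_of_dominated_convergence (fun _ => (2 * (V + W)) ^ 2) (fun n => ?_)
        (integrable_const _) (fun n => ?_) (Eventually.of_forall fun x => ?_)
      · have := (hf.moll_continuous n i)
        exact Continuous.aestronglyMeasurable (by fun_prop)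
      · filter_upwards [ae_restrict_mem measurableSet_ball] with x hx
        rw [mem_ball_zero_iff] at hx
        have h1 := hf.abs_moll_le_of_bound hc (hV x (by rw [mem_ball_zero_iff]; linarith)) n i
        have h2 := hf.abs_moll_le_of_bound hc
          (hV (x - z) (by rw [mem_ball_zero_iff]; linarith [norm_sub_le x z])) n i
        rw [Real.norm_eq_abs, abs_of_nonneg (sq_nonneg _)]
        rw [abs_le] at h1 h2
        exact sq_le_sq' (by linarith) (by linarith)
      · exact ((hf.tendsto_moll hc i (x - z)).sub (hf.tendsto_moll hc i x)).pow 2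
    refine le_of_tendsto' lim fun n => (integral_translate_sq_le
      (contDiff_moll (scale_pos n) (hf.coord i)) hz).trans ?_
    gcongr
    exact hD n
  have hk := isTest_mollk hε
  have hcont : Continuous fun p : Plane × Plane => mollk ε p.2 * (f (p.1 - p.2) i - f p.1 i) ^ 2 := by
    have := hk.continuous
    fun_prop
  have hfub : Integrable (fun p : Plane × Plane => mollk ε p.2 * (f (p.1 - p.2) i - f p.1 i) ^ 2)
      ((volume.restrict (ball 0 R)).prod volume) := by
    have : IntegrableOn (fun p : Plane × Plane => mollk ε p.2 * (f (p.1 - p.2) i - f p.1 i) ^ 2)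
        (ball 0 R ×ˢ ball 0 ε) := by
      refine (hcont.locallyIntegrable.integrableOn_isCompact ((isCompact_closedBall (0 : Plane) R).prod
        (isCompact_closedBall (0 : Plane) ε))).mono_set ?_
      exact Set.prod_mono ball_subset_closedBall ball_subset_closedBall
    have e : ball (0 : Plane) R ×ˢ (univ : Set Plane) ∩ ball (0 : Plane) R ×ˢ
        ball (0 : Plane) ε = ball (0 : Plane) R ×ˢ ball (0 : Plane) ε := by
      ext p; simp
    have h2 : IntegrableOn (fun p : Plane × Plane => mollk ε p.2 * (f (p.1 - p.2) i - f p.1 i) ^ 2)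
        (ball 0 R ×ˢ univ) := by
      refine this.of_forall_sdiff_eq_zero (measurableSet_ball.prod MeasurableSet.univ) ?_
      rintro p ⟨h1, h2⟩
      have : mollk ε p.2 = 0 := by
        by_contra h
        exact h2 ⟨h1.1, mollk_support hε h⟩
      simp [this]
    rw [IntegrableOn, Measure.volume_eq_prod, ← Measure.prod_restrict, Measure.restrict_univ] at h2
    exact h2
  have hci2 : Continuous fun y => f y i ^ 2 := hci.pow 2
  have hvc : Continuous (mvar ε fun y => f y i) :=
    (contDiff_moll hε hci2.locallyIntegrable).continuous.sub
      ((contDiff_moll hε hci.locallyIntegrable).continuous.pow 2)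
  calc _ ≤ ∫ x in ball 0 R, ∫ z, mollk ε z * (f (x - z) i - f x i) ^ 2 :=
        integral_mono (Continuous.integrableOn_ball hvc 0 R) hfub.integral_prod_left
          fun x => mvar_le hε hci.locallyIntegrable hci2.locallyIntegrable x
    _ = ∫ z, mollk ε z * ∫ x in ball 0 R, (f (x - z) i - f x i) ^ 2 := by
        rw [integral_integral_swap hfub]
        simp only [integral_const_mul]
    _ ≤ ∫ z, mollk ε z * (ε ^ 2 * D) := by
        refine integral_mono ?_ ((integrable_mollk hε).mul_const _) fun z => ?_
        · simpa only [integral_const_mul] using hfub.integral_prod_right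
        · have hD0 : 0 ≤ D := (integral_nonneg fun x => by positivity).trans (hD 0)
          by_cases h : mollk ε z = 0
          · simp [h]
          · have hz := mollk_support hε h
            rw [mem_ball_zero_iff] at hz
            refine mul_le_mul_of_nonneg_left ((tr z (by linarith)).trans ?_) (mollk_nonneg _ _)
            gcongr
    _ = _ := by rw [integral_mul_const, integral_mollk hε, one_mul]

end Variance

/-! ### Commutator estimate and the renormalized vorticity equation at a fixed time. -/

section Renormalization

variable {ε R : ℝ} {g h χ : Plane → ℝ} {β : ℝ → ℝ} {f : Plane → Plane} {w : Plane → ℝ} {W : ℝ}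

theorem continuous_mvar (hε : 0 < ε) (hg : LocallyIntegrable g volume)
    (hg2 : LocallyIntegrable (fun x => g x ^ 2) volume) : Continuous (mvar ε g) :=
  (contDiff_moll hε hg2).continuous.sub ((contDiff_moll hε hg).continuous.pow 2)

theorem continuous_mcov (hε : 0 < ε) (hg : LocallyIntegrable g volume)
    (hh : LocallyIntegrable h volume) (hgh : LocallyIntegrable (fun x => g x * h x) volume) :
    Continuous (mcov ε g h) :=
  (contDiff_moll hε hgh).continuous.sub
    ((contDiff_moll hε hg).continuous.mul (contDiff_moll hε hh).continuous)

theorem integral_abs_mcov_le (hε : 0 < ε) (hg : LocallyIntegrable g volume)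
    (hg2 : LocallyIntegrable (fun x => g x ^ 2) volume) (hh : LocallyIntegrable h volume)
    (hh2 : LocallyIntegrable (fun x => h x ^ 2) volume)
    (hgh : LocallyIntegrable (fun x => g x * h x) volume) (R : ℝ) :
    ∫ x in ball 0 R, |mcov ε g h x| ≤
      √(∫ x in ball 0 R, mvar ε g x) * √(∫ x in ball 0 R, mvar ε h x) := by
  have cg := continuous_mvar hε hg hg2
  have ch := continuous_mvar hε hh hh2
  have ng := mvar_nonneg hε hg hg2
  have nh := mvar_nonneg hε hh hh2
  have h1 := abs_integral_mul_le (memLp_two_ball (Real.continuous_sqrt.comp cg) 0 R)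
    (memLp_two_ball (Real.continuous_sqrt.comp ch) 0 R)
  simp only [Function.comp_apply, Real.sq_sqrt (ng _), Real.sq_sqrt (nh _)] at h1
  refine le_trans ?_ ((le_abs_self _).trans h1)
  refine integral_mono (Continuous.integrableOn_ball (continuous_mcov hε hg hh hgh).abs 0 R)
    (Continuous.integrableOn_ball (cg.sqrt.mul ch.sqrt) 0 R) fun x => ?_
  simp only
  rw [← Real.sqrt_mul (ng x)]
  exact Real.abs_le_sqrt (mcov_sq_le hε hg hg2 hh hh2 hgh x)

/-- The chain rule `β'(g) u · ∇g = u · ∇β(g)` in weak form. The two integrands differ by the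
divergence of `χ β'(g) g u - χ β(g) u`. -/
theorem integral_renormalized_smooth {u₀ u₁ : Plane → ℝ} (h₀ : ContDiff ℝ ∞ u₀)
    (h₁ : ContDiff ℝ ∞ u₁) (hg : ContDiff ℝ ∞ g) (hχ : IsTest χ) (hβ : ContDiff ℝ ∞ β)
    (hdiv : ∀ x, ∂_ 0 u₀ x + ∂_ 1 u₁ x = 0) :
    ∫ x, (∂_ 0 (fun y => χ y * deriv β (g y)) x * (g x * u₀ x)
        + ∂_ 1 (fun y => χ y * deriv β (g y)) x * (g x * u₁ x))
      = ∫ x, β (g x) * (u₀ x * ∂_ 0 χ x + u₁ x * ∂_ 1 χ x) := by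
  have hβ' : ContDiff ℝ ∞ (deriv β) := (contDiff_infty_iff_deriv.1 hβ).2
  have hb : IsTest fun y => χ y * deriv β (g y) := hχ.mul_right (hβ'.comp hg)
  have hβg : ContDiff ℝ ∞ fun y => β (g y) := hβ.comp hg
  have hcg : IsTest fun y => χ y * β (g y) := hχ.mul_right hβg
  have hP : ∀ u, ContDiff ℝ ∞ u → IsTest fun x =>
      (χ x * deriv β (g x)) * (g x * u x) - χ x * β (g x) * u x :=
    fun u hu => (hb.mul_right (hg.mul hu)).sub (hcg.mul_right hu)
  have df : ∀ {u : Plane → ℝ}, ContDiff ℝ ∞ u → Differentiable ℝ u :=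
    fun hu => hu.differentiable (by simp)
  have dP : ∀ u, ContDiff ℝ ∞ u → ∀ i x, ∂_ i (fun x =>
      (χ x * deriv β (g x)) * (g x * u x) - χ x * β (g x) * u x) x
      = ∂_ i (fun y => χ y * deriv β (g y)) x * (g x * u x)
        + χ x * deriv β (g x) * (∂_ i g x * u x + g x * ∂_ i u x)
        - ((∂_ i χ x * β (g x) + χ x * (deriv β (g x) * ∂_ i g x)) * u x
          + χ x * β (g x) * ∂_ i u x) := by
    intro u hu i x
    rw [partialDeriv_sub i (df (hb.mul_right (hg.mul hu)).1 x) (df (hcg.mul_right hu).1 x),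
      partialDeriv_mul i (df hb.1 x) (df (hg.mul hu) x), partialDeriv_mul i (df hg x) (df hu x),
      partialDeriv_mul i (df hcg.1 x) (df hu x), partialDeriv_mul i (df hχ.1 x) (df hβg x),
      partialDeriv_comp i (hβ.differentiable (by simp) _) (df hg x)]
  refine integral_eq_of_sub_eq_div ?_ ?_ (contDiff_one (hP _ h₀).1) (contDiff_one (hP _ h₁).1)
    (hP _ h₀).2 (hP _ h₁).2 fun x => ?_
  · exact ((hb.partialDeriv 0).integrable_mul (hg.mul h₀).continuous.locallyIntegrable).fun_add
      ((hb.partialDeriv 1).integrable_mul (hg.mul h₁).continuous.locallyIntegrable)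
  · have t := ((hχ.partialDeriv 0).mul_left h₀).add ((hχ.partialDeriv 1).mul_left h₁)
    exact (t.mul_left hβg).continuous.integrable_of_hasCompactSupport (t.mul_left hβg).2
  · rw [dP _ h₀, dP _ h₁]
    have := hdiv x
    linear_combination (-(χ x * deriv β (g x)) * g x + χ x * β (g x)) * this

theorem exists_partialDeriv_moll_le : ∃ C, 0 < C ∧ ∀ ε, 0 < ε → ∀ w : Plane → ℝ, ∀ W,
    0 ≤ W → LocallyIntegrable w volume → ∀ x, (∀ᵐ y, y ∈ closedBall x ε → |w y| ≤ W) → ∀ i,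
      |∂_ i (moll ε w) x| ≤ C * W / ε := by
  set I : Fin 2 → ℝ := fun i => ∫ z, |∂_ i rawBump z| with hI
  have hI0 : ∀ i, 0 ≤ I i := fun i => integral_nonneg fun z => abs_nonneg _
  have hrt : ∀ i, IsTest (∂_ i rawBump) := fun i =>
    IsTest.partialDeriv i ⟨contDiff_rawBump, rawBump_hasCompactSupport⟩
  have hri : ∀ i, Integrable (fun z => |∂_ i rawBump z|) := fun i =>
    ((hrt i).continuous.integrable_of_hasCompactSupport (hrt i).2).abs
  refine ⟨bumpMass⁻¹ * (I 0 + I 1 + 1), mul_pos (inv_pos.2 bumpMass_pos)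
    (by linarith [hI0 0, hI0 1]), fun ε hε w W hW hw x hb i => ?_⟩
  have hk := isTest_mollk hε
  have e1 : ∫ y, |∂_ i (mollk ε) (x - y)| = bumpMass⁻¹ * I i / ε := by
    rw [integral_sub_left_eq_self (fun y => |∂_ i (mollk ε) y|) volume x]
    simp only [partialDeriv_mollk, abs_mul]
    rw [integral_const_mul, integral_const_mul,
      integral_comp_inv_smul_plane hε (fun z => |∂_ i rawBump z|),
      abs_of_pos (inv_pos.2 (mul_pos (pow_pos hε 2) bumpMass_pos)), abs_of_pos (inv_pos.2 hε)]
    have := bumpMass_pos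
    field_simp
    rfl
  rw [moll, partialDeriv_conv i hk hw, conv_apply, ← Real.norm_eq_abs]
  calc _ ≤ ∫ y, |∂_ i (mollk ε) (x - y)| * W := by
        refine norm_integral_le_of_norm_le ?_ ?_
        · have t := (hk.partialDeriv i).comp_const_sub x
          exact (t.continuous.integrable_of_hasCompactSupport t.2).abs.mul_const W
        · filter_upwards [hb] with y hy
          rw [Real.norm_eq_abs, abs_mul]
          by_cases h : ∂_ i (mollk ε) (x - y) = 0
          · simp [h]
          · refine mul_le_mul_of_nonneg_left (hy ?_) (abs_nonneg _)
            have h1 := (closure_mono ((mollk_support hε).trans ball_subset_closedBall)).trans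
              isClosed_closedBall.closure_subset
              (partialDeriv_support_subset i _ (subset_tsupport _ h))
            simpa [dist_eq_norm, norm_sub_rev] using h1
    _ = bumpMass⁻¹ * I i * W / ε := by rw [integral_mul_const, e1]; ring
    _ ≤ _ := by
        have := bumpMass_pos
        gcongr
        fin_cases i
        · simp only [Fin.zero_eta]; linarith [hI0 1]
        · simp only [Fin.mk_one]; linarith [hI0 0]

theorem IsField.locallyIntegrable_sq (hf : IsField f w W) :
    LocallyIntegrable (fun x => w x ^ 2) volume := by
  refine (hf.wLoc.smul W).mono (hf.wLoc.aestronglyMeasurable.pow 2) ?_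
  filter_upwards [hf.bound] with x hx
  simp only [Pi.smul_apply, smul_eq_mul, Real.norm_eq_abs, abs_pow, abs_mul,
    abs_of_nonneg hf.bound_nonneg]
  nlinarith [abs_nonneg (w x)]

theorem IsField.locallyIntegrable_mul (hf : IsField f w W) (hc : Continuous f) (i : Fin 2) :
    LocallyIntegrable (fun x => w x * f x i) volume := by
  have hci := Continuous.coord hc i
  refine ((hci.abs.locallyIntegrable (μ := volume)).smul W).mono
    (hf.wLoc.aestronglyMeasurable.mul hci.aestronglyMeasurable) ?_
  filter_upwards [hf.bound] with x hx
  simp only [Pi.smul_apply, smul_eq_mul, Real.norm_eq_abs, abs_mul, abs_abs,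
    abs_of_nonneg hf.bound_nonneg]
  gcongr

theorem IsField.mvar_le_sq (hf : IsField f w W) (hε : 0 < ε) (x : Plane) : mvar ε w x ≤ W ^ 2 := by
  have : |moll ε (fun y => w y ^ 2) x| ≤ W ^ 2 := abs_moll_le hε (by
    filter_upwards [hf.bound] with y hy _
    rw [abs_pow]
    gcongr)
  rw [mvar]
  nlinarith [le_abs_self (moll ε (fun y => w y ^ 2) x), sq_nonneg (moll ε w x)]

theorem IsField.tendsto_integral_mvar (hf : IsField f w W) (R : ℝ) :
    Tendsto (fun n => ∫ x in ball 0 R, mvar (scale n) w x) atTop (𝓝 0) := by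
  have : Tendsto (fun n => ∫ x in ball 0 R, mvar (scale n) w x) atTop
      (𝓝 (∫ x in ball (0 : Plane) R, (0 : ℝ))) := by
    refine tendsto_integral_of_dominated_convergence (fun _ => W ^ 2) (fun n => (continuous_mvar
      (scale_pos n) hf.wLoc hf.locallyIntegrable_sq).aestronglyMeasurable) (integrable_const _)
      (fun n => Eventually.of_forall fun x => ?_) (ae_restrict_of_ae ?_)
    · rw [Real.norm_eq_abs, abs_of_nonneg (mvar_nonneg (scale_pos n) hf.wLoc hf.locallyIntegrable_sq x)]
      exact hf.mvar_le_sq (scale_pos n) x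
    · filter_upwards [ae_tendsto_moll_scale hf.wLoc, ae_tendsto_moll_scale hf.locallyIntegrable_sq]
        with x h1 h2
      simpa [mvar] using h2.sub (h1.pow 2)
  simpa using this

/-- The mollified divergence of the vorticity flux. -/
def vortFlux (ε : ℝ) (f : Plane → Plane) (w : Plane → ℝ) (x : Plane) : ℝ :=
  -(∂_ 0 (moll ε fun y => w y * f y 0) x + ∂_ 1 (moll ε fun y => w y * f y 1) x)

/-- The error in the renormalized vorticity equation. -/
theorem exists_renormalization_error (hχ : IsTest χ) (hR : tsupport χ ⊆ ball 0 R)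
    (hβ : ContDiff ℝ ∞ β) (W : ℝ) : ∃ c, 0 ≤ c ∧ ∀ f w D, IsField f w W → Continuous f →
    (∀ n i, ∫ x in ball 0 (R + 1), (∂_ 0 (moll (scale n) fun y => f y i) x ^ 2
        + ∂_ 1 (moll (scale n) fun y => f y i) x ^ 2) ≤ D) → ∀ n,
    |(∫ x, χ x * (deriv β (moll (scale n) w x) * vortFlux (scale n) f w x))
      - ∫ x, β (moll (scale n) w x) * (moll (scale n) (fun y => f y 0) x * ∂_ 0 χ x
        + moll (scale n) (fun y => f y 1) x * ∂_ 1 χ x)|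
      ≤ c * √D * √(∫ x in ball 0 R, mvar (scale n) w x) := by
  obtain ⟨C, hC, H⟩ := exists_partialDeriv_moll_le
  have hβ' : ContDiff ℝ ∞ (deriv β) := (contDiff_infty_iff_deriv.1 hβ).2
  have hβ'' : ContDiff ℝ ∞ (deriv (deriv β)) := (contDiff_infty_iff_deriv.1 hβ').2
  obtain ⟨b₁, hb₁⟩ := (isCompact_Icc (a := -W) (b := W)).exists_bound_of_continuousOn
    hβ'.continuous.continuousOn
  obtain ⟨b₂, hb₂⟩ := (isCompact_Icc (a := -W) (b := W)).exists_bound_of_continuousOn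
    hβ''.continuous.continuousOn
  obtain ⟨x₀, hx₀⟩ := hχ.continuous.bounded_above_of_compact_support hχ.2
  obtain ⟨x₁, hx₁⟩ := (hχ.partialDeriv 0).continuous.bounded_above_of_compact_support
    (hχ.partialDeriv 0).2
  obtain ⟨x₂, hx₂⟩ := (hχ.partialDeriv 1).continuous.bounded_above_of_compact_support
    (hχ.partialDeriv 1).2
  set c := (|x₁| + |x₂|) * |b₁| + |x₀| * (|b₂| * (C * |W|)) with hc0
  refine ⟨2 * c, by positivity, fun f w D hf hc hD n => ?_⟩
  have hε := scale_pos n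
  have hε1 := scale_le_one n
  set ε := scale n with hεn
  have hm := contDiff_moll hε hf.wLoc
  have hu : ∀ i, ContDiff ℝ ∞ (moll ε fun y => f y i) := fun i => contDiff_moll hε (hf.coord i)
  have hP : ∀ i, ContDiff ℝ ∞ (moll ε fun y => w y * f y i) :=
    fun i => contDiff_moll hε (hf.locallyIntegrable_mul hc i)
  have hwb := fun x => abs_le.1 (hf.abs_moll_curl_le hε x)
  have hβm : ContDiff ℝ ∞ fun y => deriv β (moll ε w y) := hβ'.comp hm
  have hb : IsTest fun y => χ y * deriv β (moll ε w y) := hχ.mul_right hβm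
  set b := fun y => χ y * deriv β (moll ε w y) with hbdef
  have hbs : ∀ i, Function.support (∂_ i b) ⊆ ball 0 R := fun i =>
    support_partialDeriv_subset i ((tsupport_mul_subset_left).trans hR)
  have hbd : ∀ i x, |∂_ i b x| ≤ c / ε := by
    intro i x
    have e : ∂_ i b x = ∂_ i χ x * deriv β (moll ε w x)
        + χ x * (deriv (deriv β) (moll ε w x) * ∂_ i (moll ε w) x) := by
      rw [hbdef, partialDeriv_mul i (hχ.1.differentiable (by simp) x)
        (hβm.differentiable (by simp) x),
        partialDeriv_comp i (hβ'.differentiable (by simp) _) (hm.differentiable (by simp) x)]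
    have h1 : |∂_ i χ x| ≤ |x₁| + |x₂| := by
      fin_cases i
      · exact (hx₁ x).trans (by linarith [le_abs_self x₁, abs_nonneg x₂])
      · exact (hx₂ x).trans (by linarith [le_abs_self x₂, abs_nonneg x₁])
    have h2 := (hb₁ _ (hwb x)).trans (le_abs_self b₁)
    have h3 := (hb₂ _ (hwb x)).trans (le_abs_self b₂)
    have h4 := (hx₀ x).trans (le_abs_self x₀)
    have h5 := (H ε hε w W hf.bound_nonneg hf.wLoc x
      (hf.bound.mono fun _ h _ => h) i).trans
      (by gcongr; exact le_abs_self W : C * W / ε ≤ C * |W| / ε)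
    rw [Real.norm_eq_abs] at h2 h3 h4
    rw [e]
    calc _ ≤ |∂_ i χ x| * |deriv β (moll ε w x)|
          + |χ x| * (|deriv (deriv β) (moll ε w x)| * |∂_ i (moll ε w) x|) := by
          rw [← abs_mul, ← abs_mul, ← abs_mul]; exact abs_add_le _ _
      _ ≤ (|x₁| + |x₂|) * |b₁| + |x₀| * (|b₂| * (C * |W| / ε)) := by gcongr
      _ ≤ (|x₁| + |x₂|) * |b₁| / ε + |x₀| * (|b₂| * (C * |W| / ε)) := by
          gcongr
          exact le_div_self (by positivity) hε hε1
      _ = _ := by rw [hc0]; ring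
  -- The gradient of `b` contains the gradient of the mollified vorticity, of size `1/ε`. By
  -- Cauchy-Schwarz the covariance contributes `ε √D` from the velocity, which cancels it, and the
  -- root of the variance of the vorticity, which is the factor that will tend to zero.
  have hcov : ∀ i, |∫ x, ∂_ i b x * mcov ε w (fun y => f y i) x|
      ≤ c * √D * √(∫ x in ball 0 R, mvar ε w x) := by
    intro i
    have hci := Continuous.coord hc i
    have l2 : LocallyIntegrable (fun y => f y i ^ 2) volume := (hci.pow 2).locallyIntegrable
    have hcc := continuous_mcov hε hf.wLoc (hf.coord i) (hf.locallyIntegrable_mul hc i)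
    rw [integral_eq_ball (R := R) ((Function.support_mul_subset_left _ _).trans (hbs i)),
      ← Real.norm_eq_abs]
    calc _ ≤ ∫ x in ball 0 R, c / ε * |mcov ε w (fun y => f y i) x| := by
          refine norm_integral_le_of_norm_le (Continuous.integrableOn_ball
            (continuous_const.mul hcc.abs) 0 R) (Eventually.of_forall fun x => ?_)
          rw [Real.norm_eq_abs, abs_mul]
          gcongr
          exact hbd i x
      _ ≤ c / ε * (√(∫ x in ball 0 R, mvar ε w x) * √(ε ^ 2 * D)) := by
          rw [integral_const_mul]
          refine mul_le_mul_of_nonneg_left ((integral_abs_mcov_le hε hf.wLoc hf.locallyIntegrable_sq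
            (hf.coord i) l2 (hf.locallyIntegrable_mul hc i) R).trans ?_) (by positivity)
          gcongr
          exact hf.integral_mvar_le hc i (fun m => hD m i) hε hε1
      _ = _ := by
          rw [Real.sqrt_mul (by positivity), Real.sqrt_sq hε.le]
          field_simp
  have hint : ∀ i {k : Plane → ℝ}, Continuous k → Integrable fun x => ∂_ i b x * k x :=
    fun i k hk => (hb.partialDeriv i).integrable_mul hk.locallyIntegrable
  have e1 : ∫ x, χ x * (deriv β (moll ε w x) * vortFlux ε f w x)
      = ∫ x, (∂_ 0 b x * moll ε (fun y => w y * f y 0) x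
        + ∂_ 1 b x * moll ε (fun y => w y * f y 1) x) := by
    rw [integral_add (hint 0 (hP 0).continuous) (hint 1 (hP 1).continuous)]
    have ibp := fun i => integral_mul_partialDeriv i (contDiff_one hb.1) (contDiff_one (hP i))
      (Or.inl hb.2)
    rw [← neg_eq_iff_eq_neg.2 (ibp 0), ← neg_eq_iff_eq_neg.2 (ibp 1), ← neg_add, ← integral_add
      (hb.integrable_mul (continuous_partialDeriv 0 (contDiff_one (hP 0))).locallyIntegrable)
      (hb.integrable_mul (continuous_partialDeriv 1 (contDiff_one (hP 1))).locallyIntegrable),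
      ← integral_neg]
    refine integral_congr_ae (Eventually.of_forall fun x => ?_)
    simp only [hbdef, vortFlux]
    ring
  have e2 := integral_renormalized_smooth (hu 0) (hu 1) hm hχ hβ (hf.div_moll hε)
  rw [← e2, e1, ← integral_sub ((hint 0 (hP 0).continuous).fun_add (hint 1 (hP 1).continuous))
    ((hint 0 (hm.mul (hu 0)).continuous).fun_add (hint 1 (hm.mul (hu 1)).continuous))]
  have e3 : ∀ x, ∂_ 0 b x * moll ε (fun y => w y * f y 0) x
        + ∂_ 1 b x * moll ε (fun y => w y * f y 1) x
      - (∂_ 0 b x * (moll ε w x * moll ε (fun y => f y 0) x)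
        + ∂_ 1 b x * (moll ε w x * moll ε (fun y => f y 1) x))
      = ∂_ 0 b x * mcov ε w (fun y => f y 0) x
        + ∂_ 1 b x * mcov ε w (fun y => f y 1) x := fun x => by
    simp only [mcov]; ring
  rw [integral_congr_ae (Eventually.of_forall e3), integral_add
    (hint 0 (continuous_mcov hε hf.wLoc (hf.coord 0) (hf.locallyIntegrable_mul hc 0)))
    (hint 1 (continuous_mcov hε hf.wLoc (hf.coord 1) (hf.locallyIntegrable_mul hc 1)))]
  exact (abs_add_le _ _).trans (by linarith [hcov 0, hcov 1])

theorem exists_class_gradient_bound {α M : ℝ} (hα : 0 ≤ α) (hα' : α < 1 / 2) (hR : 0 < R) :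
    ∃ D, ∀ f, InClass α M f → ∀ n i,
      ∫ x in ball 0 (R + 1), (∂_ 0 (moll (scale n) fun y => f y i) x ^ 2
        + ∂_ 1 (moll (scale n) fun y => f y i) x ^ 2) ≤ D := by
  obtain ⟨C, hC, H⟩ := exists_gradient_bound
  obtain ⟨A, hA, hlin⟩ := exists_norm_le_linear
  refine ⟨_, fun f hf n i => H (R + 1) (by linarith) f _ M (A * M * (1 + 2 * (R + 1))) hf.field
    hf.cont (fun x hx => (hlin f _ M α hf.field hf.cont hα (by linarith) hf.bound x).trans ?_) n i⟩
  have hM := hf.field.bound_nonneg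
  have := (mem_ball_zero_iff.1 hx).le
  gcongr

/-- Uniformity in `n` and over the class makes this the majorant for dominated convergence in time.
-/
theorem exists_vortFlux_bound {α M : ℝ} (hα : 0 ≤ α) (hα' : α < 1 / 2) (hχ : IsTest χ)
    (hβ : ContDiff ℝ ∞ β) : ∃ K, ∀ f, InClass α M f → ∀ n,
      |∫ x, χ x * (deriv β (moll (scale n) (curlRep f) x) * vortFlux (scale n) f (curlRep f) x)|
        ≤ K := by
  obtain ⟨R, hR, hs⟩ := exists_ball_of_hasCompactSupport hχ.2
  obtain ⟨D, hD⟩ := exists_class_gradient_bound (M := M) hα hα' hR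
  obtain ⟨c, hc, H⟩ := exists_renormalization_error hχ hs hβ M
  obtain ⟨A, hA, hlin⟩ := exists_norm_le_linear
  obtain ⟨b, hb⟩ := (isCompact_Icc (a := -M) (b := M)).exists_bound_of_continuousOn
    hβ.continuous.continuousOn
  obtain ⟨x₁, hx₁⟩ := (hχ.partialDeriv 0).continuous.bounded_above_of_compact_support
    (hχ.partialDeriv 0).2
  obtain ⟨x₂, hx₂⟩ := (hχ.partialDeriv 1).continuous.bounded_above_of_compact_support
    (hχ.partialDeriv 1).2
  set V := A * M * (1 + R) + M
  refine ⟨c * √D * √(M ^ 2 * volume.real (ball (0 : Plane) R))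
    + |b| * (|V| * |x₁| + |V| * |x₂|) * volume.real (ball (0 : Plane) R),
    fun f hf n => ?_⟩
  have h1 := H f _ D hf.field hf.cont (hD f hf) n
  have h2 : ∫ x in ball 0 R, mvar (scale n) (curlRep f) x
      ≤ M ^ 2 * volume.real (ball (0 : Plane) R) := by
    refine (le_abs_self _).trans ?_
    rw [← Real.norm_eq_abs]
    refine norm_setIntegral_le_of_norm_le_const measure_ball_lt_top fun x _ => ?_
    rw [Real.norm_eq_abs, abs_of_nonneg (mvar_nonneg (scale_pos n) hf.field.wLoc
      hf.field.locallyIntegrable_sq x)]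
    exact hf.field.mvar_le_sq (scale_pos n) x
  have h3 : |∫ x, β (moll (scale n) (curlRep f) x)
      * (moll (scale n) (fun y => f y 0) x * ∂_ 0 χ x
        + moll (scale n) (fun y => f y 1) x * ∂_ 1 χ x)|
      ≤ |b| * (|V| * |x₁| + |V| * |x₂|) * volume.real (ball (0 : Plane) R) := by
    rw [integral_eq_ball (R := R), ← Real.norm_eq_abs]
    · refine norm_setIntegral_le_of_norm_le_const measure_ball_lt_top fun x hx => ?_
      have hfx : ‖f x‖ ≤ A * M * (1 + R) := by
        have hM := hf.field.bound_nonneg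
        have := (mem_ball_zero_iff.1 hx).le
        refine (hlin f _ M α hf.field hf.cont hα (by linarith) hf.bound x).trans ?_
        gcongr
      have m := fun i => (hf.field.abs_moll_le_of_bound hf.cont hfx n i).trans (le_abs_self V)
      have hβb := (hb _ (abs_le.1 (hf.field.abs_moll_curl_le (scale_pos n) x))).trans
        (le_abs_self b)
      have h4 := (hx₁ x).trans (le_abs_self _)
      have h5 := (hx₂ x).trans (le_abs_self _)
      rw [norm_mul]
      refine mul_le_mul hβb ((norm_add_le _ _).trans ?_) (norm_nonneg _) (abs_nonneg _)
      rw [norm_mul, norm_mul]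
      exact add_le_add (mul_le_mul (m 0) h4 (norm_nonneg _) (abs_nonneg _))
        (mul_le_mul (m 1) h5 (norm_nonneg _) (abs_nonneg _))
    · intro x hx
      by_contra h
      have h0 := fun i => Function.notMem_support.1
        (fun h' => h (support_partialDeriv_subset i hs h') : x ∉ _)
      exact hx (by simp [h0])
  have h4 : c * √D * √(∫ x in ball 0 R, mvar (scale n) (curlRep f) x)
      ≤ c * √D * √(M ^ 2 * volume.real (ball (0 : Plane) R)) := by gcongr
  rw [abs_le] at *
  constructor <;> linarith [h1.1, h1.2, h3.1, h3.2]

theorem InClass.tendsto_vortFlux {α M : ℝ} (hf : InClass α M f) (hα : 0 ≤ α) (hα' : α < 1 / 2)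
    (hχ : IsTest χ) (hβ : ContDiff ℝ ∞ β) :
    Tendsto (fun n => ∫ x, χ x * (deriv β (moll (scale n) (curlRep f) x)
        * vortFlux (scale n) f (curlRep f) x)) atTop
      (𝓝 (∫ x, β (curlRep f x) * (f x 0 * ∂_ 0 χ x + f x 1 * ∂_ 1 χ x))) := by
  obtain ⟨R, hR, hs⟩ := exists_ball_of_hasCompactSupport hχ.2
  obtain ⟨D, hD⟩ := exists_class_gradient_bound (M := M) hα hα' hR
  obtain ⟨c, hc, H⟩ := exists_renormalization_error hχ hs hβ M
  obtain ⟨b, hb⟩ := (isCompact_Icc (a := -M) (b := M)).exists_bound_of_continuousOn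
    hβ.continuous.continuousOn
  obtain ⟨V, hV0, hV⟩ := IsField.exists_bound_ball hf.cont R
  have hM := hf.field.bound_nonneg
  have hm := fun n => contDiff_moll (scale_pos n) hf.field.wLoc
  have d := fun i => (hχ.partialDeriv i).continuous
  have d0 : ∀ i x, x ∉ ball (0 : Plane) R → ∂_ i χ x = 0 := fun i x h =>
    Function.notMem_support.1 fun h' => h (support_partialDeriv_subset i hs h')
  have lim : Tendsto (fun n => ∫ x, β (moll (scale n) (curlRep f) x)
      * (moll (scale n) (fun y => f y 0) x * ∂_ 0 χ x
        + moll (scale n) (fun y => f y 1) x * ∂_ 1 χ x)) atTop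
      (𝓝 (∫ x, β (curlRep f x) * (f x 0 * ∂_ 0 χ x + f x 1 * ∂_ 1 χ x))) := by
    refine tendsto_integral_of_dominated_convergence (fun x => |b| * ((V + M) * |∂_ 0 χ x|
      + (V + M) * |∂_ 1 χ x|)) (fun n => ?_) ?_ (fun n => ?_) ?_
    · have h0 := hf.field.moll_continuous n 0
      have h1 := hf.field.moll_continuous n 1
      exact ((hβ.continuous.comp (hm n).continuous).mul
        ((h0.mul (d 0)).add (h1.mul (d 1)))).aestronglyMeasurable
    · have q : ∀ i, Integrable fun x => |∂_ i χ x| := fun i => ((d i).integrable_of_hasCompactSupport (hχ.partialDeriv i).2).abs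
      exact (((q 0).const_mul _).fun_add ((q 1).const_mul _)).const_mul _
    · refine Eventually.of_forall fun x => ?_
      by_cases hx : x ∈ ball (0 : Plane) R
      · have m := fun i => hf.field.abs_moll_le_of_bound hf.cont (hV x hx) n i
        have hβb := (hb _ (abs_le.1 (hf.field.abs_moll_curl_le (scale_pos n) x))).trans
          (le_abs_self b)
        rw [norm_mul]
        refine mul_le_mul hβb ((norm_add_le _ _).trans ?_) (norm_nonneg _) (abs_nonneg _)
        rw [norm_mul, norm_mul]
        exact add_le_add (mul_le_mul_of_nonneg_right (m 0) (norm_nonneg _))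
          (mul_le_mul_of_nonneg_right (m 1) (norm_nonneg _))
      · simp [d0 _ x hx]
    · filter_upwards [ae_tendsto_moll_scale hf.field.wLoc] with x hx
      exact ((hβ.continuous.tendsto _).comp hx).mul
        (((hf.field.tendsto_moll hf.cont 0 x).mul_const _).add
          ((hf.field.tendsto_moll hf.cont 1 x).mul_const _))
  have err : Tendsto (fun n => c * √D * √(∫ x in ball 0 R, mvar (scale n) (curlRep f) x))
      atTop (𝓝 0) := by
    simpa using ((Real.continuous_sqrt.tendsto _).comp
      (hf.field.tendsto_integral_mvar R)).const_mul (c * √D)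
  have := (squeeze_zero_norm (fun n => H f _ D hf.field hf.cont (hD f hf) n) err).add lim
  simpa using this

/-- The test field is a rotated gradient of the mollifier. It is divergence-free, so the pressure
drops out, and the momentum flux becomes the flux of the vorticity by `integral_flux`. -/
theorem InClass.momForm_eq_vortFlux {α M : ℝ} {θ : Plane → ℝ} (hf : InClass α M f) (hα : 0 ≤ α)
    (hα' : α < 1 / 2) (hθ : IsCutoff θ) (hε : 0 < ε) (x : Plane) :
    momForm f (∂_ 1 fun y => mollk ε (x - y))
        (fun y => -∂_ 0 (fun y => mollk ε (x - y)) y) = vortFlux ε f (curlRep f) x := by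
  set φ : Plane → ℝ := fun y => mollk ε (x - y) with hφd
  have hφ : IsTest φ := (isTest_mollk hε).comp_const_sub x
  have t₀ := hφ.partialDeriv 1
  have t₁ := hφ.partialDeriv 0
  have en : (fun y => -∂_ 0 φ y) = fun y => (-1 : ℝ) * ∂_ 0 φ y := by
    ext y; ring
  have t₂ : IsTest fun y => -∂_ 0 φ y := ⟨t₁.1.neg, t₁.2.neg⟩
  have dn : ∀ i y, ∂_ i (fun y => -∂_ 0 φ y) y
      = -∂_ i (∂_ 0 φ) y := by
    intro i y
    rw [en, partialDeriv_const_mul i _ (t₁.1.differentiable (by simp) y)]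
    ring
  have hp : pressForm 0 (∂_ 1 φ) f + pressForm 1 (fun y => -∂_ 0 φ y) f = 0 :=
    pressForm_of_div_eq_zero (hf.farIntegrable hα hα') hf.cont hθ t₀ t₂ fun y => by
      rw [dn, partialDeriv_comm 0 1 hφ.1]; ring
  have hflux : fluxForm f (∂_ 1 φ) (fun y => -∂_ 0 φ y)
      = ∫ y, curlRep f y * (f y 0 * ∂_ 0 φ y + f y 1 * ∂_ 1 φ y) := by
    rw [← hf.field.integral_flux hf.cont hφ, fluxForm]
    simp only [dn, mul_neg, ← sub_eq_add_neg]
  rw [momForm, hp, sub_zero, hflux, vortFlux]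
  have hl := hf.field.locallyIntegrable_mul hf.cont
  have hi := fun i => (hφ.partialDeriv i).integrable_mul (hl i)
  have e : ∀ i, ∂_ i (moll ε fun y => curlRep f y * f y i) x
      = -∫ y, ∂_ i φ y * (curlRep f y * f y i) := by
    intro i
    rw [moll, partialDeriv_conv i (isTest_mollk hε) (hl i), conv_apply, ← integral_neg]
    refine integral_congr_ae (Eventually.of_forall fun y => ?_)
    simp only [hφd, partialDeriv_const_sub]; ring
  rw [e, e, ← neg_add, neg_neg, ← integral_add (hi 0) (hi 1)]
  refine integral_congr_ae (Eventually.of_forall fun y => ?_)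
  simp only
  ring

end Renormalization

/-! ### The vorticity equation in time and the maximum principle. -/

section VorticityFlow

variable {X : Type*} [MeasurableSpace X]

theorem stronglyMeasurable_partialDeriv_moll {ε : ℝ} (hε : 0 < ε) {g : X → Plane → ℝ}
    (hg : StronglyMeasurable (Function.uncurry g)) (hl : ∀ t, LocallyIntegrable (g t) volume)
    (i : Fin 2) : StronglyMeasurable (Function.uncurry fun t => ∂_ i (moll ε (g t))) := by
  have e : (Function.uncurry fun t => ∂_ i (moll ε (g t)))
      = Function.uncurry fun t => conv (∂_ i (mollk ε)) (g t) := by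
    ext p
    exact partialDeriv_conv i (isTest_mollk hε) (hl p.1) p.2
  rw [e]
  exact stronglyMeasurable_conv ((isTest_mollk hε).partialDeriv i).continuous hg

theorem stronglyMeasurable_curlRep {v : X → Plane → Plane}
    (hv : StronglyMeasurable (Function.uncurry v))
    (hl : ∀ t i, LocallyIntegrable (fun y => v t y i) volume) :
    StronglyMeasurable (Function.uncurry fun t => curlRep (v t)) :=
  StronglyMeasurable.limUnder fun n =>
    (stronglyMeasurable_partialDeriv_moll (scale_pos n) (stronglyMeasurable_coord hv 1)
      (fun t => hl t 1) 0).sub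
    (stronglyMeasurable_partialDeriv_moll (scale_pos n) (stronglyMeasurable_coord hv 0)
      (fun t => hl t 0) 1)

theorem exists_vortFlux_le {α M R ε : ℝ} (hα : 0 ≤ α) (hα' : α < 1 / 2) (hR : 0 < R) (hε : 0 < ε)
    (hε1 : ε ≤ 1) : ∃ K, ∀ f, InClass α M f → ∀ x ∈ ball (0 : Plane) R,
      |vortFlux ε f (curlRep f) x| ≤ K := by
  obtain ⟨C, hC, H⟩ := exists_partialDeriv_moll_le
  obtain ⟨A, hA, hlin⟩ := exists_norm_le_linear
  set V := A * M * (2 + R) with hV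
  refine ⟨C * (M * V) / ε + C * (M * V) / ε, fun f hf x hx => ?_⟩
  have hM := hf.field.bound_nonneg
  rw [mem_ball_zero_iff] at hx
  have h : ∀ i, |∂_ i (moll ε fun y => curlRep f y * f y i) x| ≤ C * (M * V) / ε := by
    intro i
    refine H ε hε _ _ (by positivity) (hf.field.locallyIntegrable_mul hf.cont i) x ?_ i
    filter_upwards [hf.field.bound] with y hy hyx
    have h1 : ‖y‖ ≤ 1 + R := by
      rw [mem_closedBall_iff_norm] at hyx
      linarith [norm_le_norm_add_norm_sub' y x]
    have h2 := (PiLp.norm_apply_le (f y) i).trans (hlin f _ M α hf.field hf.cont hα (by linarith)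
      hf.bound y)
    rw [Real.norm_eq_abs] at h2
    rw [abs_mul]
    refine mul_le_mul hy (h2.trans ?_) (abs_nonneg _) hM
    rw [hV]
    exact mul_le_mul_of_nonneg_left (by linarith) (by positivity)
  rw [vortFlux, abs_neg]
  exact (abs_add_le _ _).trans (add_le_add (h 0) (h 1))

variable {α M T W : ℝ} {v₀ : Plane → Plane} {v : ℝ → Plane → Plane} {w₀ : Plane → ℝ} {χ : Plane → ℝ}
  {β : ℝ → ℝ} {θ : Plane → ℝ}

theorem IsFlow.coord_locallyIntegrable (hv : IsFlow α M T v₀ v) (t : ℝ) (i : Fin 2) :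
    LocallyIntegrable (fun y => v t y i) volume := (hv.inClass t).field.coord i

theorem IsFlow.stronglyMeasurable_vorticity (hv : IsFlow α M T v₀ v) :
    StronglyMeasurable (Function.uncurry fun t => curlRep (v t)) :=
  stronglyMeasurable_curlRep hv.meas hv.coord_locallyIntegrable

/-- The mollified vorticity equation. -/
theorem IsFlow.ae_moll_vorticity (hv : IsFlow α M T v₀ v) (hα : 0 ≤ α) (hα' : α < 1 / 2)
    (hθ : IsCutoff θ) (h₀ : IsField v₀ w₀ W) {ε : ℝ} (hε : 0 < ε) (x : Plane) :
    ∀ᵐ t ∂volume.restrict (Icc 0 T), moll ε (curlRep (v t)) x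
      = moll ε w₀ x + ∫ s in (0 : ℝ)..t, vortFlux ε (v s) (curlRep (v s)) x := by
  have hφ : IsTest fun y => mollk ε (x - y) := (isTest_mollk hε).comp_const_sub x
  have t₂ : IsTest fun y => -∂_ 0 (fun y => mollk ε (x - y)) y :=
    ⟨(hφ.partialDeriv 0).1.neg, (hφ.partialDeriv 0).2.neg⟩
  have e : ∀ {f w W}, IsField f w W → ∫ y, (f y 0 * ∂_ 1 (fun y => mollk ε (x - y)) y
      + f y 1 * -∂_ 0 (fun y => mollk ε (x - y)) y) = moll ε w x := by
    intro f w W hf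
    simp only [mul_neg, ← sub_eq_add_neg]
    rw [← hf.curl.2 _ hφ, moll, conv_apply]
    simp only [mul_comm]
  filter_upwards [hv.eqn _ _ (hφ.partialDeriv 1) t₂] with t ht
  rw [e (hv.inClass t).field, e h₀] at ht
  rw [ht]
  simp only [fun s => (hv.inClass s).momForm_eq_vortFlux hα hα' hθ hε x]

/-- The chain rule in time is exact for mollified vorticities, and the commutator estimate passes to
the limit. There is no initial term, since `β` vanishes on the range of the mollified initial
vorticity. -/
theorem IsFlow.ae_renormalized (hv : IsFlow α M T v₀ v) (hα : 0 ≤ α) (hα' : α < 1 / 2)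
    (hθ : IsCutoff θ) (h₀ : IsField v₀ w₀ W) (hχ : IsTest χ) (hβ : ContDiff ℝ ∞ β)
    (hβ₀ : ∀ s, |s| ≤ W → β s = 0) :
    ∀ᵐ t ∂volume.restrict (Icc 0 T), ∫ x, χ x * β (curlRep (v t) x) = ∫ s in (0 : ℝ)..t,
      ∫ x, β (curlRep (v s) x) * (v s x 0 * ∂_ 0 χ x + v s x 1 * ∂_ 1 χ x) := by
  obtain ⟨R, hR, hs⟩ := exists_ball_of_hasCompactSupport hχ.2
  obtain ⟨K, hK⟩ := exists_vortFlux_bound (M := M) hα hα' hχ hβ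
  obtain ⟨b, hb⟩ := (isCompact_Icc (a := -M) (b := M)).exists_bound_of_continuousOn
    hβ.continuous.continuousOn
  have hw := hv.stronglyMeasurable_vorticity
  have hB : ∀ n, StronglyMeasurable
      (Function.uncurry fun t => vortFlux (scale n) (v t) (curlRep (v t))) := fun n =>
    ((stronglyMeasurable_partialDeriv_moll (scale_pos n)
      (g := fun t y => curlRep (v t) y * v t y 0) (hw.mul (stronglyMeasurable_coord hv.meas 0))
      (fun t => (hv.inClass t).field.locallyIntegrable_mul (hv.inClass t).cont 0) 0).add
    (stronglyMeasurable_partialDeriv_moll (scale_pos n)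
      (g := fun t y => curlRep (v t) y * v t y 1) (hw.mul (stronglyMeasurable_coord hv.meas 1))
      (fun t => (hv.inClass t).field.locallyIntegrable_mul (hv.inClass t).cont 1) 1)).neg
  have main : ∀ n, ∀ᵐ t ∂volume.restrict (Icc 0 T),
      ∫ x, χ x * β (moll (scale n) (curlRep (v t)) x) = ∫ s in (0 : ℝ)..t,
        ∫ x, χ x * (deriv β (moll (scale n) (curlRep (v s)) x)
          * vortFlux (scale n) (v s) (curlRep (v s)) x) := by
    intro n
    obtain ⟨L, hL⟩ := exists_vortFlux_le (M := M) hα hα' hR (scale_pos n) (scale_le_one n)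
    have h1 := ae_integral_comp_eq (K := max M L) (R := R)
      (f := fun t => moll (scale n) (curlRep (v t)))
      (B := fun t => vortFlux (scale n) (v t) (curlRep (v t))) (stronglyMeasurable_moll hw) (hB n)
      (contDiff_moll (scale_pos n) h₀.wLoc).continuous hχ.continuous ((subset_tsupport _).trans hs)
      (fun s x _ => ((hv.inClass s).field.abs_moll_curl_le (scale_pos n) x).trans (le_max_left _ _))
      (fun s x hx => (hL _ (hv.inClass s) x hx).trans (le_max_right _ _)) (hβ.of_le (by simp))
      (hv.ae_moll_vorticity hα hα' hθ h₀ (scale_pos n))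
    filter_upwards [h1] with t ht
    rw [ht]
    simp [hβ₀ _ (h₀.abs_moll_curl_le (scale_pos n) _)]
  rw [← ae_all_iff] at main
  filter_upwards [main] with t ht
  have hft := (hv.inClass t).field
  have L1 : Tendsto (fun n => ∫ x, χ x * β (moll (scale n) (curlRep (v t)) x)) atTop
      (𝓝 (∫ x, χ x * β (curlRep (v t) x))) := by
    refine tendsto_integral_of_dominated_convergence (fun x => |χ x| * b) (fun n => ?_)
      ((hχ.continuous.integrable_of_hasCompactSupport hχ.2).abs.mul_const b) (fun n => ?_) ?_
    · exact (hχ.continuous.mul (hβ.continuous.comp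
        (contDiff_moll (scale_pos n) hft.wLoc).continuous)).aestronglyMeasurable
    · refine Eventually.of_forall fun x => ?_
      rw [norm_mul]
      exact mul_le_mul_of_nonneg_left (hb _ (abs_le.1 (hft.abs_moll_curl_le (scale_pos n) x)))
        (abs_nonneg _)
    · filter_upwards [ae_tendsto_moll_scale hft.wLoc] with x hx
      exact ((hβ.continuous.tendsto _).comp hx).const_mul _
  have L2 := intervalIntegral.tendsto_integral_filter_of_dominated_convergence (μ := volume)
    (a := 0) (b := t) (l := atTop) (F := fun (n : ℕ) s => ∫ x, χ x
      * (deriv β (moll (scale n) (curlRep (v s)) x) * vortFlux (scale n) (v s) (curlRep (v s)) x))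
    (f := fun s => ∫ x, β (curlRep (v s) x)
      * (v s x 0 * ∂_ 0 χ x + v s x 1 * ∂_ 1 χ x)) (fun _ => K)
    (Eventually.of_forall fun n => by
      have hβ' := (contDiff_infty_iff_deriv.1 hβ).2.continuous
      refine (StronglyMeasurable.integral_prod_right (f := fun s x => χ x
        * (deriv β (moll (scale n) (curlRep (v s)) x)
          * vortFlux (scale n) (v s) (curlRep (v s)) x)) ?_).aestronglyMeasurable
      exact (hχ.continuous.comp_stronglyMeasurable measurable_snd.stronglyMeasurable).mul
        ((hβ'.comp_stronglyMeasurable (stronglyMeasurable_moll hw)).mul (hB n)))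
    (Eventually.of_forall fun n => Eventually.of_forall fun s _ => hK _ (hv.inClass s) n)
    intervalIntegrable_const
    (Eventually.of_forall fun s _ => (hv.inClass s).tendsto_vortFlux hα hα' hχ hβ)
  refine tendsto_nhds_unique L1 ?_
  simp only [ht]
  exact L2

/-- The vorticity of a flow is bounded by the initial vorticity. -/
theorem IsFlow.ae_isField (hv : IsFlow α M T v₀ v) (hα : 0 ≤ α) (hα' : α < 1 / 2)
    (hθ : IsCutoff θ) (h₀ : IsField v₀ w₀ W) :
    ∀ᵐ t ∂volume.restrict (Icc 0 T), IsField (v t) (curlRep (v t)) W := by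
  -- A smooth nonnegative function whose zero set is exactly `[-W, W]`; the claim is that it
  -- vanishes along the vorticity.
  set β : ℝ → ℝ := fun s => expNegInvGlue (s - W) + expNegInvGlue (-s - W) with hβd
  have hβ : ContDiff ℝ ∞ β := by
    have h1 : ContDiff ℝ ∞ fun s : ℝ => expNegInvGlue (s - W) :=
      (expNegInvGlue.contDiff (n := ⊤)).comp (contDiff_id.sub contDiff_const)
    have h2 : ContDiff ℝ ∞ fun s : ℝ => expNegInvGlue (-s - W) :=
      (expNegInvGlue.contDiff (n := ⊤)).comp (contDiff_id.neg.sub contDiff_const)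
    exact h1.add h2
  have hβn : ∀ s, 0 ≤ β s := fun s => add_nonneg (expNegInvGlue.nonneg _) (expNegInvGlue.nonneg _)
  have hβ0 : ∀ s, |s| ≤ W → β s = 0 := by
    intro s hs
    rw [abs_le] at hs
    simp only [hβd]
    rw [expNegInvGlue.zero_of_nonpos (by linarith), expNegInvGlue.zero_of_nonpos (by linarith),
      add_zero]
  have hβp : ∀ s, β s = 0 → |s| ≤ W := by
    intro s hs
    by_contra! h
    rcases lt_abs.1 h with h | h
    · have := expNegInvGlue.pos_of_pos (sub_pos.2 h)
      have := expNegInvGlue.nonneg (-s - W)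
      simp only [hβd] at hs
      linarith
    · have := expNegInvGlue.pos_of_pos (sub_pos.2 h)
      have := expNegInvGlue.nonneg (s - W)
      simp only [hβd] at hs
      linarith
  have hM := (hv.inClass 0).field.bound_nonneg
  obtain ⟨b, hb⟩ := (isCompact_Icc (a := -M) (b := M)).exists_bound_of_continuousOn
    hβ.continuous.continuousOn
  have hb0 : 0 ≤ b := (norm_nonneg _).trans (hb 0 ⟨by linarith, hM⟩)
  have hβb : ∀ t, ∀ᵐ x, |β (curlRep (v t) x)| ≤ b := fun t => by
    filter_upwards [(hv.inClass t).field.bound] with x hx using hb _ (abs_le.1 hx)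
  have hw := hv.stronglyMeasurable_vorticity
  have hβw : ∀ t, LocallyIntegrable (fun x => β (curlRep (v t) x)) volume := fun t =>
    (locallyIntegrable_const b).mono (hβ.continuous.comp_aestronglyMeasurable
      (hv.inClass t).field.wLoc.aestronglyMeasurable) (by
        filter_upwards [hβb t] with x hx using by simpa [abs_of_nonneg hb0] using hx)
  obtain ⟨C, hC, hcut⟩ := exists_partialDeriv_cut_le
  obtain ⟨A, hA, hlin⟩ := exists_norm_le_linear
  set v₁ := volume.real (ball (0 : Plane) 1) with hv₁
  have hr : ∀ j : ℕ, (1 : ℝ) ≤ 2 ^ j := fun j => one_le_pow₀ (by norm_num)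
  have hr0 : ∀ j : ℕ, (0 : ℝ) < 2 ^ j := fun j => by positivity
  -- The velocity is `O(2^j)` where the gradient of the `j`-th cut-off, of size `2^(-j)`, is
  -- nonzero, and the next cut-off equals one there. So the rate of `y j` is at most a fixed
  -- multiple of `y (j + 1)`. The trivial bound by the area grows only like `4^j`, and the iterated
  -- Gronwall inequality applies.
  set y : ℕ → ℝ → ℝ := fun j t => ∫ x, cut (2 ^ j) x * β (curlRep (v t) x) with hy
  have hym : ∀ j, StronglyMeasurable (y j) := fun j =>
    StronglyMeasurable.integral_prod_right (f := fun t x => cut (2 ^ j) x * β (curlRep (v t) x))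
      (((contDiff_cut _).continuous.comp_stronglyMeasurable measurable_snd.stronglyMeasurable).mul
        (hβ.continuous.comp_stronglyMeasurable hw))
  have hvol : ∀ j : ℕ, volume.real (ball (0 : Plane) (2 * 2 ^ j)) = 4 * v₁ * 4 ^ j := by
    intro j
    rw [Measure.real, Measure.addHaar_ball volume (0 : Plane) (by positivity), ENNReal.toReal_mul,
      ENNReal.toReal_ofReal (by positivity)]
    simp only [finrank_euclideanSpace, Fintype.card_fin]
    rw [hv₁, Measure.real, mul_pow, ← pow_mul, mul_comm j 2, pow_mul]
    norm_num
    ring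
  have hyb : ∀ j s, |y j s| ≤ (b * (4 * v₁)) * 4 ^ j := by
    intro j s
    simp only [hy]
    rw [integral_eq_ball (R := 2 * 2 ^ j) ((Function.support_mul_subset_left _ _).trans
      (cut_support (hr0 j))), ← Real.norm_eq_abs]
    refine (norm_setIntegral_le_of_norm_le_const_ae' (C := b) measure_ball_lt_top ?_).trans
      (le_of_eq ?_)
    · filter_upwards [hβb s] with x hx _
      rw [norm_mul, Real.norm_eq_abs, abs_of_nonneg (cut_nonneg _ _)]
      exact (mul_le_of_le_one_left (norm_nonneg _) (cut_le_one _ _)).trans hx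
    · rw [hvol]; ring
  have hstep : ∀ j, ∀ᵐ t ∂volume.restrict (Icc 0 T),
      y j t ≤ (6 * A * M * C) * ∫ s in (0 : ℝ)..t, y (j + 1) s := by
    intro j
    filter_upwards [hv.ae_renormalized hα hα' hθ h₀ (isTest_cut (hr0 j)) hβ hβ0,
      ae_restrict_mem measurableSet_Icc] with t ht htT
    simp only [hy]
    rw [ht, ← intervalIntegral.integral_const_mul]
    have hcj := fun i => (isTest_cut (hr0 j)).partialDeriv i
    have hmeas : StronglyMeasurable fun s => ∫ x, β (curlRep (v s) x)
        * (v s x 0 * ∂_ 0 (cut (2 ^ j)) x + v s x 1 * ∂_ 1 (cut (2 ^ j)) x) := by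
      refine StronglyMeasurable.integral_prod_right (f := fun s x => β (curlRep (v s) x)
        * (v s x 0 * ∂_ 0 (cut (2 ^ j)) x + v s x 1 * ∂_ 1 (cut (2 ^ j)) x)) ?_
      have d := fun i => (hcj i).continuous.comp_stronglyMeasurable
        (measurable_snd : Measurable fun p : ℝ × Plane => p.2).stronglyMeasurable
      exact (hβ.continuous.comp_stronglyMeasurable hw).mul
        (((stronglyMeasurable_coord hv.meas 0).mul (d 0)).add
          ((stronglyMeasurable_coord hv.meas 1).mul (d 1)))
    have hpt : ∀ s, ∫ x, β (curlRep (v s) x) * (v s x 0 * ∂_ 0 (cut (2 ^ j)) x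
        + v s x 1 * ∂_ 1 (cut (2 ^ j)) x) ≤ (6 * A * M * C) * y (j + 1) s := by
      intro s
      simp only [hy]
      rw [← integral_const_mul]
      have hi := ((isTest_cut (hr0 (j + 1))).integrable_mul (hβw s)).const_mul (6 * A * M * C)
      have hc := (hv.inClass s).cont
      have dt : Continuous fun x => v s x 0 * ∂_ 0 (cut (2 ^ j)) x
          + v s x 1 * ∂_ 1 (cut (2 ^ j)) x :=
        ((Continuous.coord hc 0).mul (hcj 0).continuous).add
          ((Continuous.coord hc 1).mul (hcj 1).continuous)
      have dts : HasCompactSupport fun x => v s x 0 * ∂_ 0 (cut (2 ^ j)) x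
          + v s x 1 * ∂_ 1 (cut (2 ^ j)) x :=
        ((hcj 0).2.mul_left).add ((hcj 1).2.mul_left)
      refine integral_mono ?_ hi fun x => ?_
      · simpa only [mul_comm] using integrable_mul_of_compact dt dts (hβw s)
      · simp only
        by_cases hx : 2 * 2 ^ j ≤ ‖x‖
        · rw [partialDeriv_cut_eq_zero (hr0 j) 0 hx, partialDeriv_cut_eq_zero (hr0 j) 1 hx]
          simp only [mul_zero, add_zero]
          exact mul_nonneg (by positivity) (mul_nonneg (cut_nonneg _ _) (hβn _))
        · push Not at hx
          rw [cut_eq_one (hr0 (j + 1)) (by rw [pow_succ]; linarith), one_mul, mul_comm]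
          refine mul_le_mul_of_nonneg_right ((le_abs_self _).trans ?_) (hβn _)
          have hV := hlin _ _ M α (hv.inClass s).field hc hα (by linarith) (hv.inClass s).bound x
          have hq : ∀ i, |v s x i * ∂_ i (cut (2 ^ j)) x| ≤ 3 * A * M * C := by
            intro i
            have h1 := (PiLp.norm_apply_le (v s x) i).trans hV
            rw [abs_mul]
            calc _ ≤ (A * M * (3 * 2 ^ j)) * (C / 2 ^ j) := by
                  refine mul_le_mul (h1.trans ?_) (hcut _ (hr0 j) i x) (abs_nonneg _) (by positivity)
                  gcongr
                  linarith [hr j]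
              _ = _ := by field_simp
          exact (abs_add_le _ _).trans (by linarith [hq 0, hq 1])
    refine intervalIntegral.integral_mono_on_of_le_Ioo htT.1 ?_
      ((intervalIntegrable_of_bounded (hym _) (hyb _) _ _).const_mul _) fun s _ => hpt s
    obtain ⟨K', hK'⟩ : ∃ K', ∀ s, |∫ x, β (curlRep (v s) x)
        * (v s x 0 * ∂_ 0 (cut (2 ^ j)) x + v s x 1 * ∂_ 1 (cut (2 ^ j)) x)|
          ≤ K' := by
      obtain ⟨K', hK'⟩ := exists_vortFlux_bound (M := M) hα hα' (isTest_cut (hr0 j)) hβ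
      exact ⟨K', fun s => le_of_tendsto ((hv.inClass s).tendsto_vortFlux hα hα'
        (isTest_cut (hr0 j)) hβ).abs (Eventually.of_forall fun n => hK' _ (hv.inClass s) n)⟩
    exact intervalIntegrable_of_bounded hmeas hK' _ _
  have hfin := fun j => ae_le_zero_of_le_integral_succ (by positivity) hym hyb hstep j
  rw [← ae_all_iff] at hfin
  filter_upwards [hfin] with t ht
  have hz : ∀ j : ℕ, ∀ᵐ x, cut (2 ^ j) x * β (curlRep (v t) x) = 0 := by
    intro j
    have hn : ∀ x, 0 ≤ cut (2 ^ j) x * β (curlRep (v t) x) :=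
      fun x => mul_nonneg (cut_nonneg _ _) (hβn _)
    have := (integral_eq_zero_iff_of_nonneg hn ((isTest_cut (hr0 j)).integrable_mul (hβw t))).1
      (le_antisymm (ht j) (integral_nonneg hn))
    exact this
  have hf := (hv.inClass t).field
  refine ⟨hf.locInt, hf.divFree, hf.curl, ?_⟩
  filter_upwards [ae_all_iff.2 hz] with x hx
  refine hβp _ ?_
  obtain ⟨j, hj⟩ := pow_unbounded_of_one_lt ‖x‖ (one_lt_two : (1 : ℝ) < 2)
  have := hx j
  rwa [cut_eq_one (hr0 j) hj.le, one_mul] at this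

end VorticityFlow

/-! ### Transport and pressure in the mollified energy balance. -/

section EnergyRate

variable {ε r : ℝ} {g χ : Plane → ℝ} {θ : Plane → ℝ} {f : Plane → Plane} {α M : ℝ}

theorem integral_mul_sq_moll_le (hε : 0 < ε) {a : Plane → ℝ} (ha : Continuous a)
    (hac : HasCompactSupport a) (ha0 : ∀ x, 0 ≤ a x) (hg : Continuous g) :
    ∫ x, a x * moll ε g x ^ 2 ≤ ∫ x, moll ε a x * g x ^ 2 := by
  have hg2 : LocallyIntegrable (fun x => g x ^ 2) volume := (hg.pow 2).locallyIntegrable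
  rw [← integral_mul_moll hε ha hac hg2]
  refine integral_mono (integrable_mul_of_compact ha hac
    ((contDiff_moll hε hg.locallyIntegrable).continuous.pow 2).locallyIntegrable)
    (integrable_mul_of_compact ha hac (contDiff_moll hε hg2).continuous.locallyIntegrable) fun x => ?_
  exact mul_le_mul_of_nonneg_left (sq_moll_le hε hg.locallyIntegrable hg2 x) (ha0 x)

theorem moll_cut_le_one (hε : 0 < ε) (R : ℝ) (x : Plane) : moll ε (cut R) x ≤ 1 :=
  (le_abs_self _).trans (abs_moll_le hε (Eventually.of_forall fun y _ => by
    rw [abs_of_nonneg (cut_nonneg R y)]; exact cut_le_one R y))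

/-- The cut-off of radius `2r` lives in the ball of radius `4r`, and mollification enlarges this by
at most `1 ≤ r`. The radius `6r` leaves room and is kept throughout the energy estimate. -/
theorem integral_sq_moll_ball_le (hε : 0 < ε) (hε1 : ε ≤ 1) (hr : 1 ≤ r) (hg : Continuous g) :
    ∫ x in ball 0 (2 * r), moll ε g x ^ 2 ≤ ∫ x in ball 0 (6 * r), g x ^ 2 := by
  have hr2 : 0 < 2 * r := by linarith
  have hc := contDiff_moll hε hg.locallyIntegrable
  have hcut := isTest_cut hr2
  have hm := contDiff_moll hε hcut.continuous.locallyIntegrable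
  have s1 : Function.support (moll ε (cut (2 * r))) ⊆ ball 0 (6 * r) :=
    (tsupport_conv_subset (mollk_support hε) (cut_support hr2)).trans
      (ball_subset_ball (by linarith))
  calc _ = ∫ x in ball 0 (2 * r), cut (2 * r) x * moll ε g x ^ 2 := by
        refine setIntegral_congr_fun measurableSet_ball fun x hx => ?_
        rw [cut_eq_one hr2 (mem_ball_zero_iff.1 hx).le, one_mul]
    _ ≤ ∫ x, cut (2 * r) x * moll ε g x ^ 2 :=
        setIntegral_le_integral (integrable_mul_of_compact hcut.continuous hcut.2
          (hc.continuous.pow 2).locallyIntegrable)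
          (Eventually.of_forall fun x => mul_nonneg (cut_nonneg _ _) (sq_nonneg _))
    _ ≤ ∫ x, moll ε (cut (2 * r)) x * g x ^ 2 :=
        integral_mul_sq_moll_le hε hcut.continuous hcut.2 (cut_nonneg _) hg
    _ = ∫ x in ball 0 (6 * r), moll ε (cut (2 * r)) x * g x ^ 2 :=
        integral_eq_ball ((Function.support_mul_subset_left _ _).trans s1)
    _ ≤ _ := integral_mono (Continuous.integrableOn_ball (hm.continuous.mul (hg.pow 2)) 0 _)
        (Continuous.integrableOn_ball (hg.pow 2) 0 _)
        fun x => mul_le_of_le_one_left (sq_nonneg _) (moll_cut_le_one hε _ x)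

theorem integral_sq_moll_le (hε : 0 < ε) (hg : Continuous g) (hgc : HasCompactSupport g) :
    ∫ x, moll ε g x ^ 2 ≤ ∫ x, g x ^ 2 := by
  obtain ⟨R, hR, hs⟩ := exists_ball_of_hasCompactSupport hgc
  have hcut := isTest_cut (R := R + ε) (by linarith)
  have hm := contDiff_moll hε hcut.continuous.locallyIntegrable
  calc ∫ x, moll ε g x ^ 2 = ∫ x, cut (R + ε) x * moll ε g x ^ 2 := by
        refine integral_congr_ae (Eventually.of_forall fun x => ?_)
        by_cases hx : x ∈ ball (0 : Plane) (R + ε)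
        · simp only [cut_eq_one (by linarith : 0 < R + ε) (mem_ball_zero_iff.1 hx).le, one_mul]
        · have : moll ε g x = 0 := Function.notMem_support.1 fun h => hx
            (tsupport_conv_subset (mollk_support hε) ((subset_tsupport g).trans hs) h)
          simp [this]
    _ ≤ ∫ x, moll ε (cut (R + ε)) x * g x ^ 2 :=
        integral_mul_sq_moll_le hε hcut.continuous hcut.2 (cut_nonneg _) hg
    _ ≤ _ := by
        have hi : Integrable fun x => g x ^ 2 :=
          (hg.pow 2).integrable_of_hasCompactSupport (by simpa [sq] using hgc.mul_left (f := g))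
        refine integral_mono_of_nonneg (Eventually.of_forall fun x => mul_nonneg ?_ (sq_nonneg _)) hi
          (Eventually.of_forall fun x => mul_le_of_le_one_left (sq_nonneg _) (moll_cut_le_one hε _ x))
        rw [moll, conv_apply]
        exact integral_nonneg fun y => mul_nonneg (mollk_nonneg _ _) (cut_nonneg _ _)

/-- Conservation of energy by the transport term. -/
theorem integral_transport_smooth {u₀ u₁ : Plane → ℝ} (h₀ : ContDiff ℝ ∞ u₀)
    (h₁ : ContDiff ℝ ∞ u₁) (hχ : IsTest χ)
    (hdiv : ∀ x, ∂_ 0 u₀ x + ∂_ 1 u₁ x = 0) :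
    2 * (∫ x, (∂_ 0 (fun y => χ y * u₀ y) x * (u₀ x * u₀ x)
        + ∂_ 1 (fun y => χ y * u₀ y) x * (u₁ x * u₀ x)
        + ∂_ 0 (fun y => χ y * u₁ y) x * (u₀ x * u₁ x)
        + ∂_ 1 (fun y => χ y * u₁ y) x * (u₁ x * u₁ x)))
      = ∫ x, (u₀ x ^ 2 + u₁ x ^ 2) * (u₀ x * ∂_ 0 χ x + u₁ x * ∂_ 1 χ x) := by
  have df : ∀ {u : Plane → ℝ}, ContDiff ℝ ∞ u → Differentiable ℝ u :=
    fun hu => hu.differentiable (by simp)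
  have hq : ContDiff ℝ ∞ fun x => u₀ x * u₀ x + u₁ x * u₁ x := (h₀.mul h₀).add (h₁.mul h₁)
  have dχu : ∀ {u : Plane → ℝ}, ContDiff ℝ ∞ u → ∀ i x, ∂_ i (fun y => χ y * u y) x
      = ∂_ i χ x * u x + χ x * ∂_ i u x :=
    fun hu i x => partialDeriv_mul i (df hχ.1 x) (df hu x)
  have dq : ∀ i x, ∂_ i (fun x => u₀ x * u₀ x + u₁ x * u₁ x) x
      = 2 * (u₀ x * ∂_ i u₀ x + u₁ x * ∂_ i u₁ x) := fun i x => by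
    rw [partialDeriv_add i (df (h₀.mul h₀) x) (df (h₁.mul h₁) x),
      partialDeriv_mul i (df h₀ x) (df h₀ x), partialDeriv_mul i (df h₁ x) (df h₁ x)]
    ring
  have hP : ∀ u, ContDiff ℝ ∞ u →
      IsTest fun x => (χ x * (u₀ x * u₀ x + u₁ x * u₁ x)) * u x :=
    fun u hu => (hχ.mul_right hq).mul_right hu
  have dP : ∀ u, ContDiff ℝ ∞ u → ∀ i x,
      ∂_ i (fun x => (χ x * (u₀ x * u₀ x + u₁ x * u₁ x)) * u x) x
      = (∂_ i χ x * (u₀ x * u₀ x + u₁ x * u₁ x)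
          + χ x * (2 * (u₀ x * ∂_ i u₀ x + u₁ x * ∂_ i u₁ x))) * u x
        + χ x * (u₀ x * u₀ x + u₁ x * u₁ x) * ∂_ i u x := fun u hu i x => by
    rw [partialDeriv_mul i (df (hχ.mul_right hq).1 x) (df hu x), dχu hq, dq]
  have hi : ∀ {u k : Plane → ℝ} (i : Fin 2), ContDiff ℝ ∞ u → ContDiff ℝ ∞ k →
      Integrable fun x => ∂_ i (fun y => χ y * u y) x * k x := fun i hu hk =>
    ((hχ.mul_right hu).partialDeriv i).integrable_mul hk.continuous.locallyIntegrable
  rw [← integral_const_mul]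
  refine integral_eq_of_sub_eq_div ((((hi 0 h₀ (h₀.mul h₀)).fun_add (hi 1 h₀ (h₁.mul h₀))).fun_add
    (hi 0 h₁ (h₀.mul h₁))).fun_add (hi 1 h₁ (h₁.mul h₁)) |>.const_mul 2) ?_
    (contDiff_one (hP _ h₀).1) (contDiff_one (hP _ h₁).1) (hP _ h₀).2 (hP _ h₁).2 fun x => ?_
  · have t := ((hχ.partialDeriv 0).mul_left h₀).add ((hχ.partialDeriv 1).mul_left h₁)
    have t' := t.mul_left ((h₀.pow 2).add (h₁.pow 2))
    exact t'.continuous.integrable_of_hasCompactSupport t'.2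
  · rw [dP _ h₀, dP _ h₁, dχu h₀, dχu h₀, dχu h₁, dχu h₁]
    linear_combination -(χ x * (u₀ x * u₀ x + u₁ x * u₁ x)) * hdiv x

/-- The mollified right-hand side of the momentum equation. -/
def momMoll (θ : Plane → ℝ) (ε : ℝ) (f : Plane → Plane) (i : Fin 2) (x : Plane) : ℝ :=
  -(∂_ 0 (moll ε fun y => f y 0 * f y i) x
    + ∂_ 1 (moll ε fun y => f y 1 * f y i) x) - moll ε (fun y => gradPi θ f f y i) x

/-- The test field with `i`-th component `φ` and other component `0`, evaluated in component `j`. -/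
def unitTest (i j : Fin 2) (φ : Plane → ℝ) : Plane → ℝ := if i = j then φ else fun _ => 0

theorem isTest_unitTest {φ : Plane → ℝ} (hφ : IsTest φ) (i j : Fin 2) : IsTest (unitTest i j φ) := by
  unfold unitTest
  split
  · exact hφ
  · exact ⟨contDiff_const, HasCompactSupport.zero⟩

theorem locallyIntegrable_mul_coord (hc : Continuous f) (i j : Fin 2) :
    LocallyIntegrable (fun y => f y j * f y i) volume :=
  ((Continuous.coord hc j).mul (Continuous.coord hc i)).locallyIntegrable

theorem InClass.momForm_eq_momMoll (hf : InClass α M f) (hα : 0 ≤ α) (hα' : α < 1 / 2)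
    (hθ : IsCutoff θ) (hε : 0 < ε) (i : Fin 2) (x : Plane) :
    momForm f (unitTest i 0 fun y => mollk ε (x - y)) (unitTest i 1 fun y => mollk ε (x - y))
      = momMoll θ ε f i x := by
  set φ : Plane → ℝ := fun y => mollk ε (x - y) with hφd
  have hφ : IsTest φ := (isTest_mollk hε).comp_const_sub x
  have hF := hf.farIntegrable hα hα'
  have hl := locallyIntegrable_mul_coord hf.cont
  have e : ∀ j, ∂_ j (moll ε fun y => f y j * f y i) x
      = -∫ y, ∂_ j φ y * (f y j * f y i) := by
    intro j
    rw [moll, partialDeriv_conv j (isTest_mollk hε) (hl i j), conv_apply, ← integral_neg]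
    refine integral_congr_ae (Eventually.of_forall fun y => ?_)
    simp only [hφd, partialDeriv_const_sub]; ring
  have q : moll ε (fun y => gradPi θ f f y i) x = pressForm i φ f := by
    rw [← hf.field.integral_gradPi_mul hf.cont hF hθ i hφ, moll, conv_apply]
  have z : ∀ k, pressForm k (fun _ => 0) f = 0 := by
    intro k
    have h0 : IsTest fun _ => (0 : ℝ) := ⟨contDiff_const, HasCompactSupport.zero⟩
    rw [← hf.field.integral_gradPi_mul hf.cont hF hθ k h0]
    simp
  have hi : ∀ j, Integrable fun y => ∂_ j φ y * (f y j * f y i) :=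
    fun j => (hφ.partialDeriv j).integrable_mul (hl i j)
  rw [momMoll, e, e, q, ← neg_add, neg_neg, ← integral_add (hi 0) (hi 1), momForm, fluxForm]
  fin_cases i
  · simp only [unitTest, Fin.zero_eta, if_true, if_neg (zero_ne_one : (0 : Fin 2) ≠ 1), z,
      partialDeriv_fun_const, mul_zero, add_zero]
    congr 1
    exact integral_congr_ae (Eventually.of_forall fun y => by simp only; ring)
  · simp only [unitTest, Fin.mk_one, if_true, if_neg (one_ne_zero : (1 : Fin 2) ≠ 0), z,
      partialDeriv_fun_const, mul_zero, zero_add]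
    congr 1
    exact integral_congr_ae (Eventually.of_forall fun y => by simp only; ring)

theorem InClass.continuous_momMoll (hf : InClass α M f) (hα : 0 ≤ α) (hα' : α < 1 / 2)
    (hθ : IsCutoff θ) (hε : 0 < ε) (i : Fin 2) : Continuous (momMoll θ ε f i) := by
  have h := fun j => continuous_partialDeriv j
    (contDiff_one (contDiff_moll hε (locallyIntegrable_mul_coord hf.cont i j)))
  exact ((h 0).add (h 1)).neg.sub (contDiff_moll hε (hf.field.locallyIntegrable_gradPi hf.cont
    (hf.farIntegrable hα hα') hθ i)).continuous

/-- Self-adjointness puts the mollifier of the pressure force onto the test function, so the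
pressure is again expressed by `pressForm`, for which bounds are known. -/
theorem InClass.integral_momMoll (hf : InClass α M f) (hα : 0 ≤ α) (hα' : α < 1 / 2)
    (hθ : IsCutoff θ) (hε : 0 < ε) (i : Fin 2) {b : Plane → ℝ} (hb : IsTest b) :
    ∫ x, b x * momMoll θ ε f i x = (∫ x, ∂_ 0 b x * moll ε (fun y => f y 0 * f y i) x)
      + (∫ x, ∂_ 1 b x * moll ε (fun y => f y 1 * f y i) x)
      - pressForm i (moll ε b) f := by
  have hF := hf.farIntegrable hα hα'
  have hP : ∀ j, ContDiff ℝ ∞ (moll ε fun y => f y j * f y i) :=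
    fun j => contDiff_moll hε (locallyIntegrable_mul_coord hf.cont i j)
  have hq := hf.field.locallyIntegrable_gradPi hf.cont hF hθ i
  have ibp := fun j => integral_mul_partialDeriv j (contDiff_one hb.1) (contDiff_one (hP j))
    (Or.inl hb.2)
  have i1 := fun j => hb.integrable_mul
    (continuous_partialDeriv j (contDiff_one (hP j))).locallyIntegrable
  rw [← hf.field.integral_gradPi_mul hf.cont hF hθ i (isTest_moll hε hb.2
    hb.continuous.locallyIntegrable), ← integral_mul_moll hε hb.continuous hb.2 hq,
    ← neg_eq_iff_eq_neg.2 (ibp 0), ← neg_eq_iff_eq_neg.2 (ibp 1), ← neg_add,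
    ← integral_add (i1 0) (i1 1), ← integral_neg, ← integral_sub ((i1 0).fun_add (i1 1)).fun_neg
    (hb.integrable_mul (contDiff_moll hε hq).continuous.locallyIntegrable)]
  refine integral_congr_ae (Eventually.of_forall fun x => ?_)
  simp only [momMoll]
  ring

end EnergyRate

/-! ### The rate of change of the localized energy. -/

section EnergyInequality

variable {α M : ℝ} {θ : Plane → ℝ}

theorem volume_real_ball {r : ℝ} (hr : 0 ≤ r) : volume.real (ball (0 : Plane) r)
    = r ^ 2 * volume.real (ball (0 : Plane) 1) := by
  rw [Measure.real, Measure.addHaar_ball volume (0 : Plane) hr, ENNReal.toReal_mul,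
    ENNReal.toReal_ofReal (by positivity)]
  simp [Measure.real]

/-- The covariance is the defect of mollifying `u ⊗ u`. One factor of its Cauchy-Schwarz bound is a
bounded velocity variance, the other gains `ε²` after integration, and the gradient of the test
function is bounded in `L²`. So the defect is of order `ε`. -/
theorem exists_covariance_error (hα : 0 ≤ α) (hα' : α < 1 / 2) {r : ℝ} (hr : 1 ≤ r) :
    ∃ K, 0 ≤ K ∧ ∀ f, InClass α M f → ∀ n i j,
      |∫ x, ∂_ j (fun y => cut r y * moll (scale n) (fun z => f z i) y) x
        * mcov (scale n) (fun y => f y j) (fun y => f y i) x| ≤ K * scale n := by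
  obtain ⟨c, hc, hcut⟩ := exists_partialDeriv_cut_le
  obtain ⟨A, hA, hlin⟩ := exists_norm_le_linear
  have hr0 : 0 < r := by linarith
  obtain ⟨D, hD⟩ := exists_class_gradient_bound (M := M) hα hα' (by linarith : 0 < 2 * r)
  set V := A * M * (1 + 3 * r) with hV
  set v := volume.real (ball (0 : Plane) (2 * r))
  refine ⟨√(2 * (c / r) ^ 2 * V ^ 2 * v + 2 * D) * (|V| * √D), by positivity,
    fun f hf n i j => ?_⟩
  have hε := scale_pos n
  have hε1 := scale_le_one n
  set ε := scale n with hεn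
  have hM := hf.field.bound_nonneg
  have hV0 : 0 ≤ V := by positivity
  have hfV : ∀ x ∈ ball (0 : Plane) (3 * r), ∀ k, |f x k| ≤ V := fun x hx k => by
    have h1 := (mem_ball_zero_iff.1 hx).le
    refine (PiLp.norm_apply_le (f x) k).trans ((hlin f _ M α hf.field hf.cont hα (by linarith)
      hf.bound x).trans ?_)
    rw [hV]
    gcongr
  have hnear : ∀ x ∈ ball (0 : Plane) (2 * r), ∀ y ∈ ball x ε,
      y ∈ ball (0 : Plane) (3 * r) := fun x hx y hy => by
    rw [mem_ball_zero_iff] at *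
    rw [mem_ball_iff_norm] at hy
    linarith [norm_le_norm_add_norm_sub' y x]
  have hu : ∀ k, ContDiff ℝ ∞ (moll ε fun y => f y k) := fun k => contDiff_moll hε (hf.field.coord k)
  have hub : ∀ x ∈ ball (0 : Plane) (2 * r), ∀ k, |moll ε (fun y => f y k) x| ≤ V :=
    fun x hx k => abs_moll_le hε (Eventually.of_forall fun y hy => hfV y (hnear x hx y hy) k)
  have hci := fun k => Continuous.coord hf.cont k
  have l1 := fun k => hf.field.coord k
  have l2 : ∀ k, LocallyIntegrable (fun y => f y k ^ 2) volume :=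
    fun k => ((hci k).pow 2).locallyIntegrable
  have hvar : ∀ x ∈ ball (0 : Plane) (2 * r), ∀ k, mvar ε (fun y => f y k) x ≤ V ^ 2 := by
    intro x hx k
    have h1 : |moll ε (fun y => f y k ^ 2) x| ≤ V ^ 2 :=
      abs_moll_le hε (Eventually.of_forall fun y hy => by
        rw [abs_pow]
        have := hfV y (hnear x hx y hy) k
        gcongr)
    rw [mvar]
    linarith [le_abs_self (moll ε (fun y => f y k ^ 2) x), sq_nonneg (moll ε (fun y => f y k) x)]
  have hb := (isTest_cut hr0).mul_right (hu i)
  have hbc := continuous_partialDeriv j (contDiff_one hb.1)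
  have hmc := continuous_mcov hε (l1 j) (l1 i) (locallyIntegrable_mul_coord hf.cont i j)
  have hbs : Function.support (∂_ j fun y => cut r y * moll ε (fun z => f z i) y)
      ⊆ ball 0 (2 * r) := by
    intro x hx
    by_contra h
    rw [mem_ball_zero_iff, not_lt] at h
    refine hx ?_
    rw [partialDeriv_mul j ((contDiff_cut r).differentiable (by simp) x)
      ((hu i).differentiable (by simp) x), partialDeriv_cut_eq_zero hr0 j h]
    have : cut r x = 0 := Function.notMem_support.1 fun h' =>
      absurd (mem_ball_zero_iff.1 (cut_support hr0 h')) (not_lt.2 h)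
    simp [this]
  have q1 : ∫ x in ball 0 (2 * r),
      ∂_ j (fun y => cut r y * moll ε (fun z => f z i) y) x ^ 2
      ≤ 2 * (c / r) ^ 2 * V ^ 2 * v + 2 * D := by
    have dc := fun k => continuous_partialDeriv k (contDiff_one (hu i))
    have i1 : Continuous fun x => ∂_ 0 (moll ε fun y => f y i) x ^ 2
        + ∂_ 1 (moll ε fun y => f y i) x ^ 2 := ((dc 0).pow 2).add ((dc 1).pow 2)
    have h2 : ∫ x in ball 0 (2 * r), (∂_ 0 (moll ε fun y => f y i) x ^ 2
        + ∂_ 1 (moll ε fun y => f y i) x ^ 2) ≤ D :=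
      (setIntegral_mono_set (Continuous.integrableOn_ball i1 0 _)
        (Eventually.of_forall fun x => by simp only [Pi.zero_apply]; positivity)
        (ball_subset_ball (by linarith)).eventuallyLE).trans (hD f hf n i)
    calc _ ≤ ∫ x in ball 0 (2 * r), (2 * (c / r) ^ 2 * V ^ 2
          + 2 * (∂_ 0 (moll ε fun y => f y i) x ^ 2
            + ∂_ 1 (moll ε fun y => f y i) x ^ 2)) := by
          refine setIntegral_mono_on (Continuous.integrableOn_ball (hbc.pow 2) 0 _)
            (Continuous.integrableOn_ball (continuous_const.add (continuous_const.mul i1)) 0 _)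
            measurableSet_ball fun x hx => ?_
          rw [partialDeriv_mul j ((contDiff_cut r).differentiable (by simp) x)
            ((hu i).differentiable (by simp) x)]
          have h3 : (∂_ j (cut r) x * moll ε (fun z => f z i) x) ^ 2
              ≤ ((c / r) * V) ^ 2 := by
            rw [← sq_abs, abs_mul]
            have := hcut r hr0 j x
            have := hub x hx i
            gcongr
          have h4 : (cut r x * ∂_ j (moll ε fun z => f z i) x) ^ 2
              ≤ ∂_ 0 (moll ε fun y => f y i) x ^ 2
                + ∂_ 1 (moll ε fun y => f y i) x ^ 2 := by
            rw [mul_pow]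
            refine (mul_le_of_le_one_left (sq_nonneg _)
              (pow_le_one₀ (cut_nonneg _ _) (cut_le_one _ _))).trans ?_
            fin_cases j
            · exact le_add_of_nonneg_right (sq_nonneg _)
            · exact le_add_of_nonneg_left (sq_nonneg _)
          refine (add_sq_le).trans ?_
          rw [mul_pow] at h3
          linarith
      _ ≤ _ := by
          rw [integral_add (integrable_const _) ((Continuous.integrableOn_ball i1 0 _).const_mul 2),
            integral_const, measureReal_restrict_apply_univ, smul_eq_mul, integral_const_mul, mul_comm]
          gcongr
  have q2 : ∫ x in ball 0 (2 * r), mcov ε (fun y => f y j) (fun y => f y i) x ^ 2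
      ≤ V ^ 2 * (ε ^ 2 * D) := by
    refine le_trans ?_ (mul_le_mul_of_nonneg_left
      (hf.field.integral_mvar_le hf.cont i (fun m => hD f hf m i) hε hε1) (sq_nonneg V))
    rw [← integral_const_mul]
    refine setIntegral_mono_on (Continuous.integrableOn_ball (hmc.pow 2) 0 _)
      (Continuous.integrableOn_ball (continuous_const.mul (continuous_mvar hε (l1 i) (l2 i))) 0 _)
      measurableSet_ball fun x hx => ?_
    refine (mcov_sq_le hε (l1 j) (l2 j) (l1 i) (l2 i)
      (locallyIntegrable_mul_coord hf.cont i j) x).trans ?_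
    exact mul_le_mul_of_nonneg_right (hvar x hx j) (mvar_nonneg hε (l1 i) (l2 i) x)
  rw [integral_eq_ball ((Function.support_mul_subset_left _ _).trans hbs)]
  refine (abs_integral_mul_le (memLp_two_ball hbc 0 _) (memLp_two_ball hmc 0 _)).trans ?_
  calc _ ≤ √(2 * (c / r) ^ 2 * V ^ 2 * v + 2 * D) * √(V ^ 2 * (ε ^ 2 * D)) := by gcongr
    _ = _ := by
        rw [Real.sqrt_mul (sq_nonneg V), Real.sqrt_sq_eq_abs, Real.sqrt_mul (sq_nonneg ε),
          Real.sqrt_sq hε.le]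
        ring

/-- The rate of change of the localized energy. -/
theorem exists_energyRate_le : ∃ C, 0 < C ∧ ∀ α M θ, 0 ≤ α → α < 1 / 2 → IsCutoff θ → ∀ r, 1 ≤ r →
    ∃ K, ∀ f, InClass α M f → ∀ V, (∀ x ∈ ball (0 : Plane) (6 * r), ‖f x‖ ≤ V) → ∀ n,
      2 * ((∫ x, cut r x * moll (scale n) (fun y => f y 0) x * momMoll θ (scale n) f 0 x)
        + ∫ x, cut r x * moll (scale n) (fun y => f y 1) x * momMoll θ (scale n) f 1 x)
      ≤ C * (V / r * energy f (6 * r) + r * √(energy f (6 * r))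
        * ∫ y in (ball 0 (6 * r))ᶜ, ‖f y‖ ^ 2 * (‖y‖ ^ 3)⁻¹) + K * scale n := by
  obtain ⟨c, hc, hcut⟩ := exists_partialDeriv_cut_le
  set v := volume.real (ball (0 : Plane) 1) with hv
  set Λ := 448 + 4 * √(2 * logMass ^ 2) with hΛ
  have hv0 : 0 ≤ v := measureReal_nonneg
  -- The three summands belong to the transport flux, the near part of the pressure and its far
  -- part.
  refine ⟨2 * c + 2 * Λ * (2 * c) + 2 * Λ * (6 * √v), by positivity,
    fun α M θ hα hα' hθ r hr => ?_⟩
  obtain ⟨K, hK0, hK⟩ := exists_covariance_error (M := M) hα hα' hr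
  -- Four covariance terms, doubled like the rest of the energy balance.
  refine ⟨8 * K, fun f hf V hV n => ?_⟩
  have hr0 : 0 < r := by linarith
  have hε := scale_pos n
  have hε1 := scale_le_one n
  have hKn := hK f hf n
  set ε := scale n with hεn
  have hV0 : 0 ≤ V := (norm_nonneg _).trans (hV 0 (mem_ball_self (by linarith)))
  set E := energy f (6 * r) with hE
  set F := ∫ y in (ball 0 (6 * r))ᶜ, ‖f y‖ ^ 2 * (‖y‖ ^ 3)⁻¹ with hF
  have hE0 : 0 ≤ E := energy_nonneg _ _
  have hF0 : 0 ≤ F := integral_nonneg fun y => by positivity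
  have hχ := isTest_cut hr0
  have hci := fun k => Continuous.coord hf.cont k
  have hu : ∀ k, ContDiff ℝ ∞ (moll ε fun y => f y k) := fun k => contDiff_moll hε (hf.field.coord k)
  set u : Fin 2 → Plane → ℝ := fun k => moll ε fun y => f y k with hud
  have huc := fun k => (hu k).continuous
  have hub : ∀ x ∈ ball (0 : Plane) (2 * r), ∀ k, |u k x| ≤ V := fun x hx k =>
    abs_moll_le hε (Eventually.of_forall fun y hy => (PiLp.norm_apply_le (f y) k).trans (hV y (by
      rw [mem_ball_zero_iff] at *
      rw [mem_ball_iff_norm] at hy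
      linarith [norm_le_norm_add_norm_sub' y x])))
  have hsq : ∀ k, IntegrableOn (fun x => u k x ^ 2) (ball 0 (2 * r)) :=
    fun k => Continuous.integrableOn_ball ((huc k).pow 2) 0 _
  have huE : (∫ x in ball 0 (2 * r), u 0 x ^ 2) + ∫ x in ball 0 (2 * r), u 1 x ^ 2
      ≤ E := by
    have e : E = (∫ x in ball 0 (6 * r), f x 0 ^ 2) + ∫ x in ball 0 (6 * r), f x 1 ^ 2 := by
      have iq : ∀ k, IntegrableOn (fun x => f x k ^ 2) (ball 0 (6 * r)) :=
        fun k => Continuous.integrableOn_ball ((hci k).pow 2) 0 _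
      rw [hE, energy, ← integral_add (iq 0) (iq 1)]
      simp only [norm_sq_eq]
    rw [e]
    exact add_le_add (integral_sq_moll_ball_le hε hε1 hr (hci 0))
      (integral_sq_moll_ball_le hε hε1 hr (hci 1))
  have n0 : ∀ k, 0 ≤ ∫ x in ball 0 (2 * r), u k x ^ 2 := fun k =>
    integral_nonneg fun x => sq_nonneg _
  have hb : ∀ k, IsTest fun y => cut r y * u k y := fun k => hχ.mul_right (hu k)
  set b : Fin 2 → Plane → ℝ := fun k y => cut r y * u k y with hbd
  have dχ0 : ∀ i x, x ∉ ball (0 : Plane) (2 * r) → ∂_ i (cut r) x = 0 :=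
    fun i x hx => partialDeriv_cut_eq_zero hr0 i (by simpa using hx)
  have flux : |∫ x, (u 0 x ^ 2 + u 1 x ^ 2)
      * (u 0 x * ∂_ 0 (cut r) x + u 1 x * ∂_ 1 (cut r) x)|
      ≤ 2 * c * (V / r * E) := by
    rw [integral_eq_ball (R := 2 * r), ← Real.norm_eq_abs]
    · calc _ ≤ ∫ x in ball 0 (2 * r), (2 * c * (V / r)) * (u 0 x ^ 2 + u 1 x ^ 2) := by
            refine norm_integral_le_of_norm_le (((hsq 0).add (hsq 1)).const_mul _) ?_
            filter_upwards [ae_restrict_mem measurableSet_ball] with x hx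
            rw [norm_mul, mul_comm, Real.norm_eq_abs, Real.norm_eq_abs,
              abs_of_nonneg (by positivity : 0 ≤ u 0 x ^ 2 + u 1 x ^ 2)]
            refine mul_le_mul_of_nonneg_right ((abs_add_le _ _).trans ?_) (by positivity)
            have q : ∀ k, |u k x * ∂_ k (cut r) x| ≤ V * (c / r) := fun k => by
              rw [abs_mul]
              exact mul_le_mul (hub x hx k) (hcut r hr0 k x) (abs_nonneg _) hV0
            exact (add_le_add (q 0) (q 1)).trans (le_of_eq (by ring))
        _ ≤ _ := by
            rw [integral_const_mul, integral_add (hsq 0) (hsq 1), mul_assoc (2 * c)]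
            gcongr
    · intro x hx
      by_contra h
      exact hx (by simp [dχ0 _ _ h])
  set h : Fin 2 → Plane → ℝ := fun k => moll ε (b k) with hhd
  have ht : ∀ k, IsTest (h k) := fun k => isTest_moll hε (hb k).2 (hb k).continuous.locallyIntegrable
  have hs : ∀ k, Function.support (h k) ⊆ ball 0 (3 * r) := fun k =>
    (tsupport_conv_subset (mollk_support hε) ((Function.support_mul_subset_left _ _).trans
      (cut_support hr0))).trans (ball_subset_ball (by linarith))
  have hb2 : ∀ k, ∫ x, b k x ^ 2 ≤ E := fun k => by
    rw [integral_eq_ball (R := 2 * r)]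
    · calc _ ≤ ∫ x in ball 0 (2 * r), u k x ^ 2 := by
            refine integral_mono (Continuous.integrableOn_ball ((hb k).continuous.pow 2) 0 _) (hsq k)
              fun x => ?_
            simp only [hbd, mul_pow]
            exact mul_le_of_le_one_left (sq_nonneg _) (pow_le_one₀ (cut_nonneg _ _) (cut_le_one _ _))
        _ ≤ E := by fin_cases k <;> simp only [Fin.zero_eta, Fin.mk_one] <;> linarith [n0 0, n0 1]
    · intro x hx
      exact cut_support hr0 fun h0 => hx (by simp [hbd, h0])
  have h1 : ∀ k, ∫ x, |h k x| ≤ 3 * √v * (r * √E) := fun k => by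
    rw [integral_eq_ball (R := 3 * r) (fun x hx => hs k fun h0 => hx (by simp [h0]))]
    have cs := abs_integral_mul_le (memLp_two_ball (ht k).continuous.abs 0 (3 * r))
      (memLp_two_ball (continuous_const (y := (1 : ℝ))) 0 (3 * r))
    simp only [mul_one, one_pow, sq_abs, integral_const, measureReal_restrict_apply_univ,
      smul_eq_mul] at cs
    refine (le_abs_self _).trans (cs.trans ?_)
    have h2 : ∫ x in ball 0 (3 * r), h k x ^ 2 ≤ E := by
      rw [← integral_eq_ball (φ := fun x => h k x ^ 2)
        (fun x hx => hs k fun h0 => hx (by simp [h0]))]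
      exact (integral_sq_moll_le hε (hb k).continuous (hb k).2).trans (hb2 k)
    have h3 : √(volume.real (ball (0 : Plane) (3 * r))) = 3 * r * √v := by
      rw [volume_real_ball (by linarith), Real.sqrt_mul (sq_nonneg _), Real.sqrt_sq (by linarith)]
    rw [h3]
    calc _ ≤ √E * (3 * r * √v) := by gcongr
      _ = _ := by ring
  -- Mollified velocities are divergence-free, so the divergence of the cut-off velocity contains
  -- only the gradient of the cut-off. The pressure thus costs `1 / r` and no derivative of the
  -- velocity.
  have hdiv : √(∫ x, (∂_ 0 (h 0) x + ∂_ 1 (h 1) x) ^ 2) ≤ 2 * c / r * √E := by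
    set g : Plane → ℝ := fun x => ∂_ 0 (b 0) x + ∂_ 1 (b 1) x with hgd
    have hg : IsTest g := ((hb 0).partialDeriv 0).add ((hb 1).partialDeriv 1)
    have e1 : ∀ x, ∂_ 0 (h 0) x + ∂_ 1 (h 1) x = moll ε g x := fun x => by
      have t := fun k : Fin 2 => (hb k).partialDeriv k
      simp only [hhd, moll]
      rw [conv_comm, conv_comm _ (b 1), partialDeriv_conv 0 (hb 0) (isTest_mollk hε).continuous.locallyIntegrable,
        partialDeriv_conv 1 (hb 1) (isTest_mollk hε).continuous.locallyIntegrable, conv_comm,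
        conv_comm (∂_ 1 _), conv_apply, conv_apply, conv_apply, ← integral_add
        ((isTest_mollk hε).integrable_conv (t 0).continuous.locallyIntegrable x)
        ((isTest_mollk hε).integrable_conv (t 1).continuous.locallyIntegrable x)]
      simp only [hgd, mul_add]
      rfl
    have e2 : ∀ x, g x = u 0 x * ∂_ 0 (cut r) x + u 1 x * ∂_ 1 (cut r) x := by
      intro x
      simp only [hgd, hbd]
      rw [partialDeriv_mul 0 (hχ.1.differentiable (by simp) x) ((hu 0).differentiable (by simp) x),
        partialDeriv_mul 1 (hχ.1.differentiable (by simp) x) ((hu 1).differentiable (by simp) x)]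
      linear_combination cut r x * hf.field.div_moll hε x
    simp only [e1]
    refine Real.sqrt_le_iff.2 ⟨by positivity, (integral_sq_moll_le hε hg.continuous hg.2).trans ?_⟩
    rw [integral_eq_ball (R := 2 * r)]
    · calc _ ≤ ∫ x in ball 0 (2 * r), (2 * (c / r) ^ 2) * (u 0 x ^ 2 + u 1 x ^ 2) := by
            refine integral_mono (Continuous.integrableOn_ball (hg.continuous.pow 2) 0 _)
              (((hsq 0).add (hsq 1)).const_mul _) fun x => ?_
            simp only [e2]
            have q : ∀ k, ∂_ k (cut r) x ^ 2 ≤ (c / r) ^ 2 := fun k =>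
              sq_le_sq' (abs_le.1 (hcut r hr0 k x)).1 (abs_le.1 (hcut r hr0 k x)).2
            refine add_sq_le.trans ?_
            rw [mul_pow, mul_pow]
            nlinarith [mul_le_mul_of_nonneg_left (q 0) (sq_nonneg (u 0 x)),
              mul_le_mul_of_nonneg_left (q 1) (sq_nonneg (u 1 x))]
        _ ≤ (2 * (c / r) ^ 2) * E := by
            rw [integral_const_mul, integral_add (hsq 0) (hsq 1)]
            gcongr
        _ ≤ _ := by
            rw [mul_pow, Real.sq_sqrt hE0]
            have : 0 ≤ (c / r) ^ 2 * E := by positivity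
            have e3 : (2 * c / r) ^ 2 = 4 * (c / r) ^ 2 := by ring
            rw [e3]
            linarith
    · intro x hx
      by_contra h0
      exact hx (by simp [e2, dχ0 _ _ h0])
  have press : |pressForm 0 (h 0) f + pressForm 1 (h 1) f|
      ≤ Λ * (2 * c) * (V / r * E) + Λ * (6 * √v) * (r * √E * F) := by
    have hp := abs_pressForm_le (hf.farIntegrable hα hα') hf.cont hθ (by linarith : 0 < 3 * r)
      (ht 0) (ht 1) (hs 0) (hs 1)
    rw [show 2 * (3 * r) = 6 * r by ring] at hp
    have h4 : √(∫ y in ball 0 (6 * r), ‖f y‖ ^ 4) ≤ V * √E := by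
      refine (Real.sqrt_le_sqrt (integral_norm_pow_four_le hf.cont hV)).trans (le_of_eq ?_)
      rw [Real.sqrt_mul (sq_nonneg V), Real.sqrt_sq hV0]
    calc _ ≤ Λ * ((V * √E) * (2 * c / r * √E) + (3 * √v * (r * √E) + 3 * √v * (r * √E)) * F) := by
          refine hp.trans ?_
          have a0 := h1 0
          have a1 := h1 1
          gcongr
      _ = Λ * (2 * c) * (V / r * (√E * √E)) + Λ * (6 * √v) * (r * √E * F) := by ring
      _ = _ := by rw [Real.mul_self_sqrt hE0]
  have tr := integral_transport_smooth (hu 0) (hu 1) hχ (hf.field.div_moll hε)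
  have mm := fun k => hf.integral_momMoll hα hα' hθ hε k (hb k)
  have i1 : ∀ i j, Integrable fun x => ∂_ j (b i) x * (u j x * u i x) := fun i j =>
    ((hb i).partialDeriv j).integrable_mul ((huc j).mul (huc i)).locallyIntegrable
  have i0 : ∀ i j, Integrable fun x =>
      ∂_ j (b i) x * mcov ε (fun y => f y j) (fun y => f y i) x := fun i j =>
    ((hb i).partialDeriv j).integrable_mul (continuous_mcov hε (hf.field.coord j)
      (hf.field.coord i) (locallyIntegrable_mul_coord hf.cont i j)).locallyIntegrable
  have split : ∀ i j, ∫ x, ∂_ j (b i) x * moll ε (fun y => f y j * f y i) x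
      = (∫ x, ∂_ j (b i) x * mcov ε (fun y => f y j) (fun y => f y i) x)
        + ∫ x, ∂_ j (b i) x * (u j x * u i x) := fun i j => by
    rw [← integral_add (i0 i j) (i1 i j)]
    refine integral_congr_ae (Eventually.of_forall fun x => ?_)
    simp only [mcov, hud]
    ring
  rw [integral_add (((i1 0 0).fun_add (i1 0 1)).fun_add (i1 1 0)) (i1 1 1),
    integral_add ((i1 0 0).fun_add (i1 0 1)) (i1 1 0), integral_add (i1 0 0) (i1 0 1)] at tr
  have m0 := mm 0
  have m1 := mm 1
  rw [split, split] at m0 m1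
  rw [m0, m1]
  have k00 := (abs_le.1 (hKn 0 0)).2
  have k01 := (abs_le.1 (hKn 0 1)).2
  have k10 := (abs_le.1 (hKn 1 0)).2
  have k11 := (abs_le.1 (hKn 1 1)).2
  have p1 := (abs_le.1 press).1
  have f1 := (abs_le.1 flux).2
  have y1 : 0 ≤ V / r * E := by positivity
  have y2 : 0 ≤ r * √E * F := by positivity
  have y3 : 0 ≤ 2 * c + 2 * Λ * (2 * c) := by positivity
  have y4 : 0 ≤ 2 * Λ * (6 * √v) := by positivity
  linarith [mul_nonneg y4 y1, mul_nonneg y3 y2]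

end EnergyInequality

/-! ### The local energy inequality along a flow. -/

section EnergyFlow

variable {α M T : ℝ} {θ : Plane → ℝ} {v₀ : Plane → Plane} {v : ℝ → Plane → Plane}

theorem exists_momMoll_le (hα : 0 ≤ α) (hα' : α < 1 / 2) (hM : 0 ≤ M) (hθ : IsCutoff θ) {R ε : ℝ}
    (hR : 0 < R) (hε : 0 < ε) (hε1 : ε ≤ 1) : ∃ K, ∀ f, InClass α M f →
      ∀ i, ∀ x ∈ ball (0 : Plane) R, |momMoll θ ε f i x| ≤ K := by
  have hk := isTest_mollk hε
  obtain ⟨c, hc⟩ := hk.continuous.bounded_above_of_compact_support hk.2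
  obtain ⟨c₀, hc₀⟩ := (hk.partialDeriv 0).continuous.bounded_above_of_compact_support
    (hk.partialDeriv 0).2
  obtain ⟨c₁, hc₁⟩ := (hk.partialDeriv 1).continuous.bounded_above_of_compact_support
    (hk.partialDeriv 1).2
  set C := |c| + |c₀| + |c₁|
  have hC : 0 ≤ C := by positivity
  obtain ⟨K, hK⟩ := exists_momForm_bound hθ hα hα' hM (by linarith : 1 ≤ R + 2) hC
  refine ⟨K, fun f hf i x hx => ?_⟩
  rw [← hf.momForm_eq_momMoll hα hα' hθ hε i x]
  set φ : Plane → ℝ := fun y => mollk ε (x - y) with hφd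
  have hφ : IsTest φ := hk.comp_const_sub x
  have s : tsupport φ ⊆ ball 0 (R + 2) := by
    have h1 : tsupport φ ⊆ closedBall x ε := by
      refine closure_minimal (fun y hy => ?_) isClosed_closedBall
      have := mollk_support hε hy
      rw [mem_ball_zero_iff, ← norm_neg, neg_sub] at this
      rw [mem_closedBall_iff_norm]
      exact this.le
    refine h1.trans fun y hy => ?_
    rw [mem_closedBall_iff_norm] at hy
    rw [mem_ball_zero_iff] at *
    linarith [norm_le_norm_add_norm_sub' y x]
  have b1 : ∀ y, |φ y| ≤ C := fun y => (hc _).trans (by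
    linarith [le_abs_self c, abs_nonneg c₀, abs_nonneg c₁])
  have b2 : ∀ k y, |∂_ k φ y| ≤ C := fun k y => by
    simp only [hφd, partialDeriv_const_sub, abs_neg]
    fin_cases k
    · exact (hc₀ _).trans (by linarith [le_abs_self c₀, abs_nonneg c, abs_nonneg c₁])
    · exact (hc₁ _).trans (by linarith [le_abs_self c₁, abs_nonneg c, abs_nonneg c₀])
  have q : ∀ j, tsupport (unitTest i j φ) ⊆ ball 0 (R + 2) ∧ (∀ y, |unitTest i j φ y| ≤ C) ∧
      ∀ k y, |∂_ k (unitTest i j φ) y| ≤ C := fun j => by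
    unfold unitTest
    split
    · exact ⟨s, b1, b2⟩
    · refine ⟨?_, fun y => by simpa using hC, fun k y => ?_⟩
      · have : tsupport (fun _ : Plane => (0 : ℝ)) = ∅ := tsupport_eq_empty_iff.2 rfl
        rw [this]
        exact empty_subset _
      · rw [partialDeriv_fun_const]
        simpa using hC
  exact (hK _ _ (isTest_unitTest hφ i 0) (isTest_unitTest hφ i 1) (q 0).1 (q 1).1 (q 0).2.1 (q 1).2.1
    (q 0).2.2 (q 1).2.2 f hf).2

/-- Measurability in time at each point follows from the formula by `momForm`, and continuity in
space is known at each time. Together they give joint measurability without any statement about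
`gradPi` as a function of time. -/
theorem IsFlow.stronglyMeasurable_momMoll (hv : IsFlow α M T v₀ v) (hα : 0 ≤ α) (hα' : α < 1 / 2)
    (hθ : IsCutoff θ) {ε : ℝ} (hε : 0 < ε) (i : Fin 2) :
    StronglyMeasurable (Function.uncurry fun s => momMoll θ ε (v s) i) := by
  have h := stronglyMeasurable_uncurry_of_continuous_of_stronglyMeasurable
    (u := fun x s => momMoll θ ε (v s) i x)
    (fun s => (hv.inClass s).continuous_momMoll hα hα' hθ hε i) (fun x => by
      simp only [← fun s => (hv.inClass s).momForm_eq_momMoll hα hα' hθ hε i x]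
      have hφ := (isTest_mollk hε).comp_const_sub x
      exact stronglyMeasurable_momForm hv.meas (isTest_unitTest hφ i 0) (isTest_unitTest hφ i 1))
  exact h.comp_measurable measurable_swap

theorem IsFlow.ae_moll_coord (hv : IsFlow α M T v₀ v) (hα : 0 ≤ α) (hα' : α < 1 / 2)
    (hθ : IsCutoff θ) {ε : ℝ} (hε : 0 < ε) (i : Fin 2) (x : Plane) :
    ∀ᵐ t ∂volume.restrict (Icc 0 T), moll ε (fun y => v t y i) x
      = moll ε (fun y => v₀ y i) x + ∫ s in (0 : ℝ)..t, momMoll θ ε (v s) i x := by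
  have hφ := (isTest_mollk hε).comp_const_sub x
  have e : ∀ f : Plane → Plane, ∫ y, (f y 0 * unitTest i 0 (fun y => mollk ε (x - y)) y
      + f y 1 * unitTest i 1 (fun y => mollk ε (x - y)) y) = moll ε (fun y => f y i) x := by
    intro f
    rw [moll, conv_apply]
    refine integral_congr_ae (Eventually.of_forall fun y => ?_)
    fin_cases i <;> simp [unitTest, mul_comm]
  filter_upwards [hv.eqn _ _ (isTest_unitTest hφ i 0) (isTest_unitTest hφ i 1)] with t ht
  rw [e, e] at ht
  rw [ht]
  simp only [fun s => (hv.inClass s).momForm_eq_momMoll hα hα' hθ hε i x]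

theorem IsField.tendsto_integral_sq {f : Plane → Plane} {w : Plane → ℝ} {W r : ℝ} (hf : IsField f w W)
    (hc : Continuous f) (hr : 0 < r) (i : Fin 2) :
    Tendsto (fun n => ∫ x, cut r x * moll (scale n) (fun y => f y i) x ^ 2) atTop
      (𝓝 (∫ x, cut r x * f x i ^ 2)) := by
  obtain ⟨V, hV0, hV⟩ := IsField.exists_bound_ball hc (2 * r)
  have hχ := isTest_cut hr
  refine tendsto_integral_of_dominated_convergence (fun x => cut r x * (V + W) ^ 2)
    (fun n => (hχ.continuous.mul ((hf.moll_continuous n i).pow 2)).aestronglyMeasurable)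
    ((hχ.continuous.integrable_of_hasCompactSupport hχ.2).mul_const _)
    (fun n => Eventually.of_forall fun x => ?_)
    (Eventually.of_forall fun x => ((hf.tendsto_moll hc i x).pow 2).const_mul _)
  rw [Real.norm_eq_abs, abs_of_nonneg (mul_nonneg (cut_nonneg _ _) (sq_nonneg _))]
  by_cases hx : cut r x = 0
  · simp [hx]
  · have h := abs_le.1 (hf.abs_moll_le_of_bound hc (hV x (cut_support hr hx)) n i)
    exact mul_le_mul_of_nonneg_left (sq_le_sq' h.1 h.2) (cut_nonneg _ _)

/-- The local energy inequality. -/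
theorem exists_ae_energy_le : ∃ C, 0 < C ∧ ∀ α M T v₀ v θ, IsFlow α M T v₀ v → 0 ≤ α → α < 1 / 2 →
    IsCutoff θ → ∀ w₀ W, IsField v₀ w₀ W → Continuous v₀ → ∀ r, 1 ≤ r → ∀ a : ℝ → ℝ,
    IntegrableOn a (Icc 0 T) → (∀ᵐ s ∂volume.restrict (Icc 0 T),
      ∃ V, (∀ x ∈ ball (0 : Plane) (6 * r), ‖v s x‖ ≤ V) ∧
        C * (V / r * energy (v s) (6 * r) + r * √(energy (v s) (6 * r))
          * ∫ y in (ball 0 (6 * r))ᶜ, ‖v s y‖ ^ 2 * (‖y‖ ^ 3)⁻¹) ≤ a s) →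
    ∀ᵐ t ∂volume.restrict (Icc 0 T),
      energy (v t) r ≤ energy v₀ (2 * r) + ∫ s in (0 : ℝ)..t, a s := by
  obtain ⟨C, hC, H⟩ := exists_energyRate_le
  refine ⟨C, hC, fun α M T v₀ v θ hv hα hα' hθ w₀ W h₀ c₀ r hr a ha hrate => ?_⟩
  obtain ⟨K, hK⟩ := H α M θ hα hα' hθ r hr
  obtain ⟨A, hA, hlin⟩ := exists_norm_le_linear
  have hr0 : 0 < r := by linarith
  have hM := (hv.inClass 0).field.bound_nonneg
  have hχ := isTest_cut hr0
  set V := A * M * (1 + 2 * r) + M with hV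
  have hfb : ∀ n i s, ∀ x ∈ ball (0 : Plane) (2 * r),
      |moll (scale n) (fun y => v s y i) x| ≤ V := fun n i s x hx => by
    refine (hv.inClass s).field.abs_moll_le_of_bound (hv.inClass s).cont ((hlin _ _ M α
      (hv.inClass s).field (hv.inClass s).cont hα (by linarith) (hv.inClass s).bound x).trans ?_) n i
    have := (mem_ball_zero_iff.1 hx).le
    gcongr
  have hf := fun n i => stronglyMeasurable_moll (ε := scale n) (stronglyMeasurable_coord hv.meas i)
  have hB := fun n i => hv.stronglyMeasurable_momMoll hα hα' hθ (scale_pos n) i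
  set J : ℕ → Fin 2 → ℝ → ℝ := fun n i s =>
    ∫ x, cut r x * moll (scale n) (fun y => v s y i) x * momMoll θ (scale n) (v s) i x with hJ
  have hJi : ∀ n i t, IntervalIntegrable (J n i) volume 0 t := by
    intro n i t
    obtain ⟨L, hL⟩ := exists_momMoll_le hα hα' hM hθ (by linarith : 0 < 2 * r) (scale_pos n)
      (scale_le_one n)
    refine intervalIntegrable_of_bounded (K := |V| * |L| * volume.real (ball (0 : Plane) (2 * r)))
      ?_ (fun s => ?_) _ _
    · refine StronglyMeasurable.integral_prod_right (f := fun s x =>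
        cut r x * moll (scale n) (fun y => v s y i) x * momMoll θ (scale n) (v s) i x) ?_
      exact ((hχ.continuous.comp_stronglyMeasurable measurable_snd.stronglyMeasurable).mul
        (hf n i)).mul (hB n i)
    · refine integral_le_of_ball (((Function.support_mul_subset_left _ _).trans
        (Function.support_mul_subset_left _ _)).trans (cut_support hr0)) fun x => ?_
      by_cases hx : cut r x = 0
      · simp only [hx, zero_mul, abs_zero]; positivity
      · have hxb := cut_support hr0 hx
        rw [abs_mul, abs_mul, abs_of_nonneg (cut_nonneg _ _)]
        have h1 := (hfb n i s x hxb).trans (le_abs_self V)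
        have h2 := (hL _ (hv.inClass s) i x hxb).trans (le_abs_self L)
        have h3 : cut r x * |moll (scale n) (fun y => v s y i) x| ≤ |V| :=
          (mul_le_of_le_one_left (abs_nonneg _) (cut_le_one _ _)).trans h1
        gcongr
  have main : ∀ n i, ∀ᵐ t ∂volume.restrict (Icc 0 T),
      ∫ x, cut r x * moll (scale n) (fun y => v t y i) x ^ 2
        = (∫ x, cut r x * moll (scale n) (fun y => v₀ y i) x ^ 2)
          + 2 * ∫ s in (0 : ℝ)..t, J n i s := by
    intro n i
    obtain ⟨L, hL⟩ := exists_momMoll_le hα hα' hM hθ (by linarith : 0 < 2 * r) (scale_pos n)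
      (scale_le_one n)
    have h1 := ae_integral_comp_eq (K := max V L) (R := 2 * r) (β := fun s => s ^ 2)
      (f := fun t => moll (scale n) (fun y => v t y i))
      (B := fun t => momMoll θ (scale n) (v t) i) (hf n i) (hB n i)
      (contDiff_moll (scale_pos n) (h₀.coord i)).continuous hχ.continuous (cut_support hr0)
      (fun s x hx => (hfb n i s x hx).trans (le_max_left _ _))
      (fun s x hx => (hL _ (hv.inClass s) i x hx).trans (le_max_right _ _)) (contDiff_id.pow 2)
      (hv.ae_moll_coord hα hα' hθ (scale_pos n) i)
    filter_upwards [h1] with t ht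
    rw [ht, ← intervalIntegral.integral_const_mul]
    congr 2
    ext s
    rw [hJ, ← integral_const_mul]
    refine integral_congr_ae (Eventually.of_forall fun x => ?_)
    simp
    ring
  have main' := ae_all_iff.2 fun n => ae_all_iff.2 fun i => main n i
  filter_upwards [main', ae_restrict_mem measurableSet_Icc] with t ht htT
  have hat : IntervalIntegrable a volume 0 t :=
    (intervalIntegrable_iff_integrableOn_Icc_of_le htT.1).2
      (ha.mono_set (Icc_subset_Icc_right htT.2))
  have hn : ∀ n, (∫ x, cut r x * moll (scale n) (fun y => v t y 0) x ^ 2)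
      + (∫ x, cut r x * moll (scale n) (fun y => v t y 1) x ^ 2)
      ≤ ((∫ x, cut r x * moll (scale n) (fun y => v₀ y 0) x ^ 2)
      + ∫ x, cut r x * moll (scale n) (fun y => v₀ y 1) x ^ 2)
        + ((∫ s in (0 : ℝ)..t, a s) + t * (K * scale n)) := by
    intro n
    rw [ht n 0, ht n 1]
    -- The coordinates are added before estimating: the conservation of energy by transport and the
    -- role of the divergence hold only for the sum.
    have h2 : ∫ s in (0 : ℝ)..t, 2 * (J n 0 s + J n 1 s) ≤ ∫ s in (0 : ℝ)..t, (a s + K * scale n) := by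
      refine intervalIntegral.integral_mono_ae_restrict htT.1
        (((hJi n 0 t).add (hJi n 1 t)).const_mul 2) (hat.add intervalIntegrable_const) ?_
      filter_upwards [ae_restrict_of_ae_restrict_of_subset (Icc_subset_Icc_right htT.2) hrate]
        with s hs
      obtain ⟨U, hU, hUa⟩ := hs
      exact (hK _ (hv.inClass s) U hU n).trans (by linarith)
    rw [intervalIntegral.integral_const_mul, intervalIntegral.integral_add (hJi n 0 t) (hJi n 1 t),
      intervalIntegral.integral_add hat intervalIntegrable_const, intervalIntegral.integral_const,
      smul_eq_mul, sub_zero] at h2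
    linarith
  have lim := le_of_tendsto_of_tendsto'
    (((hv.inClass t).field.tendsto_integral_sq (hv.inClass t).cont hr0 0).add
      ((hv.inClass t).field.tendsto_integral_sq (hv.inClass t).cont hr0 1))
    (((h₀.tendsto_integral_sq c₀ hr0 0).add (h₀.tendsto_integral_sq c₀ hr0 1)).add
      (tendsto_const_nhds.add ((tendsto_scale.const_mul K).const_mul t))) hn
  simp only [mul_zero, add_zero] at lim
  have esum : ∀ f : Plane → Plane, Continuous f → (∫ x, cut r x * f x 0 ^ 2)
      + (∫ x, cut r x * f x 1 ^ 2) = ∫ x, cut r x * ‖f x‖ ^ 2 := fun f hf => by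
    have hi : ∀ i, Integrable fun x => cut r x * f x i ^ 2 := fun i =>
      hχ.integrable_mul ((Continuous.coord hf i).pow 2).locallyIntegrable
    rw [← integral_add (hi 0) (hi 1)]
    simp only [norm_sq_eq, mul_add]
  rw [esum _ (hv.inClass t).cont, esum _ c₀] at lim
  have ic : ∀ f : Plane → Plane, Continuous f → Integrable fun x => cut r x * ‖f x‖ ^ 2 :=
    fun f hf => hχ.integrable_mul (hf.norm.pow 2).locallyIntegrable
  have lower : energy (v t) r ≤ ∫ x, cut r x * ‖v t x‖ ^ 2 := by
    refine le_trans (le_of_eq ?_) (setIntegral_le_integral (s := ball 0 r)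
      (ic _ (hv.inClass t).cont)
      (Eventually.of_forall fun x => mul_nonneg (cut_nonneg _ _) (by positivity)))
    refine setIntegral_congr_fun measurableSet_ball fun x hx => ?_
    rw [cut_eq_one hr0 (mem_ball_zero_iff.1 hx).le, one_mul]
  have upper : ∫ x, cut r x * ‖v₀ x‖ ^ 2 ≤ energy v₀ (2 * r) := by
    rw [integral_eq_ball ((Function.support_mul_subset_left _ _).trans (cut_support hr0))]
    exact integral_mono (ic _ c₀).integrableOn (Continuous.integrableOn_ball (c₀.norm.pow 2) 0 _)
      fun x => mul_le_of_le_one_left (by positivity) (cut_le_one _ _)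
  linarith

end EnergyFlow

/-! ### Propagation of the growth bound beyond a large radius. -/

section Bootstrap

/-- Countably many radii allow the exceptional sets of times to be united. A radius is compared with
a slightly larger rational one, by monotonicity of the energy and continuity of the bound. -/
theorem EnergyBound.of_rat {α N R : ℝ} {f : Plane → Plane} (hc : Continuous f) (hR : 0 < R)
    (h : ∀ q : ℚ, R ≤ q → energy f q ≤ (N * (q : ℝ) ^ (1 + α)) ^ 2) : EnergyBound α N R f := by
  intro r hr
  by_contra! hlt
  have hcont : ContinuousAt (fun q : ℝ => (N * q ^ (1 + α)) ^ 2) r :=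
    ((Real.continuousAt_rpow_const r (1 + α) (Or.inl (by linarith))).const_mul N).pow 2
  obtain ⟨l, u, hlu, hsub⟩ := mem_nhds_iff_exists_Ioo_subset.1 (hcont.eventually (gt_mem_nhds hlt))
  obtain ⟨q, hq1, hq2⟩ := exists_rat_btwn hlu.2
  have h1 : (N * (q : ℝ) ^ (1 + α)) ^ 2 < energy f r := hsub ⟨hlu.1.trans hq1, hq2⟩
  linarith [h q (by linarith), energy_mono hc hq1.le]

/-- The energy rate under a growth bound for the energy. -/
theorem exists_rate_le : ∃ C, 0 < C ∧ ∀ α f w N R W lam r, 0 ≤ α → α < 1 / 2 → IsField f w W →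
    Continuous f → EnergyBound α N R f → 0 ≤ N → 1 ≤ R → R ≤ r → 1 ≤ lam →
    ∃ V, (∀ x ∈ ball (0 : Plane) (6 * r), ‖f x‖ ≤ V) ∧
      V / r * energy f (6 * r) + r * √(energy f (6 * r))
        * ∫ y in (ball 0 (6 * r))ᶜ, ‖f y‖ ^ 2 * (‖y‖ ^ 3)⁻¹
      ≤ C * (W / lam * N ^ 2 + (lam + 1 / (1 - 2 * α)) * N ^ 3 * r ^ (α - 1)) * (r ^ (1 + α)) ^ 2 := by
  obtain ⟨C₁, hC₁, H⟩ := exists_norm_le_energy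
  refine ⟨2592 + 63504 * C₁ + 576, by positivity,
    fun α f w N R W lam r hα hα' hf hc h hN hR hr hlam => ?_⟩
  have hr1 : 1 ≤ r := hR.trans hr
  have hr0 : 0 < r := by linarith
  have hW := hf.bound_nonneg
  set s := r ^ (α - 1) with hs
  set p := r ^ (1 + α) with hp
  set κ := 1 / (1 - 2 * α) with hκ
  have hκ0 : 0 < κ := one_div_pos.2 (by linarith)
  have hs0 : 0 < s := by positivity
  have hp0 : 0 < p := by positivity
  have hps : p = s * r ^ 2 := by
    rw [hs, hp, ← Real.rpow_natCast r 2, ← Real.rpow_add hr0]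
    congr 1
    push_cast
    ring
  have hfarp : r ^ (2 * α - 1) = p * s / r := by
    rw [hs, hp, ← Real.rpow_add hr0, eq_div_iff hr0.ne', ← Real.rpow_add_one hr0.ne']
    congr 1
    ring
  have hscale : ∀ c : ℝ, 1 ≤ c → √(energy f (c * r)) ≤ N * (c ^ 2 * p) := fun c hc1 => by
    refine Real.sqrt_le_iff.2 ⟨by positivity, (h _ (by nlinarith)).trans ?_⟩
    have : (c * r) ^ (1 + α) ≤ c ^ 2 * p := by
      rw [Real.mul_rpow (by linarith) hr0.le]
      refine mul_le_mul_of_nonneg_right ?_ hp0.le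
      rw [← Real.rpow_natCast c 2]
      exact Real.rpow_le_rpow_of_exponent_le hc1 (by push_cast; linarith)
    gcongr
  have hE : √(energy f (6 * r)) ≤ 36 * N * p := (hscale 6 (by norm_num)).trans (le_of_eq (by ring))
  have hE2 : energy f (6 * r) ≤ (36 * N * p) ^ 2 := (Real.sqrt_le_left (by positivity)).1 hE
  have hfar : ∫ y in (ball 0 (6 * r))ᶜ, ‖f y‖ ^ 2 * (‖y‖ ^ 3)⁻¹
      ≤ 16 * κ * N ^ 2 * (p * s / r) := by
    refine (integral_far_le hc hα hα' h (by linarith) (by linarith : R ≤ 6 * r)).trans ?_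
    rw [← hfarp]
    have := Real.rpow_le_rpow_of_nonpos hr0 (by linarith : r ≤ 6 * r) (by linarith : 2 * α - 1 ≤ 0)
    gcongr
  -- The interpolation inequality on balls of radius `r / lam`. The parameter trades the vorticity
  -- term, divided by `lam`, against the energy term, multiplied by it. The number `49` is `7 ^ 2`,
  -- for the radius `6r + r / lam ≤ 7r`.
  set V := 2 * W * (r / lam) + C₁ / (r / lam) * (N * (49 * p)) with hV
  have hl0 : 0 < lam := by linarith
  refine ⟨V, fun x hx => ?_, ?_⟩
  · refine (H f w W hf hc (6 * r) (r / lam) (by positivity) x (mem_ball_zero_iff.1 hx).le).trans ?_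
    have h1 : 6 * r + r / lam ≤ 7 * r := by linarith [div_le_self hr0.le hlam]
    have h2 : √(energy f (6 * r + r / lam)) ≤ N * (49 * p) :=
      (Real.sqrt_le_sqrt (energy_mono hc h1)).trans
        ((hscale 7 (by norm_num)).trans (le_of_eq (by norm_num)))
    rw [hV]
    gcongr
  · have hVr : V / r = 2 * (W / lam) + 49 * C₁ * lam * N * s := by
      rw [hV, hps]
      field_simp
    have q1 : V / r * energy f (6 * r)
        ≤ (2592 * (W / lam * N ^ 2) + 63504 * C₁ * (lam * N ^ 3 * s)) * p ^ 2 := by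
      rw [hVr]
      calc _ ≤ (2 * (W / lam) + 49 * C₁ * lam * N * s) * (36 * N * p) ^ 2 := by gcongr
        _ = _ := by ring
    have q2 : r * √(energy f (6 * r)) * ∫ y in (ball 0 (6 * r))ᶜ, ‖f y‖ ^ 2 * (‖y‖ ^ 3)⁻¹
        ≤ 576 * (κ * N ^ 3 * s) * p ^ 2 := by
      calc _ ≤ r * (36 * N * p) * (16 * κ * N ^ 2 * (p * s / r)) := by gcongr
        _ = _ := by field_simp; ring
    refine (add_le_add q1 q2).trans ?_
    rw [← add_mul]
    refine mul_le_mul_of_nonneg_right ?_ (sq_nonneg p)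
    have y1 : 0 ≤ W / lam * N ^ 2 := by positivity
    have y2 : 0 ≤ lam * N ^ 3 * s := by positivity
    have y3 : 0 ≤ κ * N ^ 3 * s := by positivity
    have e : (2592 + 63504 * C₁ + 576) * (W / lam * N ^ 2 + (lam + κ) * N ^ 3 * s)
        = (2592 + 63504 * C₁ + 576) * (W / lam * N ^ 2 + lam * N ^ 3 * s + κ * N ^ 3 * s) := by ring
    rw [e]
    nlinarith [mul_nonneg hC₁.le y1, mul_nonneg hC₁.le y3]

/-- Growth of the energy of a flow beyond a large radius. -/
theorem exists_flow_growth : ∃ κ, 0 < κ ∧ ∀ α M T v₀ v θ, IsFlow α M T v₀ v → 0 ≤ α → α < 1 / 2 →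
    IsCutoff θ → ∀ w₀ W A R, IsField v₀ w₀ W → Continuous v₀ → 0 < A → EnergyBound α A 1 v₀ →
    0 ≤ T → 1 ≤ R → κ * T * A * (1 / (1 - 2 * α) + 1 + T * W) ≤ R ^ (1 - α) →
    ∀ᵐ t ∂volume.restrict (Icc 0 T), EnergyBound α (8 * A) R (v t) := by
  obtain ⟨C, hC, HE⟩ := exists_ae_energy_le
  obtain ⟨C₂, hC₂, HR⟩ := exists_rate_le
  set D := C * C₂ with hD
  have hD0 : 0 < D := by positivity
  refine ⟨32 * D * (1 + 4 * D), by positivity,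
    fun α M T v₀ v θ hv hα hα' hθ w₀ W A R h₀ c₀ hA hA₀ hT hR hRT => ?_⟩
  have hW := h₀.bound_nonneg
  have hM := (hv.inClass 0).field.bound_nonneg
  have hfield := hv.ae_isField hα hα' hθ h₀
  set κ := 1 / (1 - 2 * α) with hκ
  have hκ0 : 0 < κ := one_div_pos.2 (by linarith)
  -- Chosen so that `D * T * W / lam ≤ 1 / 4`: the vorticity term then contributes at most a quarter
  -- of `(8A)²` over the whole time interval.
  set lam := 1 + 4 * D * T * W with hlam
  have hlam1 : 1 ≤ lam := by
    have : 0 ≤ 4 * D * T * W := by positivity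
    linarith
  have hlam0 : 0 < lam := by linarith
  set rate : ℝ → ℝ → ℝ := fun N q =>
    D * (W / lam * N ^ 2 + (lam + κ) * N ^ 3 * q ^ (α - 1)) * (q ^ (1 + α)) ^ 2 with hrate
  -- A time step so short that even the a priori bound `M` yields an increment of at most `16 A²`,
  -- in units of `r^(2+2α)`. The constant `M` influences the number of steps and nothing else.
  set τ := 16 * A ^ 2 / (D * (W * M ^ 2 + (lam + κ) * M ^ 3) + 1) with hτ
  have hden : 0 ≤ D * (W * M ^ 2 + (lam + κ) * M ^ 3) := by positivity
  have hτ0 : 0 < τ := by positivity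
  have small : ∀ q, R ≤ q → T * rate (8 * A) q ≤ 32 * A ^ 2 * (q ^ (1 + α)) ^ 2 := by
    intro q hq
    have hq0 : 0 < q := by linarith
    have h1 : D * T * (W / lam) ≤ 1 / 4 := by
      rw [← mul_div_assoc, div_le_iff₀ hlam0, hlam]
      linarith
    have h2 : 32 * (D * T * (lam + κ) * A) * q ^ (α - 1) ≤ 1 := by
      have e : q ^ (α - 1) = (q ^ (1 - α))⁻¹ := by rw [← Real.rpow_neg hq0.le]; congr 1; ring
      rw [e, ← div_eq_mul_inv, div_le_one (by positivity)]
      refine le_trans ?_ (hRT.trans (Real.rpow_le_rpow (by linarith) hq (by linarith)))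
      have e2 : 32 * D * (1 + 4 * D) * T * A * (κ + 1 + T * W)
          = 32 * (D * T * A * ((1 + κ + 4 * D * T * W) + (T * W + 4 * D * (κ + 1)))) := by ring
      rw [e2]
      have : D * T * (lam + κ) * A = D * T * A * (1 + κ + 4 * D * T * W) := by rw [hlam]; ring
      rw [this]
      have : 0 ≤ T * W + 4 * D * (κ + 1) := by positivity
      exact mul_le_mul_of_nonneg_left (mul_le_mul_of_nonneg_left (by linarith) (by positivity))
        (by norm_num)
    have e : T * rate (8 * A) q = (64 * A ^ 2 * (D * T * (W / lam))
        + 16 * A ^ 2 * (32 * (D * T * (lam + κ) * A) * q ^ (α - 1))) * (q ^ (1 + α)) ^ 2 := by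
      simp only [hrate]; ring
    rw [e]
    gcongr
    nlinarith [sq_nonneg A]
  have crude : ∀ q, R ≤ q → τ * rate M q ≤ 16 * A ^ 2 * (q ^ (1 + α)) ^ 2 := by
    intro q hq
    have hq1 : 1 ≤ q := hR.trans hq
    have h1 : q ^ (α - 1) ≤ 1 := Real.rpow_le_one_of_one_le_of_nonpos hq1 (by linarith)
    have h2 : rate M q ≤ D * (W * M ^ 2 + (lam + κ) * M ^ 3) * (q ^ (1 + α)) ^ 2 := by
      simp only [hrate]
      have h3 : W / lam ≤ W := div_le_self hW hlam1
      have h4 : (lam + κ) * M ^ 3 * q ^ (α - 1) ≤ (lam + κ) * M ^ 3 :=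
        mul_le_of_le_one_right (by positivity) h1
      gcongr
    calc _ ≤ τ * (D * (W * M ^ 2 + (lam + κ) * M ^ 3) * (q ^ (1 + α)) ^ 2) := by gcongr
      _ = τ * (D * (W * M ^ 2 + (lam + κ) * M ^ 3)) * (q ^ (1 + α)) ^ 2 := by ring
      _ ≤ _ := by
        refine mul_le_mul_of_nonneg_right ?_ (by positivity)
        rw [hτ, div_mul_eq_mul_div, div_le_iff₀ (by positivity)]
        exact mul_le_mul_of_nonneg_left (by linarith) (by positivity)
  have rate0 : ∀ N q, 0 ≤ N → R ≤ q → 0 ≤ rate N q := fun N q hN hq => by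
    have : 0 < q := by linarith
    positivity
  -- Continuation in time. On the first `k` steps the bound with `8A` is known, on the next one only
  -- the bound with `M`. The budget closes without loss: `16 A²` from the initial datum on the
  -- doubled ball, `32 A²` from the known part over all of `[0, T]` and `16 A²` from the last step
  -- make `64 A² = (8A)²`.
  have step : ∀ k : ℕ, ∀ᵐ t ∂volume.restrict (Icc 0 T),
      t ≤ k * τ → EnergyBound α (8 * A) R (v t) := by
    intro k
    induction k with
    | zero =>
      have : ∀ᵐ t ∂volume.restrict (Icc 0 T), t ≠ 0 :=
        ae_restrict_of_ae (Measure.ae_ne volume 0)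
      filter_upwards [this, ae_restrict_mem measurableSet_Icc] with t h1 h2 h3
      simp only [Nat.cast_zero, zero_mul] at h3
      exact absurd (le_antisymm h3 h2.1) h1
    | succ k ih =>
      have hq : ∀ q : ℚ, R ≤ q → ∀ᵐ t ∂volume.restrict (Icc 0 T), t ≤ (k + 1 : ℕ) * τ →
          energy (v t) q ≤ (8 * A * (q : ℝ) ^ (1 + α)) ^ 2 := by
        intro q hq
        have hq1 : (1 : ℝ) ≤ q := hR.trans hq
        set S : Set ℝ := Ioi (k * τ) with hS
        set a : ℝ → ℝ := fun s => rate (8 * A) q + S.indicator (fun _ => rate M q) s with ha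
        have ii : ∀ x y, IntervalIntegrable (S.indicator fun _ : ℝ => rate M q) volume x y := fun x y =>
          intervalIntegrable_of_bounded (K := |rate M q|)
            (stronglyMeasurable_const.indicator measurableSet_Ioi) (fun s =>
              norm_indicator_le_norm_self (fun _ => rate M q) s) x y
        have hai : IntegrableOn a (Icc 0 T) :=
          (intervalIntegrable_iff_integrableOn_Icc_of_le hT).1 (intervalIntegrable_const.add (ii 0 T))
        have key := HE α M T v₀ v θ hv hα hα' hθ w₀ W h₀ c₀ q hq1 a hai (by
          filter_upwards [ih, hfield] with s hs hsf
          have hMR : EnergyBound α M R (v s) := (hv.inClass s).bound.mono hM le_rfl hR (by linarith)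
          by_cases hsk : s ≤ k * τ
          · obtain ⟨V, hV, hVr⟩ := HR α (v s) _ (8 * A) R W lam q hα hα' hsf (hv.inClass s).cont
              (hs hsk) (by positivity) hR hq hlam1
            refine ⟨V, hV, (mul_le_mul_of_nonneg_left hVr hC.le).trans ?_⟩
            have : s ∉ S := by simpa [hS] using hsk
            simp only [ha, indicator_of_notMem this, hrate, hD]
            linarith
          · obtain ⟨V, hV, hVr⟩ := HR α (v s) _ M R W lam q hα hα' hsf (hv.inClass s).cont
              hMR hM hR hq hlam1
            refine ⟨V, hV, (mul_le_mul_of_nonneg_left hVr hC.le).trans ?_⟩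
            have hsS : s ∈ S := by simpa [hS] using hsk
            have := rate0 (8 * A) q (by positivity) hq
            simp only [ha, indicator_of_mem hsS]
            refine le_add_of_nonneg_of_le this (le_of_eq ?_)
            simp only [hrate, hD]
            ring)
        filter_upwards [key, ae_restrict_mem measurableSet_Icc] with t ht htT htk
        have h1 : ∫ s in (0 : ℝ)..t, S.indicator (fun _ => rate M q) s ≤ τ * rate M q := by
          rw [intervalIntegral.integral_of_le htT.1, integral_indicator measurableSet_Ioi,
            Measure.restrict_restrict measurableSet_Ioi, integral_const, smul_eq_mul]
          refine mul_le_mul_of_nonneg_right ?_ (rate0 M q hM hq)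
          rw [measureReal_restrict_apply_univ]
          have hsub : S ∩ Ioc 0 t ⊆ Ioc (k * τ) (k * τ + τ) := fun s hs =>
            ⟨hs.1, hs.2.2.trans (htk.trans (le_of_eq (by push_cast; ring)))⟩
          refine (measureReal_mono hsub measure_Ioc_lt_top.ne).trans (le_of_eq ?_)
          rw [Measure.real, Real.volume_Ioc, ENNReal.toReal_ofReal (by linarith)]
          ring
        rw [ha, intervalIntegral.integral_add intervalIntegrable_const (ii 0 t),
          intervalIntegral.integral_const, smul_eq_mul, sub_zero] at ht
        have h2 : t * rate (8 * A) q ≤ T * rate (8 * A) q :=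
          mul_le_mul_of_nonneg_right htT.2 (rate0 _ _ (by positivity) hq)
        have h3 : energy v₀ (2 * q) ≤ 16 * A ^ 2 * ((q : ℝ) ^ (1 + α)) ^ 2 := by
          refine (hA₀ _ (by linarith)).trans ?_
          have : (2 * (q : ℝ)) ^ (1 + α) ≤ 4 * (q : ℝ) ^ (1 + α) := by
            rw [Real.mul_rpow (by norm_num) (by linarith)]
            gcongr
            calc (2 : ℝ) ^ (1 + α) ≤ 2 ^ (2 : ℝ) :=
                  Real.rpow_le_rpow_of_exponent_le (by norm_num) (by linarith)
              _ = 4 := by norm_num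
          calc _ ≤ (A * (4 * (q : ℝ) ^ (1 + α))) ^ 2 := by gcongr
            _ = _ := by ring
        have e : (8 * A * (q : ℝ) ^ (1 + α)) ^ 2 = 64 * A ^ 2 * ((q : ℝ) ^ (1 + α)) ^ 2 := by ring
        rw [e]
        linarith [small q hq, crude q hq]
      have hq' : ∀ᵐ t ∂volume.restrict (Icc 0 T), ∀ q : ℚ, R ≤ q → t ≤ (k + 1 : ℕ) * τ →
          energy (v t) q ≤ (8 * A * (q : ℝ) ^ (1 + α)) ^ 2 :=
        ae_all_iff.2 fun q => by
          by_cases h : R ≤ q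
          · filter_upwards [hq q h] with t ht _ using ht
          · exact Eventually.of_forall fun t h' => absurd h' h
      filter_upwards [hq'] with t ht htk
      exact EnergyBound.of_rat (hv.inClass t).cont (by linarith) fun q hq => ht q hq htk
  obtain ⟨k, hk⟩ := exists_nat_ge (T / τ)
  filter_upwards [step k, ae_restrict_mem measurableSet_Icc] with t ht htT
  exact ht (htT.2.trans ((div_le_iff₀ hτ0).1 hk))

end Bootstrap

/-! ### The Morrey norm: choice of the radius and lower semicontinuity. -/

section Growth

theorem add_rpow_le_add_rpow {X Y e : ℝ} (hX : 0 ≤ X) (hY : 0 ≤ Y) (he : 0 ≤ e) (he3 : e ≤ 3) :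
    (1 + X + Y) ^ e ≤ 27 * (1 + X ^ e + Y ^ e) := by
  set m := max 1 (max X Y) with hm
  have h1 : 1 ≤ m := le_max_left _ _
  have h2 : X ≤ m := (le_max_left _ _).trans (le_max_right _ _)
  have h3 : Y ≤ m := (le_max_right _ _).trans (le_max_right _ _)
  have h4 : m ^ e ≤ 1 + X ^ e + Y ^ e := by
    have hXe : 0 ≤ X ^ e := by positivity
    have hYe : 0 ≤ Y ^ e := by positivity
    rcases max_choice 1 (max X Y) with h | h
    · rw [hm, h, Real.one_rpow]; linarith
    · rcases max_choice X Y with h' | h' <;> rw [hm, h, h'] <;> linarith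
  calc (1 + X + Y) ^ e ≤ (3 * m) ^ e := Real.rpow_le_rpow (by positivity) (by linarith) he
    _ = 3 ^ e * m ^ e := Real.mul_rpow (by norm_num) (by linarith)
    _ ≤ 3 ^ (3 : ℝ) * (1 + X ^ e + Y ^ e) := by
        gcongr
        norm_num
    _ = _ := by norm_num

theorem continuous_growthBound {α : ℝ} (hα : 0 ≤ α) (hα' : α < 1 / 2) (K W : ℝ) :
    Continuous fun p : ℝ × ℝ => growthBound α K p.1 p.2 W := by
  have h : 0 < 1 - α := by linarith
  have r : ∀ q : ℝ, 0 ≤ q → Continuous fun x : ℝ => x ^ q := fun q hq => Real.continuous_rpow_const hq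
  have c1 := (r ((1 + α) / (1 - α)) (by positivity)).comp (continuous_fst (X := ℝ) (Y := ℝ))
  have c2 := (r (2 * (1 + α) / (1 - α)) (by positivity)).comp (continuous_fst (X := ℝ) (Y := ℝ))
  have c3 := (r (2 / (1 - α)) (by positivity)).comp (continuous_snd (X := ℝ) (Y := ℝ))
  exact (continuous_snd.add ((continuous_const.mul c1).mul c3)).add
    (((continuous_const.mul c2).mul continuous_const).mul c3)

theorem growthBound_nonneg {α K t A W : ℝ} (hK : 0 ≤ K) (ht : 0 ≤ t) (hA : 0 ≤ A) (hW : 0 ≤ W) :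
    0 ≤ growthBound α K t A W := by
  unfold growthBound
  positivity

/-- The growth estimate on a bounded time interval. -/
theorem exists_ae_growth : ∃ κ, 0 < κ ∧ ∀ α u₀ u T A, 0 ≤ α → α < 1 / 2 → MemYudovich α u₀ →
    IsYudovichSolution α u₀ u → 0 < T → (morreyNorm α u₀).toReal ≤ A → 0 < A →
    ∀ᵐ t ∂volume.restrict (Icc 0 T), morreyNorm α (u t) ≤ ENNReal.ofReal (216 *
      growthBound α ((1 + κ * (|1 / (1 - 2 * α)| + 1)) ^ 3) T A
        (eLpNorm (vorticity u₀) ⊤ volume).toReal) := by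
  obtain ⟨κ, hκ, H⟩ := exists_flow_growth
  refine ⟨κ, hκ, fun α u₀ u T A hα hα' hu₀ hu hT hA₀ hA => ?_⟩
  obtain ⟨M, hM, v, hv, hvu⟩ := hu.exists_isFlow hα hα' hT
  obtain ⟨θ, hθ, -⟩ := hu.momentum
  obtain ⟨M', hM'⟩ := hu.locallyBounded T hT
  set W := (eLpNorm (vorticity u₀) ⊤ volume).toReal with hW
  have hf := hu₀.isField
  have hW0 : 0 ≤ W := ENNReal.toReal_nonneg
  have ef := hf.fieldRep_ae_eq
  -- The energy inequality asks for a continuous initial field. The datum enters the flow only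
  -- through integrals, so it may be replaced by its representative.
  have hv' : IsFlow α M T (fieldRep u₀) v := ⟨hv.meas, hv.inClass, fun h₀ h₁ t₀ t₁ => by
    have e : ∫ x, (fieldRep u₀ x 0 * h₀ x + fieldRep u₀ x 1 * h₁ x)
        = ∫ x, (u₀ x 0 * h₀ x + u₀ x 1 * h₁ x) :=
      integral_congr_ae (ef.mono fun x hx => by simp only [hx])
    simpa only [e] using hv.eqn h₀ h₁ t₀ t₁⟩
  have hE : EnergyBound α A 1 (fieldRep u₀) := fun r hr => by
    rw [energy_congr_ae ef]
    refine energyBound_of_morreyNorm hu₀.aestronglyMeasurable hA.le ?_ r hr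
    rw [← ENNReal.ofReal_toReal hu₀.morreyNorm_lt_top.ne]
    exact ENNReal.ofReal_le_ofReal hA₀
  set κ₀ := 1 / (1 - 2 * α) with hκ₀
  have hκ₀0 : 0 < κ₀ := one_div_pos.2 (by linarith)
  rw [abs_of_pos hκ₀0]
  have hα1 : 0 < 1 - α := by linarith
  set e := (1 + α) / (1 - α) with he
  have he0 : 0 ≤ e := by positivity
  have he3 : e ≤ 3 := by rw [he, div_le_iff₀ hα1]; linarith
  set X := κ * (κ₀ + 1) * (T * A) with hX
  set Y := κ * (T * T * W * A) with hY
  have hX0 : 0 ≤ X := by positivity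
  have hY0 : 0 ≤ Y := by positivity
  -- The threshold for `R^(1-α)` is `X + Y`; the extra `1` ensures `R ≥ 1`.
  set R := (1 + X + Y) ^ (1 / (1 - α)) with hR
  have hR1 : 1 ≤ R := Real.one_le_rpow (by linarith) (by positivity)
  have hR0 : 0 < R := by linarith
  have hRα : R ^ (1 - α) = 1 + X + Y := by
    rw [hR, ← Real.rpow_mul (by positivity), one_div_mul_cancel hα1.ne', Real.rpow_one]
  have hRe : R ^ (1 + α) = (1 + X + Y) ^ e := by
    rw [hR, ← Real.rpow_mul (by positivity), one_div_mul_eq_div]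
  -- The exponent `(1 + α) / (1 - α)` is at most `3` for `α < 1/2`, so the cube of a base above one
  -- serves every `α` and depends on `1 / (1 - 2α)` only.
  set K := (1 + κ * (κ₀ + 1)) ^ 3 with hK
  have hKe : ∀ c, 0 ≤ c → c ≤ κ * (κ₀ + 1) → c ^ e ≤ K := fun c hc hck => by
    have hb : 1 ≤ 1 + κ * (κ₀ + 1) := by
      have : 0 < κ * (κ₀ + 1) := by positivity
      linarith
    calc c ^ e ≤ (1 + κ * (κ₀ + 1)) ^ e := Real.rpow_le_rpow hc (by linarith) he0
      _ ≤ (1 + κ * (κ₀ + 1)) ^ (3 : ℝ) := Real.rpow_le_rpow_of_exponent_le hb he3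
      _ = K := by rw [hK]; exact_mod_cast Real.rpow_natCast _ 3
  have hAe : A * A ^ e = A ^ (2 / (1 - α)) := by
    rw [mul_comm, ← Real.rpow_add_one hA.ne']
    congr 1
    rw [he]
    field_simp
    ring
  have hTe : (T * T) ^ e = T ^ (2 * (1 + α) / (1 - α)) := by
    rw [Real.mul_rpow hT.le hT.le, ← Real.rpow_add hT]
    congr 1
    rw [he]
    ring
  -- The factor is `8 * 27`, with `27` from splitting the power of the three-term sum `1 + X + Y`.
  have hfinal : 8 * A * R ^ (1 + α) ≤ 216 * growthBound α K T A W := by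
    have hXe : A * X ^ e ≤ K * T ^ e * A ^ (2 / (1 - α)) := by
      rw [hX, Real.mul_rpow (by positivity) (by positivity), Real.mul_rpow hT.le hA.le, ← hAe]
      have := hKe _ (by positivity) le_rfl
      calc _ = (κ * (κ₀ + 1)) ^ e * (T ^ e * (A * A ^ e)) := by ring
        _ ≤ K * (T ^ e * (A * A ^ e)) := by gcongr
        _ = _ := by ring
    have hYe : A * Y ^ e ≤ K * T ^ (2 * (1 + α) / (1 - α)) * W ^ e * A ^ (2 / (1 - α)) := by
      rw [hY, Real.mul_rpow hκ.le (by positivity), Real.mul_rpow (by positivity) hA.le,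
        Real.mul_rpow (by positivity) hW0, ← hAe, ← hTe]
      have := hKe κ hκ.le (by nlinarith)
      calc _ = κ ^ e * ((T * T) ^ e * W ^ e * (A * A ^ e)) := by ring
        _ ≤ K * ((T * T) ^ e * W ^ e * (A * A ^ e)) := by gcongr
        _ = _ := by ring
    have h1 := mul_le_mul_of_nonneg_left (add_rpow_le_add_rpow hX0 hY0 he0 he3)
      (by positivity : 0 ≤ 8 * A)
    rw [hRe, growthBound]
    linarith
  have main := H α M T (fieldRep u₀) v θ hv' hα hα' hθ _ W A R hf.isField_fieldRep
    hf.continuous_fieldRep hA hE hT.le hR1 (by rw [hRα, hX, hY]; linarith)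
  filter_upwards [main, hvu, hM'] with t ht htu htY
  refine (morreyNorm_le (N := 8 * A * R ^ (1 + α)) (by positivity) htY.1.memLp_ball
    fun r hr => ?_).trans (ENNReal.ofReal_le_ofReal hfinal)
  rw [← energy_congr_ae htu]
  have hr1 : 1 ≤ r ^ (1 + α) := Real.one_le_rpow hr (by linarith)
  have hRp : 1 ≤ R ^ (1 + α) := Real.one_le_rpow hR1 (by linarith)
  -- Radii below `R` are estimated by the energy at `R`. This is the only place where the factor
  -- `R^(1+α)` is really spent.
  rcases le_total R r with h | h
  · refine (ht r h).trans ?_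
    exact pow_le_pow_left₀ (by positivity) (mul_le_mul_of_nonneg_right
      (le_mul_of_one_le_right (by positivity) hRp) (by positivity)) 2
  · refine (energy_mono (hv.inClass t).cont h).trans ((ht R le_rfl).trans ?_)
    exact pow_le_pow_left₀ (by positivity) (le_mul_of_one_le_right (by positivity) hr1) 2

/-- `L²` bounds by duality with test fields. -/
theorem eLpNorm_ball_le_of_test {g : Plane → Plane} (hg : LocallyIntegrable g volume) {r c : ℝ}
    (hr : 1 ≤ r) (hc : 0 ≤ c) (h : ∀ φ, IsVectorTest φ → Function.support φ ⊆ ball 0 (3 * r) →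
      |∫ x, inner ℝ (g x) (φ x)| ≤ c * √(∫ x, ‖φ x‖ ^ 2)) :
    eLpNorm g 2 (volume.restrict (ball 0 r)) ≤ ENNReal.ofReal c := by
  have hr0 : 0 < r := by linarith
  have hχ := isTest_cut hr0
  have hl : ∀ i, LocallyIntegrable (fun x => g x i) volume := fun i =>
    hg.mono ((EuclideanSpace.proj i : Plane →L[ℝ] ℝ).continuous.comp_aestronglyMeasurable
      hg.aestronglyMeasurable) (Eventually.of_forall fun x => PiLp.norm_apply_le (g x) i)
  set m : ℕ → Fin 2 → Plane → ℝ := fun n i => moll (scale n) fun x => g x i with hm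
  have hms : ∀ n i, ContDiff ℝ ∞ (m n i) := fun n i => contDiff_moll (scale_pos n) (hl i)
  have hG : ∀ n, Continuous (vecField (m n 0) (m n 1)) :=
    fun n => (contDiff_vecField (hms n 0) (hms n 1)).continuous
  have bound : ∀ n, energy (vecField (m n 0) (m n 1)) r ≤ c ^ 2 := by
    intro n
    have hε := scale_pos n
    have ha : ∀ i, IsTest fun x => cut r x * m n i x := fun i => hχ.mul_right (hms n i)
    have hb : ∀ i, IsTest (moll (scale n) fun x => cut r x * m n i x) := fun i =>
      isTest_moll hε (ha i).2 (ha i).continuous.locallyIntegrable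
    have hi : ∀ i, Integrable fun x => cut r x * m n i x ^ 2 := fun i =>
      hχ.integrable_mul ((hms n i).continuous.pow 2).locallyIntegrable
    set S := (∫ x, cut r x * m n 0 x ^ 2) + ∫ x, cut r x * m n 1 x ^ 2 with hS
    have hS0 : 0 ≤ S := add_nonneg
      (integral_nonneg fun x => mul_nonneg (cut_nonneg _ _) (sq_nonneg _))
      (integral_nonneg fun x => mul_nonneg (cut_nonneg _ _) (sq_nonneg _))
    -- The test field is the mollification of the cut-off times the mollified field. Pairing it with
    -- `g` reproduces the localized energy `S` of the mollified field, while its own squared norm is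
    -- at most `S`. Hence `S ≤ c √S`. Its support fits into `3r` because the scales are at most `1 ≤
    -- r`.
    have h1 := h (vecField (moll (scale n) fun x => cut r x * m n 0 x)
      (moll (scale n) fun x => cut r x * m n 1 x))
      ⟨contDiff_vecField (hb 0).1 (hb 1).1, hasCompactSupport_vecField (hb 0).2 (hb 1).2⟩ (by
        have hs : ∀ i, Function.support (moll (scale n) fun x => cut r x * m n i x)
            ⊆ ball 0 (3 * r) := fun i =>
          (tsupport_conv_subset (mollk_support hε) ((Function.support_mul_subset_left _ _).trans
            (cut_support hr0))).trans (ball_subset_ball (by linarith [scale_le_one n]))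
        intro x hx
        by_contra hn
        have z := fun i => Function.notMem_support.1 fun h' => hn (hs i h')
        refine hx ?_
        ext i
        fin_cases i
        · exact z 0
        · exact z 1)
    have e1 : ∫ x, inner ℝ (g x) (vecField (moll (scale n) fun x => cut r x * m n 0 x)
        (moll (scale n) fun x => cut r x * m n 1 x) x) = S := by
      have e : ∀ i, ∫ x, g x i * moll (scale n) (fun x => cut r x * m n i x) x
          = ∫ x, cut r x * m n i x ^ 2 := fun i => by
        simp only [mul_comm (g _ i)]
        rw [← integral_mul_moll hε (ha i).continuous (ha i).2 (hl i)]
        refine integral_congr_ae (Eventually.of_forall fun x => ?_)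
        simp only [hm]
        ring
      have hgi : ∀ i, Integrable fun x => g x i * moll (scale n) (fun x => cut r x * m n i x) x :=
        fun i => by simpa only [mul_comm] using (hb i).integrable_mul (hl i)
      simp only [inner_eq_add, vecField_zero, vecField_one]
      rw [integral_add (hgi 0) (hgi 1), e, e]
    have e2 : ∫ x, ‖vecField (moll (scale n) fun x => cut r x * m n 0 x)
        (moll (scale n) fun x => cut r x * m n 1 x) x‖ ^ 2 ≤ S := by
      have q : ∀ i, ∫ x, moll (scale n) (fun x => cut r x * m n i x) x ^ 2
          ≤ ∫ x, cut r x * m n i x ^ 2 := fun i => by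
        refine (integral_sq_moll_le hε (ha i).continuous (ha i).2).trans ?_
        refine integral_mono_of_nonneg (Eventually.of_forall fun x => sq_nonneg _) (hi i)
          (Eventually.of_forall fun x => ?_)
        simp only [mul_pow]
        refine mul_le_mul_of_nonneg_right ?_ (sq_nonneg _)
        exact pow_le_of_le_one (cut_nonneg _ _) (cut_le_one _ _) two_ne_zero
      have hq : ∀ i, Integrable fun x => moll (scale n) (fun x => cut r x * m n i x) x ^ 2 :=
        fun i => by
          simpa only [sq] using (hb i).integrable_mul (hb i).continuous.locallyIntegrable
      simp only [norm_sq_eq, vecField_zero, vecField_one]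
      rw [integral_add (hq 0) (hq 1)]
      exact add_le_add (q 0) (q 1)
    rw [e1, abs_of_nonneg hS0] at h1
    have h2 : S ≤ c * √S := h1.trans (by gcongr)
    have h3 : S ≤ c ^ 2 := by nlinarith [Real.sq_sqrt hS0, Real.sqrt_nonneg S, sq_nonneg (c - √S)]
    refine le_trans ?_ h3
    have h4 : energy (vecField (m n 0) (m n 1)) r
        = ∫ x in ball 0 r, (cut r x * m n 0 x ^ 2 + cut r x * m n 1 x ^ 2) := by
      refine setIntegral_congr_fun measurableSet_ball fun x hx => ?_
      simp only [norm_sq_eq, vecField_zero, vecField_one]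
      rw [cut_eq_one hr0 (mem_ball_zero_iff.1 hx).le, one_mul, one_mul]
    rw [h4, hS, ← integral_add (hi 0) (hi 1)]
    refine setIntegral_le_integral ((hi 0).fun_add (hi 1)) (Eventually.of_forall fun x => ?_)
    exact add_nonneg (mul_nonneg (cut_nonneg _ _) (sq_nonneg _))
      (mul_nonneg (cut_nonneg _ _) (sq_nonneg _))
  have lim : ∀ᵐ x, Tendsto (fun n => vecField (m n 0) (m n 1) x) atTop (𝓝 (g x)) := by
    filter_upwards [ae_tendsto_moll_scale (hl 0), ae_tendsto_moll_scale (hl 1)] with x h0 h1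
    have : Tendsto (fun n => (vecField (m n 0) (m n 1) x).ofLp) atTop (𝓝 (g x).ofLp) := by
      rw [tendsto_pi_nhds]
      intro i
      fin_cases i
      · exact h0
      · exact h1
    exact ((PiLp.continuous_toLp 2 _).tendsto _).comp this
  refine (Lp.eLpNorm_lim_le_liminf_eLpNorm (fun n => (hG n).aestronglyMeasurable) g
    (ae_restrict_of_ae lim)).trans ?_
  refine liminf_le_of_frequently_le' (Frequently.of_forall fun n => ?_)
  have hmem : MemLp (vecField (m n 0) (m n 1)) 2 (volume.restrict (ball 0 r)) := by
    rw [← memLp_norm_iff (hG n).aestronglyMeasurable]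
    exact memLp_two_ball (hG n).norm 0 r
  rw [energy_eq_eLpNorm hmem]
  exact ENNReal.ofReal_le_ofReal (Real.sqrt_le_iff.2 ⟨hc, bound n⟩)

theorem abs_integral_inner_le {f φ : Plane → Plane} {ρ E : ℝ}
    (hf : MemLp f 2 (volume.restrict (ball 0 ρ))) (hE : 0 ≤ E) (hfE : energy f ρ ≤ E ^ 2)
    (hφ : IsVectorTest φ) (hs : Function.support φ ⊆ ball 0 ρ) :
    |∫ x, inner ℝ (f x) (φ x)| ≤ E * √(∫ x, ‖φ x‖ ^ 2) := by
  have hc := hφ.1.continuous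
  rw [integral_eq_ball (R := ρ) (fun x hx => hs fun h => hx (by simp [h])),
    integral_eq_ball (φ := fun x => ‖φ x‖ ^ 2) (R := ρ) (fun x hx => hs fun h => hx (by simp [h]))]
  have hφm := memLp_two_ball hc.norm 0 ρ
  refine le_trans ?_ ((le_abs_self _).trans ((abs_integral_mul_le hf.norm hφm).trans ?_))
  · rw [← Real.norm_eq_abs]
    exact norm_integral_le_of_norm_le (hf.norm.integrable_mul hφm)
      (Eventually.of_forall fun x => norm_inner_le_norm _ _)
  · gcongr
    exact (Real.sqrt_le_left hE).2 hfE

/-- Lower semicontinuity of the growth bound along distributional limits. -/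
theorem morreyNorm_le_of_tendsto {α : ℝ} (hα' : α ≤ 1) {f : ℕ → Plane → Plane}
    {g : Plane → Plane} {b : ℕ → ℝ} {b₀ : ℝ} (hf : ∀ n, LocallyIntegrable (f n) volume)
    (hg : LocallyIntegrable g volume) (hb : ∀ n, 0 ≤ b n) (hlim : Tendsto b atTop (𝓝 b₀))
    (hfb : ∀ n, morreyNorm α (f n) ≤ ENNReal.ofReal (b n))
    (h : ∀ φ, IsVectorTest φ → Tendsto (fun n => ∫ x, inner ℝ (f n x) (φ x)) atTop
      (𝓝 (∫ x, inner ℝ (g x) (φ x)))) :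
    morreyNorm α g ≤ ENNReal.ofReal (9 * b₀) := by
  have hb₀ : 0 ≤ b₀ := ge_of_tendsto' hlim hb
  refine iSup₂_le fun r hr => ?_
  have hr0 : 0 < r := by linarith
  have key : eLpNorm g 2 (volume.restrict (ball 0 r))
      ≤ ENNReal.ofReal (b₀ * (3 * r) ^ (1 + α)) := by
    refine eLpNorm_ball_le_of_test hg hr (by positivity) fun φ hφ hs => ?_
    refine le_of_tendsto_of_tendsto' (h φ hφ).abs
      ((hlim.mul_const ((3 * r) ^ (1 + α))).mul_const _) fun n => ?_
    have hmeas := (hf n).aestronglyMeasurable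
    exact abs_integral_inner_le (memLp_ball_of_morreyNorm hmeas
      ((hfb n).trans_lt ENNReal.ofReal_lt_top) _) (mul_nonneg (hb n) (by positivity))
      (energyBound_of_morreyNorm hmeas (hb n) (hfb n) _ (by linarith)) hφ hs
  refine (mul_le_mul_right key _).trans ?_
  rw [← ENNReal.ofReal_mul (by positivity)]
  refine ENNReal.ofReal_le_ofReal ?_
  -- The price of testing in the ball of radius `3r` rather than `r`.
  have h3 : (3 : ℝ) ^ (1 + α) ≤ 9 := by
    calc (3 : ℝ) ^ (1 + α) ≤ 3 ^ (2 : ℝ) :=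
          Real.rpow_le_rpow_of_exponent_le (by norm_num) (by linarith)
      _ = 9 := by norm_num
  rw [Real.mul_rpow (by norm_num) hr0.le, Real.rpow_neg hr0.le]
  have : 0 < r ^ (1 + α) := by positivity
  calc _ = 3 ^ (1 + α) * b₀ := by field_simp
    _ ≤ _ := by gcongr

end Growth

/-! ### Almost every time, with the exact norm of the datum. -/

section Main

/-- The growth estimate at almost every time, with the sharp norm of the initial datum. -/
theorem exists_ae_growth_Ici : ∃ κ, 0 < κ ∧ ∀ α u₀ u, 0 ≤ α → α < 1 / 2 → MemYudovich α u₀ →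
    IsYudovichSolution α u₀ u →
    ∀ᵐ t ∂volume.restrict (Ici (0 : ℝ)), morreyNorm α (u t) ≤ ENNReal.ofReal (216 *
      growthBound α ((1 + κ * (|1 / (1 - 2 * α)| + 1)) ^ 3) t (morreyNorm α u₀).toReal
        (eLpNorm (vorticity u₀) ⊤ volume).toReal) := by
  obtain ⟨κ, hκ, H⟩ := exists_ae_growth
  refine ⟨κ, hκ, fun α u₀ u hα hα' hu₀ hu => ?_⟩
  set A := (morreyNorm α u₀).toReal with hA
  have hA0 : 0 ≤ A := ENNReal.toReal_nonneg
  -- The estimate on `[0, T]` is in terms of `T` and of a positive `A`, while the norm of the datum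
  -- may vanish. Countably many end times and the values `A + 1 / (n + 1)` are used at once, and
  -- continuity of the bound lets them decrease to `t` and `A`.
  have h : ∀ p : {q : ℚ // 0 < q} × ℕ, ∀ᵐ t : ℝ, t ∈ Icc (0 : ℝ) (p.1 : ℚ) →
      morreyNorm α (u t) ≤ ENNReal.ofReal (216 *
        growthBound α ((1 + κ * (|1 / (1 - 2 * α)| + 1)) ^ 3) (p.1 : ℚ)
          (A + 1 / ((p.2 : ℝ) + 1)) (eLpNorm (vorticity u₀) ⊤ volume).toReal) := fun p => by
    have hp : (0 : ℝ) < 1 / ((p.2 : ℝ) + 1) := by positivity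
    exact (ae_restrict_iff' measurableSet_Icc).1 (H α u₀ u _ _ hα hα' hu₀ hu
      (by exact_mod_cast p.1.2) (by linarith) (by linarith))
  rw [ae_restrict_iff' measurableSet_Ici]
  filter_upwards [ae_all_iff.2 h] with t ht ht0
  have hq : ∀ n : ℕ, ∃ q : ℚ, t < q ∧ (q : ℝ) < t + 1 / ((n : ℝ) + 1) := fun n =>
    exists_rat_btwn (lt_add_of_pos_right _ (by positivity))
  choose q hq1 hq2 using hq
  have hq0 : ∀ n, 0 < q n := fun n => by exact_mod_cast lt_of_le_of_lt ht0 (hq1 n)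
  have hz := tendsto_one_div_add_atTop_nhds_zero_nat (𝕜 := ℝ)
  have l1 : Tendsto (fun n => (q n : ℝ)) atTop (𝓝 t) :=
    tendsto_of_tendsto_of_tendsto_of_le_of_le tendsto_const_nhds
      (by simpa using hz.const_add t) (fun n => (hq1 n).le) fun n => (hq2 n).le
  have l2 : Tendsto (fun n : ℕ => A + 1 / ((n : ℝ) + 1)) atTop (𝓝 A) := by
    simpa using hz.const_add A
  have l3 := ((continuous_growthBound hα hα' ((1 + κ * (|1 / (1 - 2 * α)| + 1)) ^ 3)
    (eLpNorm (vorticity u₀) ⊤ volume).toReal).tendsto (t, A)).comp (l1.prodMk_nhds l2)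
  exact ge_of_tendsto' ((ENNReal.continuous_ofReal.tendsto _).comp (l3.const_mul 216))
    fun n => ht ⟨⟨q n, hq0 n⟩, n⟩ ⟨ht0, (hq1 n).le⟩

end Main

end

end YudovichEuler

/-- The constant `C` is absolute and `K` is a function of `1 / (1 - 2 α)` alone. Since `u` is a
class of functions of time modulo null sets, the bound holds for almost every `t ≥ 0`; and it holds
for every `t ≥ 0` if `u` is a representative that is continuous in time with values in
distributions. -/
theorem corollary4p2 :
    ∃ C : ℝ, 0 < C ∧ ∃ K : ℝ → ℝ, (∀ s, 0 < K s) ∧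
      ∀ α : ℝ, 0 ≤ α → α < 1 / 2 →
      ∀ u₀ : YudovichEuler.Plane → YudovichEuler.Plane, YudovichEuler.MemYudovich α u₀ →
      ∀ u : ℝ → YudovichEuler.Plane → YudovichEuler.Plane,
        YudovichEuler.IsYudovichSolution α u₀ u →
        (∀ᵐ t ∂volume.restrict (Ici (0 : ℝ)),
          YudovichEuler.morreyNorm α (u t) ≤
            ENNReal.ofReal (C * YudovichEuler.growthBound α (K (1 / (1 - 2 * α))) t
              (YudovichEuler.morreyNorm α u₀).toReal
              (eLpNorm (YudovichEuler.vorticity u₀) ⊤ volume).toReal)) ∧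
        ((∀ t : ℝ, 0 ≤ t → LocallyIntegrable (u t) volume) →
          (∀ φ : YudovichEuler.Plane → YudovichEuler.Plane, YudovichEuler.IsVectorTest φ →
            ContinuousOn (fun t : ℝ => ∫ x, inner ℝ (u t x) (φ x)) (Ici (0 : ℝ))) →
          ∀ t : ℝ, 0 ≤ t →
            YudovichEuler.morreyNorm α (u t) ≤
              ENNReal.ofReal (C * YudovichEuler.growthBound α (K (1 / (1 - 2 * α))) t
                (YudovichEuler.morreyNorm α u₀).toReal
                (eLpNorm (YudovichEuler.vorticity u₀) ⊤ volume).toReal)) := by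
  open YudovichEuler Filter Topology in
  obtain ⟨κ, hκ, H⟩ := exists_ae_growth_Ici
  have hK : ∀ s : ℝ, 0 < (1 + κ * (|s| + 1)) ^ 3 := fun s => by positivity
  -- Here `1944 = 9 * 216`, where `9` is lost in the lower semicontinuity at individual times. The
  -- absolute value makes `K` positive at every real argument.
  refine ⟨1944, by norm_num, fun s => (1 + κ * (|s| + 1)) ^ 3, hK,
    fun α hα hα' u₀ hu₀ u hu => ?_⟩
  have hae := H α u₀ u hα hα' hu₀ hu
  have hnn : ∀ t : ℝ, 0 ≤ t → 0 ≤ growthBound α ((1 + κ * (|1 / (1 - 2 * α)| + 1)) ^ 3) t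
      (morreyNorm α u₀).toReal (eLpNorm (vorticity u₀) ⊤ volume).toReal := fun t ht =>
    growthBound_nonneg (hK _).le ht ENNReal.toReal_nonneg ENNReal.toReal_nonneg
  refine ⟨?_, fun hloc hcont t ht => ?_⟩
  · filter_upwards [hae, ae_restrict_mem measurableSet_Ici] with t h ht
    refine h.trans (ENNReal.ofReal_le_ofReal ?_)
    have := hnn t ht
    linarith
  -- Good times are picked to the right of `t`, so that `t = 0` needs no separate treatment. The
  -- estimate then passes to `t` by continuity in distributions.
  · have hs : ∀ n : ℕ, ∃ s ∈ Ioo t (t + 1 / ((n : ℝ) + 1)), morreyNorm α (u s) ≤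
        ENNReal.ofReal (216 * growthBound α ((1 + κ * (|1 / (1 - 2 * α)| + 1)) ^ 3) s
          (morreyNorm α u₀).toReal (eLpNorm (vorticity u₀) ⊤ volume).toReal) := fun n => by
      have hlt : t < t + 1 / ((n : ℝ) + 1) := lt_add_of_pos_right _ (by positivity)
      have h1 : volume (Ioo t (t + 1 / ((n : ℝ) + 1))) ≠ 0 := by
        simpa [Real.volume_Ioo] using by positivity
      have h2 := ae_restrict_of_ae_restrict_of_subset
        (fun s (hs : s ∈ Ioo t (t + 1 / ((n : ℝ) + 1))) => ht.trans hs.1.le) hae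
      have : (ae (volume.restrict (Ioo t (t + 1 / ((n : ℝ) + 1))))).NeBot :=
        ae_neBot.2 (by rwa [Ne, Measure.restrict_eq_zero])
      exact ((ae_restrict_mem measurableSet_Ioo).and h2).exists
    choose s hs1 hs2 using hs
    have hst : Filter.Tendsto s Filter.atTop (nhds t) :=
      tendsto_of_tendsto_of_tendsto_of_le_of_le tendsto_const_nhds
        (by simpa using (tendsto_one_div_add_atTop_nhds_zero_nat (𝕜 := ℝ)).const_add t)
        (fun n => (hs1 n).1.le) fun n => (hs1 n).2.le
    have hs0 : ∀ n, 0 ≤ s n := fun n => ht.trans (hs1 n).1.le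
    have hl := (((continuous_growthBound hα hα' ((1 + κ * (|1 / (1 - 2 * α)| + 1)) ^ 3)
      (eLpNorm (vorticity u₀) ⊤ volume).toReal).comp
        (continuous_id.prodMk (continuous_const (y := (morreyNorm α u₀).toReal)))).tendsto t).comp
          hst |>.const_mul 216
    refine (morreyNorm_le_of_tendsto (by linarith) (fun n => hloc _ (hs0 n)) (hloc t ht)
      (fun n => mul_nonneg (by norm_num) (hnn _ (hs0 n))) hl hs2 fun φ hφ => ?_).trans
      (ENNReal.ofReal_le_ofReal (le_of_eq ?_))
    · exact (hcont φ hφ t ht).tendsto.comp (tendsto_nhdsWithin_iff.2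
        ⟨hst, Filter.Eventually.of_forall hs0⟩)
    · simp only [Function.comp_apply, id_eq]
      ring
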